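/- **Setting.** Let $\Omega\subset\mathbb R^2$ be a bounded Lipschitz domain, divided by an interface $\Gamma$ into disjoint open sets $\Omega^+,\Omega^-$ with Lipschitz boundaries, and let $\beta=\beta^\pm>0$ be constant on $\Omega^\pm$. For $\mathbf v=(v_1,v_2)$ put $\operatorname{rot}\mathbf v=\partial_1v_2-\partial_2v_1$ (weakly). Let $\mathcal T_h$ be a finite conforming mesh of $\Omega$ by simple polygons $K$ (hanging nodes count as vertices), with diameters $h_K$, $h=\max_K h_K$; each $K$ is assigned to one of the two sides $\Omega_h^\pm$ of a discrete interface, and $\beta_h=\beta^\pm$ on the elements of $\Omega_h^\pm$. A *virtual mesh* $\mathcal T_h(K)$ of $K$ is a conforming triangulation of $K$ whose nodes are exactly the vertices of $K$. It is *admissible* with constants $\theta_M<\pi$, $d_1,d_2>0$ if (L1) all angles of its triangles are at most $\theta_M$, and (L2) every interior edge $e$ either has length $h_e\ge d_1h_K$, or its end points are connected by a chain of edges $e_l$ of $K$ with $h_e\ge d_2h_{e_l}$ for all $l$. Let $\mathbf V^e_h(K)$ be the space of $\mathbf v\in\mathbf H(\operatorname{rot};K)$ such that $\operatorname{rot}\mathbf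 v$ is constant on $K$ and $\mathbf v|_T=\mathbf a+b(-x_2,x_1)$ on each $T\in\mathcal T_h(K)$ for some $\mathbf a\in\mathbb R^2$, $b\in\mathbb R$ depending on $T$; and let $\mathbf V_h^e=\{\mathbf v\in\mathbf H_0(\operatorname{rot};\Omega):\mathbf v|_K\in\mathbf V_h^e(K)\ \forall K\in\mathcal T_h\}$. With $\Pi_K\mathbf v$ the mean value of $\mathbf v$ on $K$ and $\mathbf t$ the unit tangent to $\partial K$, let $$\|\mathbf v\|_b^2=\sum_{K\in\mathcal T_h}\Big((\beta_h\Pi_K\mathbf v,\Pi_K\mathbf v)_K+h\,\|(I-\Pi_K)\mathbf v\cdot\mathbf t\|_{0,\partial K}^2\Big),\qquad \|\mathbf v\|_a^2=\|\operatorname{rot}\mathbf v\|_{0,\Omega}^2+\|\mathbf v\|_b^2 .$$ For $s\in(1/2,1]$ let $\mathbf Y^s(\Omega)$ be the set of $\mathbf v\in\mathbf H(\operatorname{rot};\Omega)$ with $\mathbf v|_{\Omega^\pm}\in\mathbf H^s(\Omega^\pm)$ and $\beta\mathbf v\in\mathbf H(\operatorname{div};\Omega)$, and let $\|\mathbf v\|_{s,\Omega^\pm}=\|\mathbf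 v\|_{s,\Omega^+}+\|\mathbf v\|_{s,\Omega^-}$, where $\|\cdot\|_{s,D}=\|\cdot\|_{0,D}+|\cdot|_{s,D}$ with the Sobolev–Slobodeckij seminorm for $s<1$ and $|\mathbf v|_{1,D}=\|\nabla\mathbf v\|_{0,D}$. **Statement.** 1. There are integers $C_n$ ($n\ge3$) such that for every simple polygon $K$ with $n$ vertices, every virtual mesh of $K$ admissible with constants $\theta_M<\pi$ and $d_1,d_2\in(0,1]$, and every $\mathbf v_h\in\mathbf V^e_h(K)$, the tangential trace $\mathbf v_h\cdot\mathbf t$ exists in $L^2(\partial K)$ and $$\|\mathbf v_h\|_{0,K}\le\left(\frac{\cot\big((\pi-\theta_M)/2\big)\,C_n}{2\min\{d_1,d_2\}}\right)^{1/2}\Big(h_K^{1/2}\|\mathbf v_h\cdot\mathbf t\|_{0,\partial K}+h_K\|\operatorname{rot}\mathbf v_h\|_{0,K}\Big).$$ 2. There is a constant $C$, depending only on $\Omega$, $\Omega^\pm$, $\beta^\pm$, $\theta_M$, $d_1$, $d_2$ and an upper bound $N$ for the number of edges of an element, such that whenever every element has an admissible virtual mesh and at most $N$ edges, then for all $\mathbf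 v_h\in\mathbf V_h^e$ the traces in $\|\mathbf v_h\|_b$ exist in $L^2$ and $\|\mathbf v_h\|_{0,\Omega}\le C\|\mathbf v_h\|_a$. 3. Let $s\in(1/2,1]$. There is a constant $C$, depending only on $\Omega$, $\Omega^\pm$, $\beta^\pm$, $s$, $\theta_M$, $d_1$, $d_2$, $N$, $c_1$, $c_2$, $N'$, such that the following holds whenever every element $K$ has an admissible virtual mesh and at most $N$ edges, every edge $e$ of $K$ satisfies $h_eh_K\le c_1|K|$ or $c_2^{-1}h_K\le h_e\le c_2l_e^{-1}|K|$ with $l_e=\max_{x\in \overline K}\operatorname{dist}(x,e)$, and the ball of diameter $3h_K$ about the centroid of $K$ meets at most $N'$ elements: for all $\mathbf v\in\mathbf Y^s(\Omega)$ the traces in $\|\mathbf v\|_b$ exist in $L^2$ and $\|\mathbf v\|_b\le C\|\mathbf v\|_{s,\Omega^\pm}$. -/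

import Mathlib

open MeasureTheory Set
open scoped ContDiff ENNReal

noncomputable section

namespace MaxwellVEM

/-! ## Plane, differential operators, weak derivatives -/

/-- The Euclidean plane; vector fields are maps `Plane → Plane`. -/
abbrev Plane : Type := EuclideanSpace ℝ (Fin 2)

/-- The partial derivative `∂_i φ` of a scalar function. -/
def pderiv (i : Fin 2) (φ : Plane → ℝ) (x : Plane) : ℝ :=
  fderiv ℝ φ x (EuclideanSpace.single i 1)

/-- The vector rotation `(∂₂ φ, -∂₁ φ)` of a scalar function. -/
def vrot (φ : Plane → ℝ) (x : Plane) : Plane := !₂[pderiv 1 φ x, -pderiv 0 φ x]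

/-- The gradient `(∂₁ φ, ∂₂ φ)` of a scalar function. -/
def grad (φ : Plane → ℝ) (x : Plane) : Plane := !₂[pderiv 0 φ x, pderiv 1 φ x]

/-- `C_c^∞(D)`. -/
def IsTest (D : Set Plane) (φ : Plane → ℝ) : Prop :=
  ContDiff ℝ ∞ φ ∧ HasCompactSupport φ ∧ tsupport φ ⊆ D

/-- `v ∈ L²(D)²`. -/
def MemL2 (D : Set Plane) (v : Plane → Plane) : Prop := MemLp v 2 (volume.restrict D)

/-- The norm `‖v‖_{0,D}`. -/
def l2Norm {E : Type} [NormedAddCommGroup E] (D : Set Plane) (v : Plane → E) : ℝ :=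
  √(∫ x in D, ‖v x‖ ^ 2)

/-- `r ∈ L²(D)` is the weak scalar rotation `∂₁ v₂ - ∂₂ v₁` of `v` on `D`. -/
def IsWeakRot (D : Set Plane) (v : Plane → Plane) (r : Plane → ℝ) : Prop :=
  MemLp r 2 (volume.restrict D) ∧
    ∀ φ, IsTest D φ → ∫ x in D, r x * φ x = ∫ x in D, inner ℝ (v x) (vrot φ x)

/-- `v ∈ H(rot; D)`. -/
def MemHRot (D : Set Plane) (v : Plane → Plane) : Prop :=
  MemL2 D v ∧ ∃ r, IsWeakRot D v r

open Classical in
/-- The weak rotation of `v ∈ H(rot; D)` (unique almost everywhere on an open `D`). -/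
def weakRot (D : Set Plane) (v : Plane → Plane) : Plane → ℝ :=
  if h : ∃ r, IsWeakRot D v r then h.choose else 0

/-- `v ∈ H₀(rot; D)`, the fields in `H(rot; D)` with zero tangential trace: the integration by parts
formula holds without a boundary term for all smooth functions on the plane. -/
def MemHRotZero (D : Set Plane) (v : Plane → Plane) : Prop :=
  MemHRot D v ∧ ∀ φ : Plane → ℝ, ContDiff ℝ ∞ φ → HasCompactSupport φ →
    ∫ x in D, weakRot D v x * φ x = ∫ x in D, inner ℝ (v x) (vrot φ x)

/-- `v ∈ H(div; D)`. -/
def MemHDiv (D : Set Plane) (v : Plane → Plane) : Prop :=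
  MemL2 D v ∧ ∃ d : Plane → ℝ, MemLp d 2 (volume.restrict D) ∧
    ∀ φ, IsTest D φ → ∫ x in D, d x * φ x = -∫ x in D, inner ℝ (v x) (grad φ x)

/-- `g ∈ L²(D)²` is the weak partial derivative `∂_i v` of the vector field `v` on `D`. -/
def IsWeakPartial (i : Fin 2) (D : Set Plane) (v g : Plane → Plane) : Prop :=
  MemL2 D g ∧ ∀ φ, IsTest D φ → ∫ x in D, φ x • g x = -∫ x in D, pderiv i φ x • v x

/-- The seminorm `|v|_{s,D}`: the Sobolev–Slobodeckij double integral for `s < 1`, and the `L²` norm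
of the weak gradient for `s = 1` (infinite if there is no weak gradient in `L²`).
Only used for `0 < s ≤ 1`. -/
def sobolevSeminorm (s : ℝ) (D : Set Plane) (v : Plane → Plane) : ℝ≥0∞ :=
  if s < 1 then
    (∫⁻ x in D, ∫⁻ y in D, ‖v x - v y‖ₑ ^ 2 / edist x y ^ (2 * (1 + s))) ^ (1 / 2 : ℝ)
  else
    ⨅ (g : Fin 2 → Plane → Plane) (_ : ∀ i, IsWeakPartial i D v (g i)),
      (∑ i, eLpNorm (g i) 2 (volume.restrict D) ^ 2) ^ (1 / 2 : ℝ)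

/-- The norm `‖v‖_{s,D} = ‖v‖_{0,D} + |v|_{s,D}`. -/
def sobolevNorm (s : ℝ) (D : Set Plane) (v : Plane → Plane) : ℝ≥0∞ :=
  eLpNorm v 2 (volume.restrict D) + sobolevSeminorm s D v

/-- `v ∈ H^s(D)²`. -/
def MemHs (s : ℝ) (D : Set Plane) (v : Plane → Plane) : Prop :=
  MemL2 D v ∧ sobolevSeminorm s D v < ⊤

/-! ## The domain, the interface and the coefficient -/

/-- An open set which near each of its boundary points is, in suitable Cartesian coordinates, the
region above the graph of a Lipschitz function. -/
def IsLipschitzOpen (D : Set Plane) : Prop :=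
  IsOpen D ∧ ∀ p ∈ frontier D, ∃ (T : Plane ≃ᵃⁱ[ℝ] Plane) (r : ℝ) (L : NNReal) (f : ℝ → ℝ),
    0 < r ∧ LipschitzWith L f ∧ ∀ x ∈ Metric.ball p r, x ∈ D ↔ f (T x 0) < T x 1

/-- A bounded Lipschitz domain `Ω` that an interface `Γ = Ω ∩ ∂Ω⁺ ∩ ∂Ω⁻` splits into
the Lipschitz parts `Ω⁺` and `Ω⁻`, with a positive piecewise constant coefficient `β`. -/
structure InterfaceDomain where
  Ω : Set Plane
  Ωp : Set Plane
  Ωm : Set Plane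
  bounded : Bornology.IsBounded Ω
  lipschitz : IsLipschitzOpen Ω
  lipschitz_plus : IsLipschitzOpen Ωp
  lipschitz_minus : IsLipschitzOpen Ωm
  plus_subset : Ωp ⊆ Ω
  minus_subset : Ωm ⊆ Ω
  disjoint : Disjoint Ωp Ωm
  cover : Ω ⊆ closure Ωp ∪ closure Ωm
  βp : ℝ
  βm : ℝ
  βp_pos : 0 < βp
  βm_pos : 0 < βm

namespace InterfaceDomain

variable (P : InterfaceDomain)

open Classical in
/-- The coefficient `β`, equal to `β⁺` on `Ω⁺` and to `β⁻` on `Ω⁻`. -/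
def β (x : Plane) : ℝ := if x ∈ P.Ωp then P.βp else P.βm

/-- `v ∈ Y^s(Ω) = H^s(Ω^±) ∩ H(β, div; Ω) ∩ H(rot; Ω)`. -/
def MemY (s : ℝ) (v : Plane → Plane) : Prop :=
  MemHs s P.Ωp v ∧ MemHs s P.Ωm v ∧ MemHDiv P.Ω (fun x => P.β x • v x) ∧ MemHRot P.Ω v

/-- The broken norm `‖v‖_{s,Ω^±}` (finite for `v ∈ Y^s(Ω)`). -/
def brokenNorm (s : ℝ) (v : Plane → Plane) : ℝ :=
  (sobolevNorm s P.Ωp v + sobolevNorm s P.Ωm v).toReal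

end InterfaceDomain

/-! ## Polygonal elements -/

/-- A simple polygon with `m + 3` vertices in counterclockwise order (indices are cyclic, angles equal
to `π` are allowed). The carrier is the open region enclosed by the boundary polyline, i.e. the
bounded component of its complement. -/
structure PolyCell where
  m : ℕ
  vertex : Fin (m + 3) → Plane
  carrier : Set Plane
  vertex_injective : Function.Injective vertex
  simple : ∀ i j, i ≠ j →
    segment ℝ (vertex i) (vertex (i + 1)) ∩ segment ℝ (vertex j) (vertex (j + 1)) ⊆
      {vertex i, vertex (i + 1)} ∩ {vertex j, vertex (j + 1)}
  counterclockwise :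
    0 < ∑ i, (vertex i 0 * vertex (i + 1) 1 - vertex (i + 1) 0 * vertex i 1)
  isOpen : IsOpen carrier
  isConnected : IsConnected carrier
  isBounded : Bornology.IsBounded carrier
  frontier_eq : frontier carrier = ⋃ i, segment ℝ (vertex i) (vertex (i + 1))

namespace PolyCell

variable (K : PolyCell)

/-- The number of vertices (equivalently edges) of `K`. -/
def numVertices : ℕ := K.m + 3

/-- The diameter `h_K`. -/
def diam : ℝ := Metric.diam K.carrier

/-- The area `|K|`. -/
def area : ℝ := volume.real K.carrier

/-- The length `h_e` of the `i`-th edge. -/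
def edgeLength (i : Fin (K.m + 3)) : ℝ := dist (K.vertex i) (K.vertex (i + 1))

/-- The point with parameter `τ ∈ [0, 1]` on the `i`-th edge. -/
def edgePoint (i : Fin (K.m + 3)) (τ : ℝ) : Plane :=
  AffineMap.lineMap (K.vertex i) (K.vertex (i + 1)) τ

/-- The supporting height `l_e = max_{x ∈ K} dist(x, e)` of the `i`-th edge. -/
def edgeHeight (i : Fin (K.m + 3)) : ℝ :=
  sSup ((fun x => Metric.infDist x (segment ℝ (K.vertex i) (K.vertex (i + 1)))) ''
    closure K.carrier)

/-- The integral `∫_{∂K} g ds` of a function given edge by edge in the edge parameter. -/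
def boundaryIntegral (g : Fin (K.m + 3) → ℝ → ℝ) : ℝ :=
  ∑ i, K.edgeLength i * ∫ τ in (0 : ℝ)..1, g i τ

/-- `g ∈ L²(∂K)` is the tangential trace `v · t` of `v` on `∂K` (`t` counterclockwise), in the
sense of the integration by parts formula
`(rot v, φ)_K - (v, rot φ)_K = ∫_{∂K} (v · t) φ ds` for all smooth `φ`. -/
def IsTangentialTrace (v : Plane → Plane) (g : Fin (K.m + 3) → ℝ → ℝ) : Prop :=
  (∀ i, MemLp (g i) 2 (volume.restrict (Icc (0 : ℝ) 1))) ∧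
    ∀ φ : Plane → ℝ, ContDiff ℝ ∞ φ → HasCompactSupport φ →
      (∫ x in K.carrier, weakRot K.carrier v x * φ x)
          - ∫ x in K.carrier, inner ℝ (v x) (vrot φ x) =
        K.boundaryIntegral fun i τ => g i τ * φ (K.edgePoint i τ)

/-- `v ∈ H(rot; K)` has a tangential trace in `L²(∂K)`. -/
def HasTangentialTrace (v : Plane → Plane) : Prop :=
  MemHRot K.carrier v ∧ ∃ g, K.IsTangentialTrace v g

open Classical in
/-- The tangential trace `v · t` on `∂K` (unique almost everywhere). -/
def tangentialTrace (v : Plane → Plane) : Fin (K.m + 3) → ℝ → ℝ :=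
  if h : ∃ g, K.IsTangentialTrace v g then h.choose else 0

/-- The norm `‖v · t‖_{0,∂K}`. -/
def traceNorm (v : Plane → Plane) : ℝ :=
  √(K.boundaryIntegral fun i τ => K.tangentialTrace v i τ ^ 2)

/-- The `L²(K)` projection `Π_K v` onto constant vectors, i.e. the mean value. -/
def proj (v : Plane → Plane) : Plane := ⨍ x in K.carrier, v x

/-- The field `(I - Π_K) v` on `K`. -/
def projErr (v : Plane → Plane) (x : Plane) : Plane := v x - K.proj v

/-- The centroid of `K`. -/
def centroid : Plane := ⨍ x in K.carrier, x

end PolyCell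

/-! ## Virtual meshes and the local edge space -/

/-- A local virtual mesh of `K`: a conforming triangulation of `K` whose triangles are given by the
indices of their corners. All corners are vertices of `K` (no interior node), and every vertex of
`K` that lies on a triangle is one of its corners. -/
structure VirtualMesh (K : PolyCell) where
  tri : Finset (Finset (Fin (K.m + 3)))
  card_eq : ∀ t ∈ tri, t.card = 3
  nondegenerate : ∀ t ∈ tri, AffineIndependent ℝ fun i : t => K.vertex i
  cover : ⋃ t ∈ tri, convexHull ℝ (K.vertex '' t) = closure K.carrier
  conforming : ∀ t ∈ tri, ∀ t' ∈ tri,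
    convexHull ℝ (K.vertex '' t) ∩ convexHull ℝ (K.vertex '' t') =
      convexHull ℝ (K.vertex '' (t ∩ t' : Finset (Fin (K.m + 3))))
  nodes : ∀ t ∈ tri, ∀ i, K.vertex i ∈ convexHull ℝ (K.vertex '' t) → i ∈ t

namespace VirtualMesh

variable {K : PolyCell} (V : VirtualMesh K)

/-- Maximum angle condition: every angle of every triangle is at most `θM`. -/
def MaxAngle (θM : ℝ) : Prop :=
  ∀ t ∈ V.tri, ∀ i ∈ t, ∀ j ∈ t, ∀ k ∈ t, i ≠ j → j ≠ k → i ≠ k →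
    EuclideanGeometry.angle (K.vertex i) (K.vertex j) (K.vertex k) ≤ θM

/-- Short-interior-edge condition: every interior edge `e` satisfies `h_e ≥ d₁ h_K`, or its end points
are connected by a chain of edges `e_l` of `K` with `h_e ≥ d₂ h_{e_l}`. -/
def ShortInteriorEdge (d₁ d₂ : ℝ) : Prop :=
  ∀ t ∈ V.tri, ∀ i ∈ t, ∀ j ∈ t, i ≠ j → j ≠ i + 1 → i ≠ j + 1 →
    d₁ * K.diam ≤ dist (K.vertex i) (K.vertex j) ∨
      Relation.ReflTransGen
        (fun a b => (b = a + 1 ∨ a = b + 1) ∧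
          d₂ * dist (K.vertex a) (K.vertex b) ≤ dist (K.vertex i) (K.vertex j)) i j

/-- The virtual mesh satisfies both conditions. -/
def Admissible (θM d₁ d₂ : ℝ) : Prop := V.MaxAngle θM ∧ V.ShortInteriorEdge d₁ d₂

/-- The local edge space `V^e_h(K)`: fields in `H(rot; K)` with constant rotation on `K` that on
each triangle are lowest-order Nédélec fields `a + b (-x₂, x₁)`. -/
def MemEdgeSpace (v : Plane → Plane) : Prop :=
  MemHRot K.carrier v ∧
    (∀ t ∈ V.tri, ∃ (a : Plane) (b : ℝ),
      ∀ᵐ x ∂volume.restrict (convexHull ℝ (K.vertex '' t)), v x = a + b • !₂[-x 1, x 0]) ∧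
    ∃ c : ℝ, IsWeakRot K.carrier v fun _ => c

end VirtualMesh

/-! ## Global meshes, norms and the global edge space -/

/-- A polygonal mesh of `Ω`; a vertex of one element on the boundary of another element is a vertex
of both. The label `plus k` tells whether element `k` belongs to `Ω_h⁺` (`true`) or to
`Ω_h⁻` (`false`), the two sides of the discrete interface `Γ_h`. -/
structure PolyMesh (Ω : Set Plane) where
  num : ℕ
  cell : Fin num → PolyCell
  plus : Fin num → Bool
  subset : ∀ k, (cell k).carrier ⊆ Ω
  disjoint : ∀ k l, k ≠ l → Disjoint (cell k).carrier (cell l).carrier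
  cover : ⋃ k, closure (cell k).carrier = closure Ω
  conforming : ∀ k l i, (cell l).vertex i ∈ closure (cell k).carrier →
    ∃ j, (cell k).vertex j = (cell l).vertex i

namespace PolyMesh

/-- The mesh size `h = max_K h_K`. -/
def h {Ω : Set Plane} (M : PolyMesh Ω) : ℝ := ⨆ k, (M.cell k).diam

/-- Every element has at most `N` edges. -/
def EdgeCount {Ω : Set Plane} (M : PolyMesh Ω) (N : ℕ) : Prop :=
  ∀ k, (M.cell k).numVertices ≤ N

/-- Edge condition: each edge `e` of each element `K` satisfies `h_e h_K ≤ c₁ |K|` or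
`c₂⁻¹ h_K ≤ h_e ≤ c₂ l_e⁻¹ |K|`. -/
def EdgeCondition {Ω : Set Plane} (M : PolyMesh Ω) (c₁ c₂ : ℝ) : Prop :=
  ∀ k i,
    (M.cell k).edgeLength i * (M.cell k).diam ≤ c₁ * (M.cell k).area ∨
      (c₂⁻¹ * (M.cell k).diam ≤ (M.cell k).edgeLength i ∧
        (M.cell k).edgeLength i ≤ c₂ * ((M.cell k).edgeHeight i)⁻¹ * (M.cell k).area)

/-- Block condition: the ball of diameter `3 h_K` around the centroid of `K` meets at most `N`
elements. -/
def BlockCondition {Ω : Set Plane} (M : PolyMesh Ω) (N : ℕ) : Prop :=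
  ∀ k, {l | ((M.cell l).carrier ∩
    Metric.ball (M.cell k).centroid (3 / 2 * (M.cell k).diam)).Nonempty}.ncard ≤ N

variable {P : InterfaceDomain} (M : PolyMesh P.Ω)

/-- The value of `β_h` on element `k`. -/
def βh (k : Fin M.num) : ℝ := if M.plus k then P.βp else P.βm

/-- The norm `‖v‖_b`, with
`‖v‖_b² = ∑_K ((β_h Π_K v, Π_K v)_K + h ‖(I - Π_K) v · t‖²_{0,∂K})`. -/
def bNorm (v : Plane → Plane) : ℝ :=
  √(∑ k, (M.βh k * ‖(M.cell k).proj v‖ ^ 2 * (M.cell k).area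
    + M.h * (M.cell k).traceNorm ((M.cell k).projErr v) ^ 2))

/-- The norm `‖v‖_a`, with `‖v‖_a² = ‖rot v‖²_{0,Ω} + ‖v‖_b²`. -/
def aNorm (v : Plane → Plane) : ℝ :=
  √(l2Norm P.Ω (weakRot P.Ω v) ^ 2 + M.bNorm v ^ 2)

/-- The traces that enter `‖v‖_b` exist in `L²(∂K)` for every element `K`. -/
def HasTraces (v : Plane → Plane) : Prop :=
  ∀ k, (M.cell k).HasTangentialTrace ((M.cell k).projErr v)

/-- The global edge space `V^e_h`. -/
def MemEdgeSpace (V : ∀ k, VirtualMesh (M.cell k)) (v : Plane → Plane) : Prop :=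
  (∀ k, (V k).MemEdgeSpace v) ∧ MemHRotZero P.Ω v

end PolyMesh

end MaxwellVEM

end

open MaxwellVEM

noncomputable section

namespace MaxwellVEM

/-! ## Planar vector algebra -/

/-! Local bound. On each triangle of the virtual mesh an edge field is `a_t + b (-x₂, x₁)`, and `b`
is the same for all triangles because the rotation `2 b` is constant on `K`. Green's formula on a
triangle (`triangle_green`) pairs the field with a test function through circulations along the
edges. Hence the circulation along an interior edge is the same from both sides (`IsField.circ_eq`),
and the tangential trace on an edge of `K` is the constant circulation divided by the length
(`IsField.isTangentialTrace`). An interior edge cuts the mesh into two sides, and the edges of `K`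
on a side form one of the two arcs between its end points (`exists_cut`, `IsSide.arc_eq`). Stokes'
formula on a side (`IsSide.balance`) expresses the interior circulation by the circulations on that
arc and `2 b` times the area of the side; by Cauchy-Schwarz its square is bounded by the length of
the arc (`IsField.circ_sq_le_arc`). The short-edge condition provides an arc whose edges are all
comparable with the interior edge or shorter (`IsField.circ_sq_le`). Every triangle has a corner
with an angle between `π/3` and `θ_M`; the two circulations at this corner determine the field
there, at the price of a cotangent (`norm_sq_mul_cr_le`). Summation over the triangles gives
`VirtualMesh.l2Norm_le`.

Global bound. Constants are edge fields, so the local bound applies to `v - Π_K v`, and the means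
are already part of `‖v‖_b` (`PolyMesh.l2Norm_le_aNorm`).

Bound of `‖v‖_b`. The trace of `v - Π_K v` is found by duality: if the mean square over strips of
width `δ` along the edges is at most `δ A`, then the functional `(rot u, φ)_K - (u, rot φ)_K` is
bounded by the `L²(∂K)` norm of `φ`, and Riesz' theorem supplies a trace with squared norm of order
`A` times the number of edges (`exists_hasTangentialTrace`). The strip condition follows from
`thin_trace`: the values on a set of width `δ` are compared with averages over balls in a cone, at
scales doubling from `δ` to `r`; the increments form a geometric sum because `s > 1/2`. The bound is
applied on `Ω⁺` and `Ω⁻` separately and on their whole neighbourhood of `K`, so no shape regularity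
of `K` enters except through the edge condition, which controls the mean `Π_K v`. An element that
lies up to a null set in one part is treated with a Poincaré inequality. An element that meets both
parts contains boundary points of both; there no small constant can be subtracted on both sides at
once, and `h_K⁻¹ ‖v‖²` is instead bounded by an average of `|v|²` over a thin layer along the
boundary (`layer_estimates`). With one common layer width for the mesh, the layer terms add up, by
finite overlap (`exists_overlap`), to an average over the whole layer, which `thin_trace` bounds
uniformly in the width (`bNorm_sq_le`). For `s = 1` the gradient is first shown to control the
seminorm of order `3/4` (`gag_le_gradSq`), by translations along cones. -/

/-- The scalar cross product of two plane vectors. -/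
def cr (a b : Plane) : ℝ := a 0 * b 1 - a 1 * b 0

/-- The rotation of a plane vector by a right angle. -/
def rotQ (x : Plane) : Plane := !₂[-x 1, x 0]

/-- The field `a + b (-x₂, x₁)`. -/
def nedelec (a : Plane) (b : ℝ) (x : Plane) : Plane := a + b • rotQ x

/-- The circulation of `a + b (-x₂, x₁)` along the segment from `p` to `q`. -/
def circ (a : Plane) (b : ℝ) (p q : Plane) : ℝ := inner ℝ a (q - p) + b * cr p q

/-- The mean value of `η` on the segment from `p` to `q`. -/
def segAvg (η : Plane → ℝ) (p q : Plane) : ℝ := ∫ τ in (0 : ℝ)..1, η (AffineMap.lineMap p q τ)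

lemma inner_plane (a b : Plane) : inner ℝ a b = a 0 * b 0 + a 1 * b 1 := by
  simp [PiLp.inner_apply, Fin.sum_univ_two]; ring

lemma norm_sq_plane (a : Plane) : ‖a‖ ^ 2 = a 0 ^ 2 + a 1 ^ 2 := by
  rw [← real_inner_self_eq_norm_sq, inner_plane]; ring

@[simp] lemma rotQ_zero (x : Plane) : rotQ x 0 = -x 1 := by simp [rotQ]
@[simp] lemma rotQ_one (x : Plane) : rotQ x 1 = x 0 := by simp [rotQ]

lemma norm_rotQ (x : Plane) : ‖rotQ x‖ = ‖x‖ := by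
  have : ‖rotQ x‖ ^ 2 = ‖x‖ ^ 2 := by rw [norm_sq_plane, norm_sq_plane]; simp; ring
  exact (pow_left_inj₀ (norm_nonneg _) (norm_nonneg _) two_ne_zero).1 this

lemma cr_self (a : Plane) : cr a a = 0 := by simp [cr]; ring

lemma cr_swap (a b : Plane) : cr b a = -cr a b := by simp [cr]; ring

lemma abs_cr_le (a b : Plane) : |cr a b| ≤ ‖a‖ * ‖b‖ := by
  apply abs_le_of_sq_le_sq _ (by positivity)
  rw [mul_pow, norm_sq_plane, norm_sq_plane, cr]
  nlinarith [sq_nonneg (a 0 * b 0 + a 1 * b 1)]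

lemma cr_sq_add_inner_sq (a b : Plane) : cr a b ^ 2 + inner ℝ a b ^ 2 = ‖a‖ ^ 2 * ‖b‖ ^ 2 := by
  rw [norm_sq_plane, norm_sq_plane, inner_plane, cr]; ring

lemma circ_swap (a : Plane) (b : ℝ) (p q : Plane) : circ a b q p = -circ a b p q := by
  simp only [circ, inner_plane, cr, PiLp.sub_apply]; ring

lemma segAvg_swap (η : Plane → ℝ) (p q : Plane) : segAvg η q p = segAvg η p q := by
  unfold segAvg
  have := intervalIntegral.integral_comp_sub_left
    (fun τ => η (AffineMap.lineMap p q τ)) (a := 0) (b := 1) (1 : ℝ)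
  simp only [sub_self, sub_zero] at this
  rw [← this]
  congr 1; ext τ; rw [AffineMap.lineMap_apply_one_sub]

lemma fderiv_apply_plane (φ : Plane → ℝ) (x w : Plane) :
    fderiv ℝ φ x w = w 0 * pderiv 0 φ x + w 1 * pderiv 1 φ x := by
  have : w = w 0 • EuclideanSpace.single 0 (1 : ℝ) + w 1 • EuclideanSpace.single 1 (1 : ℝ) := by
    ext i; fin_cases i <;> simp
  conv_lhs => rw [this]
  simp [pderiv]

@[simp] lemma vrot_zero (φ : Plane → ℝ) (x : Plane) : vrot φ x 0 = pderiv 1 φ x := by simp [vrot]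
@[simp] lemma vrot_one (φ : Plane → ℝ) (x : Plane) : vrot φ x 1 = -pderiv 0 φ x := by simp [vrot]

/-! ## Green's formula on a triangle -/

/-- The reference triangle. -/
def refTri : Set Plane := {x | 0 ≤ x 0 ∧ 0 ≤ x 1 ∧ x 0 + x 1 ≤ 1}

/-- The linear part of the affine map from the reference triangle. -/
def triLin (u w : Plane) : Plane →L[ℝ] Plane :=
  (EuclideanSpace.proj 0 : Plane →L[ℝ] ℝ).smulRight u +
    (EuclideanSpace.proj 1 : Plane →L[ℝ] ℝ).smulRight w

lemma triLin_apply (u w x : Plane) : triLin u w x = x 0 • u + x 1 • w := by simp [triLin]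

lemma det_triLin (u w : Plane) : (triLin u w).det = cr u w := by
  rw [ContinuousLinearMap.det, ← LinearMap.det_toMatrix (EuclideanSpace.basisFun (Fin 2) ℝ).toBasis,
    Matrix.det_fin_two]
  simp [LinearMap.toMatrix_apply, triLin_apply, cr]; ring

lemma triLin_injective {u w : Plane} (h : cr u w ≠ 0) : Function.Injective (triLin u w) := by
  intro x y hxy
  have h0 : (triLin u w x) 0 = (triLin u w y) 0 := by rw [hxy]
  have h1 : (triLin u w x) 1 = (triLin u w y) 1 := by rw [hxy]
  simp only [triLin_apply, PiLp.add_apply, PiLp.smul_apply, smul_eq_mul] at h0 h1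
  unfold cr at h
  ext i
  fin_cases i
  · apply mul_right_cancel₀ h; change x 0 * _ = y 0 * _; linear_combination w 1 * h0 - w 0 * h1
  · apply mul_right_cancel₀ h; change x 1 * _ = y 1 * _; linear_combination u 0 * h1 - u 1 * h0

lemma mem_triangle {p q r y : Plane} : y ∈ convexHull ℝ ({p, q, r} : Set Plane) ↔
    ∃ s t : ℝ, 0 ≤ s ∧ 0 ≤ t ∧ s + t ≤ 1 ∧ y = p + (s • (q - p) + t • (r - p)) := by
  constructor
  · intro hy
    rw [convexHull_insert (by simp), convexHull_pair] at hy
    simp only [mem_convexJoin, mem_singleton_iff, exists_eq_left] at hy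
    obtain ⟨z, hz, hy⟩ := hy
    rw [segment_eq_image'] at hz hy
    obtain ⟨θ, ⟨hθ0, hθ1⟩, rfl⟩ := hz
    obtain ⟨ρ, ⟨hρ0, hρ1⟩, rfl⟩ := hy
    refine ⟨ρ * (1 - θ), ρ * θ, by nlinarith, by nlinarith, by nlinarith, ?_⟩
    ext i; simp; ring
  · rintro ⟨s, t, hs, ht, hst, rfl⟩
    have hc := convex_convexHull ℝ ({p, q, r} : Set Plane)
    have := hc.sum_mem (t := Finset.univ) (w := ![1 - s - t, s, t]) (z := ![p, q, r])
      (by intro i _; fin_cases i <;> simp <;> linarith) (by simp [Fin.sum_univ_three]; ring)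
      (by intro i _; fin_cases i <;> exact subset_convexHull ℝ _ (by simp))
    convert this using 1
    ext i; simp [Fin.sum_univ_three]; ring

lemma image_refTri (p q r : Plane) :
    (fun x => p + triLin (q - p) (r - p) x) '' refTri = convexHull ℝ {p, q, r} := by
  ext y
  rw [mem_triangle]
  constructor
  · rintro ⟨x, ⟨h0, h1, h2⟩, rfl⟩
    exact ⟨x 0, x 1, h0, h1, h2, by simp [triLin_apply]⟩
  · rintro ⟨s, t, hs, ht, hst, rfl⟩
    exact ⟨!₂[s, t], ⟨by simpa, by simpa, by simpa⟩, by simp [triLin_apply]⟩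

lemma measurableSet_refTri : MeasurableSet refTri := by
  have h0 : Continuous fun x : Plane => x 0 := by fun_prop
  have h1 : Continuous fun x : Plane => x 1 := by fun_prop
  exact ((isClosed_le continuous_const h0).inter ((isClosed_le continuous_const h1).inter
    (isClosed_le (h0.add h1) continuous_const))).measurableSet

lemma integral_triangle (p q r : Plane) (h : cr (q - p) (r - p) ≠ 0) (G : Plane → ℝ) :
    ∫ x in convexHull ℝ {p, q, r}, G x =
      |cr (q - p) (r - p)| * ∫ x in refTri, G (p + triLin (q - p) (r - p) x) := by
  rw [← image_refTri, integral_image_eq_integral_abs_det_fderiv_smul volume measurableSet_refTri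
    (f' := fun _ => triLin (q - p) (r - p))
    (fun x _ => (((triLin (q - p) (r - p)).hasFDerivAt).const_add p).hasFDerivWithinAt)
    (fun x _ y _ hxy => triLin_injective h (by simpa using hxy))]
  simp [det_triLin, integral_const_mul]

/-- The measurable identification of `ℝ × ℝ` with the plane. -/
def planeEquiv : ℝ × ℝ ≃ᵐ Plane :=
  (MeasurableEquiv.finTwoArrow (α := ℝ)).symm.trans (MeasurableEquiv.toLp 2 (Fin 2 → ℝ))

lemma planeEquiv_apply (z : ℝ × ℝ) : planeEquiv z = !₂[z.1, z.2] := by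
  rfl

lemma measurePreserving_planeEquiv : MeasurePreserving planeEquiv volume volume :=
  (volume_preserving_finTwoArrow ℝ).symm.trans
    (EuclideanSpace.volume_preserving_symm_measurableEquiv_toLp (Fin 2)).symm

lemma integral_refTri (G : Plane → ℝ) (hG : Continuous G) :
    ∫ x in refTri, G x = ∫ t in (0 : ℝ)..1, ∫ s in (0 : ℝ)..(1 - t), G !₂[s, t] := by
  rw [← measurePreserving_planeEquiv.setIntegral_preimage_emb planeEquiv.measurableEmbedding]
  set A : Set (ℝ × ℝ) := planeEquiv ⁻¹' refTri with hA
  have hAm : MeasurableSet A := planeEquiv.measurable measurableSet_refTri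
  have hAi : IntegrableOn (fun z : ℝ × ℝ => G (planeEquiv z)) A := by
    have hc : Continuous fun z : ℝ × ℝ => G (planeEquiv z) := by
      simp only [planeEquiv_apply]; fun_prop
    refine (hc.continuousOn.integrableOn_compact
      (isCompact_Icc (a := ((0 : ℝ), (0 : ℝ))) (b := (1, 1)))).mono_set ?_
    rintro ⟨s, t⟩ ⟨h0, h1, h2⟩
    simp only [planeEquiv_apply] at h0 h1 h2
    simp at h0 h1 h2
    exact ⟨⟨h0, h1⟩, ⟨by simp; linarith, by simp; linarith⟩⟩
  rw [← integral_indicator hAm, Measure.volume_eq_prod, integral_prod_symm]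
  swap
  · rw [← Measure.volume_eq_prod]; exact hAi.integrable_indicator hAm
  rw [intervalIntegral.integral_of_le zero_le_one, ← integral_Icc_eq_integral_Ioc,
    ← integral_indicator measurableSet_Icc]
  congr 1; ext t
  by_cases ht : t ∈ Icc (0 : ℝ) 1
  · rw [indicator_of_mem ht, intervalIntegral.integral_of_le (by linarith [ht.2]),
      ← integral_Icc_eq_integral_Ioc, ← integral_indicator measurableSet_Icc]
    congr 1; ext s
    have : (s, t) ∈ A ↔ s ∈ Icc 0 (1 - t) := by
      simp only [hA, mem_preimage, planeEquiv_apply, refTri, mem_ofPred_eq, mem_Icc]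
      simp [ht.1, le_sub_iff_add_le]
    by_cases hs : s ∈ Icc 0 (1 - t)
    · rw [indicator_of_mem hs, indicator_of_mem (this.2 hs), planeEquiv_apply]
    · rw [indicator_of_notMem hs, indicator_of_notMem (mt this.1 hs)]
  · rw [indicator_of_notMem ht]
    rw [← integral_zero ℝ ℝ]
    congr 1; ext s
    apply indicator_of_notMem
    rintro ⟨h0, h1, h2⟩
    simp only [planeEquiv_apply] at h0 h1 h2
    simp at h0 h1 h2
    exact ht ⟨h1, by linarith⟩

/-- Green's formula in one direction. -/
lemma integral_triangle_fderiv (p q r : Plane) (h : cr (q - p) (r - p) ≠ 0) (F : Plane → ℝ)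
    (hF : ContDiff ℝ 1 F) :
    ∫ x in convexHull ℝ {p, q, r}, fderiv ℝ F x (q - p) =
      |cr (q - p) (r - p)| * (segAvg F q r - segAvg F p r) := by
  have hF' : Continuous (fderiv ℝ F) := hF.continuous_fderiv one_ne_zero
  rw [integral_triangle p q r h, integral_refTri _ (by fun_prop)]
  congr 1
  have key : ∀ t : ℝ, ∫ s in (0 : ℝ)..(1 - t),
      fderiv ℝ F (p + triLin (q - p) (r - p) !₂[s, t]) (q - p) =
      F (AffineMap.lineMap q r t) - F (AffineMap.lineMap p r t) := by
    intro t
    have hd : ∀ s : ℝ, HasDerivAt (fun s : ℝ => F (p + triLin (q - p) (r - p) !₂[s, t]))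
        (fderiv ℝ F (p + triLin (q - p) (r - p) !₂[s, t]) (q - p)) s := by
      intro s
      have h1 : HasDerivAt (fun s : ℝ => p + triLin (q - p) (r - p) !₂[s, t]) (q - p) s := by
        simp only [triLin_apply]
        have := ((hasDerivAt_id s).smul_const (q - p)).const_add p |>.add_const (t • (r - p))
        simpa [add_assoc] using this
      exact ((hF.differentiable one_ne_zero _).hasFDerivAt.comp_hasDerivAt s h1)
    rw [intervalIntegral.integral_eq_sub_of_hasDerivAt (fun s _ => hd s)]
    · congr 2
      · rw [AffineMap.lineMap_apply_module', triLin_apply]; ext i; simp; ring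
      · rw [AffineMap.lineMap_apply_module', triLin_apply]; ext i; simp; ring
    · apply Continuous.intervalIntegrable
      simp only [triLin_apply]
      fun_prop
  simp_rw [key]
  rw [intervalIntegral.integral_sub] <;> [rfl; skip; skip] <;>
  · apply Continuous.intervalIntegrable
    have := hF.continuous
    fun_prop

lemma contDiff_nedelec_mul {η : Plane → ℝ} (hη : ContDiff ℝ 1 η) (a : Plane) (b : ℝ) (w : Plane) :
    ContDiff ℝ 1 fun x => η x * (inner ℝ a w + b * cr x w) := by
  unfold cr
  fun_prop

lemma fderiv_nedelec_mul {η : Plane → ℝ} (hη : ContDiff ℝ 1 η) (a : Plane) (b : ℝ) (u w x : Plane) :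
    fderiv ℝ (fun x => η x * (inner ℝ a w + b * cr x w)) x u =
      fderiv ℝ η x u * (inner ℝ a w + b * cr x w) + η x * (b * cr u w) := by
  have h0 : ∀ i, HasFDerivAt (fun x : Plane => x i) (EuclideanSpace.proj i : Plane →L[ℝ] ℝ) x :=
    fun i => (EuclideanSpace.proj i : Plane →L[ℝ] ℝ).hasFDerivAt
  have h1 := (((h0 0).mul_const (w 1)).sub ((h0 1).mul_const (w 0))).const_mul b |>.const_add
    (inner ℝ a w)
  have h2 := ((hη.differentiable one_ne_zero x).hasFDerivAt).mul h1
  have h4 : (fun x => η x * (inner ℝ a w + b * cr x w)) =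
    η * fun x : Plane => inner ℝ a w + b * (x 0 * w 1 - x 1 * w 0) := by ext; simp [cr]
  rw [h4]
  erw [h2.fderiv]
  simp [cr]; ring

/-- The factor `inner ℝ a w + b * cr x w` is the component of the field along `w`. It does not vary
along the segment, since `cr (p + τ w) w = cr p w = cr p q`, and so leaves the mean. -/
lemma segAvg_nedelec_mul (η : Plane → ℝ) (a : Plane) (b : ℝ) (p q w : Plane) (hw : w = q - p) :
    segAvg (fun x => η x * (inner ℝ a w + b * cr x w)) p q = segAvg η p q * circ a b p q := by
  unfold segAvg
  rw [← intervalIntegral.integral_mul_const]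
  congr 1; ext τ; subst hw
  rw [AffineMap.lineMap_apply_module']
  simp [circ, cr]; ring_nf; simp

/-- Green's formula for `η (a + b (-x₂, x₁))` on a triangle. -/
lemma triangle_green (p q r : Plane) (h : cr (q - p) (r - p) ≠ 0) {η : Plane → ℝ}
    (hη : ContDiff ℝ 1 η) (a : Plane) (b : ℝ) :
    ∫ x in convexHull ℝ {p, q, r}, (2 * b * η x - inner ℝ (nedelec a b x) (vrot η x)) =
      SignType.sign (cr (q - p) (r - p)) *
        (circ a b p q * segAvg η p q + circ a b q r * segAvg η q r + circ a b r p * segAvg η r p) := by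
  set D := cr (q - p) (r - p) with hD
  -- The integrand is the rotation of `η` times the field. In the oblique frame `q - p`, `r - p`
  -- with determinant `D`, this rotation is the derivative along each side of the component along
  -- the other, so that one-directional integration applies twice.
  have hpt : ∀ x, D * (2 * b * η x - inner ℝ (nedelec a b x) (vrot η x)) =
      fderiv ℝ (fun x => η x * (inner ℝ a (r - p) + b * cr x (r - p))) x (q - p) -
      fderiv ℝ (fun x => η x * (inner ℝ a (q - p) + b * cr x (q - p))) x (r - p) := by
    intro x
    rw [fderiv_nedelec_mul hη, fderiv_nedelec_mul hη, fderiv_apply_plane, fderiv_apply_plane, hD]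
    simp only [inner_plane, nedelec, cr, vrot_zero, vrot_one, PiLp.add_apply, PiLp.smul_apply,
      rotQ_zero, rotQ_one, smul_eq_mul, PiLp.sub_apply]
    ring
  have hT : IsCompact (convexHull ℝ ({p, q, r} : Set Plane)) :=
    (Set.toFinite _).isCompact_convexHull ℝ
  have hint : ∀ w u, IntegrableOn (fun x => fderiv ℝ (fun x => η x * (inner ℝ a w + b * cr x w)) x u)
      (convexHull ℝ ({p, q, r} : Set Plane)) := by
    intro w u
    apply Continuous.continuousOn _ |>.integrableOn_compact hT
    have := (contDiff_nedelec_mul hη a b w).continuous_fderiv one_ne_zero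
    fun_prop
  have h1 := integral_triangle_fderiv p q r h _ (contDiff_nedelec_mul hη a b (r - p))
  have hperm : ({p, r, q} : Set Plane) = {p, q, r} := by rw [pair_comm]
  have h2 := integral_triangle_fderiv p r q (by rw [cr_swap]; simpa using h) _
    (contDiff_nedelec_mul hη a b (q - p))
  rw [hperm, cr_swap, abs_neg, segAvg_swap _ q r] at h2
  have hsum : D * ∫ x in convexHull ℝ {p, q, r}, (2 * b * η x - inner ℝ (nedelec a b x) (vrot η x)) =
      |D| * (circ a b p q * segAvg η p q + circ a b q r * segAvg η q r
        + circ a b r p * segAvg η r p) := by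
    rw [← integral_const_mul]
    simp_rw [hpt]
    rw [integral_sub (hint _ _) (hint _ _), h1, h2, segAvg_nedelec_mul η a b p r _ rfl,
      segAvg_nedelec_mul η a b p q _ rfl, circ_swap a b p r, segAvg_swap η p r, ← mul_sub]
    congr 1
    -- On the side opposite to `p` the two boundary terms combine, as `(r - p) - (q - p) = r - q` is
    -- the tangent there.
    have h3 : segAvg (fun x => η x * (inner ℝ a (r - p) + b * cr x (r - p))) q r -
        segAvg (fun x => η x * (inner ℝ a (q - p) + b * cr x (q - p))) q r =
        circ a b q r * segAvg η q r := by
      rw [mul_comm, ← segAvg_nedelec_mul η a b q r _ rfl]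
      unfold segAvg
      rw [← intervalIntegral.integral_sub]
      · congr 1; ext τ; simp [inner_plane, cr]; ring
      all_goals
        apply Continuous.intervalIntegrable
        have := hη.continuous
        unfold cr
        fun_prop
    linear_combination h3
  have hs : |D| = D * SignType.sign D := by rw [mul_comm]; exact (sign_mul_self D).symm
  rw [hs, mul_assoc] at hsum
  exact mul_left_cancel₀ h hsum

/-! ## Triangles of a virtual mesh -/

lemma cr_eq_zero_of_mem_segment {p q z : Plane} (hz : z ∈ segment ℝ p q) :
    cr (q - p) (z - p) = 0 := by
  rw [segment_eq_image'] at hz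
  obtain ⟨θ, -, rfl⟩ := hz
  simp [cr]; ring

lemma volume_segment (p q : Plane) : volume (segment ℝ p q) = 0 := by
  refine measure_mono_null (t := (affineSpan ℝ {p, q} : Set Plane)) ?_ ?_
  · rw [← convexHull_pair]; exact convexHull_subset_affineSpan _
  · refine Measure.addHaar_affineSubspace _ _ fun h => ?_
    have h1 := finrank_vectorSpan_insert_le_set ℝ ({q} : Set Plane) p
    have h2 : Module.finrank ℝ (vectorSpan ℝ ({p, q} : Set Plane)) = 2 := by
      rw [← direction_affineSpan, h, AffineSubspace.direction_top, finrank_top, finrank_euclideanSpace,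
        Fintype.card_fin]
    rw [vectorSpan_singleton, finrank_bot] at h1
    omega

lemma collinear_of_cr_eq_zero {p q r : Plane} (h : cr (q - p) (r - p) = 0) :
    Collinear ℝ {p, q, r} := by
  by_cases hq : q = p
  · subst hq; simpa using collinear_pair ℝ q r
  rw [collinear_iff_of_mem (p₀ := p) (by simp)]
  have hn : ‖q - p‖ ^ 2 ≠ 0 := by simpa [sub_eq_zero] using hq
  refine ⟨q - p, ?_⟩
  intro x hx
  simp only [mem_insert_iff, mem_singleton_iff] at hx
  rcases hx with rfl | rfl | rfl
  · exact ⟨0, by simp⟩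
  · exact ⟨1, by simp⟩
  · refine ⟨inner ℝ (q - p) (x - p) / ‖q - p‖ ^ 2, ?_⟩
    have key : x - p = (inner ℝ (q - p) (x - p) / ‖q - p‖ ^ 2) • (q - p) := by
      rw [div_eq_inv_mul, mul_smul, eq_inv_smul_iff₀ hn]
      rw [norm_sq_plane, inner_plane]
      unfold cr at h
      ext i
      fin_cases i
      · change _ * (x - p) 0 = _ * (q - p) 0
        linear_combination (-(q - p) 1) * h
      · change _ * (x - p) 1 = _ * (q - p) 1
        linear_combination ((q - p) 0) * h
    rw [vadd_eq_add, ← key]; simp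

namespace PolyCell
variable (K : PolyCell)

/-- The convex hull of the vertices with indices in `t`. -/
def hull (t : Finset (Fin (K.m + 3))) : Set Plane := convexHull ℝ (K.vertex '' t)

/-- Twice the signed area of a triangle of vertices. -/
def det (i j k : Fin (K.m + 3)) : ℝ := cr (K.vertex j - K.vertex i) (K.vertex k - K.vertex i)

/-- The orientation sign of the ordered edge `(i, j)` in the triangle `t`. -/
def orient (t : Finset (Fin (K.m + 3))) (i j : Fin (K.m + 3)) : ℝ :=
  if i ∈ t ∧ j ∈ t then SignType.sign (∑ k ∈ t, K.det i j k) else 0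

lemma det_rotate (i j k : Fin (K.m + 3)) : K.det j k i = K.det i j k := by
  simp only [det, cr, PiLp.sub_apply]; ring

lemma det_swap (i j k : Fin (K.m + 3)) : K.det j i k = -K.det i j k := by
  simp only [det, cr, PiLp.sub_apply]; ring

@[simp] lemma det_self_left (i j : Fin (K.m + 3)) : K.det i i j = 0 := by
  simp [det, cr]

@[simp] lemma det_self_right (i j : Fin (K.m + 3)) : K.det i j j = 0 := by
  simp [det, cr_self]

@[simp] lemma det_self_out (i j : Fin (K.m + 3)) : K.det i j i = 0 := by
  simp [det, cr]

variable {K}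

lemma hull_eq (i j k : Fin (K.m + 3)) :
    K.hull {i, j, k} = convexHull ℝ {K.vertex i, K.vertex j, K.vertex k} := by
  simp [hull, image_insert_eq]

lemma isCompact_hull (t : Finset (Fin (K.m + 3))) : IsCompact (K.hull t) :=
  (t.finite_toSet.image _).isCompact_convexHull ℝ

lemma segment_subset_hull {t : Finset (Fin (K.m + 3))} {i j : Fin (K.m + 3)} (hi : i ∈ t)
    (hj : j ∈ t) : segment ℝ (K.vertex i) (K.vertex j) ⊆ K.hull t :=
  (convex_convexHull ℝ _).segment_subset (subset_convexHull ℝ _ ⟨i, hi, rfl⟩)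
    (subset_convexHull ℝ _ ⟨j, hj, rfl⟩)

lemma orient_swap (t : Finset (Fin (K.m + 3))) (i j : Fin (K.m + 3)) :
    K.orient t j i = -K.orient t i j := by
  unfold orient
  by_cases h : i ∈ t ∧ j ∈ t
  · rw [if_pos h, if_pos h.symm]
    simp_rw [K.det_swap i j, Finset.sum_neg_distrib, Left.sign_neg]; simp
  · rw [if_neg h, if_neg (fun h' => h h'.symm), neg_zero]

lemma orient_eq {i j k : Fin (K.m + 3)} (hij : i ≠ j) (hik : i ≠ k) (hjk : j ≠ k) :
    K.orient {i, j, k} i j = SignType.sign (K.det i j k) := by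
  rw [orient, if_pos (by simp), Finset.sum_insert (by simp [hij, hik]),
    Finset.sum_insert (by simp [hjk]), Finset.sum_singleton]
  simp

lemma orient_self (t : Finset (Fin (K.m + 3))) (i : Fin (K.m + 3)) : K.orient t i i = 0 := by
  simp [orient]

/-- The sign and `F` are both antisymmetric, so their product is symmetric and every edge is counted
twice; along the cycle `i, j, k` all signs equal that of the determinant. This turns sums over
triangle sides into sums over all ordered pairs, which can be exchanged with sums over triangles. -/
lemma orient_sum {i j k : Fin (K.m + 3)} (hij : i ≠ j) (hik : i ≠ k) (hjk : j ≠ k)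
    (F : Fin (K.m + 3) → Fin (K.m + 3) → ℝ) (hF : ∀ i j, F j i = -F i j) :
    ∑ i', ∑ j', K.orient {i, j, k} i' j' * F i' j' =
      2 * (SignType.sign (K.det i j k) * (F i j + F j k + F k i)) := by
  have h0 : ∀ i' j', ¬ (i' ∈ ({i, j, k} : Finset _) ∧ j' ∈ ({i, j, k} : Finset _)) →
      K.orient {i, j, k} i' j' * F i' j' = 0 := by
    intro i' j' h
    rw [orient, if_neg h, zero_mul]
  have h1 : ∑ i', ∑ j', K.orient {i, j, k} i' j' * F i' j' =
      ∑ i' ∈ {i, j, k}, ∑ j' ∈ {i, j, k}, K.orient {i, j, k} i' j' * F i' j' := by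
    symm
    rw [Finset.sum_subset (Finset.subset_univ _)]
    · refine Finset.sum_congr rfl fun i' _ => ?_
      exact Finset.sum_subset (Finset.subset_univ _) fun j' _ hj => h0 i' j' fun h => hj h.2
    · intro i' _ hi
      exact Finset.sum_eq_zero fun j' _ => h0 i' j' fun h => hi h.1
  have e1 : ({i, j, k} : Finset (Fin (K.m + 3))) = {j, k, i} := by
    ext; simp; tauto
  have e2 : ({i, j, k} : Finset (Fin (K.m + 3))) = {k, i, j} := by
    ext; simp; tauto
  have o1 := orient_eq hij hik hjk
  have o2 : K.orient {i, j, k} j k = SignType.sign (K.det i j k) := by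
    rw [e1, orient_eq hjk hij.symm hik.symm, det_rotate]
  have o3 : K.orient {i, j, k} k i = SignType.sign (K.det i j k) := by
    rw [e2, orient_eq hik.symm hjk.symm hij, ← det_rotate, ← det_rotate]
  rw [h1]
  simp only [Finset.sum_insert (show i ∉ ({j, k} : Finset _) by simp [hij, hik]),
    Finset.sum_insert (show j ∉ ({k} : Finset _) by simp [hjk]), Finset.sum_singleton]
  rw [orient_self, orient_self, orient_self, orient_swap _ i j, orient_swap _ j k, orient_swap _ k i,
    o1, o2, o3, hF i j, hF j k, hF k i]
  ring

end PolyCell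

namespace VirtualMesh
variable {K : PolyCell} (V : VirtualMesh K)

lemma exists_third {t : Finset (Fin (K.m + 3))} (ht : t ∈ V.tri) {i j : Fin (K.m + 3)} (hi : i ∈ t)
    (hj : j ∈ t) (hij : i ≠ j) : ∃ k, i ≠ k ∧ j ≠ k ∧ t = {i, j, k} := by
  have hc : ((t.erase i).erase j).card = 1 := by
    rw [Finset.card_erase_of_mem (by simp [hj, hij.symm]), Finset.card_erase_of_mem hi,
      V.card_eq t ht]
  obtain ⟨k, hk⟩ := Finset.card_eq_one.1 hc
  have hkm : k ∈ (t.erase i).erase j := by rw [hk]; simp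
  simp only [Finset.mem_erase] at hkm
  refine ⟨k, hkm.2.1.symm, hkm.1.symm, ?_⟩
  rw [← hk, Finset.insert_erase (by simp [hj, hij.symm]), Finset.insert_erase hi]

lemma exists_eq {t : Finset (Fin (K.m + 3))} (ht : t ∈ V.tri) :
    ∃ i j k, i ≠ j ∧ i ≠ k ∧ j ≠ k ∧ t = {i, j, k} := Finset.card_eq_three.1 (V.card_eq t ht)

lemma det_ne_zero {i j k : Fin (K.m + 3)} (ht : {i, j, k} ∈ V.tri) (hij : i ≠ j) (hik : i ≠ k)
    (hjk : j ≠ k) : K.det i j k ≠ 0 := by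
  intro h
  have hai := V.nondegenerate _ ht
  let f : Fin 3 → ({i, j, k} : Finset (Fin (K.m + 3))) :=
    ![⟨i, by simp⟩, ⟨j, by simp⟩, ⟨k, by simp⟩]
  have hf : Function.Injective f := by
    intro a b hab
    fin_cases a <;> fin_cases b <;> simp_all [f]
  have h3 := hai.comp_embedding ⟨f, hf⟩
  have h4 : ((fun i : ({i, j, k} : Finset (Fin (K.m + 3))) => K.vertex i) ∘ f) =
      ![K.vertex i, K.vertex j, K.vertex k] := by
    ext a; fin_cases a <;> rfl
  have h5 : AffineIndependent ℝ ![K.vertex i, K.vertex j, K.vertex k] := by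
    rw [← h4]; exact h3
  rw [affineIndependent_iff_not_collinear_set] at h5
  exact h5 (collinear_of_cr_eq_zero h)

/-- If `i` were not a corner of `t'`, conformity would place the common point `z` on the side `j k`,
where the cross product vanishes. This is the form in which conformity is used below. -/
lemma mem_of_cr_ne_zero {i j k : Fin (K.m + 3)} (ht : {i, j, k} ∈ V.tri)
    {t' : Finset (Fin (K.m + 3))} (ht' : t' ∈ V.tri) {z : Plane} (hz : z ∈ K.hull {i, j, k})
    (hz' : z ∈ K.hull t') (hc : cr (K.vertex k - K.vertex j) (z - K.vertex j) ≠ 0) : i ∈ t' := by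
  by_contra hi
  apply hc
  apply cr_eq_zero_of_mem_segment
  have h1 : z ∈ convexHull ℝ (K.vertex '' (({i, j, k} : Finset _) ∩ t' : Finset _)) := by
    rw [← V.conforming _ ht _ ht']; exact ⟨hz, hz'⟩
  rw [← convexHull_pair]
  refine convexHull_mono ?_ h1
  rintro _ ⟨l, hl, rfl⟩
  simp only [Finset.coe_inter, mem_inter_iff, Finset.mem_coe, Finset.mem_insert,
    Finset.mem_singleton] at hl
  rcases hl with ⟨rfl | rfl | rfl, h2⟩
  · exact absurd h2 hi
  · simp
  · simp

lemma cr_of_mem_openSegment {K : PolyCell} {i j k : Fin (K.m + 3)} {z : Plane}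
    (hz : z ∈ openSegment ℝ (K.vertex i) (K.vertex j)) :
    ∃ θ, 0 < θ ∧ θ < 1 ∧ cr (K.vertex k - K.vertex j) (z - K.vertex j) = θ * K.det i j k := by
  rw [openSegment_eq_image'] at hz
  obtain ⟨θ, ⟨h0, h1⟩, rfl⟩ := hz
  refine ⟨1 - θ, by linarith, by linarith, ?_⟩
  simp only [PolyCell.det, cr, PiLp.sub_apply, PiLp.add_apply, PiLp.smul_apply, smul_eq_mul]; ring

lemma mem_of_mem_openSegment {t t' : Finset (Fin (K.m + 3))} (ht : t ∈ V.tri) (ht' : t' ∈ V.tri)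
    {i j : Fin (K.m + 3)} (hi : i ∈ t) (hj : j ∈ t) (hij : i ≠ j) {z : Plane}
    (hz : z ∈ openSegment ℝ (K.vertex i) (K.vertex j)) (hz' : z ∈ K.hull t') : i ∈ t' := by
  obtain ⟨k, hik, hjk, rfl⟩ := V.exists_third ht hi hj hij
  obtain ⟨θ, h0, -, h⟩ := cr_of_mem_openSegment (k := k) hz
  refine V.mem_of_cr_ne_zero ht ht' (PolyCell.segment_subset_hull hi hj
    (openSegment_subset_segment _ _ _ hz)) hz' ?_
  rw [h]
  exact mul_ne_zero h0.ne' (V.det_ne_zero ht hij hik hjk)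

/-- A point in the relative interior of an edge lies on no other edge. -/
lemma edge_unique {t t' : Finset (Fin (K.m + 3))} (ht : t ∈ V.tri) (ht' : t' ∈ V.tri)
    {i j k l : Fin (K.m + 3)} (hi : i ∈ t) (hj : j ∈ t) (hij : i ≠ j) (hk : k ∈ t') (hl : l ∈ t')
    {z : Plane} (hz : z ∈ openSegment ℝ (K.vertex i) (K.vertex j))
    (hz' : z ∈ segment ℝ (K.vertex k) (K.vertex l)) : (k = i ∧ l = j) ∨ (k = j ∧ l = i) := by
  have hzt := PolyCell.segment_subset_hull hk hl hz'
  have hi' := V.mem_of_mem_openSegment ht ht' hi hj hij hz hzt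
  have hj' := V.mem_of_mem_openSegment ht ht' hj hi hij.symm (by rwa [openSegment_symm]) hzt
  obtain ⟨m, him, hjm, rfl⟩ := V.exists_third ht' hi' hj' hij
  have hd := V.det_ne_zero ht' hij him hjm
  have hz2 : z ∈ openSegment ℝ (K.vertex j) (K.vertex i) := by rwa [openSegment_symm]
  obtain ⟨θ, h0, -, h⟩ := cr_of_mem_openSegment (k := m) hz
  obtain ⟨θ', h0', -, h'⟩ := cr_of_mem_openSegment (k := m) hz2
  rw [PolyCell.det_swap] at h'
  -- By now `t'` is the triangle `i, j, m`. A point inside the edge `i j` has a nonzero cross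
  -- product with the other two sides, so it misses them, and only the edge `i j` remains.
  have g1 : z ∉ segment ℝ (K.vertex j) (K.vertex m) := fun hm => by
    rw [cr_eq_zero_of_mem_segment hm] at h
    exact (mul_ne_zero h0.ne' hd) h.symm
  have g2 : z ∉ segment ℝ (K.vertex i) (K.vertex m) := fun hm => by
    rw [cr_eq_zero_of_mem_segment hm] at h'
    exact (mul_ne_zero h0'.ne' (neg_ne_zero.2 hd)) h'.symm
  have g1' : z ∉ segment ℝ (K.vertex m) (K.vertex j) := by rwa [segment_symm]
  have g2' : z ∉ segment ℝ (K.vertex m) (K.vertex i) := by rwa [segment_symm]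
  have hii : ∀ a : Fin (K.m + 3), a = i ∨ a = j ∨ a = m →
      z ∉ segment ℝ (K.vertex a) (K.vertex a) := by
    rintro a ha hm
    rw [segment_same, mem_singleton_iff] at hm
    subst hm
    rcases ha with rfl | rfl | rfl
    · exact g2 (left_mem_segment _ _ _)
    · exact g1 (left_mem_segment _ _ _)
    · exact g1 (right_mem_segment _ _ _)
  simp only [Finset.mem_insert, Finset.mem_singleton] at hk hl
  rcases hk with rfl | rfl | rfl <;> rcases hl with rfl | rfl | rfl <;>
    first
    | (exact absurd hz' (hii _ (by simp)))
    | (exact absurd hz' (by assumption))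
    | simp

lemma frontier_null (K : PolyCell) : volume (frontier K.carrier) = 0 := by
  rw [K.frontier_eq]
  exact measure_iUnion_null fun i => volume_segment _ _

/-- A corner of `t` that is missing in `t'` is lost in the intersection, which by conformity lies in
the segment between the remaining two corners. -/
lemma hull_inter_null {t t' : Finset (Fin (K.m + 3))} (ht : t ∈ V.tri) (ht' : t' ∈ V.tri)
    (h : t ≠ t') : volume (K.hull t ∩ K.hull t') = 0 := by
  have : ∃ i ∈ t, i ∉ t' := by
    by_contra! hc
    exact h (Finset.eq_of_subset_of_card_le hc (by rw [V.card_eq t ht, V.card_eq t' ht']))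
  obtain ⟨i, hi, hi'⟩ := this
  have hc : ((t.erase i)).card = 2 := by rw [Finset.card_erase_of_mem hi, V.card_eq t ht]
  obtain ⟨j, k, hjk, he⟩ := Finset.card_eq_two.1 hc
  refine measure_mono_null ?_ (volume_segment (K.vertex j) (K.vertex k))
  unfold PolyCell.hull
  rw [V.conforming _ ht _ ht', ← convexHull_pair]
  refine convexHull_mono ?_
  rintro _ ⟨l, hl, rfl⟩
  simp only [Finset.coe_inter, mem_inter_iff, Finset.mem_coe] at hl
  have : l ∈ t.erase i := Finset.mem_erase.2 ⟨fun h => hi' (h ▸ hl.2), hl.1⟩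
  rw [he] at this
  simp only [Finset.mem_insert, Finset.mem_singleton] at this
  rcases this with rfl | rfl <;> simp

lemma restrict_carrier :
    volume.restrict K.carrier = ∑ t ∈ V.tri, volume.restrict (K.hull t) := by
  have h1 : K.carrier =ᵐ[volume] (closure K.carrier : Set Plane) := by
    refine (Filter.EventuallyLE.antisymm (subset_closure.eventuallyLE) ?_)
    rw [ae_le_set]
    exact measure_mono_null (by rw [frontier, K.isOpen.interior_eq]) (frontier_null K)
  rw [Measure.restrict_congr_set h1, ← V.cover, ← Finset.sum_coe_sort,
    ← Measure.sum_fintype, ← Measure.restrict_iUnion_ae]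
  · congr 1
    ext z; simp [PolyCell.hull]
  · intro t t' h
    exact V.hull_inter_null t.2 t'.2 (fun e => h (Subtype.ext e))
  · intro t
    exact (PolyCell.isCompact_hull _).measurableSet.nullMeasurableSet

lemma integral_carrier {E : Type*} [NormedAddCommGroup E] [NormedSpace ℝ E] {F : Plane → E}
    (hF : IntegrableOn F K.carrier) :
    ∫ x in K.carrier, F x = ∑ t ∈ V.tri, ∫ x in K.hull t, F x := by
  unfold IntegrableOn at hF
  rw [V.restrict_carrier] at hF ⊢
  exact integral_finsetSum_measure fun t ht => hF.mono_measure
    (Finset.single_le_sum (f := fun t => volume.restrict (K.hull t)) (fun _ _ => Measure.zero_le _) ht)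

/-- Green's formula for a piecewise field on a set of triangles. -/
lemma green_tri {t : Finset (Fin (K.m + 3))} (ht : t ∈ V.tri) {η : Plane → ℝ}
    (hη : ContDiff ℝ 1 η) (a : Plane) (b : ℝ) :
    ∫ x in K.hull t, (2 * b * η x - inner ℝ (nedelec a b x) (vrot η x)) =
      1 / 2 * ∑ i, ∑ j, K.orient t i j *
        (circ a b (K.vertex i) (K.vertex j) * segAvg η (K.vertex i) (K.vertex j)) := by
  obtain ⟨i, j, k, hij, hik, hjk, rfl⟩ := V.exists_eq ht
  rw [PolyCell.orient_sum hij hik hjk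
    (fun i j => circ a b (K.vertex i) (K.vertex j) * segAvg η (K.vertex i) (K.vertex j)),
    PolyCell.hull_eq, triangle_green _ _ _ (V.det_ne_zero ht hij hik hjk) hη]
  · simp only [PolyCell.det]; ring
  · intro i j
    rw [circ_swap, segAvg_swap]; ring

end VirtualMesh

/-! ## Incidence structure of a virtual mesh -/

lemma fin_two_ne_zero (m : ℕ) : (1 : Fin (m + 3)) + 1 ≠ 0 := by
  intro h
  have := congrArg Fin.val h
  rw [Fin.val_add] at this
  simp at this
  rw [Nat.mod_eq_of_lt (by omega)] at this
  omega

lemma fin_add_one_ne {m : ℕ} (i : Fin (m + 3)) : i + 1 ≠ i := by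
  intro h
  simp at h

lemma fin_not_both {m : ℕ} {i j : Fin (m + 3)} (h : j = i + 1) : i ≠ j + 1 := by
  intro h'
  rw [h, add_assoc] at h'
  exact fin_two_ne_zero m (by simpa using h'.symm)

lemma fin_const {m : ℕ} {α : Type*} {f : Fin (m + 3) → α} (h : ∀ i, f (i + 1) = f i)
    (i : Fin (m + 3)) : f i = f 0 := by
  induction i using Fin.induction with
  | zero => rfl
  | succ i ih => rw [← Fin.coeSucc_eq_succ, h, ih]

/-- A double sum of a symmetric function that vanishes off the cyclic neighbours and one other
pair. -/
lemma sum_symm_eq {m : ℕ} (Z : Fin (m + 3) → Fin (m + 3) → ℝ) (hZ : ∀ i j, Z j i = Z i j)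
    {i₀ j₀ : Fin (m + 3)} (h1 : j₀ ≠ i₀ + 1) (h2 : i₀ ≠ j₀ + 1) (h3 : i₀ ≠ j₀)
    (h0 : ∀ i j, j ≠ i + 1 → i ≠ j + 1 → ¬ (i = i₀ ∧ j = j₀) → ¬ (i = j₀ ∧ j = i₀) → Z i j = 0) :
    ∑ i, ∑ j, Z i j = 2 * (Z i₀ j₀ + ∑ l, Z l (l + 1)) := by
  have key : ∀ i j, Z i j = (if j = i + 1 then Z i (i + 1) else 0) +
      (if i = j + 1 then Z j (j + 1) else 0) + (if i = i₀ then if j = j₀ then Z i₀ j₀ else 0 else 0) +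
      (if i = j₀ then if j = i₀ then Z i₀ j₀ else 0 else 0) := by
    intro i j
    by_cases a : j = i + 1
    · have b := fin_not_both a
      have c : ¬ (i = i₀ ∧ j = j₀) := by rintro ⟨rfl, rfl⟩; exact h1 a
      have d : ¬ (i = j₀ ∧ j = i₀) := by rintro ⟨rfl, rfl⟩; exact h2 a
      rw [← ite_and, ← ite_and, if_pos a, if_neg b, if_neg c, if_neg d, a]; simp
    by_cases b : i = j + 1
    · have c : ¬ (i = i₀ ∧ j = j₀) := by rintro ⟨rfl, rfl⟩; exact h2 b
      have d : ¬ (i = j₀ ∧ j = i₀) := by rintro ⟨rfl, rfl⟩; exact h1 b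
      rw [← ite_and, ← ite_and, if_neg a, if_pos b, if_neg c, if_neg d, ← b, hZ]; simp
    by_cases c : i = i₀ ∧ j = j₀
    · have d : ¬ (i = j₀ ∧ j = i₀) := by rintro ⟨rfl, rfl⟩; exact h3 c.1.symm
      rw [← ite_and, ← ite_and, if_neg a, if_neg b, if_pos c, if_neg d, c.1, c.2]; simp
    by_cases d : i = j₀ ∧ j = i₀
    · rw [← ite_and, ← ite_and, if_neg a, if_neg b, if_neg c, if_pos d, d.1, d.2, hZ]; simp
    rw [← ite_and, ← ite_and, if_neg a, if_neg b, if_neg c, if_neg d, h0 i j a b c d]; simp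
  calc ∑ i, ∑ j, Z i j = _ := Finset.sum_congr rfl fun i _ => Finset.sum_congr rfl fun j _ => key i j
    _ = _ := by
      simp only [Finset.sum_add_distrib]
      rw [Finset.sum_comm (f := fun i j => if i = j + 1 then Z j (j + 1) else 0)]
      simp
      ring

/-- The vertices are cyclically adjacent. -/
def CycAdj {m : ℕ} (i j : Fin (m + 3)) : Prop := j = i + 1 ∨ i = j + 1

lemma vertex_mem_segment {K : PolyCell} {i l : Fin (K.m + 3)}
    (h : K.vertex i ∈ segment ℝ (K.vertex l) (K.vertex (l + 1))) : i = l ∨ i = l + 1 := by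
  by_cases hil : i = l
  · exact Or.inl hil
  have := K.simple i l hil ⟨left_mem_segment _ _ _, h⟩
  simp only [mem_inter_iff, mem_insert_iff, mem_singleton_iff] at this
  rcases this.2 with h | h
  · exact Or.inl (K.vertex_injective h)
  · exact Or.inr (K.vertex_injective h)

lemma tsupport_pderiv_subset (i : Fin 2) (φ : Plane → ℝ) : tsupport (pderiv i φ) ⊆ tsupport φ :=
  tsupport_fderiv_apply_subset ℝ _

lemma pderiv_eq_zero {i : Fin 2} {φ : Plane → ℝ} {x : Plane} (h : x ∉ tsupport φ) :
    pderiv i φ x = 0 :=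
  image_eq_zero_of_notMem_tsupport fun h' => h (tsupport_pderiv_subset i φ h')

lemma vrot_eq_zero {φ : Plane → ℝ} {x : Plane} (h : x ∉ tsupport φ) : vrot φ x = 0 := by
  ext i; fin_cases i <;> simp [vrot, pderiv_eq_zero h]

lemma continuous_pderiv {φ : Plane → ℝ} (hφ : ContDiff ℝ 1 φ) (i : Fin 2) :
    Continuous (pderiv i φ) := by
  have := hφ.continuous_fderiv one_ne_zero
  unfold pderiv; fun_prop

lemma continuous_vrot {φ : Plane → ℝ} (hφ : ContDiff ℝ 1 φ) : Continuous (vrot φ) := by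
  have h0 := continuous_pderiv hφ 0
  have h1 := continuous_pderiv hφ 1
  unfold vrot; fun_prop

lemma hasCompactSupport_vrot {φ : Plane → ℝ} (hφ : HasCompactSupport φ) :
    HasCompactSupport (vrot φ) :=
  HasCompactSupport.intro hφ fun _ hx => vrot_eq_zero hx

lemma integral_pderiv {φ : Plane → ℝ} (hφ : ContDiff ℝ 1 φ) (hc : HasCompactSupport φ) (i : Fin 2) :
    ∫ x, pderiv i φ x = 0 := by
  have h := integral_mul_fderiv_eq_neg_fderiv_mul_of_integrable (μ := (volume : Measure Plane))
    (f := fun _ => (1 : ℝ)) (g := φ) (v := EuclideanSpace.single i 1) (by simp)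
    (by
      simp only [one_mul]
      exact (continuous_pderiv hφ i).integrable_of_hasCompactSupport
        (HasCompactSupport.intro hc fun _ hx => pderiv_eq_zero hx))
    (by simpa using hφ.continuous.integrable_of_hasCompactSupport hc) (by simp)
    (fun x _ => hφ.differentiable one_ne_zero x)
  simpa [pderiv] using h

lemma integral_inner_vrot {φ : Plane → ℝ} (hφ : ContDiff ℝ 1 φ) (hc : HasCompactSupport φ)
    (a : Plane) : ∫ x, inner ℝ a (vrot φ x) = 0 := by
  have hi : ∀ i, Integrable (pderiv i φ) := fun i =>
    (continuous_pderiv hφ i).integrable_of_hasCompactSupport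
      (HasCompactSupport.intro hc fun _ hx => pderiv_eq_zero hx)
  simp_rw [inner_plane, vrot_zero, vrot_one]
  simp_rw [mul_neg, ← sub_eq_add_neg]
  rw [integral_sub ((hi 1).const_mul _) ((hi 0).const_mul _), integral_const_mul,
    integral_const_mul, integral_pderiv hφ hc, integral_pderiv hφ hc]
  simp

lemma continuous_nedelec (a : Plane) (b : ℝ) : Continuous (nedelec a b) := by
  unfold nedelec rotQ; fun_prop

lemma continuous_green {η : Plane → ℝ} (hη : ContDiff ℝ 1 η) (a : Plane) (b : ℝ) :
    Continuous fun x => 2 * b * η x - inner ℝ (nedelec a b x) (vrot η x) := by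
  have := continuous_vrot hη
  have := continuous_nedelec a b
  have := hη.continuous
  fun_prop

namespace VirtualMesh
variable {K : PolyCell} (V : VirtualMesh K)

lemma hull_subset {t : Finset (Fin (K.m + 3))} (ht : t ∈ V.tri) : K.hull t ⊆ closure K.carrier := by
  rw [← V.cover]
  exact subset_biUnion_of_mem (u := fun t : Finset (Fin (K.m + 3)) =>
    convexHull ℝ (K.vertex '' t)) ht

lemma vertex_notMem_openSegment {t : Finset (Fin (K.m + 3))} (ht : t ∈ V.tri)
    {i j : Fin (K.m + 3)} (hi : i ∈ t) (hj : j ∈ t) (hij : i ≠ j) (l : Fin (K.m + 3)) :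
    K.vertex l ∉ openSegment ℝ (K.vertex i) (K.vertex j) := by
  intro hl
  have hlt := V.nodes t ht l
    (PolyCell.segment_subset_hull hi hj (openSegment_subset_segment _ _ _ hl))
  have h := V.edge_unique ht ht hi hj hij hlt hlt hl (left_mem_segment _ _ _)
  rcases h with ⟨h, h'⟩ | ⟨h, h'⟩
  · exact hij (h.symm.trans h')
  · exact hij (h'.symm.trans h)

/-- An edge of the virtual mesh that does not meet the open cell is an edge of the cell. -/
lemma cycAdj_of_disjoint {t : Finset (Fin (K.m + 3))} (ht : t ∈ V.tri)
    {i j : Fin (K.m + 3)} (hi : i ∈ t) (hj : j ∈ t) (hij : i ≠ j)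
    (h : Disjoint (openSegment ℝ (K.vertex i) (K.vertex j)) K.carrier) : CycAdj i j := by
  set s := openSegment ℝ (K.vertex i) (K.vertex j) with hs
  have hsK : s ⊆ ⋃ l, segment ℝ (K.vertex l) (K.vertex (l + 1)) := by
    rw [← K.frontier_eq, frontier, K.isOpen.interior_eq]
    intro z hz
    exact ⟨V.hull_subset ht (PolyCell.segment_subset_hull hi hj (openSegment_subset_segment _ _ _ hz)),
      fun hz' => disjoint_left.1 h hz hz'⟩
  obtain ⟨p, hp⟩ : s.Nonempty := ⟨_, midpoint_mem_openSegment _ _⟩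
  obtain ⟨l, hl⟩ := mem_iUnion.1 (hsK hp)
  have hclosed : ∀ l, IsClosed (segment ℝ (K.vertex l) (K.vertex (l + 1))) := fun l => by
    rw [← convexHull_pair]
    exact ((toFinite _).isCompact_convexHull ℝ).isClosed
  have hpre : IsPreconnected s := (convex_openSegment _ _).isPreconnected
  -- Connectedness: the edge `l` and the union of the other edges of `K` are closed and cover the
  -- open segment. They meet only at vertices of `K`, none of which lies on the open segment, so one
  -- of them contains it.
  have hsub : s ⊆ segment ℝ (K.vertex l) (K.vertex (l + 1)) := by
    have hB : IsClosed (⋃ l' ∈ ({l}ᶜ : Set (Fin (K.m + 3))),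
        segment ℝ (K.vertex l') (K.vertex (l' + 1))) :=
      (toFinite _).isClosed_biUnion fun l' _ => hclosed l'
    have hdis : s ∩ (segment ℝ (K.vertex l) (K.vertex (l + 1)) ∩ ⋃ l' ∈ ({l}ᶜ : Set (Fin (K.m + 3))),
        segment ℝ (K.vertex l') (K.vertex (l' + 1))) = ∅ := by
      rw [eq_empty_iff_forall_notMem]
      rintro z ⟨hz, hz1, hz2⟩
      simp only [mem_iUnion] at hz2
      obtain ⟨l', hl', hz2⟩ := hz2
      have := (K.simple l l' (fun e => hl' e.symm) ⟨hz1, hz2⟩).1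
      rcases this with rfl | rfl
      · exact V.vertex_notMem_openSegment ht hi hj hij _ hz
      · exact V.vertex_notMem_openSegment ht hi hj hij _ hz
    rcases isPreconnected_iff_subset_of_disjoint_closed.1 hpre _ _ (hclosed l) hB (fun z hz => by
      obtain ⟨l', hl'⟩ := mem_iUnion.1 (hsK hz)
      by_cases e : l' = l
      · subst e; exact Or.inl hl'
      · exact Or.inr (mem_iUnion₂.2 ⟨l', e, hl'⟩)) hdis with h1 | h1
    · exact h1
    · have : p ∈ (∅ : Set Plane) := hdis ▸ ⟨hp, hl, h1 hp⟩
      exact this.elim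
  have hcl : segment ℝ (K.vertex i) (K.vertex j) ⊆ segment ℝ (K.vertex l) (K.vertex (l + 1)) := by
    rw [← closure_openSegment]
    exact closure_minimal hsub (hclosed l)
  have h1 := vertex_mem_segment (hcl (left_mem_segment _ _ _))
  have h2 := vertex_mem_segment (hcl (right_mem_segment _ _ _))
  rcases h1 with rfl | rfl <;> rcases h2 with rfl | rfl
  · exact absurd rfl hij
  · exact Or.inl rfl
  · exact Or.inr rfl
  · exact absurd rfl hij

/-- A smooth bump near an interior point of an edge that vanishes on all other edges. -/
lemma exists_edge_bump {t : Finset (Fin (K.m + 3))} (ht : t ∈ V.tri) {i j : Fin (K.m + 3)}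
    (hi : i ∈ t) (hj : j ∈ t) (hij : i ≠ j) {p : Plane}
    (hp : p ∈ openSegment ℝ (K.vertex i) (K.vertex j)) {U : Set Plane} (hU : IsOpen U) (hpU : p ∈ U) :
    ∃ η : Plane → ℝ, ContDiff ℝ ∞ η ∧ HasCompactSupport η ∧ tsupport η ⊆ U ∧
      0 < segAvg η (K.vertex i) (K.vertex j) ∧
      ∀ t' ∈ V.tri, ∀ k ∈ t', ∀ l ∈ t', ¬ (k = i ∧ l = j) → ¬ (k = j ∧ l = i) →
        segAvg η (K.vertex k) (K.vertex l) = 0 := by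
  set A : Set (Fin (K.m + 3) × Fin (K.m + 3)) :=
    {e | (∃ t' ∈ V.tri, e.1 ∈ t' ∧ e.2 ∈ t') ∧ ¬ (e.1 = i ∧ e.2 = j) ∧ ¬ (e.1 = j ∧ e.2 = i)} with hA
  set F : Set Plane := ⋃ e ∈ A, segment ℝ (K.vertex e.1) (K.vertex e.2) with hF
  have hFc : IsClosed F := by
    refine (toFinite _).isClosed_biUnion fun e _ => ?_
    rw [← convexHull_pair]
    exact ((toFinite _).isCompact_convexHull ℝ).isClosed
  have hpF : p ∉ F := by
    intro hpF
    simp only [hF, mem_iUnion] at hpF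
    obtain ⟨⟨k, l⟩, ⟨⟨t', ht', hk, hl⟩, h1, h2⟩, hz⟩ := hpF
    rcases V.edge_unique ht ht' hi hj hij hk hl hp hz with h | h
    · exact h1 h
    · exact h2 h
  obtain ⟨η, hη1, hη2, hη3, hη4, hη5⟩ := exists_contDiff_tsupport_subset (n := ⊤)
    ((hU.inter hFc.isOpen_compl).mem_nhds ⟨hpU, hpF⟩)
  have hpos : ∀ x, 0 ≤ η x := fun x => (hη4 ⟨x, rfl⟩).1
  refine ⟨η, hη3, hη2, hη1.trans inter_subset_left, ?_, ?_⟩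
  · rw [openSegment_eq_image_lineMap] at hp
    obtain ⟨θ, hθ, rfl⟩ := hp
    have := hη3.continuous
    refine intervalIntegral.integral_pos zero_lt_one (Continuous.continuousOn (by fun_prop))
      (fun τ _ => hpos _) ⟨θ, Ioo_subset_Icc_self hθ, ?_⟩
    rw [hη5]; exact zero_lt_one
  · intro t' ht' k hk l hl h1 h2
    have : ∀ τ ∈ Icc (0 : ℝ) 1, η (AffineMap.lineMap (K.vertex k) (K.vertex l) τ) = 0 := by
      intro τ hτ
      by_contra h
      have h3 := hη1 (subset_tsupport η h)
      refine h3.2 (mem_iUnion₂.2 ⟨(k, l), ⟨⟨t', ht', hk, hl⟩, h1, h2⟩, ?_⟩)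
      rw [segment_eq_image_lineMap]
      exact ⟨τ, hτ, rfl⟩
    unfold segAvg
    rw [intervalIntegral.integral_congr (g := fun _ => (0 : ℝ)), intervalIntegral.integral_zero]
    intro τ hτ
    rw [uIcc_of_le zero_le_one] at hτ
    exact this τ hτ

/-- The jump of the circulations of a piecewise field over the triangles of `S`. -/
def jump (_V : VirtualMesh K) (S : Finset (Finset (Fin (K.m + 3)))) (a : Finset (Fin (K.m + 3)) → Plane)
    (b : ℝ) (i j : Fin (K.m + 3)) : ℝ :=
  ∑ t ∈ S, K.orient t i j * circ (a t) b (K.vertex i) (K.vertex j)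

lemma jump_symm (S : Finset (Finset (Fin (K.m + 3)))) (a : Finset (Fin (K.m + 3)) → Plane)
    (b : ℝ) (i j : Fin (K.m + 3)) : V.jump S a b j i = V.jump S a b i j := by
  unfold jump
  refine Finset.sum_congr rfl fun t _ => ?_
  rw [PolyCell.orient_swap, circ_swap]; ring

lemma green_set {S : Finset (Finset (Fin (K.m + 3)))} (hS : S ⊆ V.tri)
    (a : Finset (Fin (K.m + 3)) → Plane) (b : ℝ) {η : Plane → ℝ} (hη : ContDiff ℝ 1 η) :
    ∑ t ∈ S, ∫ x in K.hull t, (2 * b * η x - inner ℝ (nedelec (a t) b x) (vrot η x)) =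
      1 / 2 * ∑ i, ∑ j, V.jump S a b i j * segAvg η (K.vertex i) (K.vertex j) := by
  rw [Finset.sum_congr rfl fun t ht => V.green_tri (hS ht) hη (a t) b, ← Finset.mul_sum,
    Finset.sum_comm]
  congr 1
  refine Finset.sum_congr rfl fun i _ => ?_
  rw [Finset.sum_comm]
  refine Finset.sum_congr rfl fun j _ => ?_
  rw [jump, Finset.sum_mul]
  exact Finset.sum_congr rfl fun t _ => by ring

/-- A bump around a point of the open edge inside `K` has zero mean on every other edge of the mesh.
Green's formula then contains this jump alone, times a positive mean. -/
lemma jump_eq_zero {a : Finset (Fin (K.m + 3)) → Plane} {b : ℝ}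
    (hzero : ∀ η : Plane → ℝ, ContDiff ℝ ∞ η → HasCompactSupport η → tsupport η ⊆ K.carrier →
      ∑ t ∈ V.tri, ∫ x in K.hull t, (2 * b * η x - inner ℝ (nedelec (a t) b x) (vrot η x)) = 0)
    {t : Finset (Fin (K.m + 3))} (ht : t ∈ V.tri) {i j : Fin (K.m + 3)}
    (hi : i ∈ t) (hj : j ∈ t) (hij : i ≠ j)
    (h : ¬ Disjoint (openSegment ℝ (K.vertex i) (K.vertex j)) K.carrier) :
    V.jump V.tri a b i j = 0 := by
  obtain ⟨p, hp, hpK⟩ := not_disjoint_iff.1 h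
  obtain ⟨η, h1, h2, h3, h4, h5⟩ := V.exists_edge_bump ht hi hj hij hp K.isOpen hpK
  have h6 := hzero η h1 h2 h3
  rw [V.green_set (Finset.Subset.refl _) a b (h1.of_le (by exact_mod_cast le_top))] at h6
  have h7 : ∀ k l, ¬ (k = i ∧ l = j) → ¬ (k = j ∧ l = i) →
      V.jump V.tri a b k l * segAvg η (K.vertex k) (K.vertex l) = 0 := by
    intro k l hk hl
    by_cases hm : ∃ t' ∈ V.tri, k ∈ t' ∧ l ∈ t'
    · obtain ⟨t', ht', hk', hl'⟩ := hm
      rw [h5 t' ht' k hk' l hl' hk hl, mul_zero]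
    · rw [jump, Finset.sum_eq_zero, zero_mul]
      intro t' ht'
      rw [PolyCell.orient, if_neg (fun hh => hm ⟨t', ht', hh⟩), zero_mul]
  have h8 : ∑ k, ∑ l, V.jump V.tri a b k l * segAvg η (K.vertex k) (K.vertex l) =
      2 * (V.jump V.tri a b i j * segAvg η (K.vertex i) (K.vertex j)) := by
    have : ∀ k l, V.jump V.tri a b k l * segAvg η (K.vertex k) (K.vertex l) =
        (if k = i then if l = j then V.jump V.tri a b i j * segAvg η (K.vertex i) (K.vertex j) else 0
          else 0) +
        (if k = j then if l = i then V.jump V.tri a b i j * segAvg η (K.vertex i) (K.vertex j) else 0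
          else 0) := by
      intro k l
      by_cases hk : k = i ∧ l = j
      · have hl : ¬ (k = j ∧ l = i) := fun hl => hij (hk.1.symm.trans hl.1)
        rw [← ite_and, ← ite_and, if_pos hk, if_neg hl, hk.1, hk.2, add_zero]
      by_cases hl : k = j ∧ l = i
      · rw [← ite_and, ← ite_and, if_neg hk, if_pos hl, hl.1, hl.2, zero_add, jump_symm, segAvg_swap]
      · rw [← ite_and, ← ite_and, if_neg hk, if_neg hl, h7 k l hk hl, add_zero]
    rw [Finset.sum_congr rfl fun k _ => Finset.sum_congr rfl fun l _ => this k l]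
    generalize V.jump V.tri a b i j * segAvg η (K.vertex i) (K.vertex j) = c
    simp_rw [Finset.sum_add_distrib]
    simp only [Finset.sum_ite_irrel, Finset.sum_const_zero, Finset.sum_ite_eq', Finset.mem_univ,
      if_true]
    ring
  rw [h8] at h6
  have : V.jump V.tri a b i j * segAvg η (K.vertex i) (K.vertex j) = 0 := by linarith
  exact (mul_eq_zero.1 this).resolve_right h4.ne'

end VirtualMesh

lemma carrier_isBounded_closure (K : PolyCell) : IsCompact (closure K.carrier) :=
  K.isBounded.isCompact_closure

/-- A smooth compactly supported function that equals one near a bounded set. -/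
lemma exists_cutoff {s : Set Plane} (hs : Bornology.IsBounded s) :
    ∃ (χ : Plane → ℝ) (U : Set Plane), ContDiff ℝ ∞ χ ∧ HasCompactSupport χ ∧ IsOpen U ∧ s ⊆ U ∧
      ∀ x ∈ U, χ x = 1 := by
  obtain ⟨R, hR⟩ := hs.subset_ball 0
  let f : ContDiffBump (0 : Plane) := ⟨max R 1, max R 1 + 1, by positivity, by linarith⟩
  refine ⟨f, Metric.ball 0 (max R 1), f.contDiff, f.hasCompactSupport, Metric.isOpen_ball,
    hR.trans (Metric.ball_subset_ball (le_max_left _ _)), fun x hx => ?_⟩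
  exact f.one_of_mem_closedBall (Metric.ball_subset_closedBall hx)

namespace VirtualMesh
variable {K : PolyCell} (V : VirtualMesh K)

lemma orient_eq_zero {t : Finset (Fin (K.m + 3))} {i j : Fin (K.m + 3)} (h : ¬ (i ∈ t ∧ j ∈ t)) :
    K.orient t i j = 0 := if_neg h

/-- The boundary of a triangle is a cycle. Apply `orient_sum` to the increments of the indicator of
the vertex `i`: they add up to zero around the triangle, while the double sum is minus twice the row
sum. -/
lemma orient_sum_right {t : Finset (Fin (K.m + 3))} (ht : t ∈ V.tri) (i : Fin (K.m + 3)) :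
    ∑ j, K.orient t i j = 0 := by
  obtain ⟨p, q, r, hpq, hpr, hqr, rfl⟩ := V.exists_eq ht
  set f : Fin (K.m + 3) → ℝ := Pi.single i 1 with hf
  have h := PolyCell.orient_sum (K := K) hpq hpr hqr (fun k l => f l - f k) (fun _ _ => by ring)
  have h1 : ∑ k, ∑ l, K.orient {p, q, r} k l * (f l - f k) =
      ∑ k, K.orient {p, q, r} k i - ∑ l, K.orient {p, q, r} i l := by
    have e1 : ∑ k, ∑ l, K.orient {p, q, r} k l * f l = ∑ k, K.orient {p, q, r} k i := by
      refine Finset.sum_congr rfl fun k _ => ?_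
      simp [hf, Pi.single_apply]
    have e2 : ∑ k, ∑ l, K.orient {p, q, r} k l * f k = ∑ l, K.orient {p, q, r} i l := by
      rw [Finset.sum_comm]
      refine Finset.sum_congr rfl fun k _ => ?_
      simp [hf, Pi.single_apply]
    simp_rw [mul_sub, Finset.sum_sub_distrib, e1, e2]
  have h2 : ∑ k, K.orient {p, q, r} k i = -∑ k, K.orient {p, q, r} i k := by
    rw [← Finset.sum_neg_distrib]
    exact Finset.sum_congr rfl fun k _ => PolyCell.orient_swap _ _ _
  rw [h1, h2] at h
  have h3 : f q - f p + (f r - f q) + (f p - f r) = 0 := by ring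
  rw [h3] at h
  linarith

/-- The signed number of triangles at an edge. -/
def edgeSign (i j : Fin (K.m + 3)) : ℝ := ∑ t ∈ V.tri, K.orient t i j

lemma edgeSign_swap (i j : Fin (K.m + 3)) : V.edgeSign j i = -V.edgeSign i j := by
  unfold edgeSign
  rw [← Finset.sum_neg_distrib]
  exact Finset.sum_congr rfl fun t _ => PolyCell.orient_swap _ _ _

lemma jump_const (a : Plane) (i j : Fin (K.m + 3)) :
    V.jump V.tri (fun _ => a) 0 i j = V.edgeSign i j * inner ℝ a (K.vertex j - K.vertex i) := by
  unfold jump edgeSign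
  rw [Finset.sum_mul]
  exact Finset.sum_congr rfl fun t _ => by simp [circ]

lemma integral_green {η : Plane → ℝ} (hη : ContDiff ℝ 1 η) (a : Plane) (b : ℝ) :
    ∑ t ∈ V.tri, ∫ x in K.hull t, (2 * b * η x - inner ℝ (nedelec a b x) (vrot η x)) =
      ∫ x in K.carrier, (2 * b * η x - inner ℝ (nedelec a b x) (vrot η x)) := by
  rw [V.integral_carrier]
  exact ((continuous_green hη a b).continuousOn.integrableOn_compact
    (carrier_isBounded_closure K)).mono_set subset_closure

/-- A constant field has no jump across an edge through the interior. For the constant field along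
the edge the jump is the signed count times the squared length. -/
lemma edgeSign_eq_zero {t : Finset (Fin (K.m + 3))} (ht : t ∈ V.tri) {i j : Fin (K.m + 3)}
    (hi : i ∈ t) (hj : j ∈ t) (hij : i ≠ j) (h : ¬ CycAdj i j) : V.edgeSign i j = 0 := by
  have hd : ¬ Disjoint (openSegment ℝ (K.vertex i) (K.vertex j)) K.carrier :=
    fun hd => h (V.cycAdj_of_disjoint ht hi hj hij hd)
  have := V.jump_eq_zero (a := fun _ => K.vertex j - K.vertex i) (b := 0) ?_ ht hi hj hij hd
  · rw [jump_const, real_inner_self_eq_norm_sq] at this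
    refine (mul_eq_zero.1 this).resolve_right ?_
    have : K.vertex j - K.vertex i ≠ 0 := sub_ne_zero.2 fun e => hij (K.vertex_injective e).symm
    positivity
  · intro η h1 h2 h3
    have h1' : ContDiff ℝ 1 η := h1.of_le (by exact_mod_cast le_top)
    rw [V.integral_green h1', setIntegral_eq_integral_of_forall_compl_eq_zero]
    · simp only [mul_zero, zero_mul, zero_sub, nedelec, zero_smul, add_zero]
      rw [integral_neg, integral_inner_vrot h1' h2, neg_zero]
    · intro x hx
      rw [vrot_eq_zero fun h => hx (h3 h)]; simp

/-- The signed counts at the vertex `i + 1` add up to zero, and by `edgeSign_eq_zero` only the two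
neighbours on the boundary contribute; so what enters along one boundary edge leaves along the next.
-/
lemma edgeSign_succ (i : Fin (K.m + 3)) : V.edgeSign i (i + 1) = V.edgeSign 0 (0 + 1) := by
  refine fin_const (f := fun i => V.edgeSign i (i + 1)) (fun i => ?_) i
  have h0 : ∑ j, V.edgeSign (i + 1) j = 0 := by
    unfold edgeSign
    rw [Finset.sum_comm]
    exact Finset.sum_eq_zero fun t ht => V.orient_sum_right ht _
  have hne : i + 1 + 1 ≠ i := fun h => fin_not_both (i := i) rfl h.symm
  rw [Finset.sum_eq_add_of_mem (i + 1 + 1) i (Finset.mem_univ _) (Finset.mem_univ _) hne] at h0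
  · have := V.edgeSign_swap i (i + 1)
    linarith
  · rintro j - ⟨hj1, hj2⟩
    by_cases hij : i + 1 = j
    · subst hij
      exact Finset.sum_eq_zero fun t _ => PolyCell.orient_self _ _
    by_cases hm : ∃ t ∈ V.tri, i + 1 ∈ t ∧ j ∈ t
    · obtain ⟨t, ht, h1, h2⟩ := hm
      refine V.edgeSign_eq_zero ht h1 h2 hij ?_
      rintro (h | h)
      · exact hj1 h
      · exact hj2 (add_right_cancel h).symm
    · exact Finset.sum_eq_zero fun t ht => if_neg fun hh => hm ⟨t, ht, hh⟩

/-- Otherwise all signed counts vanish and Green's formula has no boundary terms. With the constant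
field along the second axis and a test function equal to `x 0` on `K`, it would say that the area of
`K` is zero. -/
lemma edgeSign_ne_zero : V.edgeSign 0 (0 + 1) ≠ 0 := by
  intro h0
  have hall : ∀ i j, V.edgeSign i j = 0 := by
    intro i j
    by_cases hij : i = j
    · subst hij
      exact Finset.sum_eq_zero fun t _ => PolyCell.orient_self _ _
    by_cases hc : CycAdj i j
    · rcases hc with rfl | rfl
      · rw [V.edgeSign_succ, h0]
      · rw [edgeSign_swap, V.edgeSign_succ, h0, neg_zero]
    by_cases hm : ∃ t ∈ V.tri, i ∈ t ∧ j ∈ t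
    · obtain ⟨t, ht, h1, h2⟩ := hm
      exact V.edgeSign_eq_zero ht h1 h2 hij hc
    · exact Finset.sum_eq_zero fun t ht => if_neg fun hh => hm ⟨t, ht, hh⟩
  obtain ⟨χ, U, hχ1, hχ2, hU, hsU, hχ3⟩ := exists_cutoff K.isBounded
  set η : Plane → ℝ := fun x => x 0 * χ x with hη
  have hη1 : ContDiff ℝ 1 η := by
    have := hχ1.of_le (m := 1) (by exact_mod_cast le_top)
    fun_prop
  have h1 := V.green_set (Finset.Subset.refl _) (fun _ => EuclideanSpace.single 1 1) 0 hη1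
  rw [V.integral_green hη1] at h1
  simp_rw [jump_const, hall] at h1
  have h2 : ∀ x ∈ K.carrier, 2 * 0 * η x -
      inner ℝ (nedelec (EuclideanSpace.single 1 1) 0 x) (vrot η x) = 1 := by
    intro x hx
    have he : η =ᶠ[nhds x] fun x => x 0 := by
      filter_upwards [hU.mem_nhds (hsU hx)] with y hy
      simp [hη, hχ3 y hy]
    have hd : pderiv 0 η x = 1 := by
      rw [pderiv, he.fderiv_eq]
      have : HasFDerivAt (fun x : Plane => x 0) (EuclideanSpace.proj 0 : Plane →L[ℝ] ℝ) x :=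
        (EuclideanSpace.proj 0 : Plane →L[ℝ] ℝ).hasFDerivAt
      rw [this.fderiv]; simp
    rw [inner_plane]
    simp [nedelec, hd]
  rw [setIntegral_congr_fun K.isOpen.measurableSet h2] at h1
  simp only [integral_const, smul_eq_mul, mul_one, zero_mul, Finset.sum_const_zero, mul_zero,
    Measure.real, Measure.restrict_apply_univ] at h1
  have hpos := K.isOpen.measure_pos volume K.isConnected.nonempty
  have hfin := K.isBounded.measure_lt_top (μ := volume)
  exact (ENNReal.toReal_pos hpos.ne' hfin.ne).ne' h1

/-- At most one triangle lies on a given side of an edge. -/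
lemma eq_of_orient_eq {t t' : Finset (Fin (K.m + 3))} (ht : t ∈ V.tri) (ht' : t' ∈ V.tri)
    {i j : Fin (K.m + 3)} (hi : i ∈ t) (hj : j ∈ t) (hi' : i ∈ t') (hj' : j ∈ t') (hij : i ≠ j)
    (h : K.orient t i j = K.orient t' i j) : t = t' := by
  obtain ⟨k, hik, hjk, rfl⟩ := V.exists_third ht hi hj hij
  obtain ⟨l, hil, hjl, rfl⟩ := V.exists_third ht' hi' hj' hij
  have hd := V.det_ne_zero ht hij hik hjk
  have hd' := V.det_ne_zero ht' hij hil hjl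
  rw [PolyCell.orient_eq hij hik hjk, PolyCell.orient_eq hij hil hjl] at h
  have hs : SignType.sign (K.det i j k) = SignType.sign (K.det i j l) := by
    revert h
    rcases lt_trichotomy (K.det i j k) 0 with a | a | a <;>
    rcases lt_trichotomy (K.det i j l) 0 with b | b | b <;>
    simp_all [sign_neg, sign_pos] <;> norm_num
  have hβ : 0 < K.det i j k / K.det i j l := by
    rcases lt_or_gt_of_ne hd with a | a
    · rw [sign_neg a] at hs
      exact div_pos_of_neg_of_neg a (sign_eq_neg_one_iff.1 hs.symm)
    · rw [sign_pos a] at hs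
      exact div_pos a (sign_eq_one_iff.1 hs.symm)
  set β := K.det i j k / K.det i j l with hβd
  set α := cr (K.vertex k - K.vertex i) (K.vertex l - K.vertex i) / K.det i j l with hαd
  have hk : K.vertex k - K.vertex i = α • (K.vertex j - K.vertex i) +
      β • (K.vertex l - K.vertex i) := by
    have e : K.det i j l • (K.vertex k - K.vertex i) =
        K.det i j l • (α • (K.vertex j - K.vertex i) + β • (K.vertex l - K.vertex i)) := by
      rw [smul_add, smul_smul, smul_smul, hαd, hβd, mul_div_cancel₀ _ hd', mul_div_cancel₀ _ hd']
      ext c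
      fin_cases c <;> (simp [PolyCell.det, cr]; ring)
    exact smul_right_injective _ hd' e
  -- The third corners lie on the same side, so `k - i` has a positive coefficient `β` along `l -
  -- i`. The point `z` is moved from the edge slightly towards `k`; with `ε (1 + |α| + β) = 1/2` its
  -- coordinates stay admissible in both triangles. Two triangles with such a common point must
  -- share the corner `k`.
  set ε : ℝ := 1 / (2 * (1 + |α| + β)) with hε
  have hpos : 0 < 1 + |α| + β := by positivity
  have hε0 : 0 < ε := by positivity
  have hε1 : ε * (1 + |α| + β) = 1 / 2 := by rw [hε]; field_simp
  have hα1 := abs_nonneg α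
  have hα2 := le_abs_self α
  have hα3 := neg_abs_le α
  set z : Plane := K.vertex i + ((1 / 2 * (1 - ε)) • (K.vertex j - K.vertex i) +
    ε • (K.vertex k - K.vertex i)) with hz
  have hεle : ε ≤ 1 / 2 := by nlinarith
  have hz1 : z ∈ K.hull {i, j, k} := by
    rw [PolyCell.hull_eq, mem_triangle]
    exact ⟨_, _, by nlinarith, hε0.le, by nlinarith, hz⟩
  have hz2 : z ∈ K.hull {i, j, l} := by
    rw [PolyCell.hull_eq, mem_triangle]
    refine ⟨1 / 2 * (1 - ε) + ε * α, ε * β, by nlinarith, by positivity, by nlinarith, ?_⟩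
    rw [hz, hk]
    ext c; simp; ring
  have he : ({i, j, k} : Finset (Fin (K.m + 3))) = {k, i, j} := by ext; simp; tauto
  have hmem : k ∈ ({i, j, l} : Finset (Fin (K.m + 3))) := by
    refine V.mem_of_cr_ne_zero (he ▸ ht) ht' (he ▸ hz1) hz2 ?_
    have : cr (K.vertex j - K.vertex i) (z - K.vertex i) = ε * K.det i j k := by
      simp [hz, PolyCell.det, cr]; ring
    rw [this]
    exact mul_ne_zero hε0.ne' hd
  simp only [Finset.mem_insert, Finset.mem_singleton] at hmem
  rcases hmem with h | h | h
  · exact absurd h hik.symm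
  · exact absurd h hjk.symm
  · rw [h]

lemma orient_eq_one_or {t : Finset (Fin (K.m + 3))} (ht : t ∈ V.tri) {i j : Fin (K.m + 3)}
    (hi : i ∈ t) (hj : j ∈ t) (hij : i ≠ j) : K.orient t i j = 1 ∨ K.orient t i j = -1 := by
  obtain ⟨k, hik, hjk, rfl⟩ := V.exists_third ht hi hj hij
  rw [PolyCell.orient_eq hij hik hjk]
  rcases lt_or_gt_of_ne (V.det_ne_zero ht hij hik hjk) with a | a
  · right; rw [sign_neg a]; simp
  · left; rw [sign_pos a]; simp

/-- Pigeonhole: there are only two signs, and each sign belongs to at most one triangle at the edge.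
-/
lemma orient_third_zero {t t' t'' : Finset (Fin (K.m + 3))} (ht : t ∈ V.tri) (ht' : t' ∈ V.tri)
    {i j : Fin (K.m + 3)} (hi : i ∈ t) (hj : j ∈ t) (hi' : i ∈ t') (hj' : j ∈ t') (hij : i ≠ j)
    (hne : t ≠ t') (ht'' : t'' ∈ V.tri) (h1 : t'' ≠ t) (h2 : t'' ≠ t') : K.orient t'' i j = 0 := by
  by_contra h
  have hm : i ∈ t'' ∧ j ∈ t'' := by
    by_contra hm
    exact h (if_neg hm)
  rcases V.orient_eq_one_or ht hi hj hij with a | a <;>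
  rcases V.orient_eq_one_or ht' hi' hj' hij with b | b <;>
  rcases V.orient_eq_one_or ht'' hm.1 hm.2 hij with c | c
  · exact h1 (V.eq_of_orient_eq ht'' ht hm.1 hm.2 hi hj hij (c.trans a.symm))
  · exact hne (V.eq_of_orient_eq ht ht' hi hj hi' hj' hij (a.trans b.symm))
  · exact h1 (V.eq_of_orient_eq ht'' ht hm.1 hm.2 hi hj hij (c.trans a.symm))
  · exact h2 (V.eq_of_orient_eq ht'' ht' hm.1 hm.2 hi' hj' hij (c.trans b.symm))
  · exact h2 (V.eq_of_orient_eq ht'' ht' hm.1 hm.2 hi' hj' hij (c.trans b.symm))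
  · exact h1 (V.eq_of_orient_eq ht'' ht hm.1 hm.2 hi hj hij (c.trans a.symm))
  · exact hne (V.eq_of_orient_eq ht ht' hi hj hi' hj' hij (a.trans b.symm))
  · exact h1 (V.eq_of_orient_eq ht'' ht hm.1 hm.2 hi hj hij (c.trans a.symm))

lemma orient_opposite {t t' : Finset (Fin (K.m + 3))} (ht : t ∈ V.tri) (ht' : t' ∈ V.tri)
    {i j : Fin (K.m + 3)} (hi : i ∈ t) (hj : j ∈ t) (hi' : i ∈ t') (hj' : j ∈ t') (hij : i ≠ j)
    (hne : t ≠ t') : K.orient t' i j = -K.orient t i j := by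
  have := fun h => hne (V.eq_of_orient_eq ht ht' hi hj hi' hj' hij h)
  rcases V.orient_eq_one_or ht hi hj hij with a | a <;>
  rcases V.orient_eq_one_or ht' hi' hj' hij with b | b <;> rw [a, b] at this ⊢ <;>
    first | exact absurd rfl this | norm_num

/-- An interior edge belongs to exactly two triangles. -/
lemma exists_neighbour {t : Finset (Fin (K.m + 3))} (ht : t ∈ V.tri) {i j : Fin (K.m + 3)}
    (hi : i ∈ t) (hj : j ∈ t) (hij : i ≠ j) (h : ¬ CycAdj i j) :
    ∃ t' ∈ V.tri, i ∈ t' ∧ j ∈ t' ∧ t ≠ t' := by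
  by_contra! hc
  have h0 := V.edgeSign_eq_zero ht hi hj hij h
  unfold edgeSign at h0
  rw [Finset.sum_eq_single t (fun t' ht' hne => orient_eq_zero fun hm => hne (hc t' ht' hm.1 hm.2).symm)
    (fun h => absurd ht h)] at h0
  rcases V.orient_eq_one_or ht hi hj hij with a | a <;> rw [a] at h0 <;> norm_num at h0

/-- An edge of the cell belongs to exactly one triangle, always on the same side. -/
lemma exists_boundary_triangle : ∃ σ : ℝ, (σ = 1 ∨ σ = -1) ∧
    ∃ T : Fin (K.m + 3) → Finset (Fin (K.m + 3)), ∀ l, T l ∈ V.tri ∧ l ∈ T l ∧ l + 1 ∈ T l ∧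
      K.orient (T l) l (l + 1) = σ ∧ ∀ t ∈ V.tri, l ∈ t → l + 1 ∈ t → t = T l := by
  have hex : ∀ l, ∃ t ∈ V.tri, l ∈ t ∧ l + 1 ∈ t := by
    intro l
    by_contra! hc
    apply V.edgeSign_ne_zero
    rw [← V.edgeSign_succ l]
    exact Finset.sum_eq_zero fun t ht => if_neg fun hm => hc t ht hm.1 hm.2
  choose T hT1 hT2 hT3 using hex
  -- Two triangles at a boundary edge would carry opposite signs, no third one could contribute, and
  -- the signed count would vanish.
  have huniq : ∀ l, ∀ t ∈ V.tri, l ∈ t → l + 1 ∈ t → t = T l := by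
    intro l t ht h1 h2
    by_contra hne
    apply V.edgeSign_ne_zero
    rw [← V.edgeSign_succ l, edgeSign, Finset.sum_eq_add_of_mem t (T l) ht (hT1 l) hne,
      V.orient_opposite ht (hT1 l) h1 h2 (hT2 l) (hT3 l) (fin_add_one_ne l).symm hne, add_neg_cancel]
    intro t'' ht'' ⟨ha, hb⟩
    exact V.orient_third_zero ht (hT1 l) h1 h2 (hT2 l) (hT3 l) (fin_add_one_ne l).symm hne ht'' ha hb
  have hσ : ∀ l, K.orient (T l) l (l + 1) = V.edgeSign 0 (0 + 1) := by
    intro l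
    rw [← V.edgeSign_succ l, edgeSign,
      Finset.sum_eq_single (T l) (fun t' ht' hne => orient_eq_zero fun hm => hne (huniq l t' ht' hm.1 hm.2))
        (fun h => absurd (hT1 l) h)]
  refine ⟨V.edgeSign 0 (0 + 1), ?_, T, fun l => ⟨hT1 l, hT2 l, hT3 l, hσ l, huniq l⟩⟩
  rw [← hσ 0]
  exact V.orient_eq_one_or (hT1 0) (hT2 0) (hT3 0) (fin_add_one_ne 0).symm

end VirtualMesh

/-! ## Weak rotation and tangential traces -/

lemma weakRot_spec {D : Set Plane} {v : Plane → Plane} (h : ∃ r, IsWeakRot D v r) :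
    IsWeakRot D v (weakRot D v) := by
  unfold weakRot
  rw [dif_pos h]
  exact h.choose_spec

lemma integrableOn_mul_of_memLp {D : Set Plane} {r φ : Plane → ℝ}
    (hr : MemLp r 2 (volume.restrict D)) (hφ : Continuous φ) (hc : HasCompactSupport φ) :
    IntegrableOn (fun x => r x * φ x) D :=
  hr.integrable_mul (q := 2) ((hφ.memLp_of_hasCompactSupport hc).restrict D)

lemma integrableOn_inner_of_memLp {D : Set Plane} {v w : Plane → Plane}
    (hv : MemL2 D v) (hw : Continuous w) (hc : HasCompactSupport w) :
    IntegrableOn (fun x => (inner ℝ (v x) (w x) : ℝ)) D := by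
  have hw2 : MemLp w 2 (volume.restrict D) := (hw.memLp_of_hasCompactSupport hc).restrict D
  refine Integrable.mono (hv.norm.integrable_mul hw2.norm) (hv.1.inner hw2.1) ?_
  filter_upwards with x
  simpa using abs_real_inner_le_norm (v x) (w x)

/-- Two weak rotations have the same integrals against all test functions. Since `weakRot` is a
choice, this is what identifies it with an explicit rotation. -/
lemma IsWeakRot.ae_eq {D : Set Plane} (hD : IsOpen D) {v : Plane → Plane} {r r' : Plane → ℝ}
    (h : IsWeakRot D v r) (h' : IsWeakRot D v r') : r =ᵐ[volume.restrict D] r' := by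
  have hl : LocallyIntegrableOn (fun x => r x - r' x) D :=
    locallyIntegrableOn_of_locallyIntegrable_restrict ((h.1.sub h'.1).locallyIntegrable (by norm_num))
  have := hD.ae_eq_zero_of_integral_contDiff_smul_eq_zero hl fun φ h1 h2 h3 => by
    rw [← setIntegral_eq_integral_of_forall_compl_eq_zero (s := D) (fun x hx => by
      rw [image_eq_zero_of_notMem_tsupport (fun h => hx (h3 h)), zero_smul])]
    have e1 := integrableOn_mul_of_memLp h.1 h1.continuous h2
    have e2 := integrableOn_mul_of_memLp h'.1 h1.continuous h2
    calc ∫ x in D, φ x • (r x - r' x) = ∫ x in D, (r x * φ x - r' x * φ x) := by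
          congr 1; ext x; simp only [smul_eq_mul]; ring
      _ = 0 := by
          rw [integral_sub e1 e2, h.2 φ ⟨h1, h2, h3⟩, h'.2 φ ⟨h1, h2, h3⟩, sub_self]
  rw [Filter.EventuallyEq, ae_restrict_iff' hD.measurableSet]
  filter_upwards [this] with x hx hxD
  exact sub_eq_zero.1 (hx hxD)

namespace PolyCell
variable (K : PolyCell)

lemma edgeLength_pos (i : Fin (K.m + 3)) : 0 < K.edgeLength i :=
  dist_pos.2 fun h => fin_add_one_ne i (K.vertex_injective h).symm

lemma continuous_edgePoint (i : Fin (K.m + 3)) : Continuous (K.edgePoint i) := by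
  unfold edgePoint; fun_prop

variable {K}

lemma edgePoint_mem {i : Fin (K.m + 3)} {τ : ℝ} (h : τ ∈ Icc (0 : ℝ) 1) :
    K.edgePoint i τ ∈ segment ℝ (K.vertex i) (K.vertex (i + 1)) := by
  rw [segment_eq_image_lineMap]; exact ⟨τ, h, rfl⟩

lemma edgePoint_notMem {i j : Fin (K.m + 3)} (hij : i ≠ j) {τ : ℝ} (h : τ ∈ Ioo (0 : ℝ) 1) :
    K.edgePoint i τ ∉ segment ℝ (K.vertex j) (K.vertex (j + 1)) := by
  intro hm
  have hne : K.vertex i ≠ K.vertex (i + 1) := fun h => fin_add_one_ne i (K.vertex_injective h).symm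
  have h1 := (K.simple i j hij ⟨edgePoint_mem (Ioo_subset_Icc_self h), hm⟩).1
  simp only [edgePoint, mem_insert_iff, mem_singleton_iff] at h1
  rcases h1 with h1 | h1
  · rw [AffineMap.lineMap_eq_left_iff] at h1
    rcases h1 with h1 | h1
    · exact hne h1
    · exact h.1.ne' h1
  · rw [AffineMap.lineMap_eq_right_iff] at h1
    rcases h1 with h1 | h1
    · exact hne h1
    · exact h.2.ne h1

/-- The affine parameter of the projection to the line of an edge. -/
def edgeParam (K : PolyCell) (i : Fin (K.m + 3)) (x : Plane) : ℝ :=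
  inner ℝ (K.vertex (i + 1) - K.vertex i) (x - K.vertex i) / K.edgeLength i ^ 2

lemma edgeParam_edgePoint (i : Fin (K.m + 3)) (τ : ℝ) : K.edgeParam i (K.edgePoint i τ) = τ := by
  have := (K.edgeLength_pos i).ne'
  unfold edgeParam edgePoint
  rw [AffineMap.lineMap_apply_module', add_sub_cancel_right, inner_smul_right,
    real_inner_self_eq_norm_sq, ← dist_eq_norm, dist_comm, ← edgeLength]
  field_simp

/-- The profile `θ` is extended constantly across the edge through the projection parameter, then
multiplied by a cut-off which is one on the image of its support and zero on all other edges. Edges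
that touch do so at end points only, where `θ` vanishes. -/
lemma exists_boundary_test (i : Fin (K.m + 3)) {θ : ℝ → ℝ} (h1 : ContDiff ℝ ∞ θ)
    (h2 : HasCompactSupport θ) (h3 : tsupport θ ⊆ Ioo 0 1) :
    ∃ φ : Plane → ℝ, ContDiff ℝ ∞ φ ∧ HasCompactSupport φ ∧
      (∀ τ ∈ Icc (0 : ℝ) 1, φ (K.edgePoint i τ) = θ τ) ∧
      ∀ j ≠ i, ∀ τ ∈ Icc (0 : ℝ) 1, φ (K.edgePoint j τ) = 0 := by
  set F : Set Plane := ⋃ j ∈ ({i}ᶜ : Set (Fin (K.m + 3))),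
    segment ℝ (K.vertex j) (K.vertex (j + 1)) with hF
  have hFc : IsClosed F := (toFinite _).isClosed_biUnion fun j _ => by
    rw [← convexHull_pair]
    exact ((toFinite _).isCompact_convexHull ℝ).isClosed
  set A : Set Plane := K.edgePoint i '' tsupport θ with hA
  have hAc : IsCompact A := h2.isCompact.image (K.continuous_edgePoint i)
  have hAF : Disjoint A F := by
    rw [disjoint_left]
    rintro _ ⟨τ, hτ, rfl⟩ hm
    simp only [hF, mem_iUnion] at hm
    obtain ⟨j, hj, hm⟩ := hm
    exact edgePoint_notMem (fun e => hj e.symm) (h3 hτ) hm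
  obtain ⟨R, hR⟩ := (K.isBounded.closure.union hAc.isBounded).subset_ball 0
  have hAU : A ⊆ Fᶜ ∩ Metric.ball 0 R := fun x hx =>
    ⟨fun hx' => disjoint_left.1 hAF hx hx', hR (Or.inr hx)⟩
  obtain ⟨χ, hχ1, -, hχ2, hχ3⟩ := exists_contMDiff_support_eq_eq_one_iff (n := ⊤)
    (I := modelWithCornersSelf ℝ Plane) (hFc.isOpen_compl.inter (Metric.isOpen_ball (x := 0) (ε := R)))
    hAc.isClosed hAU
  have hχ : ContDiff ℝ ∞ χ := hχ1.contDiff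
  refine ⟨fun x => θ (K.edgeParam i x) * χ x, ?_, ?_, ?_, ?_⟩
  · have : ContDiff ℝ ∞ (K.edgeParam i) := by
      unfold edgeParam
      simp only [inner_plane]
      fun_prop
    exact (h1.comp this).mul hχ
  · refine HasCompactSupport.mul_left (HasCompactSupport.of_support_subset_isCompact
      (isCompact_closedBall (0 : Plane) R) ?_)
    rw [hχ2]
    exact inter_subset_right.trans Metric.ball_subset_closedBall
  · intro τ hτ
    simp only [edgeParam_edgePoint]
    by_cases h : τ ∈ tsupport θ
    · rw [(hχ3 _).1 ⟨τ, h, rfl⟩, mul_one]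
    · rw [image_eq_zero_of_notMem_tsupport h, zero_mul]
  · intro j hj τ hτ
    have : χ (K.edgePoint j τ) = 0 := by
      rw [← Function.notMem_support, hχ2]
      exact fun h => h.1 (mem_iUnion₂.2 ⟨j, hj, edgePoint_mem hτ⟩)
    simp [this]

/-- Test functions concentrated on one edge show that the trace is determined there. It allows
`traceNorm`, defined by a choice, to be computed from any trace at hand. -/
lemma IsTangentialTrace.ae_eq {v : Plane → Plane} {g g' : Fin (K.m + 3) → ℝ → ℝ}
    (h : K.IsTangentialTrace v g) (h' : K.IsTangentialTrace v g') (i : Fin (K.m + 3)) :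
    g i =ᵐ[volume.restrict (Icc (0 : ℝ) 1)] g' i := by
  have hm := (h.1 i).sub (h'.1 i)
  have hl : LocallyIntegrableOn (fun τ => g i τ - g' i τ) (Ioo (0 : ℝ) 1) := by
    refine IntegrableOn.locallyIntegrableOn ?_
    have : IntegrableOn (fun τ => g i τ - g' i τ) (Icc (0 : ℝ) 1) := hm.integrable (by norm_num)
    exact this.mono_set Ioo_subset_Icc_self
  have key := isOpen_Ioo.ae_eq_zero_of_integral_contDiff_smul_eq_zero hl fun θ h1 h2 h3 => by
    obtain ⟨φ, hφ1, hφ2, hφ3, hφ4⟩ := exists_boundary_test i h1 h2 h3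
    have e := (h.2 φ hφ1 hφ2).symm.trans (h'.2 φ hφ1 hφ2)
    have hb : ∀ g : Fin (K.m + 3) → ℝ → ℝ, K.boundaryIntegral (fun i τ => g i τ * φ (K.edgePoint i τ)) =
        K.edgeLength i * ∫ τ in (0 : ℝ)..1, g i τ * θ τ := by
      intro g
      unfold boundaryIntegral
      rw [Finset.sum_eq_single i]
      · congr 1
        apply intervalIntegral.integral_congr
        intro τ hτ
        rw [uIcc_of_le zero_le_one] at hτ
        change g i τ * φ _ = _
        rw [hφ3 τ hτ]
      · intro j _ hj
        rw [intervalIntegral.integral_congr (g := fun _ => (0 : ℝ))]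
        · simp
        · intro τ hτ
          rw [uIcc_of_le zero_le_one] at hτ
          change g j τ * φ _ = 0
          rw [hφ4 j hj τ hτ, mul_zero]
      · simp
    rw [hb, hb] at e
    have e' := mul_left_cancel₀ (K.edgeLength_pos i).ne' e
    have hθ : MemLp θ 2 (volume.restrict (Icc (0 : ℝ) 1)) :=
      (h1.continuous.memLp_of_hasCompactSupport h2).restrict _
    have i1 : IntervalIntegrable (fun τ => g i τ * θ τ) volume 0 1 := by
      rw [intervalIntegrable_iff_integrableOn_Icc_of_le zero_le_one]
      exact (h.1 i).integrable_mul hθ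
    have i2 : IntervalIntegrable (fun τ => g' i τ * θ τ) volume 0 1 := by
      rw [intervalIntegrable_iff_integrableOn_Icc_of_le zero_le_one]
      exact (h'.1 i).integrable_mul hθ
    rw [← sub_eq_zero, ← intervalIntegral.integral_sub i1 i2, intervalIntegral.integral_of_le zero_le_one,
      integral_Ioc_eq_integral_Ioo] at e'
    rw [← setIntegral_eq_integral_of_forall_compl_eq_zero (s := Ioo (0 : ℝ) 1) (fun x hx => by
      rw [image_eq_zero_of_notMem_tsupport (fun h => hx (h3 h)), zero_smul])]
    refine Eq.trans ?_ e'
    congr 1; ext τ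
    change θ τ * (g i τ - g' i τ) = _
    ring
  rw [Filter.EventuallyEq, ← restrict_Ioo_eq_restrict_Icc, ae_restrict_iff' measurableSet_Ioo]
  filter_upwards [key] with τ hτ hm
  exact sub_eq_zero.1 (hτ hm)

lemma boundaryIntegral_sq_nonneg (g : Fin (K.m + 3) → ℝ → ℝ) :
    0 ≤ K.boundaryIntegral fun i τ => g i τ ^ 2 :=
  Finset.sum_nonneg fun i _ => mul_nonneg (K.edgeLength_pos i).le
    (intervalIntegral.integral_nonneg zero_le_one fun _ _ => sq_nonneg _)

lemma IsTangentialTrace.traceNorm_sq {v : Plane → Plane} {g : Fin (K.m + 3) → ℝ → ℝ}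
    (h : K.IsTangentialTrace v g) :
    K.traceNorm v ^ 2 = K.boundaryIntegral fun i τ => g i τ ^ 2 := by
  have hex : ∃ g, K.IsTangentialTrace v g := ⟨g, h⟩
  have hc : K.IsTangentialTrace v (K.tangentialTrace v) := by
    unfold tangentialTrace
    rw [dif_pos hex]; exact hex.choose_spec
  unfold traceNorm
  rw [Real.sq_sqrt (boundaryIntegral_sq_nonneg _)]
  unfold boundaryIntegral
  refine Finset.sum_congr rfl fun i _ => ?_
  congr 1
  simp only [intervalIntegral.integral_of_le zero_le_one, ← integral_Icc_eq_integral_Ioc]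
  refine integral_congr_ae ?_
  filter_upwards [hc.ae_eq h i] with τ hτ
  simp only [hτ]

end PolyCell

namespace VirtualMesh
variable {K : PolyCell} (V : VirtualMesh K)

/-- `v` is the piecewise field `a_t + b (-x₂, x₁)` with weak rotation `2 b`. -/
structure IsField (v : Plane → Plane) (a : Finset (Fin (K.m + 3)) → Plane) (b : ℝ) : Prop where
  memL2 : MemL2 K.carrier v
  eq_ae : ∀ t ∈ V.tri, ∀ᵐ x ∂volume.restrict (K.hull t), v x = nedelec (a t) b x
  weakRot : IsWeakRot K.carrier v fun _ => 2 * b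

variable {V}

/-- The open triangle of three vertices. -/
def openTri (p q r : Plane) : Set Plane :=
  {z | 0 < cr (q - p) (z - p) * cr (q - p) (r - p) ∧ 0 < cr (r - q) (z - q) * cr (q - p) (r - p) ∧
    0 < cr (p - r) (z - r) * cr (q - p) (r - p)}

lemma isOpen_openTri (p q r : Plane) : IsOpen (openTri p q r) := by
  have h : ∀ (u w : Plane) (d : ℝ), IsOpen {z : Plane | 0 < cr u (z - w) * d} := fun u w d => by
    refine isOpen_lt continuous_const ?_
    simp only [cr, PiLp.sub_apply]
    fun_prop
  exact (h _ _ _).inter ((h _ _ _).inter (h _ _ _))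

lemma openTri_subset {p q r : Plane} : openTri p q r ⊆ convexHull ℝ {p, q, r} := by
  rintro z ⟨h1, h2, h3⟩
  set D := cr (q - p) (r - p) with hD
  have hD0 : D ≠ 0 := by rintro h; rw [h] at h1; simp at h1
  have hD2 : 0 < D ^ 2 := by positivity
  rw [mem_triangle]
  have e : ∀ x, x / D = x * D / D ^ 2 := fun x => by field_simp
  refine ⟨cr (p - r) (z - r) / D, cr (q - p) (z - p) / D, ?_, ?_, ?_, ?_⟩
  · rw [e]; positivity
  · rw [e]; positivity
  · have h4 : cr (p - r) (z - r) / D + cr (q - p) (z - p) / D = 1 - cr (r - q) (z - q) / D := by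
      field_simp
      rw [hD]; simp [cr]; ring
    have : 0 < cr (r - q) (z - q) / D := by rw [e]; positivity
    linarith
  · have e : D • z = D • (p + ((cr (p - r) (z - r) / D) • (q - p) +
        (cr (q - p) (z - p) / D) • (r - p))) := by
      rw [smul_add, smul_add, smul_smul, smul_smul, mul_div_cancel₀ _ hD0, mul_div_cancel₀ _ hD0, hD]
      ext c
      fin_cases c <;> (simp [cr]; ring)
    exact smul_right_injective _ hD0 e

lemma centroid_mem_openTri {p q r : Plane} (h : cr (q - p) (r - p) ≠ 0) :
    (1 / 3 : ℝ) • (p + q + r) ∈ openTri p q r := by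
  have h2 : 0 < cr (q - p) (r - p) ^ 2 := by positivity
  refine ⟨?_, ?_, ?_⟩
  · have : cr (q - p) ((1 / 3 : ℝ) • (p + q + r) - p) = 1 / 3 * cr (q - p) (r - p) := by
      simp [cr]; ring
    rw [this]; nlinarith
  · have : cr (r - q) ((1 / 3 : ℝ) • (p + q + r) - q) = 1 / 3 * cr (q - p) (r - p) := by
      simp [cr]; ring
    rw [this]; nlinarith
  · have : cr (p - r) ((1 / 3 : ℝ) • (p + q + r) - r) = 1 / 3 * cr (q - p) (r - p) := by
      simp [cr]; ring
    rw [this]; nlinarith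

lemma notMem_openTri {p q r z : Plane} (hz : z ∈ segment ℝ p q ∨ z ∈ segment ℝ q r ∨ z ∈ segment ℝ r p) :
    z ∉ openTri p q r := by
  rintro ⟨h1, h2, h3⟩
  rcases hz with h | h | h <;> rw [cr_eq_zero_of_mem_segment h] at * <;> simp_all

variable (V)

lemma integrableOn_inner_vrot {D : Set Plane} {v : Plane → Plane} (hv : MemL2 D v) {η : Plane → ℝ}
    (h1 : ContDiff ℝ 1 η) (h2 : HasCompactSupport η) :
    IntegrableOn (fun x => (inner ℝ (v x) (vrot η x) : ℝ)) D :=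
  integrableOn_inner_of_memLp hv (continuous_vrot h1) (hasCompactSupport_vrot h2)

/-- For a bump inside the open triangle the boundary terms in Green's formula disappear, and what is
left is `2 b ∫ η = c ∫ η` with a positive integral. -/
lemma rot_coeff_eq {v : Plane → Plane} {c : ℝ}
    (hw : IsWeakRot K.carrier v fun _ => c) {t : Finset (Fin (K.m + 3))} (ht : t ∈ V.tri)
    {a : Plane} {b : ℝ} (hv : ∀ᵐ x ∂volume.restrict (K.hull t), v x = nedelec a b x) : c = 2 * b := by
  obtain ⟨i, j, k, hij, hik, hjk, rfl⟩ := V.exists_eq ht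
  have hd := V.det_ne_zero ht hij hik hjk
  set O := openTri (K.vertex i) (K.vertex j) (K.vertex k) with hO
  have hOo : IsOpen O := isOpen_openTri _ _ _
  have hOh : O ⊆ K.hull {i, j, k} := by rw [PolyCell.hull_eq]; exact openTri_subset
  obtain ⟨p, hpO, hpK⟩ : (O ∩ K.carrier).Nonempty :=
    (mem_closure_iff.1 (V.hull_subset ht (hOh (centroid_mem_openTri hd)))) O hOo
      (centroid_mem_openTri hd)
  obtain ⟨η, h3, h4, h5, h6, h7⟩ := exists_contDiff_tsupport_subset (n := ⊤)
    ((hOo.inter K.isOpen).mem_nhds ⟨hpO, hpK⟩)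
  have h5' : ContDiff ℝ 1 η := h5.of_le (by exact_mod_cast le_top)
  have hoff : ∀ x, x ∉ O ∩ K.carrier → η x = 0 := fun x hx =>
    image_eq_zero_of_notMem_tsupport fun h => hx (h3 h)
  have hoff' : ∀ x, x ∉ O ∩ K.carrier → vrot η x = 0 := fun x hx =>
    vrot_eq_zero fun h => hx (h3 h)
  have e1 := V.green_tri ht h5' a b
  have hz : ∀ p q, (∀ z ∈ segment ℝ p q, z ∉ O) → segAvg η p q = 0 := by
    intro p q hpq
    unfold segAvg
    rw [intervalIntegral.integral_congr (g := fun _ => (0 : ℝ)), intervalIntegral.integral_zero]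
    intro τ hτ
    rw [uIcc_of_le zero_le_one] at hτ
    refine hoff _ fun h => hpq _ ?_ h.1
    rw [segment_eq_image_lineMap]; exact ⟨τ, hτ, rfl⟩
  rw [PolyCell.orient_sum hij hik hjk
    (fun i j => circ a b (K.vertex i) (K.vertex j) * segAvg η (K.vertex i) (K.vertex j))
    (fun i j => by rw [circ_swap, segAvg_swap]; ring),
    hz _ _ fun z h => notMem_openTri (Or.inl h), hz _ _ fun z h => notMem_openTri (Or.inr (Or.inl h)),
    hz _ _ fun z h => notMem_openTri (Or.inr (Or.inr h))] at e1
  simp only [mul_zero, add_zero] at e1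
  have e2 := hw.2 η ⟨h5, h4, h3.trans inter_subset_right⟩
  have hsub : ∀ F : Plane → ℝ, (∀ x, x ∉ O ∩ K.carrier → F x = 0) →
      ∫ x in K.carrier, F x = ∫ x in K.hull {i, j, k}, F x := by
    intro F hF
    rw [setIntegral_eq_integral_of_forall_compl_eq_zero (fun x hx => hF x fun h => hx h.2),
      setIntegral_eq_integral_of_forall_compl_eq_zero (fun x hx => hF x fun h => hx (hOh h.1))]
  rw [hsub _ (fun x hx => by rw [hoff x hx, mul_zero]),
    hsub _ (fun x hx => by rw [hoff' x hx, inner_zero_right])] at e2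
  have e3 : ∫ x in K.hull {i, j, k}, inner ℝ (v x) (vrot η x) =
      ∫ x in K.hull {i, j, k}, inner ℝ (nedelec a b x) (vrot η x) := by
    refine integral_congr_ae ?_
    filter_upwards [hv] with x hx
    rw [hx]
  have i1 : IntegrableOn η (K.hull {i, j, k}) :=
    (h5.continuous.integrable_of_hasCompactSupport h4).integrableOn
  have i2 : IntegrableOn (fun x => (inner ℝ (nedelec a b x) (vrot η x) : ℝ)) (K.hull {i, j, k}) :=
    (((continuous_nedelec a b).inner (continuous_vrot h5')).continuousOn).integrableOn_compact
      (PolyCell.isCompact_hull _)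
  rw [integral_sub (i1.const_mul _) i2, ← e3, ← e2, integral_const_mul, integral_const_mul] at e1
  have hpos : 0 < ∫ x in K.hull {i, j, k}, η x := by
    rw [setIntegral_eq_integral_of_forall_compl_eq_zero
      (fun x hx => hoff x fun h => hx (hOh h.1))]
    exact h5.continuous.integral_pos_of_hasCompactSupport_nonneg_nonzero (x := p) h4
      (fun x => (h6 ⟨x, rfl⟩).1) (by rw [h7]; exact one_ne_zero)
  have e4 : (2 * b - c) * ∫ x in K.hull {i, j, k}, η x = 0 := by linarith
  rcases mul_eq_zero.1 e4 with h | h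
  · linarith
  · exact absurd h hpos.ne'

/-- The constant rotation on `K` forces the coefficient `b` to be the same on all triangles; only
the vectors `a t` vary. -/
lemma exists_isField {v : Plane → Plane} (hv : V.MemEdgeSpace v) : ∃ a b, V.IsField v a b := by
  obtain ⟨⟨h2, -⟩, ht, c, hc⟩ := hv
  choose! a b hab using ht
  refine ⟨a, c / 2, h2, fun t ht => ?_, ?_⟩
  · have := V.rot_coeff_eq hc ht (hab t ht)
    rw [this, mul_div_cancel_left₀ _ two_ne_zero]
    exact hab t ht
  · rwa [mul_div_cancel₀ _ two_ne_zero]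

variable {V}
variable {v : Plane → Plane} {a : Finset (Fin (K.m + 3)) → Plane} {b : ℝ}

lemma IsField.green (h : V.IsField v a b) {η : Plane → ℝ} (h1 : ContDiff ℝ 1 η)
    (h2 : HasCompactSupport η) :
    (∫ x in K.carrier, 2 * b * η x) - ∫ x in K.carrier, inner ℝ (v x) (vrot η x) =
      1 / 2 * ∑ i, ∑ j, V.jump V.tri a b i j * segAvg η (K.vertex i) (K.vertex j) := by
  have i1 : IntegrableOn (fun x => 2 * b * η x) K.carrier :=
    ((h1.continuous.integrable_of_hasCompactSupport h2).const_mul _).integrableOn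
  have i2 := integrableOn_inner_vrot h.memL2 h1 h2
  rw [← V.green_set (Finset.Subset.refl _) a b h1, ← integral_sub i1 i2]
  have i3 : IntegrableOn (fun x => 2 * b * η x - inner ℝ (v x) (vrot η x)) K.carrier := i1.sub i2
  rw [V.integral_carrier i3]
  refine Finset.sum_congr rfl fun t ht => integral_congr_ae ?_
  filter_upwards [h.eq_ae t ht] with x hx
  rw [hx]

lemma IsField.jump_eq_zero (h : V.IsField v a b) {t : Finset (Fin (K.m + 3))} (ht : t ∈ V.tri)
    {i j : Fin (K.m + 3)} (hi : i ∈ t) (hj : j ∈ t) (hij : i ≠ j) (hc : ¬ CycAdj i j) :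
    V.jump V.tri a b i j = 0 := by
  refine V.jump_eq_zero (fun η h1 h2 h3 => ?_) ht hi hj hij
    fun hd => hc (V.cycAdj_of_disjoint ht hi hj hij hd)
  have h1' : ContDiff ℝ 1 η := h1.of_le (by exact_mod_cast le_top)
  rw [V.green_set (Finset.Subset.refl _) a b h1', ← h.green h1' h2, h.weakRot.2 η ⟨h1, h2, h3⟩,
    sub_self]

/-- The two triangles at an interior edge have opposite orientation signs, so that a vanishing jump
is equality of the circulations. -/
lemma IsField.circ_eq (h : V.IsField v a b) {t t' : Finset (Fin (K.m + 3))} (ht : t ∈ V.tri)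
    (ht' : t' ∈ V.tri) {i j : Fin (K.m + 3)} (hi : i ∈ t) (hj : j ∈ t) (hi' : i ∈ t') (hj' : j ∈ t')
    (hij : i ≠ j) (hc : ¬ CycAdj i j) :
    circ (a t) b (K.vertex i) (K.vertex j) = circ (a t') b (K.vertex i) (K.vertex j) := by
  by_cases hne : t = t'
  · rw [hne]
  have := h.jump_eq_zero ht hi hj hij hc
  unfold jump at this
  rw [Finset.sum_eq_add_of_mem t t' ht ht' hne,
    V.orient_opposite ht ht' hi hj hi' hj' hij hne] at this
  · rcases V.orient_eq_one_or ht hi hj hij with e | e <;> rw [e] at this <;> linarith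
  · intro t'' ht'' hh
    rw [V.orient_third_zero ht ht' hi hj hi' hj' hij hne ht'' hh.1 hh.2, zero_mul]

/-- The summation formula over a set of triangles with one distinguished interior edge. -/
lemma sum_tri_set {σ : ℝ} {T : Fin (K.m + 3) → Finset (Fin (K.m + 3))}
    (hT : ∀ l, T l ∈ V.tri ∧ l ∈ T l ∧ l + 1 ∈ T l ∧ K.orient (T l) l (l + 1) = σ ∧
      ∀ t ∈ V.tri, l ∈ t → l + 1 ∈ t → t = T l)
    {S : Finset (Finset (Fin (K.m + 3)))} (hS : S ⊆ V.tri)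
    {t₀ t₁ : Finset (Fin (K.m + 3))} (h0 : t₀ ∈ S) (h1 : t₁ ∈ V.tri) (h1' : t₁ ∉ S)
    {i₀ j₀ : Fin (K.m + 3)} (hi0 : i₀ ∈ t₀) (hj0 : j₀ ∈ t₀) (hi1 : i₀ ∈ t₁) (hj1 : j₀ ∈ t₁)
    (hij : i₀ ≠ j₀) (hc : ¬ CycAdj i₀ j₀)
    (hcl : ∀ i j, i ≠ j → ¬ CycAdj i j → ¬ (i = i₀ ∧ j = j₀) → ¬ (i = j₀ ∧ j = i₀) →
      ∀ t ∈ V.tri, ∀ t' ∈ V.tri, i ∈ t → j ∈ t → i ∈ t' → j ∈ t' → t ∈ S → t' ∈ S)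
    (G : Finset (Fin (K.m + 3)) → Fin (K.m + 3) → Fin (K.m + 3) → ℝ)
    (hG : ∀ t i j, G t j i = -G t i j)
    (hGc : ∀ i j, i ≠ j → ¬ CycAdj i j → ∀ t ∈ V.tri, ∀ t' ∈ V.tri, i ∈ t → j ∈ t → i ∈ t' → j ∈ t' →
      G t i j = G t' i j) :
    ∑ i, ∑ j, ∑ t ∈ S, K.orient t i j * G t i j =
      2 * (K.orient t₀ i₀ j₀ * G t₀ i₀ j₀ +
        ∑ l, if T l ∈ S then σ * G (T l) l (l + 1) else 0) := by
  classical
  have hc' : ¬ (j₀ = i₀ + 1) ∧ ¬ (i₀ = j₀ + 1) := not_or.1 hc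
  rw [sum_symm_eq (fun i j => ∑ t ∈ S, K.orient t i j * G t i j) ?_ hc'.1 hc'.2 hij]
  · congr 2
    · refine Finset.sum_eq_single t₀ (fun t ht hne => ?_) (fun h => absurd h0 h)
      have : t ≠ t₁ := fun e => h1' (e ▸ ht)
      have hne' : t₀ ≠ t₁ := fun e => h1' (e ▸ h0)
      rw [V.orient_third_zero (hS h0) h1 hi0 hj0 hi1 hj1 hij hne' (hS ht) hne this, zero_mul]
    · refine Finset.sum_congr rfl fun l _ => ?_
      obtain ⟨a1, a2, a3, a4, a5⟩ := hT l
      have hz : ∀ t ∈ S, t ≠ T l → K.orient t l (l + 1) * G t l (l + 1) = 0 := fun t ht hne => by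
        rw [orient_eq_zero fun hm => hne (a5 t (hS ht) hm.1 hm.2), zero_mul]
      split_ifs with hm
      · rw [Finset.sum_eq_single (T l) hz (fun h => absurd hm h), a4]
      · exact Finset.sum_eq_zero fun t ht => hz t ht fun e => hm (e ▸ ht)
  · intro i j h1 h2 h3 h4
    by_cases hii : i = j
    · subst hii
      exact Finset.sum_eq_zero fun t _ => by rw [PolyCell.orient_self, zero_mul]
    have hcij : ¬ CycAdj i j := not_or.2 ⟨h1, h2⟩
    by_cases hm : ∃ t ∈ S, i ∈ t ∧ j ∈ t
    · obtain ⟨t, ht, ha, hb⟩ := hm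
      -- An interior edge other than the distinguished one has both of its triangles in `S` by
      -- `hcl`; their signs are opposite and their values of `G` agree, so they cancel.
      obtain ⟨t', ht', ha', hb', hne⟩ := V.exists_neighbour (hS ht) ha hb hii hcij
      have ht'S := hcl i j hii hcij h3 h4 t (hS ht) t' ht' ha hb ha' hb' ht
      rw [Finset.sum_eq_add_of_mem t t' ht ht'S hne,
        V.orient_opposite (hS ht) ht' ha hb ha' hb' hii hne,
        hGc i j hii hcij t (hS ht) t' ht' ha hb ha' hb']
      · ring
      · intro t'' ht'' hh
        rw [V.orient_third_zero (hS ht) ht' ha hb ha' hb' hii hne (hS ht'') hh.1 hh.2, zero_mul]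
    · exact Finset.sum_eq_zero fun t ht => by
        rw [orient_eq_zero fun hh => hm ⟨t, ht, hh⟩, zero_mul]
  · intro i j
    refine Finset.sum_congr rfl fun t _ => ?_
    rw [PolyCell.orient_swap, hG]; ring

end VirtualMesh

/-! ## Separation of a virtual mesh by an interior edge -/

/-- The complex coordinate of a point. -/
def toC (x : Plane) : ℂ := ⟨x 0, x 1⟩

/-- The angle under which the segment from `p` to `q` is seen from `x`. -/
def viewAngle (p q x : Plane) : ℝ := Complex.arg ((toC q - toC x) / (toC p - toC x))

lemma continuous_toC : Continuous toC := by
  have : toC = fun x : Plane => (x 0 : ℂ) + (x 1 : ℂ) * Complex.I := by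
    ext x
    apply Complex.ext <;> simp [toC]
  rw [this]; fun_prop

lemma toC_injective : Function.Injective toC := by
  intro x y h
  have h0 := congrArg Complex.re h
  have h1 := congrArg Complex.im h
  ext i; fin_cases i
  · exact h0
  · exact h1

/-- The argument is continuous off the non-positive real axis. The quotient is a non-positive real
number exactly when the directions to `p` and `q` are opposite (or one vanishes), which places `x`
on the segment. -/
lemma continuousAt_viewAngle {p q x : Plane} (hx : x ∉ segment ℝ p q) :
    ContinuousAt (viewAngle p q) x := by
  have hp : toC p - toC x ≠ 0 := sub_ne_zero.2 fun h => hx (toC_injective h ▸ left_mem_segment ℝ p q)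
  have hc := continuous_toC.continuousAt (x := x)
  refine ContinuousAt.comp (g := Complex.arg) (Complex.continuousAt_arg ?_)
    ((continuousAt_const.sub hc).div (continuousAt_const.sub hc) hp)
  rw [Complex.mem_slitPlane_iff]
  by_contra! h
  set r := ((toC q - toC x) / (toC p - toC x)).re with hr
  have hq : toC q - toC x = (r : ℂ) * (toC p - toC x) := by
    have : (toC q - toC x) / (toC p - toC x) = (r : ℂ) := Complex.ext (by simp [hr]) (by simp [h.2])
    rw [← this, div_mul_cancel₀ _ hp]
  have e0 := congrArg Complex.re hq
  have e1 := congrArg Complex.im hq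
  simp [toC] at e0 e1
  have hr1 : 0 < 1 - r := by linarith [h.1]
  refine hx ⟨-r / (1 - r), 1 / (1 - r), div_nonneg (by linarith [h.1]) hr1.le, by positivity,
    by field_simp; ring, ?_⟩
  ext i
  fin_cases i
  · simp; field_simp; linarith
  · simp; field_simp; linarith

lemma sum_arc {m : ℕ} {α : Type*} [AddCommGroup α] (f : Fin (m + 3) → α) (i j : Fin (m + 3))
    (hij : i ≤ j) : ∑ l ∈ Finset.univ.filter (fun l => i ≤ l ∧ l < j), (f (l + 1) - f l) = f j - f i := by
  induction j using Fin.induction with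
  | zero =>
    have : i = 0 := Fin.le_zero_iff.1 hij
    subst this; simp
  | succ j ih =>
    rcases eq_or_lt_of_le hij with h | h
    · rw [← h, sub_self]
      refine Finset.sum_eq_zero fun l hl => ?_
      simp only [Finset.mem_filter] at hl
      exact absurd hl.2.2 (not_lt.2 hl.2.1)
    · have hle : i ≤ j.castSucc := Fin.le_castSucc_iff.2 h
      have : Finset.univ.filter (fun l => i ≤ l ∧ l < j.succ) =
          insert j.castSucc (Finset.univ.filter (fun l => i ≤ l ∧ l < j.castSucc)) := by
        ext l
        simp only [Finset.mem_filter, Finset.mem_univ, true_and, Finset.mem_insert]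
        constructor
        · rintro ⟨h1, h2⟩
          rcases eq_or_lt_of_le (Fin.le_castSucc_iff.2 h2) with h3 | h3
          · exact Or.inl h3
          · exact Or.inr ⟨h1, h3⟩
        · rintro (rfl | ⟨h1, h2⟩)
          · exact ⟨hle, Fin.castSucc_lt_succ⟩
          · exact ⟨h1, h2.trans Fin.castSucc_lt_succ⟩
      rw [this, Finset.sum_insert (by simp), ih hle, Fin.coeSucc_eq_succ]
      abel

namespace PolyCell
variable (K : PolyCell)

/-- The angle function of the closed polygon made of the edges `i, …, j - 1` and the diagonal. -/
def winding (i j : Fin (K.m + 3)) (x : Plane) : ℝ :=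
  ∑ l ∈ Finset.univ.filter (fun l => i ≤ l ∧ l < j), viewAngle (K.vertex l) (K.vertex (l + 1)) x -
    viewAngle (K.vertex i) (K.vertex j) x

/-- The polygon made of the edges `i, …, j - 1` and the diagonal. -/
def loop (i j : Fin (K.m + 3)) : Set Plane :=
  segment ℝ (K.vertex i) (K.vertex j) ∪
    ⋃ l ∈ Finset.univ.filter (fun l => i ≤ l ∧ l < j), segment ℝ (K.vertex l) (K.vertex (l + 1))

variable {K}

/-- Modulo `2 π` each view angle is a difference of arguments of its end points. The sum along the
arc telescopes and cancels the angle of the diagonal. -/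
lemma winding_mem {i j : Fin (K.m + 3)} (hij : i ≤ j) {x : Plane} (hx : x ∉ K.loop i j) :
    ∃ n : ℤ, (n : ℝ) = K.winding i j x / (2 * Real.pi) := by
  simp only [loop, mem_union, mem_iUnion, not_or, not_exists] at hx
  have hne : ∀ {p q : Plane}, x ∉ segment ℝ p q → toC p - toC x ≠ 0 ∧ toC q - toC x ≠ 0 := by
    intro p q h
    exact ⟨sub_ne_zero.2 fun e => h (toC_injective e ▸ left_mem_segment ℝ p q),
      sub_ne_zero.2 fun e => h (toC_injective e ▸ right_mem_segment ℝ p q)⟩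
  have hang : ((K.winding i j x : ℝ) : Real.Angle) = 0 := by
    have hs : ∀ s : Finset (Fin (K.m + 3)), ((∑ l ∈ s, viewAngle (K.vertex l) (K.vertex (l + 1)) x : ℝ) :
        Real.Angle) = ∑ l ∈ s, ((viewAngle (K.vertex l) (K.vertex (l + 1)) x : ℝ) : Real.Angle) :=
      fun s => map_sum Real.Angle.coeHom _ s
    rw [winding, Real.Angle.coe_sub, hs]
    unfold viewAngle
    rw [Complex.arg_div_coe_angle (hne hx.1).2 (hne hx.1).1, Finset.sum_congr rfl fun l hl =>
      Complex.arg_div_coe_angle (hne (hx.2 l hl)).2 (hne (hx.2 l hl)).1,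
      sum_arc (fun l => ((Complex.arg (toC (K.vertex l) - toC x) : ℝ) : Real.Angle)) i j hij, sub_self]
  rw [Real.Angle.coe_eq_zero_iff] at hang
  obtain ⟨n, hn⟩ := hang
  refine ⟨n, ?_⟩
  rw [← hn, zsmul_eq_mul]
  field_simp

lemma continuousAt_winding {i j : Fin (K.m + 3)} {x : Plane} (hx : x ∉ K.loop i j) :
    ContinuousAt (K.winding i j) x := by
  simp only [loop, mem_union, mem_iUnion, not_or, not_exists] at hx
  exact (tendsto_finsetSum _ fun l hl => continuousAt_viewAngle (hx.2 l hl)).sub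
    (continuousAt_viewAngle hx.1)

/-- Divided by `2 π` the function is continuous off the loop and takes integer values, hence is
constant on connected sets. -/
lemma winding_eq {i j : Fin (K.m + 3)} (hij : i ≤ j) {s : Set Plane} (hs : IsPreconnected s)
    (hd : ∀ x ∈ s, x ∉ K.loop i j) {x y : Plane} (hx : x ∈ s) (hy : y ∈ s) :
    K.winding i j x = K.winding i j y := by
  have hdisc : DiscreteTopology (range ((↑) : ℤ → ℝ)) :=
    (Int.isClosedEmbedding_coe_real.isEmbedding.toHomeomorph.symm).isEmbedding.discreteTopology
  have h := hs.constant_of_mapsTo (T := range ((↑) : ℤ → ℝ)) ⟨hdisc⟩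
    (f := fun z => K.winding i j z / (2 * Real.pi))
    (fun z hz => ((continuousAt_winding (hd z hz)).div_const _).continuousWithinAt)
    (fun z hz => winding_mem hij (hd z hz)) hx hy
  have h2 : (2 * Real.pi) ≠ 0 := by positivity
  exact (div_left_inj' h2).1 h

/-- The centroid of a triangle of vertices. -/
def triCenter (K : PolyCell) (t : Finset (Fin (K.m + 3))) : Plane := (1 / 3 : ℝ) • ∑ i ∈ t, K.vertex i

lemma triCenter_eq {i j k : Fin (K.m + 3)} (hij : i ≠ j) (hik : i ≠ k) (hjk : j ≠ k) :
    K.triCenter {i, j, k} = (1 / 3 : ℝ) • (K.vertex i + K.vertex j + K.vertex k) := by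
  rw [triCenter, Finset.sum_insert (by simp [hij, hik]), Finset.sum_insert (by simp [hjk]),
    Finset.sum_singleton, add_assoc]

end PolyCell

/-- Seen from the midpoint the end points are opposite, so the quotient tends to `-1`, and it does
so within the half plane given by the side of approach. The two one-sided limits differ by `2 π`:
this is the jump of the winding number across the diagonal. -/
lemma viewAngle_tendsto {p q d : Plane} (hd : cr (q - p) d ≠ 0) :
    Filter.Tendsto (fun τ : ℝ => viewAngle p q (midpoint ℝ p q + τ • d)) (nhdsWithin 0 (Ioi 0))
      (nhds (SignType.sign (cr (q - p) d) * Real.pi)) := by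
  set f : ℝ → ℂ := fun τ => (toC q - toC (midpoint ℝ p q + τ • d)) /
    (toC p - toC (midpoint ℝ p q + τ • d)) with hf
  have hpq : toC q - toC p ≠ 0 := sub_ne_zero.2 fun h => hd (by
    rw [toC_injective h]; simp [cr])
  have hmid : toC (midpoint ℝ p q) = (toC p + toC q) / 2 := by
    apply Complex.ext <;> simp [toC, midpoint_eq_smul_add] <;> ring
  have hden : toC p - toC (midpoint ℝ p q) ≠ 0 := by
    rw [hmid]
    intro h
    apply hpq
    linear_combination (-2) * h
  have h0 : f 0 = -1 := by
    simp only [hf, zero_smul, add_zero]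
    rw [div_eq_iff hden, hmid]; ring
  have hcont : ContinuousAt f 0 := by
    have hc : Continuous fun τ : ℝ => toC (midpoint ℝ p q + τ • d) :=
      continuous_toC.comp (by fun_prop)
    exact (continuousAt_const.sub hc.continuousAt).div (continuousAt_const.sub hc.continuousAt)
      (by simpa using hden)
  have him : ∀ τ, (f τ).im = τ * cr (q - p) d / Complex.normSq (toC p - toC (midpoint ℝ p q + τ • d)) := by
    intro τ
    simp only [hf, Complex.div_im]
    rw [← sub_div]
    congr 1
    simp [toC, cr, midpoint_eq_smul_add]; ring
  have hlim : Filter.Tendsto f (nhdsWithin 0 (Ioi 0)) (nhds (-1)) := by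
    rw [← h0]; exact hcont.tendsto.mono_left nhdsWithin_le_nhds
  rcases lt_or_gt_of_ne hd with h | h
  · have hw : Filter.Tendsto f (nhdsWithin 0 (Ioi 0)) (nhdsWithin (-1) {z | z.im < 0}) := by
      refine tendsto_nhdsWithin_iff.2 ⟨hlim, ?_⟩
      have hne : ∀ᶠ τ in nhdsWithin 0 (Ioi 0), f τ ≠ 0 := hlim.eventually_ne (by norm_num)
      filter_upwards [self_mem_nhdsWithin, hne] with τ hτ hne
      rw [mem_Ioi] at hτ
      have hn : toC p - toC (midpoint ℝ p q + τ • d) ≠ 0 := fun e => hne (by simp [hf, e])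
      change (f τ).im < 0
      rw [him]
      exact div_neg_of_neg_of_pos (mul_neg_of_pos_of_neg hτ h) (Complex.normSq_pos.2 hn)
    have := (Complex.tendsto_arg_nhdsWithin_im_neg_of_re_neg_of_im_zero (z := -1) (by simp) (by simp)).comp hw
    rw [sign_neg h]
    have e : ((-1 : SignType) : ℝ) * Real.pi = -Real.pi := by simp
    rw [e]
    exact this
  · have hw : Filter.Tendsto f (nhdsWithin 0 (Ioi 0)) (nhdsWithin (-1) {z | 0 ≤ z.im}) := by
      refine tendsto_nhdsWithin_iff.2 ⟨hlim, ?_⟩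
      filter_upwards [self_mem_nhdsWithin] with τ hτ
      rw [mem_Ioi] at hτ
      rw [him]
      exact div_nonneg (mul_nonneg hτ.le h.le) (Complex.normSq_nonneg _)
    have := (Complex.tendsto_arg_nhdsWithin_im_nonneg_of_re_neg_of_im_zero (z := -1) (by simp) (by simp)).comp hw
    rw [sign_pos h]
    have e : ((1 : SignType) : ℝ) * Real.pi = Real.pi := by simp
    rw [e]
    exact this

namespace VirtualMesh
variable {K : PolyCell} (V : VirtualMesh K)

lemma toward_center_mem {i j k : Fin (K.m + 3)} (ht : {i, j, k} ∈ V.tri) (hij : i ≠ j) (hik : i ≠ k)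
    (hjk : j ≠ k) {τ : ℝ} (h0 : 0 < τ) (h1 : τ ≤ 1) :
    midpoint ℝ (K.vertex i) (K.vertex j) +
      τ • (K.triCenter {i, j, k} - midpoint ℝ (K.vertex i) (K.vertex j)) ∈
      openTri (K.vertex i) (K.vertex j) (K.vertex k) := by
  have hd := V.det_ne_zero ht hij hik hjk
  have hd2 : 0 < K.det i j k ^ 2 := by positivity
  rw [PolyCell.triCenter_eq hij hik hjk, midpoint_eq_smul_add]
  simp only [PolyCell.det, cr, PiLp.sub_apply] at hd2
  refine ⟨?_, ?_, ?_⟩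
  · have := mul_pos h0 hd2
    simp only [cr, PiLp.sub_apply, PiLp.add_apply, PiLp.smul_apply, smul_eq_mul, invOf_eq_inv]
    nlinarith
  · have : 0 < (1 / 2 - τ / 6) * ((K.vertex j 0 - K.vertex i 0) * (K.vertex k 1 - K.vertex i 1) -
      (K.vertex j 1 - K.vertex i 1) * (K.vertex k 0 - K.vertex i 0)) ^ 2 := mul_pos (by linarith) hd2
    simp only [cr, PiLp.sub_apply, PiLp.add_apply, PiLp.smul_apply, smul_eq_mul, invOf_eq_inv]
    nlinarith
  · have : 0 < (1 / 2 - τ / 6) * ((K.vertex j 0 - K.vertex i 0) * (K.vertex k 1 - K.vertex i 1) -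
      (K.vertex j 1 - K.vertex i 1) * (K.vertex k 0 - K.vertex i 0)) ^ 2 := mul_pos (by linarith) hd2
    simp only [cr, PiLp.sub_apply, PiLp.add_apply, PiLp.smul_apply, smul_eq_mul, invOf_eq_inv]
    nlinarith

/-- Inside the open triangle all three cross products are nonzero, so conformity makes `i`, `j`, `k`
corners of every triangle `t'` through the point. Then `t'` is the same triangle, whose sides miss
its open part. -/
lemma openTri_notMem_segment {i j k : Fin (K.m + 3)} (ht : {i, j, k} ∈ V.tri)
    {t' : Finset (Fin (K.m + 3))} (ht' : t' ∈ V.tri) {p q : Fin (K.m + 3)}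
    (hp : p ∈ t') (hq : q ∈ t') (hpq : p ≠ q) {z : Plane}
    (hz : z ∈ openTri (K.vertex i) (K.vertex j) (K.vertex k)) :
    z ∉ segment ℝ (K.vertex p) (K.vertex q) := by
  intro hs
  have hz1 : z ∈ K.hull {i, j, k} := by rw [PolyCell.hull_eq]; exact openTri_subset hz
  have hz2 := PolyCell.segment_subset_hull hp hq hs
  obtain ⟨a1, a2, a3⟩ := hz
  have e1 : ({i, j, k} : Finset (Fin (K.m + 3))) = {k, i, j} := by ext; simp; tauto
  have e2 : ({i, j, k} : Finset (Fin (K.m + 3))) = {j, k, i} := by ext; simp; tauto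
  have hk : k ∈ t' := V.mem_of_cr_ne_zero (e1 ▸ ht) ht' (e1 ▸ hz1) hz2 (fun h => by simp [h] at a1)
  have hi : i ∈ t' := V.mem_of_cr_ne_zero ht ht' hz1 hz2 (fun h => by simp [h] at a2)
  have hj : j ∈ t' := V.mem_of_cr_ne_zero (e2 ▸ ht) ht' (e2 ▸ hz1) hz2 (fun h => by simp [h] at a3)
  have hsub : {i, j, k} ⊆ t' := by
    intro x hx
    simp only [Finset.mem_insert, Finset.mem_singleton] at hx
    rcases hx with rfl | rfl | rfl <;> assumption
  have heq := Finset.eq_of_subset_of_card_le hsub (by rw [V.card_eq _ ht, V.card_eq _ ht'])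
  rw [← heq] at hp hq
  have hs' : z ∈ segment ℝ (K.vertex q) (K.vertex p) := by rwa [segment_symm]
  have hnot := fun h => notMem_openTri (p := K.vertex i) (q := K.vertex j) (r := K.vertex k) (z := z) h
    ⟨a1, a2, a3⟩
  simp only [Finset.mem_insert, Finset.mem_singleton] at hp hq
  rcases hp with rfl | rfl | rfl <;> rcases hq with rfl | rfl | rfl <;>
    first
    | exact hpq rfl
    | exact hnot (Or.inl (by assumption))
    | exact hnot (Or.inr (Or.inl (by assumption)))
    | exact hnot (Or.inr (Or.inr (by assumption)))

/-- The interior edge `(i₀, j₀)` separates the triangles of the virtual mesh. -/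
lemma exists_cut {T : Fin (K.m + 3) → Finset (Fin (K.m + 3))}
    (hT : ∀ l, T l ∈ V.tri ∧ l ∈ T l ∧ l + 1 ∈ T l)
    {t₀ t₁ : Finset (Fin (K.m + 3))} (h0 : t₀ ∈ V.tri) (h1 : t₁ ∈ V.tri) (hne : t₀ ≠ t₁)
    {i₀ j₀ : Fin (K.m + 3)} (hi0 : i₀ ∈ t₀) (hj0 : j₀ ∈ t₀) (hi1 : i₀ ∈ t₁) (hj1 : j₀ ∈ t₁)
    (hij : i₀ < j₀) (hc : ¬ CycAdj i₀ j₀) :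
    ∃ S ⊆ V.tri, t₀ ∈ S ∧ t₁ ∉ S ∧
      ∀ i j, i ≠ j → ¬ CycAdj i j → ¬ (i = i₀ ∧ j = j₀) → ¬ (i = j₀ ∧ j = i₀) →
        ∀ t ∈ V.tri, ∀ t' ∈ V.tri, i ∈ t → j ∈ t → i ∈ t' → j ∈ t' → t ∈ S → t' ∈ S := by
  classical
  set W := K.winding i₀ j₀ with hW
  have hloop : ∀ z ∈ K.loop i₀ j₀, ∃ t' ∈ V.tri, ∃ p ∈ t', ∃ q ∈ t', p ≠ q ∧
      z ∈ segment ℝ (K.vertex p) (K.vertex q) ∧ ((p = i₀ ∧ q = j₀) ∨ q = p + 1) := by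
    intro z hz
    rcases hz with hz | hz
    · exact ⟨t₀, h0, i₀, hi0, j₀, hj0, hij.ne, hz, Or.inl ⟨rfl, rfl⟩⟩
    · simp only [mem_iUnion] at hz
      obtain ⟨l, -, hz⟩ := hz
      exact ⟨T l, (hT l).1, l, (hT l).2.1, l + 1, (hT l).2.2, (fin_add_one_ne l).symm, hz, Or.inr rfl⟩
  have hpath : ∀ {i j k : Fin (K.m + 3)}, {i, j, k} ∈ V.tri → i ≠ j → i ≠ k → j ≠ k → ∀ τ : ℝ, 0 < τ →
      τ ≤ 1 → midpoint ℝ (K.vertex i) (K.vertex j) +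
        τ • (K.triCenter {i, j, k} - midpoint ℝ (K.vertex i) (K.vertex j)) ∉ K.loop i₀ j₀ := by
    intro i j k ht hij hik hjk τ hτ0 hτ1 hz
    obtain ⟨t', ht', p, hp, q, hq, hpq, hs, -⟩ := hloop _ hz
    exact V.openTri_notMem_segment ht ht' hp hq hpq (V.toward_center_mem ht hij hik hjk hτ0 hτ1) hs
  -- Across any other interior edge the winding number does not change: the path from the midpoint
  -- of the edge to the centre of either adjacent triangle avoids the loop.
  have hconst : ∀ i j, i ≠ j → ¬ CycAdj i j → ¬ (i = i₀ ∧ j = j₀) → ¬ (i = j₀ ∧ j = i₀) →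
      ∀ t ∈ V.tri, i ∈ t → j ∈ t → W (K.triCenter t) = W (midpoint ℝ (K.vertex i) (K.vertex j)) := by
    intro i j hij' hcij hn1 hn2 t ht hi hj
    obtain ⟨k, hik, hjk, rfl⟩ := V.exists_third ht hi hj hij'
    refine PolyCell.winding_eq hij.le
      (convex_segment (midpoint ℝ (K.vertex i) (K.vertex j)) (K.triCenter {i, j, k})).isPreconnected
      ?_ (right_mem_segment _ _ _) (left_mem_segment _ _ _)
    intro z hz hzl
    rw [segment_eq_image'] at hz
    obtain ⟨τ, ⟨hτ0, hτ1⟩, rfl⟩ := hz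
    rcases hτ0.eq_or_lt with rfl | hτ0
    · simp only [zero_smul, add_zero] at hzl
      obtain ⟨t', ht', p, hp, q, hq, hpq, hs, hd⟩ := hloop _ hzl
      rcases V.edge_unique ht ht' hi hj hij' hp hq (midpoint_mem_openSegment _ _) hs with h | h
      · rcases hd with hd | hd
        · exact hn1 ⟨h.1.symm.trans hd.1, h.2.symm.trans hd.2⟩
        · exact hcij (Or.inl (by rw [← h.1, ← h.2, hd]))
      · rcases hd with hd | hd
        · exact hn2 ⟨h.2.symm.trans hd.2, h.1.symm.trans hd.1⟩
        · exact hcij (Or.inr (by rw [← h.1, ← h.2, hd]))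
    · exact hpath ht hij' hik hjk τ hτ0 hτ1 hzl
  set C : ℝ := ∑ l ∈ Finset.univ.filter (fun l => i₀ ≤ l ∧ l < j₀),
    viewAngle (K.vertex l) (K.vertex (l + 1)) (midpoint ℝ (K.vertex i₀) (K.vertex j₀)) with hC
  -- At the distinguished edge the path to the midpoint is followed to its limit. The arc
  -- contributes the same value `C` from both sides, the diagonal `±π` according to the side.
  have hjump : ∀ t ∈ V.tri, i₀ ∈ t → j₀ ∈ t →
      W (K.triCenter t) = C - K.orient t i₀ j₀ * Real.pi := by
    intro t ht hi hj
    obtain ⟨k, hik, hjk, rfl⟩ := V.exists_third ht hi hj hij.ne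
    set mid := midpoint ℝ (K.vertex i₀) (K.vertex j₀) with hmid
    set d := K.triCenter {i₀, j₀, k} - mid with hd
    have hcrd : cr (K.vertex j₀ - K.vertex i₀) d = 1 / 3 * K.det i₀ j₀ k := by
      rw [hd, hmid, PolyCell.triCenter_eq hij.ne hik hjk, midpoint_eq_smul_add]
      simp [PolyCell.det, cr]; ring
    have hdet := V.det_ne_zero ht hij.ne hik hjk
    have hlim1 := viewAngle_tendsto (p := K.vertex i₀) (q := K.vertex j₀) (d := d)
      (by rw [hcrd]; exact mul_ne_zero (by norm_num) hdet)
    have hsgn : SignType.sign (cr (K.vertex j₀ - K.vertex i₀) d) = SignType.sign (K.det i₀ j₀ k) := by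
      rw [hcrd, sign_mul, sign_pos (by norm_num : (0 : ℝ) < 1 / 3), one_mul]
    rw [hsgn, ← PolyCell.orient_eq hij.ne hik hjk] at hlim1
    have hpt : Filter.Tendsto (fun τ : ℝ => mid + τ • d) (nhdsWithin 0 (Ioi 0)) (nhds mid) := by
      have : ContinuousAt (fun τ : ℝ => mid + τ • d) 0 := by fun_prop
      have h2 := this.tendsto
      simp only [zero_smul, add_zero] at h2
      exact h2.mono_left nhdsWithin_le_nhds
    have hlim2 : Filter.Tendsto (fun τ : ℝ => ∑ l ∈ Finset.univ.filter (fun l => i₀ ≤ l ∧ l < j₀),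
        viewAngle (K.vertex l) (K.vertex (l + 1)) (mid + τ • d)) (nhdsWithin 0 (Ioi 0)) (nhds C) := by
      refine tendsto_finsetSum _ fun l _ => (ContinuousAt.tendsto (f := viewAngle (K.vertex l) (K.vertex (l + 1)))
        (continuousAt_viewAngle ?_)).comp hpt
      intro hs
      rcases V.edge_unique ht (hT l).1 hi hj hij.ne (hT l).2.1 (hT l).2.2
        (midpoint_mem_openSegment _ _) hs with h | h
      · exact hc (Or.inl (by rw [← h.1, ← h.2]))
      · exact hc (Or.inr (by rw [← h.1, ← h.2]))
    have hlim := hlim2.sub hlim1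
    refine tendsto_nhds_unique (f := fun τ : ℝ => W (mid + τ • d)) (l := nhdsWithin 0 (Ioi 0)) ?_ hlim
    refine tendsto_const_nhds.congr' ?_
    filter_upwards [Ioc_mem_nhdsGT (zero_lt_one (α := ℝ))] with τ hτ
    refine PolyCell.winding_eq hij.le (s := (fun τ : ℝ => mid + τ • d) '' Ioc 0 1)
      (isPreconnected_Ioc.image _ (by fun_prop)) ?_ ⟨1, ⟨zero_lt_one, le_rfl⟩, by simp [hd]⟩ ⟨τ, hτ, rfl⟩
    rintro _ ⟨ρ, hρ, rfl⟩
    exact hpath ht hij.ne hik hjk ρ hρ.1 hρ.2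
  -- The side of `t₀` consists of the triangles at whose centres the winding number is the same as
  -- at the centre of `t₀`.
  refine ⟨V.tri.filter fun t => W (K.triCenter t) = W (K.triCenter t₀), Finset.filter_subset _ _,
    by simp [h0], ?_, ?_⟩
  · simp only [Finset.mem_filter, not_and]
    intro _
    rw [hjump t₀ h0 hi0 hj0, hjump t₁ h1 hi1 hj1, V.orient_opposite h0 h1 hi0 hj0 hi1 hj1 hij.ne hne]
    have := Real.pi_pos
    rcases V.orient_eq_one_or h0 hi0 hj0 hij.ne with e | e <;> rw [e] <;> intro h <;> linarith
  · intro i j hij' hcij hn1 hn2 t ht t' ht' hi hj hi' hj' hS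
    simp only [Finset.mem_filter] at hS ⊢
    exact ⟨ht', by rw [hconst i j hij' hcij hn1 hn2 t' ht' hi' hj',
      ← hconst i j hij' hcij hn1 hn2 t ht hi hj, hS.2]⟩

end VirtualMesh

/-! ## Circulations along interior edges -/

lemma sum_symm_adj {m : ℕ} (Z : Fin (m + 3) → Fin (m + 3) → ℝ) (hZ : ∀ i j, Z j i = Z i j)
    (h0 : ∀ i j, ¬ CycAdj i j → Z i j = 0) : ∑ i, ∑ j, Z i j = 2 * ∑ l, Z l (l + 1) := by
  have key : ∀ i j, Z i j = (if j = i + 1 then Z i (i + 1) else 0) +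
      (if i = j + 1 then Z j (j + 1) else 0) := by
    intro i j
    by_cases a : j = i + 1
    · rw [if_pos a, if_neg (fin_not_both a), a, add_zero]
    by_cases b : i = j + 1
    · rw [if_neg a, if_pos b, ← b, hZ, zero_add]
    rw [if_neg a, if_neg b, h0 i j (not_or.2 ⟨a, b⟩), add_zero]
  simp_rw [fun i => Finset.sum_congr rfl fun j (_ : j ∈ Finset.univ) => key i j]
  simp only [Finset.sum_add_distrib]
  rw [Finset.sum_comm (f := fun i j => if i = j + 1 then Z j (j + 1) else 0)]
  simp
  ring

/-- The vertices `i, …, j - 1`. -/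
def arc {m : ℕ} (i j : Fin (m + 3)) : Finset (Fin (m + 3)) :=
  Finset.univ.filter fun l => i ≤ l ∧ l < j

lemma fin_val_succ {m : ℕ} (k : Fin (m + 3)) :
    (k + 1).val = if k.val = m + 2 then 0 else k.val + 1 := by
  rw [Fin.val_add_one]
  simp only [Fin.ext_iff, Fin.val_last]

/-- A chain of edges from `i` to `j` contains one of the two arcs between `i` and `j`. -/
lemma arc_of_chain {m : ℕ} {P : Fin (m + 3) → Prop} {i j : Fin (m + 3)} (_hij : i < j)
    (h : Relation.ReflTransGen (fun a b => (b = a + 1 ∧ P a) ∨ (a = b + 1 ∧ P b)) i j) :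
    (∀ l ∈ arc i j, P l) ∨ ∀ l ∈ (arc i j)ᶜ, P l := by
  by_contra! hc
  obtain ⟨⟨l, hl, hPl⟩, k, hk, hPk⟩ := hc
  simp only [arc, Finset.mem_filter, Finset.mem_univ, true_and, Finset.mem_compl, not_and,
    not_lt] at hl hk
  -- With a forbidden edge `l` on the arc and a forbidden edge `k` off it, a chain from `i` cannot
  -- pass either one. It stays in the cyclic interval from `k + 1` to `l`, which does not contain
  -- `j`.
  have hinv : ∀ b, Relation.ReflTransGen (fun a b => (b = a + 1 ∧ P a) ∨ (a = b + 1 ∧ P b)) i b →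
      ((k < l ∧ k < b ∧ b ≤ l) ∨ (l < k ∧ ¬ (l < b ∧ b ≤ k))) := by
    intro b hb
    induction hb with
    | refl =>
      simp only [Fin.lt_def, Fin.le_def] at *
      by_cases h1 : i.val ≤ k.val
      · have := hk h1; right; omega
      · left; omega
    | tail _ hab ih =>
      rename_i b c _
      rcases hab with ⟨rfl, hP⟩ | ⟨rfl, hP⟩
      · have h1 : b ≠ l := fun e => hPl (e ▸ hP)
        have h2 : b ≠ k := fun e => hPk (e ▸ hP)
        have h3 := fin_val_succ b
        have h4 := b.isLt; have h5 := l.isLt; have h6 := k.isLt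
        simp only [Fin.lt_def, Fin.le_def, ne_eq, Fin.ext_iff] at *
        split_ifs at h3 <;> omega
      · have h1 : c ≠ l := fun e => hPl (e ▸ hP)
        have h2 : c ≠ k := fun e => hPk (e ▸ hP)
        have h3 := fin_val_succ c
        have h4 := c.isLt; have h5 := l.isLt; have h6 := k.isLt
        simp only [Fin.lt_def, Fin.le_def, ne_eq, Fin.ext_iff] at *
        split_ifs at h3 <;> omega
  have := hinv j h
  simp only [Fin.lt_def, Fin.le_def] at *
  by_cases h1 : i.val ≤ k.val
  · have := hk h1; omega
  · omega

namespace VirtualMesh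
variable {K : PolyCell} (V : VirtualMesh K)

/-- `T l` is the unique triangle at the `l`-th edge of the polygon, and `σ` is the common orientation
of the triangles at these edges. -/
def BoundaryTriangles (σ : ℝ) (T : Fin (K.m + 3) → Finset (Fin (K.m + 3))) : Prop :=
  ∀ l, T l ∈ V.tri ∧ l ∈ T l ∧ l + 1 ∈ T l ∧ K.orient (T l) l (l + 1) = σ ∧
    ∀ t ∈ V.tri, l ∈ t → l + 1 ∈ t → t = T l

/-- `S` is the set of triangles on the side of `t₀` of the interior edge `(i₀, j₀)`. -/
structure IsSide (i₀ j₀ : Fin (K.m + 3)) (t₀ t₁ : Finset (Fin (K.m + 3)))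
    (S : Finset (Finset (Fin (K.m + 3)))) : Prop where
  subset : S ⊆ V.tri
  mem₀ : t₀ ∈ S
  mem₁ : t₁ ∈ V.tri
  notMem₁ : t₁ ∉ S
  i₀_mem₀ : i₀ ∈ t₀
  j₀_mem₀ : j₀ ∈ t₀
  i₀_mem₁ : i₀ ∈ t₁
  j₀_mem₁ : j₀ ∈ t₁
  closed : ∀ i j, i ≠ j → ¬ CycAdj i j → ¬ (i = i₀ ∧ j = j₀) → ¬ (i = j₀ ∧ j = i₀) →
    ∀ t ∈ V.tri, ∀ t' ∈ V.tri, i ∈ t → j ∈ t → i ∈ t' → j ∈ t' → t ∈ S → t' ∈ S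

variable {V} {σ : ℝ} {T : Fin (K.m + 3) → Finset (Fin (K.m + 3))}
variable {i₀ j₀ : Fin (K.m + 3)} {t₀ t₁ : Finset (Fin (K.m + 3))}
variable {S : Finset (Finset (Fin (K.m + 3)))}

lemma IsSide.compl (h : V.IsSide i₀ j₀ t₀ t₁ S) : V.IsSide i₀ j₀ t₁ t₀ (V.tri \ S) where
  subset := Finset.sdiff_subset
  mem₀ := Finset.mem_sdiff.2 ⟨h.mem₁, h.notMem₁⟩
  mem₁ := h.subset h.mem₀
  notMem₁ := fun hm => (Finset.mem_sdiff.1 hm).2 h.mem₀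
  i₀_mem₀ := h.i₀_mem₁
  j₀_mem₀ := h.j₀_mem₁
  i₀_mem₁ := h.i₀_mem₀
  j₀_mem₁ := h.j₀_mem₀
  closed i j hij hc h1 h2 t ht t' ht' a b c d hS := Finset.mem_sdiff.2 ⟨ht', fun hS' =>
    (Finset.mem_sdiff.1 hS).2 (h.closed i j hij hc h1 h2 t' ht' t ht c d a b hS')⟩

/-- The boundary edges of a side form an arc. -/
lemma IsSide.arc_eq (h : V.IsSide i₀ j₀ t₀ t₁ S) (hT : V.BoundaryTriangles σ T)
    (hσ : σ = 1 ∨ σ = -1) (hij : i₀ < j₀) (hc : ¬ CycAdj i₀ j₀) :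
    (∀ l, T l ∈ S ↔ l ∈ arc i₀ j₀) ∨ ∀ l, T l ∈ S ↔ l ∈ (arc i₀ j₀)ᶜ := by
  classical
  -- The boundary of the side is a cycle of boundary edges and the diagonal. By telescoping, the
  -- diagonal may be replaced by the arc from `i₀` to `j₀`; `u` is the coefficient of the resulting
  -- chain on the boundary polygon. A cycle on a polygon has constant coefficients.
  set u : Fin (K.m + 3) → ℝ := fun l => (if T l ∈ S then σ else 0) +
    (if l ∈ arc i₀ j₀ then K.orient t₀ i₀ j₀ else 0) with hu
  have hsum : ∀ f : Fin (K.m + 3) → ℝ, ∑ l, u l * (f (l + 1) - f l) = 0 := by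
    intro f
    have h1 := V.sum_tri_set hT h.subset h.mem₀ h.mem₁ h.notMem₁ h.i₀_mem₀ h.j₀_mem₀ h.i₀_mem₁
      h.j₀_mem₁ hij.ne hc h.closed (fun _ i j => f j - f i) (fun _ _ _ => by ring)
      (fun _ _ _ _ _ _ _ _ _ _ _ _ => rfl)
    have h2 : ∑ i, ∑ j, ∑ t ∈ S, K.orient t i j * (f j - f i) = 0 := by
      have : ∀ t ∈ S, ∑ i, ∑ j, K.orient t i j * (f j - f i) = 0 := by
        intro t ht
        obtain ⟨p, q, r, hpq, hpr, hqr, rfl⟩ := V.exists_eq (h.subset ht)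
        rw [PolyCell.orient_sum hpq hpr hqr (fun k l => f l - f k) (fun _ _ => by ring)]
        ring
      rw [← Finset.sum_eq_zero this, Finset.sum_comm]
      simp_rw [Finset.sum_comm (s := S)]
      rw [Finset.sum_comm]
    rw [h2] at h1
    have h3 := sum_arc f i₀ j₀ hij.le
    have h4 : ∑ l, (if l ∈ arc i₀ j₀ then K.orient t₀ i₀ j₀ else 0) * (f (l + 1) - f l) =
        K.orient t₀ i₀ j₀ * (f j₀ - f i₀) := by
      rw [← h3, Finset.mul_sum, ← Finset.sum_filter_add_sum_filter_not Finset.univ (fun l => l ∈ arc i₀ j₀),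
        Finset.sum_eq_zero (s := Finset.univ.filter fun l => ¬ l ∈ arc i₀ j₀), add_zero]
      · refine Finset.sum_congr (by ext; simp [arc]) fun l hl => ?_
        rw [if_pos (by simpa [arc] using hl)]
      · intro l hl
        rw [if_neg (Finset.mem_filter.1 hl).2, zero_mul]
    have h5 : ∀ l, (if T l ∈ S then σ else 0) * (f (l + 1) - f l) =
        if T l ∈ S then σ * (f (l + 1) - f l) else 0 := fun l => by split_ifs <;> simp
    simp only [hu, add_mul, Finset.sum_add_distrib]
    rw [h4, Finset.sum_congr rfl fun l _ => h5 l]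
    linarith
  have hconst : ∀ l, u (l + 1) = u l := by
    intro l
    have h1 := hsum (Pi.single (l + 1) 1)
    rw [Finset.sum_eq_add_of_mem l (l + 1) (Finset.mem_univ _) (Finset.mem_univ _)
      (fin_add_one_ne l).symm] at h1
    · rw [Pi.single_eq_same, Pi.single_eq_of_ne (fin_add_one_ne l).symm,
        Pi.single_eq_of_ne (fin_add_one_ne (l + 1))] at h1
      linarith
    · rintro k - ⟨hk1, hk2⟩
      rw [Pi.single_eq_of_ne hk2, Pi.single_eq_of_ne fun e => hk1 (add_right_cancel e)]
      ring
  have hu0 : ∀ l, u l = u i₀ := fun l => (fin_const hconst l).trans (fin_const hconst i₀).symm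
  have hi : i₀ ∈ arc i₀ j₀ := by simp [arc, hij]
  have hj : j₀ ∉ arc i₀ j₀ := by simp [arc]
  have ho := V.orient_eq_one_or (h.subset h.mem₀) h.i₀_mem₀ h.j₀_mem₀ hij.ne
  have hji := hu0 j₀
  simp only [hu, hi, hj, if_true, if_false] at hji
  -- Every coefficient is one of the sums of `0` or `σ` and `0` or `±1`. Equality at `i₀`, on the
  -- arc, and at `j₀`, off it, leaves only the two arcs.
  by_cases hTi : T i₀ ∈ S
  · left
    intro l
    have := hu0 l
    simp only [hu, hi, hTi, if_true] at this hji
    by_cases hTl : T l ∈ S <;> by_cases hla : l ∈ arc i₀ j₀ <;> by_cases hTj : T j₀ ∈ S <;>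
      simp only [hTl, hla, hTj, if_true, if_false, iff_false, not_true] at this hji ⊢ <;>
      rcases hσ with rfl | rfl <;> rcases ho with e | e <;> rw [e] at this hji <;>
      first | trivial | (exfalso; linarith)
  · right
    intro l
    have := hu0 l
    simp only [hu, hi, hTi, if_true, if_false] at this hji
    by_cases hTl : T l ∈ S <;> by_cases hla : l ∈ arc i₀ j₀ <;> by_cases hTj : T j₀ ∈ S <;>
      simp only [Finset.mem_compl, hTl, hla, hTj, if_true, if_false, iff_false, not_true] at this hji ⊢ <;>
      rcases hσ with rfl | rfl <;> rcases ho with e | e <;> rw [e] at this hji <;>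
      first | trivial | (exfalso; linarith)

/-- Each of the two arcs between the end points of an interior edge belongs to a side. -/
lemma exists_side (hT : V.BoundaryTriangles σ T) (hσ : σ = 1 ∨ σ = -1) {t : Finset (Fin (K.m + 3))}
    (ht : t ∈ V.tri) (hi : i₀ ∈ t) (hj : j₀ ∈ t) (hij : i₀ < j₀) (hc : ¬ CycAdj i₀ j₀)
    {Λ : Finset (Fin (K.m + 3))} (hΛ : Λ = arc i₀ j₀ ∨ Λ = (arc i₀ j₀)ᶜ) :
    ∃ t₀ t₁ S, V.IsSide i₀ j₀ t₀ t₁ S ∧ ∀ l, T l ∈ S ↔ l ∈ Λ := by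
  obtain ⟨t', ht', hi', hj', hne⟩ := V.exists_neighbour ht hi hj hij.ne hc
  obtain ⟨S, h1, h2, h3, h4⟩ := V.exists_cut (fun l => ⟨(hT l).1, (hT l).2.1, (hT l).2.2.1⟩) ht ht' hne hi hj
    hi' hj' hij hc
  have hS : V.IsSide i₀ j₀ t t' S := ⟨h1, h2, ht', h3, hi, hj, hi', hj', h4⟩
  have hcompl : ∀ l, T l ∈ V.tri \ S ↔ ¬ T l ∈ S := fun l => by simp [(hT l).1]
  rcases hS.arc_eq hT hσ hij hc with h | h <;> rcases hΛ with rfl | rfl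
  · exact ⟨t, t', S, hS, h⟩
  · exact ⟨t', t, _, hS.compl, fun l => by rw [hcompl, h l, Finset.mem_compl]⟩
  · exact ⟨t', t, _, hS.compl, fun l => by rw [hcompl, h l, Finset.mem_compl, not_not]⟩
  · exact ⟨t, t', S, hS, h⟩

/-- Green's formula with the test function `1`, so that only the rotation `2 b` and the circulations
remain. -/
lemma area_pos_sum (S : Finset (Finset (Fin (K.m + 3)))) (a : Finset (Fin (K.m + 3)) → Plane) (b : ℝ)
    (hS : S ⊆ V.tri) : ∑ i, ∑ j, V.jump S a b i j = 4 * b * ∑ t ∈ S, volume.real (K.hull t) := by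
  have h := V.green_set hS a b (η := fun _ => 1) contDiff_const
  have h0 : ∀ x, vrot (fun _ => (1 : ℝ)) x = 0 := by
    intro x
    ext i; fin_cases i <;> simp [vrot, pderiv]
  simp only [h0, inner_zero_right, sub_zero, mul_one, integral_const, segAvg, intervalIntegral.integral_const,
    smul_eq_mul, MeasurableSet.univ, measureReal_restrict_apply, univ_inter] at h
  rw [Finset.mul_sum]
  have e : ∀ t, volume.real (K.hull t) * (2 * b) * 2 = 4 * b * volume.real (K.hull t) := fun t => by ring
  rw [← Finset.sum_congr rfl fun t _ => e t, ← Finset.sum_mul, h]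
  ring

/-- The circulation balance on a side of an interior edge. -/
lemma IsSide.balance (h : V.IsSide i₀ j₀ t₀ t₁ S) (hT : V.BoundaryTriangles σ T)
    (hij : i₀ < j₀) (hc : ¬ CycAdj i₀ j₀) {Λ : Finset (Fin (K.m + 3))} (hΛ : ∀ l, T l ∈ S ↔ l ∈ Λ)
    {a : Finset (Fin (K.m + 3)) → Plane} {b : ℝ}
    (hQ : ∀ i j, i ≠ j → ¬ CycAdj i j → ∀ t ∈ V.tri, ∀ t' ∈ V.tri, i ∈ t → j ∈ t → i ∈ t' → j ∈ t' →
      circ (a t) b (K.vertex i) (K.vertex j) = circ (a t') b (K.vertex i) (K.vertex j)) :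
    K.orient t₀ i₀ j₀ * circ (a t₀) b (K.vertex i₀) (K.vertex j₀) +
      σ * ∑ l ∈ Λ, circ (a (T l)) b (K.vertex l) (K.vertex (l + 1)) =
      2 * b * ∑ t ∈ S, volume.real (K.hull t) := by
  classical
  have h1 := V.sum_tri_set hT h.subset h.mem₀ h.mem₁ h.notMem₁ h.i₀_mem₀ h.j₀_mem₀ h.i₀_mem₁
    h.j₀_mem₁ hij.ne hc h.closed (fun t i j => circ (a t) b (K.vertex i) (K.vertex j))
    (fun _ _ _ => circ_swap _ _ _ _) hQ
  have h2 := area_pos_sum (V := V) S a b h.subset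
  unfold jump at h2
  rw [h2] at h1
  simp only [hΛ] at h1
  rw [← Finset.sum_filter, Finset.filter_mem_eq_inter, Finset.univ_inter, ← Finset.mul_sum] at h1
  linarith

lemma dist_vertex_le (i j : Fin (K.m + 3)) : dist (K.vertex i) (K.vertex j) ≤ K.diam := by
  have hm : ∀ i, K.vertex i ∈ closure K.carrier := fun i => by
    apply frontier_subset_closure
    rw [K.frontier_eq]
    exact mem_iUnion.2 ⟨i, left_mem_segment ℝ _ _⟩
  rw [PolyCell.diam, ← Metric.diam_closure]
  exact Metric.dist_le_diam_of_mem K.isBounded.closure (hm i) (hm j)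

/-- The area of a side is bounded by the length of its boundary edges. -/
lemma IsSide.area_le (h : V.IsSide i₀ j₀ t₀ t₁ S) (hT : V.BoundaryTriangles σ T)
    (hσ : σ = 1 ∨ σ = -1) (hij : i₀ < j₀) (hc : ¬ CycAdj i₀ j₀) {Λ : Finset (Fin (K.m + 3))}
    (hΛ : ∀ l, T l ∈ S ↔ l ∈ Λ) :
    ∑ t ∈ S, volume.real (K.hull t) ≤ 1 / 2 * K.diam * ∑ l ∈ Λ, K.edgeLength l := by
  -- The field `(1/2) rotQ (x - vertex i₀)` has rotation `1`, so its balance computes the area of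
  -- the side. It is centred at an end point of the diagonal, along which its circulation therefore
  -- vanishes.
  have e : ∀ p q, circ (-(1 / 2 : ℝ) • rotQ (K.vertex i₀)) (1 / 2) p q =
      1 / 2 * cr (p - K.vertex i₀) (q - p) := fun p q => by
    simp only [circ, inner_plane, cr, PiLp.sub_apply, PiLp.smul_apply, rotQ_zero, rotQ_one, smul_eq_mul]
    ring
  have h1 := h.balance hT hij hc hΛ (a := fun _ => -(1 / 2 : ℝ) • rotQ (K.vertex i₀)) (b := 1 / 2)
    (fun _ _ _ _ _ _ _ _ _ _ _ _ => rfl)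
  simp only [e, sub_self] at h1
  have h0 : cr 0 (K.vertex j₀ - K.vertex i₀) = 0 := by simp [cr]
  rw [h0, mul_zero, mul_zero, zero_add] at h1
  have h2 : |∑ l ∈ Λ, 1 / 2 * cr (K.vertex l - K.vertex i₀) (K.vertex (l + 1) - K.vertex l)| ≤
      1 / 2 * K.diam * ∑ l ∈ Λ, K.edgeLength l := by
    rw [Finset.mul_sum]
    refine (Finset.abs_sum_le_sum_abs _ _).trans (Finset.sum_le_sum fun l _ => ?_)
    rw [abs_mul, abs_of_pos (by norm_num : (0 : ℝ) < 1 / 2), mul_assoc]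
    refine mul_le_mul_of_nonneg_left ((abs_cr_le _ _).trans ?_) (by norm_num)
    rw [← dist_eq_norm, ← dist_eq_norm, dist_comm (K.vertex (l + 1))]
    exact mul_le_mul_of_nonneg_right (dist_vertex_le _ _) dist_nonneg
  have h3 : |σ| = 1 := by rcases hσ with rfl | rfl <;> simp
  calc ∑ t ∈ S, volume.real (K.hull t) = σ * ∑ l ∈ Λ, 1 / 2 *
        cr (K.vertex l - K.vertex i₀) (K.vertex (l + 1) - K.vertex l) := by linarith
    _ ≤ |σ| * |∑ l ∈ Λ, 1 / 2 * cr (K.vertex l - K.vertex i₀) (K.vertex (l + 1) - K.vertex l)| := by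
      rw [← abs_mul]; exact le_abs_self _
    _ ≤ _ := by rw [h3, one_mul]; exact h2

lemma sum_area : ∑ t ∈ V.tri, volume.real (K.hull t) = K.area := by
  have h := V.integral_carrier (F := fun _ => (1 : ℝ))
    (integrableOn_const (hs := K.isBounded.measure_lt_top.ne))
  simp only [integral_const, smul_eq_mul, mul_one, MeasurableSet.univ, measureReal_restrict_apply,
    univ_inter] at h
  exact h.symm

lemma IsSide.area_le_area (h : V.IsSide i₀ j₀ t₀ t₁ S) :
    ∑ t ∈ S, volume.real (K.hull t) ≤ K.area := by
  rw [← sum_area (V := V)]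
  exact Finset.sum_le_sum_of_subset_of_nonneg h.subset fun _ _ _ => measureReal_nonneg

end VirtualMesh

/-! ## The local bound -/

/-- The cotangent equals `tan (θ/2)`. If the cosine is negative, `(1 - cos α)/sin α = tan (α/2)`.
Otherwise the quotient is `cot (α/2)`, which for `α ≥ π/3` is at most `3 tan (α/2)`. The lower bound
`1/2` serves to absorb the rotation term in the final estimate. -/
lemma cot_half_bounds {α θ : ℝ} (h1 : Real.pi / 3 ≤ α) (h2 : α ≤ θ) (h3 : θ < Real.pi) :
    0 < Real.sin α ∧ (1 + |Real.cos α|) / Real.sin α ≤ 3 * Real.cot ((Real.pi - θ) / 2) ∧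
      1 / 2 ≤ Real.cot ((Real.pi - θ) / 2) := by
  have hpi := Real.pi_pos
  have hcot : Real.cot ((Real.pi - θ) / 2) = Real.tan (θ / 2) := by
    rw [Real.cot_eq_cos_div_sin, Real.tan_eq_sin_div_cos, show (Real.pi - θ) / 2 = Real.pi / 2 - θ / 2 by ring,
      Real.cos_pi_div_two_sub, Real.sin_pi_div_two_sub]
  have hs : 0 < Real.sin (α / 2) := Real.sin_pos_of_pos_of_lt_pi (by linarith) (by linarith)
  have hc : 0 < Real.cos (α / 2) := Real.cos_pos_of_mem_Ioo ⟨by linarith, by linarith⟩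
  have hmono : Real.tan (α / 2) ≤ Real.tan (θ / 2) :=
    Real.strictMonoOn_tan.monotoneOn ⟨by linarith, by linarith⟩ ⟨by linarith, by linarith⟩ (by linarith)
  have hsin : Real.sin α = 2 * Real.sin (α / 2) * Real.cos (α / 2) := by
    rw [← Real.sin_two_mul]; ring_nf
  have hcos : Real.cos α = 2 * Real.cos (α / 2) ^ 2 - 1 := by
    rw [← Real.cos_two_mul]; ring_nf
  have hsq := Real.sin_sq_add_cos_sq (α / 2)
  have hc1 : Real.cos α ≤ 1 / 2 := by
    rw [← Real.cos_pi_div_three]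
    exact Real.cos_le_cos_of_nonneg_of_le_pi (by linarith) (by linarith) h1
  have ht := Real.tan_eq_sin_div_cos (α / 2)
  have h4 : Real.cos (α / 2) ^ 2 ≤ 3 / 4 := by linarith
  have hr : Real.cos (α / 2) / Real.sin (α / 2) ≤ 3 * Real.tan (α / 2) := by
    rw [ht, div_le_iff₀ hs]
    have : 3 * (Real.sin (α / 2) / Real.cos (α / 2)) * Real.sin (α / 2) =
        3 * Real.sin (α / 2) ^ 2 / Real.cos (α / 2) := by ring
    rw [this, le_div_iff₀ hc]
    nlinarith
  have htp : 0 < Real.tan (α / 2) := by rw [ht]; positivity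
  have h5 : (1 + |Real.cos α|) / Real.sin α ≤ 3 * Real.tan (α / 2) := by
    rcases abs_cases (Real.cos α) with ⟨h, -⟩ | ⟨h, -⟩
    · rw [h, hcos, hsin]
      have : (1 + (2 * Real.cos (α / 2) ^ 2 - 1)) / (2 * Real.sin (α / 2) * Real.cos (α / 2)) =
          Real.cos (α / 2) / Real.sin (α / 2) := by field_simp; ring
      rw [this]; exact hr
    · rw [h, hcos, hsin]
      have : (1 + -(2 * Real.cos (α / 2) ^ 2 - 1)) / (2 * Real.sin (α / 2) * Real.cos (α / 2)) =
          Real.tan (α / 2) := by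
        rw [ht]; field_simp; nlinarith
      rw [this]; linarith
  refine ⟨by rw [hsin]; positivity, ?_, ?_⟩
  · rw [hcot]; linarith
  · rw [hcot]
    refine le_trans ?_ hmono
    rw [ht, le_div_iff₀ hc]
    nlinarith

/-- A vector is controlled by its components along two sides of a triangle. -/
lemma norm_sq_mul_cr_le {u w z : Plane} {ε h θ : ℝ} (hu : ‖u‖ ≤ h) (hw : ‖w‖ ≤ h) (hε : 0 ≤ ε)
    (hcr : cr u w ≠ 0) (hp : inner ℝ z u ^ 2 ≤ ε * ‖u‖) (hq : inner ℝ z w ^ 2 ≤ ε * ‖w‖)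
    (h1 : Real.pi / 3 ≤ InnerProductGeometry.angle u w) (h2 : InnerProductGeometry.angle u w ≤ θ)
    (h3 : θ < Real.pi) :
    ‖z‖ ^ 2 * (|cr u w| / 2) ≤ 3 * (ε * h) * Real.cot ((Real.pi - θ) / 2) := by
  obtain ⟨hs, hb, -⟩ := cot_half_bounds h1 h2 h3
  set α := InnerProductGeometry.angle u w
  set p := inner ℝ z u with hpd
  set q := inner ℝ z w with hqd
  have hin : ‖u‖ * ‖w‖ * Real.cos α = inner ℝ u w := by
    rw [mul_comm, InnerProductGeometry.cos_angle_mul_norm_mul_norm]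
  -- Inversion of the Gram matrix: the norm of `z` in terms of its inner products `p`, `q` with the
  -- basis `u`, `w`. Only the mixed term involves the angle.
  have hid : ‖z‖ ^ 2 * cr u w ^ 2 = p ^ 2 * ‖w‖ ^ 2 - 2 * (p * q) * inner ℝ u w + q ^ 2 * ‖u‖ ^ 2 := by
    rw [hpd, hqd]
    simp only [norm_sq_plane, inner_plane, cr]
    ring
  have hcrabs : |cr u w| = ‖u‖ * ‖w‖ * Real.sin α := by
    have h4 := cr_sq_add_inner_sq u w
    rw [← hin] at h4
    have h5 : cr u w ^ 2 = (‖u‖ * ‖w‖ * Real.sin α) ^ 2 := by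
      have := Real.sin_sq_add_cos_sq α
      have e : Real.sin α ^ 2 = 1 - Real.cos α ^ 2 := by linarith
      rw [mul_pow, e]; linarith
    rw [← sq_abs (cr u w)] at h5
    exact (pow_left_inj₀ (abs_nonneg _) (by positivity) two_ne_zero).1 h5
  have hcp : 0 < |cr u w| := abs_pos.2 hcr
  have hup : 0 < ‖u‖ := norm_pos_iff.2 (by rintro rfl; simp [cr] at hcr)
  have hwp : 0 < ‖w‖ := norm_pos_iff.2 (by rintro rfl; simp [cr] at hcr)
  have hbound : ‖z‖ ^ 2 * |cr u w| ^ 2 ≤ (1 + |Real.cos α|) * (2 * (ε * h)) * (‖u‖ * ‖w‖) := by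
    rw [sq_abs, hid, ← hin]
    have a1 : -(2 * (p * q) * (‖u‖ * ‖w‖ * Real.cos α)) ≤ |Real.cos α| * (p ^ 2 * ‖w‖ ^ 2 + q ^ 2 * ‖u‖ ^ 2) := by
      have b1 : -(2 * (p * q) * (‖u‖ * ‖w‖ * Real.cos α)) ≤
          |Real.cos α| * (2 * (|p| * ‖w‖) * (|q| * ‖u‖)) := by
        refine (neg_le_abs _).trans (le_of_eq ?_)
        simp only [abs_mul, abs_two, abs_of_pos hup, abs_of_pos hwp]
        ring
      refine b1.trans (mul_le_mul_of_nonneg_left ?_ (abs_nonneg _))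
      nlinarith [sq_nonneg (|p| * ‖w‖ - |q| * ‖u‖), sq_abs p, sq_abs q]
    have a2 : p ^ 2 * ‖w‖ ^ 2 ≤ ε * h * (‖u‖ * ‖w‖) := by
      calc p ^ 2 * ‖w‖ ^ 2 ≤ ε * ‖u‖ * ‖w‖ ^ 2 := by gcongr
        _ = ε * ‖w‖ * (‖u‖ * ‖w‖) := by ring
        _ ≤ _ := by gcongr
    have a3 : q ^ 2 * ‖u‖ ^ 2 ≤ ε * h * (‖u‖ * ‖w‖) := by
      calc q ^ 2 * ‖u‖ ^ 2 ≤ ε * ‖w‖ * ‖u‖ ^ 2 := by gcongr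
        _ = ε * ‖u‖ * (‖u‖ * ‖w‖) := by ring
        _ ≤ _ := by gcongr
    nlinarith [mul_nonneg (abs_nonneg (Real.cos α)) (sub_nonneg.2 (add_le_add a2 a3))]
  have hfin : ‖z‖ ^ 2 * |cr u w| ≤ (1 + |Real.cos α|) / Real.sin α * (2 * (ε * h)) := by
    have e : (1 + |Real.cos α|) / Real.sin α * (2 * (ε * h)) =
        ((1 + |Real.cos α|) * (2 * (ε * h)) * (‖u‖ * ‖w‖)) / |cr u w| := by
      rw [hcrabs]; field_simp
    rw [e, le_div_iff₀ hcp]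
    linarith [hbound]
  have hh : 0 ≤ ε * h := mul_nonneg hε (hup.le.trans hu)
  nlinarith [mul_le_mul_of_nonneg_right hb (by positivity : 0 ≤ 2 * (ε * h))]

lemma circ_eq_inner (a : Plane) (b : ℝ) (p q : Plane) : circ a b p q = inner ℝ (nedelec a b p) (q - p) := by
  simp only [circ, nedelec, inner_plane, cr, PiLp.sub_apply, PiLp.add_apply, PiLp.smul_apply, rotQ_zero,
    rotQ_one, smul_eq_mul]
  ring

namespace VirtualMesh
variable {K : PolyCell} {V : VirtualMesh K} {σ : ℝ} {T : Fin (K.m + 3) → Finset (Fin (K.m + 3))}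
variable {v : Plane → Plane} {a : Finset (Fin (K.m + 3)) → Plane} {b : ℝ}

/-- In Green's formula the interior edges drop out, and on an edge of `K` the tangential component
is constant, namely circulation over length. The sign `σ` makes the direction counterclockwise. -/
lemma IsField.isTangentialTrace (h : V.IsField v a b) (hT : V.BoundaryTriangles σ T) :
    K.IsTangentialTrace v fun l _ =>
      σ * circ (a (T l)) b (K.vertex l) (K.vertex (l + 1)) / K.edgeLength l := by
  refine ⟨fun i => memLp_const _, fun φ h1 h2 => ?_⟩
  have h1' : ContDiff ℝ 1 φ := h1.of_le (by exact_mod_cast le_top)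
  have e1 : ∫ x in K.carrier, MaxwellVEM.weakRot K.carrier v x * φ x = ∫ x in K.carrier, 2 * b * φ x := by
    refine integral_congr_ae ?_
    filter_upwards [IsWeakRot.ae_eq K.isOpen (weakRot_spec ⟨_, h.weakRot⟩) h.weakRot] with x hx
    rw [hx]
  rw [e1, h.green h1' h2, sum_symm_adj (fun i j => V.jump V.tri a b i j * segAvg φ (K.vertex i) (K.vertex j))]
  · rw [← mul_assoc, one_div, inv_mul_cancel₀ two_ne_zero, one_mul, PolyCell.boundaryIntegral]
    refine Finset.sum_congr rfl fun l _ => ?_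
    obtain ⟨a1, a2, a3, a4, a5⟩ := hT l
    have hj : V.jump V.tri a b l (l + 1) = σ * circ (a (T l)) b (K.vertex l) (K.vertex (l + 1)) := by
      rw [jump, Finset.sum_eq_single (T l) (fun t ht hne => ?_) (fun hm => absurd a1 hm), a4]
      rw [orient_eq_zero fun hm => hne (a5 t ht hm.1 hm.2), zero_mul]
    rw [hj, intervalIntegral.integral_const_mul]
    have := (K.edgeLength_pos l).ne'
    unfold segAvg PolyCell.edgePoint
    field_simp
  · intro i j
    rw [jump_symm, segAvg_swap]
  · intro i j hc
    by_cases hij : i = j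
    · subst hij
      rw [jump, Finset.sum_eq_zero fun t _ => by rw [PolyCell.orient_self, zero_mul], zero_mul]
    by_cases hm : ∃ t ∈ V.tri, i ∈ t ∧ j ∈ t
    · obtain ⟨t, ht, hi, hj⟩ := hm
      rw [h.jump_eq_zero ht hi hj hij hc, zero_mul]
    · rw [jump, Finset.sum_eq_zero, zero_mul]
      intro t ht
      rw [orient_eq_zero fun hh => hm ⟨t, ht, hh⟩, zero_mul]

lemma IsField.traceNorm_sq (h : V.IsField v a b) (hT : V.BoundaryTriangles σ T) (hσ : σ = 1 ∨ σ = -1) :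
    K.traceNorm v ^ 2 =
      ∑ l, circ (a (T l)) b (K.vertex l) (K.vertex (l + 1)) ^ 2 / K.edgeLength l := by
  rw [(h.isTangentialTrace hT).traceNorm_sq, PolyCell.boundaryIntegral]
  refine Finset.sum_congr rfl fun l _ => ?_
  have := (K.edgeLength_pos l).ne'
  have hs : σ ^ 2 = 1 := by rcases hσ with rfl | rfl <;> norm_num
  rw [intervalIntegral.integral_const, sub_zero, one_smul, div_pow, mul_pow, hs]
  field_simp

lemma IsField.l2Norm_rot_sq (h : V.IsField v a b) :
    l2Norm K.carrier (MaxwellVEM.weakRot K.carrier v) ^ 2 = 4 * b ^ 2 * K.area := by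
  have e : ∫ x in K.carrier, ‖MaxwellVEM.weakRot K.carrier v x‖ ^ 2 = ∫ _ in K.carrier, 4 * b ^ 2 := by
    refine integral_congr_ae ?_
    filter_upwards [IsWeakRot.ae_eq K.isOpen (weakRot_spec ⟨_, h.weakRot⟩) h.weakRot] with x hx
    rw [hx, Real.norm_eq_abs, sq_abs]; ring
  rw [l2Norm, Real.sq_sqrt (integral_nonneg fun _ => by positivity), e, integral_const, smul_eq_mul,
    measureReal_restrict_apply MeasurableSet.univ, univ_inter, PolyCell.area]
  ring

lemma diam_pos (K : PolyCell) : 0 < K.diam := (K.edgeLength_pos 0).trans_le (dist_vertex_le _ _)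

/-- By the balance on the side bounded by `Λ`, the circulation is, up to signs, that along `Λ` plus
`2 b` times the area of the side. Cauchy-Schwarz gives the first square a factor `∑ edgeLength` over
`Λ`; the squared area is bounded by the area of `K` times `1/2 h_K` times the same length. -/
lemma IsField.circ_sq_le_arc (h : V.IsField v a b) (hT : V.BoundaryTriangles σ T)
    (hσ : σ = 1 ∨ σ = -1) {t : Finset (Fin (K.m + 3))} (ht : t ∈ V.tri) {i j : Fin (K.m + 3)}
    (hi : i ∈ t) (hj : j ∈ t) (hij : i < j) (hc : ¬ CycAdj i j) {Λ : Finset (Fin (K.m + 3))}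
    (hΛ : Λ = arc i j ∨ Λ = (arc i j)ᶜ) :
    K.diam * circ (a t) b (K.vertex i) (K.vertex j) ^ 2 ≤ 2 * (∑ l ∈ Λ, K.edgeLength l) *
      (K.diam * K.traceNorm v ^ 2 + K.diam ^ 2 * (4 * b ^ 2 * K.area)) := by
  obtain ⟨t₀, t₁, S, hS, hl⟩ := exists_side hT hσ ht hi hj hij hc hΛ
  have hQ : ∀ i j, i ≠ j → ¬ CycAdj i j → ∀ t ∈ V.tri, ∀ t' ∈ V.tri, i ∈ t → j ∈ t → i ∈ t' → j ∈ t' →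
      circ (a t) b (K.vertex i) (K.vertex j) = circ (a t') b (K.vertex i) (K.vertex j) :=
    fun i j hij hc t ht t' ht' h1 h2 h3 h4 => h.circ_eq ht ht' h1 h2 h3 h4 hij hc
  have hb := hS.balance hT hij hc hl hQ
  have hA1 := hS.area_le hT hσ hij hc hl
  have hA2 := hS.area_le_area
  rw [h.circ_eq ht (hS.subset hS.mem₀) hi hj hS.i₀_mem₀ hS.j₀_mem₀ hij.ne hc, h.traceNorm_sq hT hσ]
  set Q := circ (a t₀) b (K.vertex i) (K.vertex j)
  set s := ∑ l ∈ Λ, K.edgeLength l with hs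
  set A := ∑ t ∈ S, volume.real (K.hull t) with hA
  set G := ∑ l, circ (a (T l)) b (K.vertex l) (K.vertex (l + 1)) ^ 2 / K.edgeLength l with hG
  set q := ∑ l ∈ Λ, circ (a (T l)) b (K.vertex l) (K.vertex (l + 1)) with hq
  have hA0 : 0 ≤ A := Finset.sum_nonneg fun _ _ => measureReal_nonneg
  have hs0 : 0 ≤ s := Finset.sum_nonneg fun l _ => (K.edgeLength_pos l).le
  have hG0 : ∀ l, 0 ≤ circ (a (T l)) b (K.vertex l) (K.vertex (l + 1)) ^ 2 / K.edgeLength l :=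
    fun l => div_nonneg (sq_nonneg _) (K.edgeLength_pos l).le
  have hq2 : q ^ 2 ≤ G * s := by
    refine (Finset.sum_sq_le_sum_mul_sum_of_sq_le_mul Λ (fun l _ => hG0 l)
      (fun l _ => (K.edgeLength_pos l).le) fun l _ => ?_).trans ?_
    · rw [div_mul_cancel₀ _ (K.edgeLength_pos l).ne']
    · exact mul_le_mul_of_nonneg_right (Finset.sum_le_sum_of_subset_of_nonneg (Finset.subset_univ _)
        fun l _ _ => hG0 l) hs0
  have hQ2 : Q ^ 2 ≤ 2 * q ^ 2 + 8 * b ^ 2 * A ^ 2 := by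
    have e : (K.orient t₀ i j * Q) ^ 2 = Q ^ 2 := by
      rcases V.orient_eq_one_or (hS.subset hS.mem₀) hS.i₀_mem₀ hS.j₀_mem₀ hij.ne with e | e <;> rw [e] <;> ring
    have e2 : (σ * q) ^ 2 = q ^ 2 := by rcases hσ with rfl | rfl <;> ring
    have e3 : K.orient t₀ i j * Q = 2 * b * A - σ * q := by linarith
    rw [← e, e3, ← e2]
    nlinarith [sq_nonneg (2 * b * A + σ * q)]
  have hA3 : A ^ 2 ≤ K.area * (1 / 2 * K.diam * s) := by
    rw [sq]; exact mul_le_mul hA2 hA1 hA0 measureReal_nonneg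
  have hd := diam_pos K
  have : Q ^ 2 ≤ 2 * (G * s) + 8 * b ^ 2 * (K.area * (1 / 2 * K.diam * s)) :=
    hQ2.trans (add_le_add (by linarith) (by gcongr))
  calc K.diam * Q ^ 2 ≤ K.diam * (2 * (G * s) + 8 * b ^ 2 * (K.area * (1 / 2 * K.diam * s))) := by gcongr
    _ = 2 * s * (K.diam * G) + s * (K.diam ^ 2 * (4 * b ^ 2 * K.area)) := by ring
    _ ≤ _ := by
      have : 0 ≤ s * (K.diam ^ 2 * (4 * b ^ 2 * K.area)) := by
        have : 0 ≤ K.area := measureReal_nonneg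
        positivity
      linarith

/-- The circulation along any edge of the virtual mesh. -/
lemma IsField.circ_sq_le (h : V.IsField v a b) {d₁ d₂ : ℝ} (hd1 : 0 < d₁) (hd1' : d₁ ≤ 1) (hd2 : 0 < d₂)
    (hV : V.ShortInteriorEdge d₁ d₂) {t : Finset (Fin (K.m + 3))} (ht : t ∈ V.tri)
    {i j : Fin (K.m + 3)} (hi : i ∈ t) (hj : j ∈ t) (hij : i ≠ j) :
    K.diam * circ (a t) b (K.vertex i) (K.vertex j) ^ 2 ≤
      2 * (K.numVertices : ℝ) / min d₁ d₂ * (K.diam * K.traceNorm v ^ 2 + K.diam ^ 2 * (4 * b ^ 2 * K.area)) *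
        dist (K.vertex i) (K.vertex j) := by
  obtain ⟨σ, hσ, T, hT'⟩ := V.exists_boundary_triangle
  have hT : V.BoundaryTriangles σ T := hT'
  have hd := diam_pos K
  have hm : 0 < min d₁ d₂ := lt_min hd1 hd2
  have hn : (1 : ℝ) ≤ (K.numVertices : ℝ) := by
    rw [PolyCell.numVertices]; push_cast; linarith [(Nat.cast_nonneg K.m : (0 : ℝ) ≤ K.m)]
  have har : 0 ≤ K.area := measureReal_nonneg
  set X := K.diam * K.traceNorm v ^ 2 + K.diam ^ 2 * (4 * b ^ 2 * K.area) with hX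
  have hX0 : 0 ≤ X := by positivity
  have hsucc : ∀ l, l ∈ t → l + 1 ∈ t → K.diam * circ (a t) b (K.vertex l) (K.vertex (l + 1)) ^ 2 ≤
      2 * (K.numVertices : ℝ) / min d₁ d₂ * X * dist (K.vertex l) (K.vertex (l + 1)) := by
    intro l h1 h2
    rw [(hT l).2.2.2.2 t ht h1 h2]
    have hL : 0 < dist (K.vertex l) (K.vertex (l + 1)) := K.edgeLength_pos l
    have e1 : circ (a (T l)) b (K.vertex l) (K.vertex (l + 1)) ^ 2 / K.edgeLength l ≤ K.traceNorm v ^ 2 := by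
      rw [h.traceNorm_sq hT hσ]
      exact Finset.single_le_sum (f := fun l => circ (a (T l)) b (K.vertex l) (K.vertex (l + 1)) ^ 2 /
        K.edgeLength l) (fun l _ => div_nonneg (sq_nonneg _) (K.edgeLength_pos l).le) (Finset.mem_univ l)
    rw [div_le_iff₀ (K.edgeLength_pos l)] at e1
    have e2 : (1 : ℝ) ≤ 2 * (K.numVertices : ℝ) / min d₁ d₂ := by
      rw [le_div_iff₀ hm]
      linarith [min_le_left d₁ d₂]
    calc K.diam * circ (a (T l)) b (K.vertex l) (K.vertex (l + 1)) ^ 2 ≤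
          K.diam * (K.traceNorm v ^ 2 * K.edgeLength l) := by gcongr
      _ = 1 * (K.diam * K.traceNorm v ^ 2) * dist (K.vertex l) (K.vertex (l + 1)) := by
        rw [PolyCell.edgeLength]; ring
      _ ≤ _ := by
        gcongr
        rw [hX]
        have : 0 ≤ K.diam ^ 2 * (4 * b ^ 2 * K.area) := by positivity
        linarith
  by_cases hc : CycAdj i j
  · rcases hc with rfl | rfl
    · exact hsucc i hi hj
    · have := hsucc j hj hi
      rwa [circ_swap, neg_sq, dist_comm] at this
  have main : ∀ i j, i ∈ t → j ∈ t → i < j → ¬ CycAdj i j →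
      K.diam * circ (a t) b (K.vertex i) (K.vertex j) ^ 2 ≤
      2 * (K.numVertices : ℝ) / min d₁ d₂ * X * dist (K.vertex i) (K.vertex j) := by
    intro i j hi hj hij hc
    have hc' := not_or.1 hc
    -- A long interior edge dominates `d₁` times every edge of `K`, so either arc will do. For a
    -- short one the chain must contain a full arc, all of whose edges are comparable with it or
    -- shorter.
    obtain ⟨Λ, hΛ, hs⟩ : ∃ Λ, (Λ = arc i j ∨ Λ = (arc i j)ᶜ) ∧ ∀ l ∈ Λ,
        min d₁ d₂ * K.edgeLength l ≤ dist (K.vertex i) (K.vertex j) := by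
      rcases hV t ht i hi j hj hij.ne hc'.1 hc'.2 with hL | hch
      · refine ⟨_, Or.inl rfl, fun l _ => le_trans ?_ hL⟩
        exact mul_le_mul (min_le_left _ _) (dist_vertex_le _ _) dist_nonneg hd1.le
      · have hch' : Relation.ReflTransGen (fun a b =>
            (b = a + 1 ∧ d₂ * K.edgeLength a ≤ dist (K.vertex i) (K.vertex j)) ∨
            (a = b + 1 ∧ d₂ * K.edgeLength b ≤ dist (K.vertex i) (K.vertex j))) i j := by
          refine Relation.ReflTransGen.mono (fun p q hpq => ?_) _ _ hch
          rcases hpq with ⟨rfl | rfl, hpq⟩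
          · exact Or.inl ⟨rfl, hpq⟩
          · exact Or.inr ⟨rfl, by rwa [dist_comm] at hpq⟩
        rcases arc_of_chain hij hch' with h1 | h1
        · exact ⟨_, Or.inl rfl, fun l hl => le_trans
            (mul_le_mul_of_nonneg_right (min_le_right _ _) (K.edgeLength_pos l).le) (h1 l hl)⟩
        · exact ⟨_, Or.inr rfl, fun l hl => le_trans
            (mul_le_mul_of_nonneg_right (min_le_right _ _) (K.edgeLength_pos l).le) (h1 l hl)⟩
    have hsum : ∑ l ∈ Λ, K.edgeLength l ≤ (K.numVertices : ℝ) * (dist (K.vertex i) (K.vertex j) / min d₁ d₂) := by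
      calc ∑ l ∈ Λ, K.edgeLength l ≤ ∑ l ∈ Λ, dist (K.vertex i) (K.vertex j) / min d₁ d₂ :=
            Finset.sum_le_sum fun l hl => by rw [le_div_iff₀ hm, mul_comm]; exact hs l hl
        _ = Λ.card * (dist (K.vertex i) (K.vertex j) / min d₁ d₂) := by rw [Finset.sum_const, nsmul_eq_mul]
        _ ≤ _ := by
          gcongr
          have := Finset.card_le_univ Λ
          rwa [Fintype.card_fin] at this
    refine (h.circ_sq_le_arc hT hσ ht hi hj hij hc hΛ).trans ?_
    calc 2 * (∑ l ∈ Λ, K.edgeLength l) * X ≤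
          2 * ((K.numVertices : ℝ) * (dist (K.vertex i) (K.vertex j) / min d₁ d₂)) * X := by gcongr
      _ = _ := by ring
  rcases lt_or_gt_of_ne hij with hlt | hlt
  · exact main i j hi hj hlt hc
  · have := main j i hj hi hlt fun hc' => hc (Or.symm hc')
    rwa [circ_swap, neg_sq, dist_comm] at this

/-- Green's formula for the field `(1/2) rotQ (x - vertex i)` with rotation `1`. -/
lemma area_hull {i j k : Fin (K.m + 3)} (ht : {i, j, k} ∈ V.tri) (hij : i ≠ j) (hik : i ≠ k) (hjk : j ≠ k) :
    volume.real (K.hull {i, j, k}) = |K.det i j k| / 2 := by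
  classical
  have h := area_pos_sum (V := V) {({i, j, k} : Finset (Fin (K.m + 3)))}
    (fun _ => -(1 / 2 : ℝ) • rotQ (K.vertex i)) (1 / 2) (by simpa using ht)
  simp only [jump, Finset.sum_singleton] at h
  rw [PolyCell.orient_sum hij hik hjk (fun p q => circ (-(1 / 2 : ℝ) • rotQ (K.vertex i)) (1 / 2)
    (K.vertex p) (K.vertex q)) (fun _ _ => circ_swap _ _ _ _)] at h
  have e : circ (-(1 / 2 : ℝ) • rotQ (K.vertex i)) (1 / 2) (K.vertex i) (K.vertex j) +
      circ (-(1 / 2 : ℝ) • rotQ (K.vertex i)) (1 / 2) (K.vertex j) (K.vertex k) +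
      circ (-(1 / 2 : ℝ) • rotQ (K.vertex i)) (1 / 2) (K.vertex k) (K.vertex i) = 1 / 2 * K.det i j k := by
    simp only [circ, inner_plane, cr, PolyCell.det, PiLp.sub_apply, PiLp.smul_apply, rotQ_zero, rotQ_one,
      smul_eq_mul]
    ring
  rw [e] at h
  have h2 := sign_mul_self (K.det i j k)
  linarith

/-- The three angles add up to `π`. The lower bound keeps the angle away from zero, while the
maximum angle condition keeps it away from `π`, so the two sides at this corner form a stable basis.
-/
lemma exists_large_angle {t : Finset (Fin (K.m + 3))} (ht : t ∈ V.tri) :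
    ∃ i j k, i ≠ j ∧ i ≠ k ∧ j ≠ k ∧ t = {i, j, k} ∧
      Real.pi / 3 ≤ EuclideanGeometry.angle (K.vertex j) (K.vertex i) (K.vertex k) := by
  obtain ⟨i, j, k, hij, hik, hjk, rfl⟩ := V.exists_eq ht
  have hv := fun {p q : Fin (K.m + 3)} (h : p ≠ q) => K.vertex_injective.ne h
  have h := EuclideanGeometry.angle_add_angle_add_angle_eq_pi (p₁ := K.vertex i) (p₂ := K.vertex j)
    (K.vertex k) (hv hij.symm)
  by_contra! hc
  have h1 := hc i j k hij hik hjk rfl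
  have h2 := hc j i k hij.symm hjk hik (by ext; simp; tauto)
  have h3 := hc k i j hik.symm hjk.symm hij (by ext; simp; tauto)
  rw [EuclideanGeometry.angle_comm] at h1
  rw [EuclideanGeometry.angle_comm] at h3
  linarith [EuclideanGeometry.angle_comm (K.vertex i) (K.vertex j) (K.vertex k),
    EuclideanGeometry.angle_comm (K.vertex j) (K.vertex k) (K.vertex i),
    EuclideanGeometry.angle_comm (K.vertex k) (K.vertex i) (K.vertex j)]

/-- At a corner with an angle in `[π/3, θ]` the value `z` of the field is controlled by the
circulations along the two sides there; elsewhere on the triangle the field differs from `z` by at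
most `|b| h_K`. Each circulation estimate carries the length of its side, which the area of the
triangle supplies in turn, so thin triangles do no harm. -/
lemma IsField.integral_hull_le (h : V.IsField v a b) {d₁ d₂ θ : ℝ} (hd1 : 0 < d₁) (hd1' : d₁ ≤ 1)
    (hd2 : 0 < d₂) (hθ : θ < Real.pi) (hV : V.Admissible θ d₁ d₂) {t : Finset (Fin (K.m + 3))}
    (ht : t ∈ V.tri) :
    ∫ x in K.hull t, ‖v x‖ ^ 2 ≤ 6 * (2 * (K.numVertices : ℝ) / min d₁ d₂ *
        (K.diam * K.traceNorm v ^ 2 + K.diam ^ 2 * (4 * b ^ 2 * K.area))) *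
        Real.cot ((Real.pi - θ) / 2) + 2 * b ^ 2 * K.diam ^ 2 * volume.real (K.hull t) ∧
      1 / 2 ≤ Real.cot ((Real.pi - θ) / 2) := by
  obtain ⟨i, j, k, hij, hik, hjk, rfl, hang⟩ := exists_large_angle ht
  have hang2 : EuclideanGeometry.angle (K.vertex j) (K.vertex i) (K.vertex k) ≤ θ :=
    hV.1 _ ht j (by simp) i (by simp) k (by simp) hij.symm hik hjk
  refine ⟨?_, (cot_half_bounds hang hang2 hθ).2.2⟩
  have hd := diam_pos K
  have hm : 0 < min d₁ d₂ := lt_min hd1 hd2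
  have har : 0 ≤ K.area := measureReal_nonneg
  set E := 2 * (K.numVertices : ℝ) / min d₁ d₂ *
        (K.diam * K.traceNorm v ^ 2 + K.diam ^ 2 * (4 * b ^ 2 * K.area)) with hE
  have hE0 : 0 ≤ E := by positivity
  set z := nedelec (a {i, j, k}) b (K.vertex i) with hz
  have hedge : ∀ l, l ∈ ({i, j, k} : Finset (Fin (K.m + 3))) → i ≠ l →
      inner ℝ z (K.vertex l - K.vertex i) ^ 2 ≤ E / K.diam * ‖K.vertex l - K.vertex i‖ := by
    intro l hl hil
    have := h.circ_sq_le hd1 hd1' hd2 hV.2 ht (i := i) (j := l) (by simp) hl hil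
    rw [circ_eq_inner, dist_comm, dist_eq_norm] at this
    rw [div_mul_eq_mul_div, le_div_iff₀ hd]
    linarith
  have hnorm : ∀ l, ‖K.vertex l - K.vertex i‖ ≤ K.diam := fun l => by
    rw [← dist_eq_norm]; exact dist_vertex_le _ _
  have hzb := norm_sq_mul_cr_le (hnorm j) (hnorm k) (div_nonneg hE0 hd.le)
    (V.det_ne_zero ht hij hik hjk) (hedge j (by simp) hij) (hedge k (by simp) hik) hang hang2 hθ
  rw [div_mul_cancel₀ _ hd.ne'] at hzb
  have hvol := area_hull ht hij hik hjk
  change ‖z‖ ^ 2 * (|K.det i j k| / 2) ≤ _ at hzb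
  rw [← hvol] at hzb
  have hfin : volume (K.hull {i, j, k}) ≠ ⊤ := (PolyCell.isCompact_hull _).measure_lt_top.ne
  have hpt : ∀ x ∈ K.hull {i, j, k}, ‖nedelec (a {i, j, k}) b x‖ ^ 2 ≤ 2 * ‖z‖ ^ 2 + 2 * b ^ 2 * K.diam ^ 2 := by
    intro x hx
    have e : nedelec (a {i, j, k}) b x = z + b • rotQ (x - K.vertex i) := by
      rw [hz]
      ext c
      fin_cases c <;> simp [nedelec] <;> ring
    have hxd : ‖x - K.vertex i‖ ≤ K.diam := by
      rw [← dist_eq_norm, PolyCell.diam, ← Metric.diam_closure]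
      exact Metric.dist_le_diam_of_mem K.isBounded.closure (V.hull_subset ht hx)
        (V.hull_subset ht (subset_convexHull ℝ _ ⟨i, by simp, rfl⟩))
    have h1 : ‖b • rotQ (x - K.vertex i)‖ ^ 2 ≤ b ^ 2 * K.diam ^ 2 := by
      rw [norm_smul, mul_pow, norm_rotQ, Real.norm_eq_abs, sq_abs]
      gcongr
    have h2 := norm_add_le z (b • rotQ (x - K.vertex i))
    rw [e]
    nlinarith [sq_nonneg (‖z‖ - ‖b • rotQ (x - K.vertex i)‖), norm_nonneg (z + b • rotQ (x - K.vertex i)),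
      norm_nonneg z, norm_nonneg (b • rotQ (x - K.vertex i))]
  calc ∫ x in K.hull {i, j, k}, ‖v x‖ ^ 2 = ∫ x in K.hull {i, j, k}, ‖nedelec (a {i, j, k}) b x‖ ^ 2 := by
        refine integral_congr_ae ?_
        filter_upwards [h.eq_ae _ ht] with x hx
        rw [hx]
    _ ≤ ∫ _ in K.hull {i, j, k}, (2 * ‖z‖ ^ 2 + 2 * b ^ 2 * K.diam ^ 2) := by
        refine setIntegral_mono_on ?_ (integrableOn_const (hs := hfin))
          (PolyCell.isCompact_hull _).isClosed.measurableSet hpt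
        exact (((continuous_nedelec _ _).norm.pow 2).continuousOn).integrableOn_compact
          (PolyCell.isCompact_hull _)
    _ = 2 * (‖z‖ ^ 2 * volume.real (K.hull {i, j, k})) +
          2 * b ^ 2 * K.diam ^ 2 * volume.real (K.hull {i, j, k}) := by
        rw [integral_const, smul_eq_mul, measureReal_restrict_apply MeasurableSet.univ, univ_inter]; ring
    _ ≤ _ := by linarith

lemma l2Norm_sq {E : Type} [NormedAddCommGroup E] (D : Set Plane) (f : Plane → E) :
    l2Norm D f ^ 2 = ∫ x in D, ‖f x‖ ^ 2 := Real.sq_sqrt (integral_nonneg fun _ => by positivity)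

/-- The local Poincaré-type bound on the edge space. -/
theorem l2Norm_le {d₁ d₂ θ : ℝ} (hd1 : 0 < d₁) (hd1' : d₁ ≤ 1) (hd2 : 0 < d₂) (hθ : θ < Real.pi)
    (hV : V.Admissible θ d₁ d₂) (hv : V.MemEdgeSpace v) :
    K.HasTangentialTrace v ∧ 0 ≤ Real.cot ((Real.pi - θ) / 2) ∧
      l2Norm K.carrier v ≤ √(Real.cot ((Real.pi - θ) / 2) *
        ((24 * K.numVertices * 2 ^ K.numVertices + 2 : ℕ) : ℝ) / (2 * min d₁ d₂)) *
          (√K.diam * K.traceNorm v + K.diam * l2Norm K.carrier (weakRot K.carrier v)) := by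
  obtain ⟨a, b, h⟩ := V.exists_isField hv
  obtain ⟨σ, hσ, T, hT⟩ := V.exists_boundary_triangle
  set c := Real.cot ((Real.pi - θ) / 2) with hc
  have hc1 : 1 / 2 ≤ c := (h.integral_hull_le hd1 hd1' hd2 hθ hV (hT 0).1).2
  refine ⟨⟨hv.1, _, h.isTangentialTrace hT⟩, by linarith, ?_⟩
  have hd := diam_pos K
  have hm : 0 < min d₁ d₂ := lt_min hd1 hd2
  have hm1 : min d₁ d₂ ≤ 1 := (min_le_left _ _).trans hd1'
  have har : 0 ≤ K.area := measureReal_nonneg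
  have hr := h.l2Norm_rot_sq
  set r := l2Norm K.carrier (MaxwellVEM.weakRot K.carrier v) with hrd
  set g := K.traceNorm v with hg
  set X := K.diam * g ^ 2 + K.diam ^ 2 * (4 * b ^ 2 * K.area) with hX
  have hX0 : 0 ≤ X := by positivity
  have hg0 : 0 ≤ g := Real.sqrt_nonneg _
  have hr0 : 0 ≤ r := Real.sqrt_nonneg _
  set n : ℝ := (K.numVertices : ℝ) with hn
  have hint : IntegrableOn (fun x => ‖v x‖ ^ 2) K.carrier := h.memL2.integrable_norm_pow two_ne_zero
  -- A crude count: triangles are sets of vertices. This is the origin of the power of two in the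
  -- constant.
  have hcard : (V.tri.card : ℝ) ≤ 2 ^ K.numVertices := by
    have := Finset.card_le_univ V.tri
    rw [Fintype.card_finset, Fintype.card_fin] at this
    exact_mod_cast this
  have hsum : ∫ x in K.carrier, ‖v x‖ ^ 2 ≤ c * (24 * n * 2 ^ K.numVertices + 2) / (2 * min d₁ d₂) * X := by
    calc ∫ x in K.carrier, ‖v x‖ ^ 2 = ∑ t ∈ V.tri, ∫ x in K.hull t, ‖v x‖ ^ 2 := V.integral_carrier hint
      _ ≤ ∑ t ∈ V.tri, (6 * (2 * n / min d₁ d₂ * X) * c + 2 * b ^ 2 * K.diam ^ 2 * volume.real (K.hull t)) :=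
          Finset.sum_le_sum fun t ht => (h.integral_hull_le hd1 hd1' hd2 hθ hV ht).1
      _ = V.tri.card * (6 * (2 * n / min d₁ d₂ * X) * c) + 2 * b ^ 2 * K.diam ^ 2 * K.area := by
          rw [Finset.sum_add_distrib, Finset.sum_const, nsmul_eq_mul, ← Finset.mul_sum, sum_area]
      -- The rotation term is at most `X / 2`, and `1/2 ≤ c` and `min d₁ d₂ ≤ 1` bring it under the
      -- common factor; hence the summand `2` in the constant.
      _ ≤ 2 ^ K.numVertices * (6 * (2 * n / min d₁ d₂ * X) * c) + c * X / min d₁ d₂ := by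
          gcongr
          rw [le_div_iff₀ hm]
          have e1 : 2 * b ^ 2 * K.diam ^ 2 * K.area ≤ 1 / 2 * X := by
            have : 0 ≤ K.diam * g ^ 2 := by positivity
            rw [hX]; linarith
          have e2 : 0 ≤ 2 * b ^ 2 * K.diam ^ 2 * K.area := by positivity
          nlinarith
      _ = _ := by field_simp; ring
  have hXle : X ≤ (√K.diam * g + K.diam * r) ^ 2 := by
    have e := Real.sq_sqrt hd.le
    have : 0 ≤ 2 * (√K.diam * g) * (K.diam * r) := by positivity
    rw [hX, ← hr]
    nlinarith
  refine le_of_sq_le_sq ?_ (by positivity)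
  rw [l2Norm_sq, mul_pow, Real.sq_sqrt (by positivity)]
  refine hsum.trans ?_
  push_cast
  gcongr

end VirtualMesh

/-! ## The global bound on the edge space -/

lemma IsWeakRot.mono {D D' : Set Plane} (hD : D' ⊆ D) {v : Plane → Plane} {r : Plane → ℝ}
    (h : IsWeakRot D v r) : IsWeakRot D' v r := by
  refine ⟨h.1.mono_measure (Measure.restrict_mono hD le_rfl), fun φ hφ => ?_⟩
  have h1 := h.2 φ ⟨hφ.1, hφ.2.1, hφ.2.2.trans hD⟩
  have e : ∀ F : Plane → ℝ, (∀ x, x ∉ tsupport φ → F x = 0) → ∫ x in D, F x = ∫ x in D', F x := by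
    intro F hF
    rw [setIntegral_eq_integral_of_forall_compl_eq_zero fun x hx => hF x fun hm => hx (hD (hφ.2.2 hm)),
      setIntegral_eq_integral_of_forall_compl_eq_zero fun x hx => hF x fun hm => hx (hφ.2.2 hm)]
  rwa [e _ fun x hx => by rw [image_eq_zero_of_notMem_tsupport hx, mul_zero],
    e _ fun x hx => by rw [vrot_eq_zero hx, inner_zero_right]] at h1

lemma memL2_const {D : Set Plane} (hD : volume D ≠ ⊤) (a : Plane) : MemL2 D fun _ => a := by
  have : IsFiniteMeasure (volume.restrict D) := ⟨by simpa using hD.lt_top⟩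
  exact memLp_const a

lemma IsWeakRot.sub_const {D : Set Plane} (hD : volume D ≠ ⊤) {v : Plane → Plane} {r : Plane → ℝ}
    (hv : MemL2 D v) (h : IsWeakRot D v r) (a : Plane) : IsWeakRot D (fun x => v x - a) r := by
  refine ⟨h.1, fun φ hφ => ?_⟩
  have h1 : ContDiff ℝ 1 φ := hφ.1.of_le (by exact_mod_cast le_top)
  have e : ∫ x in D, inner ℝ a (vrot φ x) = 0 := by
    rw [setIntegral_eq_integral_of_forall_compl_eq_zero fun x hx => by
      rw [vrot_eq_zero fun hm => hx (hφ.2.2 hm), inner_zero_right]]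
    exact integral_inner_vrot h1 hφ.2.1 a
  have i1 := VirtualMesh.integrableOn_inner_vrot hv h1 hφ.2.1
  have i2 := VirtualMesh.integrableOn_inner_vrot (memL2_const hD a) h1 hφ.2.1
  rw [h.2 φ hφ]
  simp_rw [inner_sub_left]
  rw [integral_sub i1 i2, e, sub_zero]

lemma volume_carrier_ne_top (K : PolyCell) : volume K.carrier ≠ ⊤ := K.isBounded.measure_lt_top.ne

/-- Constants are edge fields without rotation. Therefore the local bound applies to `v - Π_K v`,
whose trace is the one in `‖v‖_b`. -/
lemma VirtualMesh.MemEdgeSpace.sub_const {K : PolyCell} {V : VirtualMesh K} {v : Plane → Plane}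
    (h : V.MemEdgeSpace v) (c : Plane) : V.MemEdgeSpace fun x => v x - c := by
  obtain ⟨⟨h1, r, hr⟩, h2, b, hb⟩ := h
  refine ⟨⟨h1.sub (memL2_const (volume_carrier_ne_top K) c), r,
    hr.sub_const (volume_carrier_ne_top K) h1 c⟩, fun t ht => ?_,
    b, hb.sub_const (volume_carrier_ne_top K) h1 c⟩
  obtain ⟨a, b, hab⟩ := h2 t ht
  refine ⟨a - c, b, ?_⟩
  filter_upwards [hab] with x hx
  rw [hx]; abel

/-- The local bound needs `d₁ ≤ 1`; in the global bounds `d₁` is arbitrary and is replaced by `min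
d₁ 1`. -/
lemma VirtualMesh.Admissible.mono {K : PolyCell} {V : VirtualMesh K} {θ d₁ d₂ d₁' d₂' : ℝ}
    (h : V.Admissible θ d₁ d₂) (h1 : d₁' ≤ d₁) (h2 : d₂' ≤ d₂) : V.Admissible θ d₁' d₂' := by
  refine ⟨h.1, fun t ht i hi j hj hij h3 h4 => ?_⟩
  rcases h.2 t ht i hi j hj hij h3 h4 with h5 | h5
  · exact Or.inl ((mul_le_mul_of_nonneg_right h1 (diam_pos K).le).trans h5)
  · refine Or.inr (Relation.ReflTransGen.mono (fun p q hpq => ⟨hpq.1, ?_⟩) _ _ h5)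
    exact (mul_le_mul_of_nonneg_right h2 dist_nonneg).trans hpq.2

namespace PolyMesh

lemma restrict_domain {Ω : Set Plane} (M : PolyMesh Ω) :
    volume.restrict Ω = ∑ k, volume.restrict (M.cell k).carrier := by
  have h1 : Ω =ᵐ[volume] ⋃ k, (M.cell k).carrier := by
    refine Filter.EventuallyLE.antisymm ?_ (LE.le.eventuallyLE (iUnion_subset M.subset))
    have hnull : volume (⋃ k, frontier (M.cell k).carrier) = 0 :=
      measure_iUnion_null fun k => VirtualMesh.frontier_null _
    filter_upwards [measure_eq_zero_iff_ae_notMem.1 hnull] with x hx hxΩ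
    have : x ∈ ⋃ k, closure (M.cell k).carrier := by rw [M.cover]; exact subset_closure hxΩ
    obtain ⟨k, hk⟩ := mem_iUnion.1 this
    refine mem_iUnion.2 ⟨k, ?_⟩
    by_contra hn
    refine hx (mem_iUnion.2 ⟨k, ?_⟩)
    rw [(M.cell k).isOpen.frontier_eq]
    exact ⟨hk, hn⟩
  rw [Measure.restrict_congr_set h1, Measure.restrict_iUnion (fun k l hkl => M.disjoint k l hkl)
    fun k => (M.cell k).isOpen.measurableSet, Measure.sum_fintype]

lemma integral_domain {Ω : Set Plane} (M : PolyMesh Ω) {F : Plane → ℝ} (hF : IntegrableOn F Ω) :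
    ∫ x in Ω, F x = ∑ k, ∫ x in (M.cell k).carrier, F x := by
  rw [restrict_domain M, integral_finsetSum_measure]
  intro k _
  exact hF.mono_set (M.subset k)

lemma diam_le_h {Ω : Set Plane} (M : PolyMesh Ω) (k : Fin M.num) : (M.cell k).diam ≤ M.h :=
  le_ciSup (f := fun k => (M.cell k).diam) (finite_range _).bddAbove k

lemma diam_cell_le {Ω : Set Plane} (M : PolyMesh Ω) (hΩ : Bornology.IsBounded Ω) (k : Fin M.num) :
    (M.cell k).diam ≤ Metric.diam Ω := Metric.diam_mono (M.subset k) hΩ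

variable {P : InterfaceDomain} (M : PolyMesh P.Ω)

lemma bNorm_term_nonneg (v : Plane → Plane) (k : Fin M.num) :
    0 ≤ M.βh k * ‖(M.cell k).proj v‖ ^ 2 * (M.cell k).area ∧
      0 ≤ M.h * (M.cell k).traceNorm ((M.cell k).projErr v) ^ 2 := by
  have h1 : 0 < M.βh k := by
    unfold βh; split_ifs
    · exact P.βp_pos
    · exact P.βm_pos
  have h2 : 0 ≤ M.h := (VirtualMesh.diam_pos _).le.trans (M.diam_le_h k)
  exact ⟨mul_nonneg (mul_nonneg h1.le (sq_nonneg _)) measureReal_nonneg, mul_nonneg h2 (sq_nonneg _)⟩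

lemma bNorm_sq (v : Plane → Plane) : M.bNorm v ^ 2 =
    ∑ k, (M.βh k * ‖(M.cell k).proj v‖ ^ 2 * (M.cell k).area
      + M.h * (M.cell k).traceNorm ((M.cell k).projErr v) ^ 2) :=
  Real.sq_sqrt (Finset.sum_nonneg fun k _ => add_nonneg (M.bNorm_term_nonneg v k).1
    (M.bNorm_term_nonneg v k).2)

lemma domain_finite : volume P.Ω ≠ ⊤ := P.bounded.measure_lt_top.ne

lemma projErr_weakRot {v : Plane → Plane} (hv : MemHRot P.Ω v) (k : Fin M.num) :
    IsWeakRot (M.cell k).carrier ((M.cell k).projErr v) (weakRot P.Ω v) :=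
  ((weakRot_spec hv.2).mono (M.subset k)).sub_const (volume_carrier_ne_top _)
    (hv.1.mono_measure (Measure.restrict_mono (M.subset k) le_rfl)) _

lemma projErr_memHRot {v : Plane → Plane} (hv : MemHRot P.Ω v) (k : Fin M.num) :
    MemHRot (M.cell k).carrier ((M.cell k).projErr v) :=
  ⟨(hv.1.mono_measure (Measure.restrict_mono (M.subset k) le_rfl)).sub
    (memL2_const (volume_carrier_ne_top _) _), _, M.projErr_weakRot hv k⟩

/-- The constant of the local bound. -/
def localConst (θ d : ℝ) (N : ℕ) : ℝ :=
  |Real.cot ((Real.pi - θ) / 2)| * (24 * N * 2 ^ N + 2) / (2 * d)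

/-- The square of the local bound for `v - Π_K v`, with `h_K ≤ h` before the trace and `h_K ≤ diam
Ω` before the rotation. The rotation taken in `K` agrees almost everywhere with the one taken in
`Ω`. -/
lemma l2Norm_projErr_sq_le {θ d₁ d₂ : ℝ} {N : ℕ} (hd1 : 0 < d₁) (hd2 : 0 < d₂) (hθ : θ < Real.pi)
    {V : ∀ k, VirtualMesh (M.cell k)} (hV : ∀ k, (V k).Admissible θ d₁ d₂) (hN : M.EdgeCount N)
    {v : Plane → Plane} (hv : MemEdgeSpace M V v) (k : Fin M.num) :
    (M.cell k).HasTangentialTrace ((M.cell k).projErr v) ∧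
      ∫ x in (M.cell k).carrier, ‖(M.cell k).projErr v x‖ ^ 2 ≤
        localConst θ (min (min d₁ 1) d₂) N * 2 * (M.h * (M.cell k).traceNorm ((M.cell k).projErr v) ^ 2 +
          Metric.diam P.Ω ^ 2 * ∫ x in (M.cell k).carrier, ‖weakRot P.Ω v x‖ ^ 2) := by
  set K := M.cell k
  obtain ⟨h1, h2, h3⟩ := VirtualMesh.l2Norm_le (lt_min hd1 one_pos) (min_le_right _ _) hd2 hθ
    ((hV k).mono (min_le_left _ _) le_rfl) ((hv.1 k).sub_const (K.proj v))
  refine ⟨h1, ?_⟩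
  have hd := VirtualMesh.diam_pos K
  change l2Norm K.carrier (K.projErr v) ≤ _ * (_ * K.traceNorm (K.projErr v) +
    K.diam * l2Norm K.carrier (weakRot K.carrier (K.projErr v))) at h3
  have hr : l2Norm K.carrier (weakRot K.carrier (K.projErr v)) =
      l2Norm K.carrier (weakRot P.Ω v) := by
    unfold l2Norm
    congr 1
    refine integral_congr_ae ?_
    have hw := M.projErr_weakRot hv.2.1 k
    filter_upwards [IsWeakRot.ae_eq K.isOpen (weakRot_spec ⟨_, hw⟩) hw] with x hx
    rw [hx]
  rw [hr] at h3
  rw [← VirtualMesh.l2Norm_sq, ← VirtualMesh.l2Norm_sq]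
  set g := K.traceNorm (K.projErr v)
  set r := l2Norm K.carrier (weakRot P.Ω v)
  have hg0 : 0 ≤ g := Real.sqrt_nonneg _
  have hr0 : 0 ≤ r := Real.sqrt_nonneg _
  have hm : 0 < min (min d₁ 1) d₂ := lt_min (lt_min hd1 one_pos) hd2
  have hNk : (K.numVertices : ℝ) ≤ N := by exact_mod_cast hN k
  have hNk' : (2 : ℝ) ^ K.numVertices ≤ 2 ^ N := pow_le_pow_right₀ one_le_two (hN k)
  calc l2Norm K.carrier (K.projErr v) ^ 2 ≤ _ := pow_le_pow_left₀ (Real.sqrt_nonneg _) h3 2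
    _ = Real.cot ((Real.pi - θ) / 2) * ((24 * K.numVertices * 2 ^ K.numVertices + 2 : ℕ) : ℝ) /
          (2 * min (min d₁ 1) d₂) * (√K.diam * g + K.diam * r) ^ 2 := by
        rw [mul_pow, Real.sq_sqrt (by positivity)]
    _ ≤ localConst θ (min (min d₁ 1) d₂) N * (2 * (M.h * g ^ 2 + Metric.diam P.Ω ^ 2 * r ^ 2)) := by
        unfold localConst
        push_cast
        have e1 : (√K.diam * g + K.diam * r) ^ 2 ≤ 2 * (M.h * g ^ 2 + Metric.diam P.Ω ^ 2 * r ^ 2) := by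
          have e2 : (√K.diam * g) ^ 2 = K.diam * g ^ 2 := by rw [mul_pow, Real.sq_sqrt hd.le]
          have e3 : K.diam * g ^ 2 ≤ M.h * g ^ 2 := by gcongr; exact M.diam_le_h k
          have e4 : (K.diam * r) ^ 2 ≤ Metric.diam P.Ω ^ 2 * r ^ 2 := by
            rw [mul_pow]; gcongr; exact M.diam_cell_le P.bounded k
          nlinarith [sq_nonneg (√K.diam * g - K.diam * r)]
        have e5 : Real.cot ((Real.pi - θ) / 2) ≤ |Real.cot ((Real.pi - θ) / 2)| := le_abs_self _
        gcongr
    _ = _ := by ring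

lemma norm_proj_sub {K : PolyCell} (v : Plane → Plane) (x : Plane) :
    ‖v x‖ ^ 2 ≤ 2 * ‖K.projErr v x‖ ^ 2 + 2 * ‖K.proj v‖ ^ 2 := by
  have : v x = K.projErr v x + K.proj v := by simp [PolyCell.projErr]
  have h := norm_add_le (K.projErr v x) (K.proj v)
  rw [← this] at h
  nlinarith [sq_nonneg (‖K.projErr v x‖ - ‖K.proj v‖), norm_nonneg (v x), norm_nonneg (K.proj v),
    norm_nonneg (K.projErr v x)]

/-- On each element `v` splits into its mean, which the first part of `‖v‖_b` controls because `β_h`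
is bounded below, and `v - Π_K v`, which the local bound reduces to the trace and the rotation. -/
theorem l2Norm_le_aNorm (P : InterfaceDomain) {θ d₁ d₂ : ℝ} (N : ℕ) (hθ : θ < Real.pi)
    (hd1 : 0 < d₁) (hd2 : 0 < d₂) :
    ∃ C : ℝ, 0 < C ∧ ∀ (M : PolyMesh P.Ω) (V : ∀ k, VirtualMesh (M.cell k)),
      (∀ k, (V k).Admissible θ d₁ d₂) → M.EdgeCount N →
      ∀ v : Plane → Plane, M.MemEdgeSpace V v → M.HasTraces v ∧ l2Norm P.Ω v ≤ C * M.aNorm v := by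
  set D := Metric.diam P.Ω
  set c := localConst θ (min (min d₁ 1) d₂) N with hcdef
  have hm : 0 < min (min d₁ 1) d₂ := lt_min (lt_min hd1 one_pos) hd2
  have hc : 0 ≤ c := by rw [hcdef]; unfold localConst; positivity
  set β := min P.βp P.βm with hβ
  have hβ0 : 0 < β := lt_min P.βp_pos P.βm_pos
  set A := 4 * c * (1 + D ^ 2) + 2 / β with hA
  have hA0 : 0 < A := by positivity
  refine ⟨√A, Real.sqrt_pos.2 hA0, fun M V hV hN v hv => ⟨fun k =>
    (M.l2Norm_projErr_sq_le hd1 hd2 hθ hV hN hv k).1, ?_⟩⟩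
  refine le_of_sq_le_sq ?_ (mul_nonneg (Real.sqrt_nonneg _) (Real.sqrt_nonneg _))
  have hL2 : MemL2 P.Ω v := hv.2.1.1
  have hrot : MemLp (weakRot P.Ω v) 2 (volume.restrict P.Ω) := (weakRot_spec hv.2.1.2).1
  have hi1 : IntegrableOn (fun x => ‖v x‖ ^ 2) P.Ω := hL2.integrable_norm_pow two_ne_zero
  have hi2 : IntegrableOn (fun x => ‖weakRot P.Ω v x‖ ^ 2) P.Ω := hrot.integrable_norm_pow two_ne_zero
  rw [mul_pow, Real.sq_sqrt hA0.le, aNorm, Real.sq_sqrt (by positivity), VirtualMesh.l2Norm_sq, VirtualMesh.l2Norm_sq,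
    M.integral_domain hi1, M.integral_domain hi2, bNorm_sq, ← Finset.sum_add_distrib, Finset.mul_sum]
  refine Finset.sum_le_sum fun k _ => ?_
  obtain ⟨-, hk⟩ := M.l2Norm_projErr_sq_le hd1 hd2 hθ hV hN hv k
  obtain ⟨b1, b2⟩ := M.bNorm_term_nonneg v k
  set K := M.cell k
  set R := ∫ x in K.carrier, ‖weakRot P.Ω v x‖ ^ 2
  have hR : 0 ≤ R := integral_nonneg fun _ => by positivity
  have hE : IntegrableOn (fun x => ‖K.projErr v x‖ ^ 2) K.carrier :=
    (M.projErr_memHRot hv.2.1 k).1.integrable_norm_pow two_ne_zero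
  have hcst : IntegrableOn (fun _ => 2 * ‖K.proj v‖ ^ 2) K.carrier :=
    integrableOn_const (hs := volume_carrier_ne_top K)
  have hsplit : ∫ x in K.carrier, ‖v x‖ ^ 2 ≤
      2 * (∫ x in K.carrier, ‖K.projErr v x‖ ^ 2) + 2 * (‖K.proj v‖ ^ 2 * K.area) := by
    calc ∫ x in K.carrier, ‖v x‖ ^ 2 ≤ ∫ x in K.carrier, (2 * ‖K.projErr v x‖ ^ 2 + 2 * ‖K.proj v‖ ^ 2) :=
          integral_mono (hi1.mono_set (M.subset k)) ((hE.const_mul 2).add hcst) fun x => norm_proj_sub v x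
      _ = _ := by
        rw [integral_add (hE.const_mul 2) hcst, integral_const_mul, integral_const, smul_eq_mul,
          measureReal_restrict_apply MeasurableSet.univ, univ_inter, PolyCell.area]
        ring
  have hβk : ‖K.proj v‖ ^ 2 * K.area ≤ 1 / β * (M.βh k * ‖K.proj v‖ ^ 2 * K.area) := by
    have : β ≤ M.βh k := by
      unfold βh; split_ifs
      · exact min_le_left _ _
      · exact min_le_right _ _
    have h3 : 0 ≤ ‖K.proj v‖ ^ 2 * K.area := mul_nonneg (sq_nonneg _) measureReal_nonneg
    rw [div_mul_eq_mul_div, le_div_iff₀ hβ0]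
    nlinarith
  set B := M.βh k * ‖K.proj v‖ ^ 2 * K.area
  set G := M.h * K.traceNorm (K.projErr v) ^ 2
  have t1 : 0 ≤ 4 * c * D ^ 2 * (B + G) := by positivity
  have t2 : 0 ≤ 2 / β * (R + G) := by positivity
  have t3 : 0 ≤ 4 * c * (B + R) := by positivity
  have t4 : 2 * (1 / β * B) = 2 / β * B := by ring
  nlinarith

end PolyMesh

/-! ## A trace inequality on thin sets -/

/-- The square of the Sobolev–Slobodeckij seminorm of `w` on `E`. -/
def gag (s : ℝ) (E : Set Plane) (w : Plane → Plane) : ℝ≥0∞ :=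
  ∫⁻ x in E, ∫⁻ y in E, ‖w x - w y‖ₑ ^ 2 / edist x y ^ (2 * (1 + s))

/-- A measurable set which looks like a strip of width `δ`. -/
def Thin (N : Set Plane) (δ : ℝ) : Prop :=
  MeasurableSet N ∧ ∀ z l, 0 < l → volume (N ∩ Metric.closedBall z l) ≤ ENNReal.ofReal (8 * δ * l)

/-- The ball at distance `l` of `x` in the cone around the direction `e`. -/
def coneBall (e : Plane) (lam l : ℝ) (x : Plane) : Set Plane := Metric.closedBall (x + l • e) (l * lam)

section ThinTrace
variable {N E : Set Plane} {e m : Plane} {lam l δ s r : ℝ} {w : Plane → Plane}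

lemma coneBall_subset (he : ‖e‖ + lam ≤ 1) (hl : 0 ≤ l) (x : Plane) :
    coneBall e lam l x ⊆ Metric.closedBall x l := by
  intro z hz
  rw [coneBall, Metric.mem_closedBall] at hz
  rw [Metric.mem_closedBall]
  have h1 : dist (x + l • e) x = l * ‖e‖ := by
    rw [dist_eq_norm, add_sub_cancel_left, norm_smul, Real.norm_eq_abs, abs_of_nonneg hl]
  calc dist z x ≤ dist z (x + l • e) + dist (x + l • e) x := dist_triangle _ _ _
    _ ≤ l * lam + l * ‖e‖ := by rw [h1]; linarith
    _ ≤ l := by nlinarith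

lemma volume_coneBall (hl : 0 ≤ l) (hlam : 0 ≤ lam) (x : Plane) :
    volume (coneBall e lam l x) = ENNReal.ofReal (l ^ 2 * (lam ^ 2 * Real.pi)) := by
  rw [coneBall, EuclideanSpace.volume_closedBall_fin_two, ← ENNReal.ofReal_pow (by positivity),
    ← ENNReal.ofReal_mul (by positivity)]
  congr 1; ring

lemma measurableSet_coneBall_prod : MeasurableSet {p : Plane × Plane | p.2 ∈ coneBall e lam l p.1} := by
  have : IsClosed {p : Plane × Plane | dist p.2 (p.1 + l • e) ≤ l * lam} :=
    isClosed_le (by fun_prop) continuous_const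
  exact this.measurableSet

lemma measurableSet_coneBall (x : Plane) : MeasurableSet (coneBall e lam l x) :=
  Metric.isClosed_closedBall.measurableSet

/-- Tonelli: `z` belongs to the cone ball at `x` exactly when `x` belongs to the ball of the same
radius around `z - l • e`. -/
lemma lintegral_coneBall_swap {Q : Plane → ℝ≥0∞} (hQ : Measurable Q) :
    ∫⁻ x in N, ∫⁻ z in coneBall e lam l x, Q z =
      ∫⁻ z, Q z * volume (N ∩ Metric.closedBall (z - l • e) (l * lam)) := by
  have hmem : ∀ x z, z ∈ coneBall e lam l x ↔ x ∈ Metric.closedBall (z - l • e) (l * lam) := by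
    intro x z
    rw [coneBall, Metric.mem_closedBall, Metric.mem_closedBall, dist_eq_norm, dist_eq_norm,
      show z - (x + l • e) = -(x - (z - l • e)) by abel, norm_neg]
  have h1 : ∀ x, ∫⁻ z in coneBall e lam l x, Q z =
      ∫⁻ z, {p : Plane × Plane | p.2 ∈ coneBall e lam l p.1}.indicator (fun p => Q p.2) (x, z) := by
    intro x
    rw [← lintegral_indicator (measurableSet_coneBall x)]
    rfl
  simp_rw [h1]
  rw [lintegral_lintegral_swap (f := fun x z => {p : Plane × Plane | p.2 ∈ coneBall e lam l p.1}.indicator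
    (fun p => Q p.2) (x, z)) (((hQ.comp measurable_snd).indicator measurableSet_coneBall_prod).aemeasurable)]
  refine lintegral_congr fun z => ?_
  have h2 : ∀ x, {p : Plane × Plane | p.2 ∈ coneBall e lam l p.1}.indicator (fun p => Q p.2) (x, z) =
      (Metric.closedBall (z - l • e) (l * lam)).indicator (fun _ => Q z) x := by
    intro x
    by_cases h : x ∈ Metric.closedBall (z - l • e) (l * lam)
    · rw [indicator_of_mem h, indicator_of_mem (by exact (hmem x z).2 h)]
    · rw [indicator_of_notMem h, indicator_of_notMem (by exact fun h' => h ((hmem x z).1 h'))]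
  simp_rw [h2]
  rw [lintegral_indicator_const Metric.isClosed_closedBall.measurableSet,
    Measure.restrict_apply Metric.isClosed_closedBall.measurableSet, inter_comm]

/-- After the exchange each `z` is reached only from the part of `N` in a ball of radius at most
`l`, whose measure is at most `8 δ l` since `N` is thin. The gain over the full ball, of order `δ /
l`, is the source of the factor `δ` in the trace inequality. -/
lemma lintegral_coneBall_le (hT : Thin N δ) (hl : 0 < l) (he : ‖e‖ + lam ≤ 1)
    (hE : MeasurableSet E) (hEx : ∀ x ∈ N, coneBall e lam l x ⊆ E) {Q : Plane → ℝ≥0∞} (hQ : Measurable Q) :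
    ∫⁻ x in N, ∫⁻ z in coneBall e lam l x, Q z ≤ ENNReal.ofReal (8 * δ * l) * ∫⁻ z in E, Q z := by
  have h1 : ∫⁻ x in N, ∫⁻ z in coneBall e lam l x, Q z =
      ∫⁻ x in N, ∫⁻ z in coneBall e lam l x, E.indicator Q z := by
    refine setLIntegral_congr_fun hT.1 fun x hx => ?_
    refine setLIntegral_congr_fun (measurableSet_coneBall x) fun z hz => ?_
    exact (indicator_of_mem (hEx x hx hz) Q).symm
  rw [h1, lintegral_coneBall_swap (hQ.indicator hE), ← lintegral_indicator hE, mul_comm (ENNReal.ofReal _),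
    ← lintegral_mul_const _ (hQ.indicator hE)]
  refine lintegral_mono fun z => ?_
  gcongr
  have hlam1 : lam ≤ 1 := by linarith [norm_nonneg e]
  refine le_trans (measure_mono (inter_subset_inter_right _
    (Metric.closedBall_subset_closedBall ?_))) (hT.2 (z - l • e) l hl)
  nlinarith

lemma lintegral_triple (hN : MeasurableSet N) {l' : ℝ} {h : Plane × Plane × Plane → ℝ≥0∞}
    (hh : Measurable h) :
    ∫⁻ p in {p : Plane × Plane × Plane | p.1 ∈ N ∧ p.2.1 ∈ coneBall e lam l p.1 ∧
        p.2.2 ∈ coneBall e lam l' p.1}, h p =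
      ∫⁻ x in N, ∫⁻ z in coneBall e lam l x, ∫⁻ z' in coneBall e lam l' x, h (x, z, z') := by
  have hΘ : MeasurableSet {p : Plane × Plane × Plane | p.1 ∈ N ∧ p.2.1 ∈ coneBall e lam l p.1 ∧
        p.2.2 ∈ coneBall e lam l' p.1} := by
    refine (measurable_fst hN).inter (MeasurableSet.inter ?_ ?_)
    · exact (measurable_fst.prodMk (measurable_fst.comp measurable_snd))
        (measurableSet_coneBall_prod (e := e) (lam := lam) (l := l))
    · exact (measurable_fst.prodMk (measurable_snd.comp measurable_snd))
        (measurableSet_coneBall_prod (e := e) (lam := lam) (l := l'))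
  rw [← lintegral_indicator hΘ, Measure.volume_eq_prod, lintegral_prod _ (hh.indicator hΘ).aemeasurable,
    ← lintegral_indicator hN]
  refine lintegral_congr fun x => ?_
  by_cases hx : x ∈ N
  · have hm : Measurable fun y => {p : Plane × Plane × Plane | p.1 ∈ N ∧ p.2.1 ∈ coneBall e lam l p.1 ∧
        p.2.2 ∈ coneBall e lam l' p.1}.indicator h (x, y) := (hh.indicator hΘ).comp measurable_prodMk_left
    rw [indicator_of_mem hx, Measure.volume_eq_prod, lintegral_prod _ hm.aemeasurable,
      ← lintegral_indicator (measurableSet_coneBall x)]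
    refine lintegral_congr fun z => ?_
    by_cases hz : z ∈ coneBall e lam l x
    · rw [indicator_of_mem hz, ← lintegral_indicator (measurableSet_coneBall x)]
      refine lintegral_congr fun z' => ?_
      by_cases hz' : z' ∈ coneBall e lam l' x
      · rw [indicator_of_mem hz', indicator_of_mem (by exact ⟨hx, hz, hz'⟩)]
      · rw [indicator_of_notMem hz', indicator_of_notMem fun hm => hz' hm.2.2]
    · rw [indicator_of_notMem hz]
      exact (lintegral_congr fun z' => indicator_of_notMem (fun hm => hz hm.2.1) _).trans lintegral_zero
  · rw [indicator_of_notMem hx]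
    exact (lintegral_congr fun z' => indicator_of_notMem (fun hm => hx hm.1) _).trans lintegral_zero

/-- The mean square deviation of `w` from `m` over the cone balls at the points of `N`. -/
def coneInt (N : Set Plane) (e m : Plane) (lam l : ℝ) (w : Plane → Plane) : ℝ≥0∞ :=
  ∫⁻ x in N, ∫⁻ z in coneBall e lam l x, ‖w z - m‖ₑ ^ 2

/-- Minkowski's inequality in `L²` of the triples `(x, z, z')` for `w z - m = (w z' - m) + (w z - w
z')`. Integration over the idle variable yields the volumes of the two balls. -/
lemma coneInt_minkowski (hN : MeasurableSet N) (hw : Measurable w) (hl : 0 ≤ l) (hlam : 0 ≤ lam) :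
    (ENNReal.ofReal ((2 * l) ^ 2 * (lam ^ 2 * Real.pi)) * coneInt N e m lam l w) ^ (1 / 2 : ℝ) ≤
      (ENNReal.ofReal (l ^ 2 * (lam ^ 2 * Real.pi)) * coneInt N e m lam (2 * l) w) ^ (1 / 2 : ℝ) +
        (∫⁻ x in N, ∫⁻ z in coneBall e lam l x, ∫⁻ z' in coneBall e lam (2 * l) x,
          ‖w z - w z'‖ₑ ^ 2) ^ (1 / 2 : ℝ) := by
  set ν := (volume : Measure (Plane × Plane × Plane)).restrict {p | p.1 ∈ N ∧
    p.2.1 ∈ coneBall e lam l p.1 ∧ p.2.2 ∈ coneBall e lam (2 * l) p.1} with hν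
  have m1 : Measurable fun p : Plane × Plane × Plane => ‖w p.2.1 - m‖ₑ :=
    ((hw.comp (measurable_fst.comp measurable_snd)).sub_const m).enorm
  have m2 : Measurable fun p : Plane × Plane × Plane => ‖w p.2.2 - m‖ₑ :=
    ((hw.comp (measurable_snd.comp measurable_snd)).sub_const m).enorm
  have m3 : Measurable fun p : Plane × Plane × Plane => ‖w p.2.1 - w p.2.2‖ₑ :=
    ((hw.comp (measurable_fst.comp measurable_snd)).sub
      (hw.comp (measurable_snd.comp measurable_snd))).enorm
  have e1 : ∫⁻ p, ‖w p.2.1 - m‖ₑ ^ (2 : ℝ) ∂ν =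
      ENNReal.ofReal ((2 * l) ^ 2 * (lam ^ 2 * Real.pi)) * coneInt N e m lam l w := by
    simp only [ENNReal.rpow_two]
    rw [hν, lintegral_triple hN (m1.pow_const 2), coneInt, ← lintegral_const_mul']
    · refine lintegral_congr fun x => ?_
      rw [← lintegral_const_mul' _ _ ENNReal.ofReal_ne_top]
      refine lintegral_congr fun z => ?_
      change ∫⁻ _ in coneBall e lam (2 * l) x, ‖w z - m‖ₑ ^ 2 = _
      rw [lintegral_const, Measure.restrict_apply MeasurableSet.univ, univ_inter,
        volume_coneBall (by positivity) hlam, mul_comm]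
    · exact ENNReal.ofReal_ne_top
  have e2 : ∫⁻ p, ‖w p.2.2 - m‖ₑ ^ (2 : ℝ) ∂ν =
      ENNReal.ofReal (l ^ 2 * (lam ^ 2 * Real.pi)) * coneInt N e m lam (2 * l) w := by
    simp only [ENNReal.rpow_two]
    rw [hν, lintegral_triple hN (m2.pow_const 2), coneInt, ← lintegral_const_mul']
    · refine lintegral_congr fun x => ?_
      change ∫⁻ _ in coneBall e lam l x, ∫⁻ z in coneBall e lam (2 * l) x, ‖w z - m‖ₑ ^ 2 = _
      rw [lintegral_const, Measure.restrict_apply MeasurableSet.univ, univ_inter,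
        volume_coneBall hl hlam, mul_comm]
    · exact ENNReal.ofReal_ne_top
  have e3 : ∫⁻ p, ‖w p.2.1 - w p.2.2‖ₑ ^ (2 : ℝ) ∂ν =
      ∫⁻ x in N, ∫⁻ z in coneBall e lam l x, ∫⁻ z' in coneBall e lam (2 * l) x, ‖w z - w z'‖ₑ ^ 2 := by
    simp only [ENNReal.rpow_two]
    rw [hν, lintegral_triple hN (m3.pow_const 2)]
  rw [← e1, ← e2, ← e3]
  refine le_trans ?_ (ENNReal.lintegral_Lp_add_le m2.aemeasurable m3.aemeasurable one_le_two)
  refine ENNReal.rpow_le_rpow (lintegral_mono fun p => ?_) (by norm_num)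
  refine ENNReal.rpow_le_rpow ?_ (by norm_num)
  simp only [Pi.add_apply]
  rw [add_comm]
  have : w p.2.1 - m = (w p.2.1 - w p.2.2) + (w p.2.2 - m) := by abel
  rw [this]
  exact enorm_add_le _ _

lemma measurable_gag_integrand (hw : Measurable w) (s : ℝ) :
    Measurable fun p : Plane × Plane => ‖w p.1 - w p.2‖ₑ ^ 2 / edist p.1 p.2 ^ (2 * (1 + s)) :=
  ((((hw.comp measurable_fst).sub (hw.comp measurable_snd)).enorm).pow_const 2).div
    ((measurable_fst.edist measurable_snd).pow_const _)

/-- The difference quotient bounds the difference at a bounded distance. -/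
lemma enorm_sq_le_gag_integrand (hs : 0 ≤ s) {x y : Plane} {d : ℝ} (hd : dist x y ≤ d) :
    ‖w x - w y‖ₑ ^ 2 ≤ ENNReal.ofReal (d ^ (2 * (1 + s))) *
      (‖w x - w y‖ₑ ^ 2 / edist x y ^ (2 * (1 + s))) := by
  rcases eq_or_ne x y with rfl | hxy
  · simp
  have hpos : 0 < dist x y := dist_pos.2 hxy
  have h1 : edist x y ^ (2 * (1 + s)) = ENNReal.ofReal (dist x y ^ (2 * (1 + s))) := by
    rw [edist_dist, ENNReal.ofReal_rpow_of_pos hpos]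
  have h2 : ENNReal.ofReal (dist x y ^ (2 * (1 + s))) ≠ 0 := by
    rw [ne_eq, ENNReal.ofReal_eq_zero, not_le]; positivity
  rw [h1]
  calc ‖w x - w y‖ₑ ^ 2 = ENNReal.ofReal (dist x y ^ (2 * (1 + s))) *
        (‖w x - w y‖ₑ ^ 2 / ENNReal.ofReal (dist x y ^ (2 * (1 + s)))) :=
      (ENNReal.mul_div_cancel h2 ENNReal.ofReal_ne_top).symm
    _ ≤ _ := by
      gcongr

end ThinTrace

section ThinTrace
variable {N E : Set Plane} {e m : Plane} {lam l δ s r : ℝ} {w : Plane → Plane}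

lemma enorm_add_sq_le {F : Type*} [NormedAddCommGroup F] (a b : F) :
    ‖a + b‖ₑ ^ 2 ≤ 2 * ‖a‖ₑ ^ 2 + 2 * ‖b‖ₑ ^ 2 := by
  calc ‖a + b‖ₑ ^ 2 ≤ (‖a‖ₑ + ‖b‖ₑ) ^ 2 := by gcongr; exact enorm_add_le a b
    _ ≤ _ := by
      have := ENNReal.rpow_add_le_mul_rpow_add_rpow ‖a‖ₑ ‖b‖ₑ (one_le_two)
      norm_num at this
      rw [← mul_add]
      simpa using this

/-- Both points lie within `2 l` and `l` of `x`, hence within `3 l` of each other, so a difference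
is bounded by its difference quotient times a power of `3 l`. The cone balls at `2 l` are then
enlarged to `E`, and `lintegral_coneBall_le` applies in `z`. -/
lemma lintegral_triple_le (hT : Thin N δ) (hl : 0 < l) (he : ‖e‖ + lam ≤ 1)
    (hE : MeasurableSet E) (h1 : ∀ x ∈ N, coneBall e lam l x ⊆ E)
    (h2 : ∀ x ∈ N, coneBall e lam (2 * l) x ⊆ E) (hw : Measurable w) (hs : 0 ≤ s) :
    ∫⁻ x in N, ∫⁻ z in coneBall e lam l x, ∫⁻ z' in coneBall e lam (2 * l) x, ‖w z - w z'‖ₑ ^ 2 ≤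
      ENNReal.ofReal ((3 * l) ^ (2 * (1 + s))) * (ENNReal.ofReal (8 * δ * l) * gag s E w) := by
  have hQ : Measurable fun z => ∫⁻ z' in E, ‖w z - w z'‖ₑ ^ 2 / edist z z' ^ (2 * (1 + s)) :=
    Measurable.lintegral_prod_right' (measurable_gag_integrand hw s)
  refine le_trans ?_ (mul_le_mul_right (lintegral_coneBall_le hT hl he hE h1 hQ) _)
  rw [← lintegral_const_mul' _ _ ENNReal.ofReal_ne_top]
  refine setLIntegral_mono' hT.1 fun x hx => ?_
  rw [← lintegral_const_mul' _ _ ENNReal.ofReal_ne_top]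
  refine setLIntegral_mono' (measurableSet_coneBall x) fun z hz => ?_
  rw [← lintegral_const_mul' _ _ ENNReal.ofReal_ne_top]
  refine le_trans (setLIntegral_mono' (measurableSet_coneBall x) fun z' hz' => ?_)
    (lintegral_mono_set (h2 x hx))
  refine enorm_sq_le_gag_integrand hs ?_
  have a1 := coneBall_subset he hl.le x hz
  have a2 := coneBall_subset he (by positivity) x hz'
  rw [Metric.mem_closedBall] at a1 a2
  calc dist z z' ≤ dist z x + dist z' x := dist_triangle_right _ _ _
    _ ≤ 3 * l := by linarith

lemma ofReal_rpow_half_mul {a : ℝ} (ha : 0 ≤ a) (X : ℝ≥0∞) :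
    (ENNReal.ofReal a * X) ^ (1 / 2 : ℝ) = ENNReal.ofReal √a * X ^ (1 / 2 : ℝ) := by
  rw [ENNReal.mul_rpow_of_nonneg _ _ (by norm_num), ENNReal.ofReal_rpow_of_nonneg ha (by norm_num),
    Real.sqrt_eq_rpow]

/-- Passing from the scale `l` to the scale `2 l`. -/
lemma coneInt_step (hT : Thin N δ) (hδ : 0 < δ) (hl : 0 < l) (hlam : 0 < lam) (he : ‖e‖ + lam ≤ 1)
    (hE : MeasurableSet E) (h1 : ∀ x ∈ N, coneBall e lam l x ⊆ E)
    (h2 : ∀ x ∈ N, coneBall e lam (2 * l) x ⊆ E) (hw : Measurable w) (hs : 0 ≤ s) :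
    (ENNReal.ofReal (l ^ 2 * (lam ^ 2 * Real.pi))⁻¹ * coneInt N e m lam l w) ^ (1 / 2 : ℝ) ≤
      (ENNReal.ofReal ((2 * l) ^ 2 * (lam ^ 2 * Real.pi))⁻¹ * coneInt N e m lam (2 * l) w) ^ (1 / 2 : ℝ) +
      ENNReal.ofReal (√(2 * 3 ^ (2 * (1 + s)) / (lam ^ 2 * Real.pi) ^ 2) * √δ * l ^ (s - 1 / 2)) *
        gag s E w ^ (1 / 2 : ℝ) := by
  set b := lam ^ 2 * Real.pi with hb
  have hpi := Real.pi_pos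
  have hb0 : 0 < b := by positivity
  have hM := coneInt_minkowski (e := e) (m := m) hT.1 hw hl.le hlam.le
  have hG := lintegral_triple_le hT hl he hE h1 h2 hw hs
  rw [← hb] at hM
  clear_value b
  set G := ∫⁻ x in N, ∫⁻ z in coneBall e lam l x, ∫⁻ z' in coneBall e lam (2 * l) x, ‖w z - w z'‖ₑ ^ 2
  -- The inverse product of the two ball volumes, which turns the integrals into averages.
  set c := (4 * l ^ 4 * b ^ 2)⁻¹ with hc
  have hc0 : 0 ≤ c := by positivity
  have hd := mul_le_mul_right hM (ENNReal.ofReal √c)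
  rw [mul_add, ← ofReal_rpow_half_mul hc0, ← ofReal_rpow_half_mul hc0, ← ofReal_rpow_half_mul hc0,
    ← mul_assoc, ← mul_assoc, ← ENNReal.ofReal_mul hc0, ← ENNReal.ofReal_mul hc0] at hd
  have e1 : c * ((2 * l) ^ 2 * b) = (l ^ 2 * b)⁻¹ := by rw [hc]; field_simp; ring
  have e2 : c * (l ^ 2 * b) = ((2 * l) ^ 2 * b)⁻¹ := by rw [hc]; field_simp; ring
  rw [e1, e2] at hd
  refine hd.trans (add_le_add le_rfl ?_)
  calc (ENNReal.ofReal c * G) ^ (1 / 2 : ℝ) ≤ (ENNReal.ofReal c * (ENNReal.ofReal ((3 * l) ^ (2 * (1 + s))) *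
        (ENNReal.ofReal (8 * δ * l) * gag s E w))) ^ (1 / 2 : ℝ) := by gcongr
    _ = _ := by
      rw [← mul_assoc, ← mul_assoc, ← ENNReal.ofReal_mul hc0, ← ENNReal.ofReal_mul (by positivity),
        ofReal_rpow_half_mul (by positivity)]
      congr 2
      have e3 : l ^ (s - 1 / 2) = √(l ^ (2 * s - 1)) := by
        rw [Real.sqrt_eq_rpow, ← Real.rpow_mul hl.le]; congr 1; ring
      rw [e3, ← Real.sqrt_mul (by positivity), ← Real.sqrt_mul (by positivity)]
      congr 1
      have e4 : (3 * l) ^ (2 * (1 + s)) = 3 ^ (2 * (1 + s)) * (l ^ (2 * s - 1) * l ^ 3) := by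
        rw [Real.mul_rpow (by norm_num) hl.le, ← Real.rpow_natCast l 3, ← Real.rpow_add hl]
        congr 2; push_cast; ring
      rw [e4, hc]
      field_simp
      ring

/-- Induction over dyadic scales. The step at scale `l` costs a multiple of `l ^ (s - 1/2)`; as `s >
1/2` these costs grow geometrically, and their sum is a fixed multiple of the last one. -/
lemma coneInt_chain (hT : Thin N δ) (hδ : 0 < δ) (hlam : 0 < lam) (he : ‖e‖ + lam ≤ 1)
    (hE : MeasurableSet E) (h : ∀ x ∈ N, ∀ l, 0 ≤ l → l ≤ r → coneBall e lam l x ⊆ E)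
    (hw : Measurable w) (hs : 1 / 2 < s) {κ : ℝ}
    (hκ : κ = √(2 * 3 ^ (2 * (1 + s)) / (lam ^ 2 * Real.pi) ^ 2)) (k : ℕ) (hk : δ * 2 ^ k ≤ r) :
    (ENNReal.ofReal (δ ^ 2 * (lam ^ 2 * Real.pi))⁻¹ * coneInt N e m lam δ w) ^ (1 / 2 : ℝ) ≤
      (ENNReal.ofReal ((δ * 2 ^ k) ^ 2 * (lam ^ 2 * Real.pi))⁻¹ * coneInt N e m lam (δ * 2 ^ k) w) ^ (1 / 2 : ℝ) +
      ENNReal.ofReal (κ / (2 ^ (s - 1 / 2) - 1) * √δ * (δ * 2 ^ k) ^ (s - 1 / 2)) *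
        gag s E w ^ (1 / 2 : ℝ) := by
  have hγ : (1 : ℝ) < 2 ^ (s - 1 / 2) := Real.one_lt_rpow one_lt_two (by linarith)
  have hκ0 : 0 ≤ κ := by rw [hκ]; positivity
  have hq : 0 ≤ κ / (2 ^ (s - 1 / 2) - 1) := div_nonneg hκ0 (by linarith)
  induction k with
  | zero =>
    rw [pow_zero, mul_one]
    exact le_self_add
  | succ k ih =>
    have hpos : 0 < δ * 2 ^ k := by positivity
    have hle : 2 * (δ * 2 ^ k) ≤ r := by rw [pow_succ] at hk; linarith
    have hle' : δ * 2 ^ k ≤ r := by linarith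
    have hst := coneInt_step (s := s) (m := m) hT hδ hpos hlam he hE (fun x hx => h x hx _ hpos.le hle')
      (fun x hx => h x hx _ (by positivity) hle) hw (by linarith)
    rw [← hκ] at hst
    have e1 : δ * 2 ^ (k + 1) = 2 * (δ * 2 ^ k) := by ring
    rw [e1]
    refine (ih hle').trans ?_
    refine (add_le_add hst le_rfl).trans ?_
    rw [add_assoc, ← add_mul, ← ENNReal.ofReal_add (by positivity) (by positivity)]
    refine add_le_add le_rfl (mul_le_mul' (ENNReal.ofReal_le_ofReal (le_of_eq ?_)) le_rfl)
    have h2 : (2 : ℝ) ^ (s - 1 / 2) - 1 ≠ 0 := by linarith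
    rw [Real.mul_rpow (by norm_num) hpos.le]
    generalize (2 : ℝ) ^ (s - 1 / 2) = q at h2 ⊢
    field_simp
    ring

/-- The mean square over a thin set is controlled by the scale-invariant norm on the set reached by
cones. -/
theorem thin_trace {s lam : ℝ} (hs : 1 / 2 < s) (hlam : 0 < lam) :
    ∃ C : ℝ, 0 < C ∧ ∀ {N E : Set Plane} {e : Plane} {δ r : ℝ} {w : Plane → Plane} (m : Plane),
      Thin N δ → 0 < δ → 0 < r → ‖e‖ + lam ≤ 1 → MeasurableSet E →
      (∀ x ∈ N, ∀ l, 0 ≤ l → l ≤ r → coneBall e lam l x ⊆ E) → Measurable w →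
      ∫⁻ x in N, ‖w x - m‖ₑ ^ 2 ≤ ENNReal.ofReal (C * δ) *
        (ENNReal.ofReal r⁻¹ * (∫⁻ x in E, ‖w x - m‖ₑ ^ 2) + ENNReal.ofReal (r ^ (2 * s - 1)) * gag s E w) := by
  set b := lam ^ 2 * Real.pi with hb
  have hpi := Real.pi_pos
  have hb0 : 0 < b := by positivity
  set κ := √(2 * 3 ^ (2 * (1 + s)) / (lam ^ 2 * Real.pi) ^ 2) with hκ
  set c := κ / (2 ^ (s - 1 / 2) - 1) with hc
  have hγ : (1 : ℝ) < 2 ^ (s - 1 / 2) := Real.one_lt_rpow one_lt_two (by linarith)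
  have hc0 : 0 ≤ c := div_nonneg (Real.sqrt_nonneg _) (by linarith)
  refine ⟨1 + 64 / b + (4 * c ^ 2 + 2 / b), by positivity, ?_⟩
  intro N E e δ r w m hT hδ hr he hE h hw
  set C := 1 + 64 / b + (4 * c ^ 2 + 2 / b) with hC
  have hC0 : 0 ≤ C := by positivity
  have hNE : N ⊆ E := fun x hx => h x hx 0 le_rfl hr.le (by
    rw [coneBall, Metric.mem_closedBall]; simp)
  set S := ∫⁻ x in E, ‖w x - m‖ₑ ^ 2 with hS
  set Γ := gag s E w with hΓ
  -- If the width exceeds `r` there is nothing to gain from thinness: `N ⊆ E` and `δ / r ≥ 1`.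
  rcases le_or_gt r δ with hrδ | hδr
  · calc ∫⁻ x in N, ‖w x - m‖ₑ ^ 2 ≤ S := lintegral_mono_set hNE
      _ = ENNReal.ofReal 1 * S := by simp
      _ ≤ ENNReal.ofReal (C * δ * r⁻¹) * S := by
        gcongr
        rw [← div_eq_mul_inv, le_div_iff₀ hr, one_mul]
        have : 1 ≤ C := by
          have : 0 ≤ 64 / b + (4 * c ^ 2 + 2 / b) := by positivity
          rw [hC]; linarith
        nlinarith
      _ ≤ _ := by
        rw [ENNReal.ofReal_mul (by positivity), mul_assoc]
        gcongr
        exact le_self_add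
  -- The chain ends at a scale `R = δ 2 ^ k` with `R ≤ r < 2 R`, where the average is replaced by
  -- the full integral over `E`.
  obtain ⟨k, hk1, hk2⟩ : ∃ k : ℕ, δ * 2 ^ k ≤ r ∧ r < δ * 2 ^ (k + 1) := by
    obtain ⟨k, h1, h2⟩ := exists_nat_pow_near (x := r / δ) (y := 2)
      ((one_le_div hδ).2 hδr.le) one_lt_two
    refine ⟨k, ?_, ?_⟩
    · rw [le_div_iff₀ hδ] at h1; linarith
    · rw [div_lt_iff₀ hδ] at h2; linarith
  set R := δ * 2 ^ k with hR
  have hR0 : 0 < R := by positivity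
  have hRr : r < 2 * R := by rw [hR]; rw [pow_succ] at hk2; linarith
  have hchain := coneInt_chain (m := m) hT hδ hlam he hE h hw hs hκ k hk1
  rw [← hR, ← hb, ← hc, ← hΓ] at hchain
  clear_value R
  have hend : coneInt N e m lam R w ≤ ENNReal.ofReal (8 * δ * R) * S :=
    lintegral_coneBall_le hT hR0 he hE (fun x hx => h x hx R hR0.le hk1)
      (((hw.sub_const m).enorm).pow_const 2)
  have hrp : (r : ℝ) ^ (2 * s - 1) = (r ^ (s - 1 / 2)) ^ 2 := by
    rw [← Real.rpow_natCast, ← Real.rpow_mul hr.le]; congr 1; push_cast; ring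
  have hRγ : R ^ (s - 1 / 2) ≤ r ^ (s - 1 / 2) := Real.rpow_le_rpow hR0.le hk1 (by linarith)
  have hFδ : ENNReal.ofReal (δ ^ 2 * b)⁻¹ * coneInt N e m lam δ w ≤
      ENNReal.ofReal (32 / b * δ * r⁻¹) * S + ENNReal.ofReal (2 * c ^ 2 * δ * r ^ (2 * s - 1)) * Γ := by
    have hsq : ∀ X : ℝ≥0∞, (X ^ (1 / 2 : ℝ)) ^ 2 = X := fun X => by
      rw [← ENNReal.rpow_natCast, ← ENNReal.rpow_mul]; norm_num
    have h1 := pow_le_pow_left' hchain 2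
    rw [hsq] at h1
    have h2 : ∀ X Y : ℝ≥0∞, (X + Y) ^ 2 ≤ 2 * X ^ 2 + 2 * Y ^ 2 := fun X Y => by
      have := ENNReal.rpow_add_le_mul_rpow_add_rpow X Y (one_le_two)
      norm_num at this
      rw [← mul_add]
      simpa using this
    refine (h1.trans (h2 _ _)).trans ?_
    rw [hsq, mul_pow, hsq]
    refine add_le_add ?_ ?_
    · calc 2 * (ENNReal.ofReal (R ^ 2 * b)⁻¹ * coneInt N e m lam R w) ≤
          ENNReal.ofReal 2 * (ENNReal.ofReal (R ^ 2 * b)⁻¹ * (ENNReal.ofReal (8 * δ * R) * S)) := by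
            rw [ENNReal.ofReal_ofNat]; gcongr
        _ = ENNReal.ofReal (2 * ((R ^ 2 * b)⁻¹ * (8 * δ * R))) * S := by
            rw [ENNReal.ofReal_mul (p := 2) (by norm_num),
              ENNReal.ofReal_mul (p := (R ^ 2 * b)⁻¹) (by positivity)]
            ring
        _ ≤ _ := by
            refine mul_le_mul' (ENNReal.ofReal_le_ofReal ?_) le_rfl
            have : 2 * ((R ^ 2 * b)⁻¹ * (8 * δ * R)) = 16 / b * δ * R⁻¹ := by field_simp; ring
            rw [this]
            have h3 : R⁻¹ ≤ 2 * r⁻¹ := by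
              rw [← div_eq_mul_inv, inv_eq_one_div, div_le_div_iff₀ hR0 hr]; linarith
            calc 16 / b * δ * R⁻¹ ≤ 16 / b * δ * (2 * r⁻¹) := by gcongr
              _ = _ := by ring
    · rw [← ENNReal.ofReal_pow (by positivity), ← mul_assoc, ← ENNReal.ofReal_ofNat 2,
        ← ENNReal.ofReal_mul (by norm_num)]
      refine mul_le_mul' (ENNReal.ofReal_le_ofReal ?_) le_rfl
      rw [mul_pow, mul_pow, Real.sq_sqrt hδ.le, hrp]
      have : (R ^ (s - 1 / 2)) ^ 2 ≤ (r ^ (s - 1 / 2)) ^ 2 := by gcongr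
      have h4 : 0 ≤ c ^ 2 * δ := by positivity
      nlinarith
  -- The first link compares `w x` with its values on the cone ball of scale `δ`. After division by
  -- the ball volume its cost is of order `δ ^ (2 s) = δ * δ ^ (2 s - 1)`, and `δ ≤ r`.
  have hstart : ENNReal.ofReal (δ ^ 2 * b) * ∫⁻ x in N, ‖w x - m‖ₑ ^ 2 ≤
      2 * coneInt N e m lam δ w + 2 * (ENNReal.ofReal (δ ^ (2 * (1 + s))) * Γ) := by
    rw [← lintegral_const_mul' _ _ ENNReal.ofReal_ne_top]
    have hmz : ∀ _ : ℕ, Measurable fun z => ‖w z - m‖ₑ ^ 2 := fun _ => ((hw.sub_const m).enorm).pow_const 2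
    have hA : Measurable fun x => ∫⁻ z in coneBall e lam δ x, ‖w z - m‖ₑ ^ 2 := by
      have h1 : (fun x => ∫⁻ z in coneBall e lam δ x, ‖w z - m‖ₑ ^ 2) = fun x =>
          ∫⁻ z, {p : Plane × Plane | p.2 ∈ coneBall e lam δ p.1}.indicator
            (fun p => ‖w p.2 - m‖ₑ ^ 2) (x, z) := by
        funext x
        rw [← lintegral_indicator (measurableSet_coneBall x)]; rfl
      rw [h1]
      exact Measurable.lintegral_prod_right' (((hmz 0).comp measurable_snd).indicator measurableSet_coneBall_prod)
    calc ∫⁻ x in N, ENNReal.ofReal (δ ^ 2 * b) * ‖w x - m‖ₑ ^ 2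
        ≤ ∫⁻ x in N, (2 * (∫⁻ z in coneBall e lam δ x, ‖w z - m‖ₑ ^ 2) +
            2 * (ENNReal.ofReal (δ ^ (2 * (1 + s))) *
              ∫⁻ z in E, ‖w x - w z‖ₑ ^ 2 / edist x z ^ (2 * (1 + s)))) := by
          refine setLIntegral_mono' hT.1 fun x hx => ?_
          rw [hb, ← volume_coneBall (e := e) hδ.le hlam.le x, mul_comm, ← setLIntegral_const]
          calc ∫⁻ _ in coneBall e lam δ x, ‖w x - m‖ₑ ^ 2 ≤
              ∫⁻ z in coneBall e lam δ x, (2 * ‖w z - m‖ₑ ^ 2 + 2 * (ENNReal.ofReal (δ ^ (2 * (1 + s))) *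
                (‖w x - w z‖ₑ ^ 2 / edist x z ^ (2 * (1 + s))))) := by
                refine setLIntegral_mono' (measurableSet_coneBall x) fun z hz => ?_
                have e1 : w x - m = (w z - m) + (w x - w z) := by abel
                rw [e1]
                refine (enorm_add_sq_le _ _).trans (add_le_add le_rfl ?_)
                gcongr
                refine enorm_sq_le_gag_integrand (by linarith) ?_
                have := coneBall_subset he hδ.le x hz
                rwa [Metric.mem_closedBall, dist_comm] at this
            _ = 2 * (∫⁻ z in coneBall e lam δ x, ‖w z - m‖ₑ ^ 2) + 2 * (ENNReal.ofReal (δ ^ (2 * (1 + s))) *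
                ∫⁻ z in coneBall e lam δ x, ‖w x - w z‖ₑ ^ 2 / edist x z ^ (2 * (1 + s))) := by
                rw [lintegral_add_left ((hmz 0).const_mul 2), lintegral_const_mul' _ _ (by norm_num),
                  lintegral_const_mul' _ _ (by norm_num), lintegral_const_mul' _ _ ENNReal.ofReal_ne_top]
            _ ≤ _ := by
                gcongr
                exact h x hx δ hδ.le hδr.le
      _ = 2 * coneInt N e m lam δ w + 2 * (ENNReal.ofReal (δ ^ (2 * (1 + s))) *
            ∫⁻ x in N, ∫⁻ z in E, ‖w x - w z‖ₑ ^ 2 / edist x z ^ (2 * (1 + s))) := by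
          rw [lintegral_add_left (hA.const_mul 2), lintegral_const_mul' _ _ (by norm_num),
            lintegral_const_mul' _ _ (by norm_num), lintegral_const_mul' _ _ ENNReal.ofReal_ne_top]
          rfl
      _ ≤ _ := by
          gcongr
          exact lintegral_mono_set hNE
  have hinv : ENNReal.ofReal (δ ^ 2 * b)⁻¹ * ENNReal.ofReal (δ ^ 2 * b) = 1 := by
    rw [← ENNReal.ofReal_mul (by positivity), inv_mul_cancel₀ (by positivity), ENNReal.ofReal_one]
  calc ∫⁻ x in N, ‖w x - m‖ₑ ^ 2 = ENNReal.ofReal (δ ^ 2 * b)⁻¹ *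
        (ENNReal.ofReal (δ ^ 2 * b) * ∫⁻ x in N, ‖w x - m‖ₑ ^ 2) := by rw [← mul_assoc, hinv, one_mul]
    _ ≤ ENNReal.ofReal (δ ^ 2 * b)⁻¹ *
        (2 * coneInt N e m lam δ w + 2 * (ENNReal.ofReal (δ ^ (2 * (1 + s))) * Γ)) := by gcongr
    _ = 2 * (ENNReal.ofReal (δ ^ 2 * b)⁻¹ * coneInt N e m lam δ w) +
        ENNReal.ofReal (2 / b * δ * δ ^ (2 * s - 1)) * Γ := by
        rw [mul_add]
        congr 1
        · ring
        · have e1 : 2 / b * δ * δ ^ (2 * s - 1) = (δ ^ 2 * b)⁻¹ * (2 * δ ^ (2 * (1 + s))) := by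
            have : δ ^ (2 * (1 + s)) = δ ^ 3 * δ ^ (2 * s - 1) := by
              rw [← Real.rpow_natCast, ← Real.rpow_add hδ]; congr 1; push_cast; ring
            rw [this]; field_simp
          rw [e1, ENNReal.ofReal_mul (by positivity), ENNReal.ofReal_mul (by norm_num), ENNReal.ofReal_ofNat]
          ring
    _ ≤ 2 * (ENNReal.ofReal (32 / b * δ * r⁻¹) * S + ENNReal.ofReal (2 * c ^ 2 * δ * r ^ (2 * s - 1)) * Γ) +
        ENNReal.ofReal (2 / b * δ * r ^ (2 * s - 1)) * Γ := by
        gcongr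
        linarith
    _ = ENNReal.ofReal (64 / b * δ * r⁻¹) * S +
        ENNReal.ofReal ((4 * c ^ 2 + 2 / b) * δ * r ^ (2 * s - 1)) * Γ := by
        have hrs : 0 ≤ r ^ (2 * s - 1) := by positivity
        rw [mul_add, add_assoc, ← mul_assoc, ← mul_assoc, ← ENNReal.ofReal_ofNat 2,
          ← ENNReal.ofReal_mul (by norm_num), ← ENNReal.ofReal_mul (by norm_num), ← add_mul,
          ← ENNReal.ofReal_add (by positivity) (by positivity)]
        congr 3 <;> ring
    _ ≤ ENNReal.ofReal (C * δ * r⁻¹) * S + ENNReal.ofReal (C * δ * r ^ (2 * s - 1)) * Γ := by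
        have a1 : 64 / b ≤ C := by
          have : 0 ≤ 1 + (4 * c ^ 2 + 2 / b) := by positivity
          rw [hC]; linarith
        have a2 : 4 * c ^ 2 + 2 / b ≤ C := by
          have : 0 ≤ 64 / b := by positivity
          rw [hC]; linarith
        gcongr
    _ = _ := by
        rw [ENNReal.ofReal_mul (by positivity), ENNReal.ofReal_mul (q := r ^ (2 * s - 1)) (by positivity)]
        ring

end ThinTrace

/-- A functional that is bounded by `‖tr ·‖` is represented by a vector of the Hilbert space. -/
lemma exists_riesz {S H : Type*} [AddCommGroup S] [Module ℝ S] [NormedAddCommGroup H]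
    [InnerProductSpace ℝ H] [CompleteSpace H] (tr : S →ₗ[ℝ] H) (l : S →ₗ[ℝ] ℝ) {B : ℝ} (hB : 0 ≤ B)
    (h : ∀ φ, |l φ| ≤ B * ‖tr φ‖) : ∃ g : H, ‖g‖ ≤ B ∧ ∀ φ, l φ = inner ℝ g (tr φ) := by
  have hk : LinearMap.ker tr ≤ LinearMap.ker l := fun φ hφ => by
    have := h φ
    rw [LinearMap.mem_ker.1 hφ, norm_zero, mul_zero] at this
    exact LinearMap.mem_ker.2 (abs_nonpos_iff.1 this)
  -- Since `l` vanishes on the kernel of `tr`, it descends to the range; the functional is then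
  -- extended with the same norm and represented by Riesz' theorem.
  let f : LinearMap.range tr →ₗ[ℝ] ℝ :=
    (LinearMap.ker tr).liftQ l hk ∘ₗ tr.quotKerEquivRange.symm.toLinearMap
  have hf : ∀ φ, f ⟨tr φ, LinearMap.mem_range_self tr φ⟩ = l φ := fun φ => by
    have : tr.quotKerEquivRange.symm ⟨tr φ, LinearMap.mem_range_self tr φ⟩ =
        Submodule.Quotient.mk φ := by
      rw [LinearEquiv.symm_apply_eq]; rfl
    simp [f, this]
  have hfB : ∀ y, ‖f y‖ ≤ B * ‖y‖ := by
    rintro ⟨_, φ, rfl⟩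
    rw [hf]
    exact h φ
  obtain ⟨F, hF, hFn⟩ := _root_.exists_extension_norm_eq (LinearMap.range tr) (f.mkContinuous B hfB)
  refine ⟨(InnerProductSpace.toDual ℝ H).symm F, ?_, fun φ => ?_⟩
  · rw [LinearIsometryEquiv.norm_map, hFn]
    exact f.mkContinuous_norm_le hB hfB
  · rw [InnerProductSpace.toDual_symm_apply, ← hf]
    exact (hF ⟨tr φ, LinearMap.mem_range_self tr φ⟩).symm

/-! ### Isometric coordinates and regions between graphs -/

section Frame

lemma exists_unit (p : Plane) : ∃ τ : Plane, ‖τ‖ = 1 ∧ p = ‖p‖ • τ := by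
  by_cases h : p = 0
  · exact ⟨EuclideanSpace.single 0 1, by simp, by simp [h]⟩
  · exact ⟨‖p‖⁻¹ • p, by rw [norm_smul, norm_inv, norm_norm, inv_mul_cancel₀ (norm_ne_zero_iff.2 h)],
      by rw [smul_inv_smul₀ (norm_ne_zero_iff.2 h)]⟩

/-- Cartesian coordinates in which `p` is the origin and `q` lies on the positive first axis. -/
lemma exists_frame (p q : Plane) : ∃ T : Plane ≃ᵃⁱ[ℝ] Plane, T p = 0 ∧ T q = !₂[dist p q, 0] := by
  obtain ⟨τ, h1, h2⟩ := exists_unit (q - p)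
  let l : Plane →ₗ[ℝ] Plane :=
    { toFun := fun x => !₂[inner ℝ τ x, cr τ x]
      map_add' := fun x y => by
        ext i; fin_cases i <;> simp [cr, inner_add_right]; ring
      map_smul' := fun c x => by
        ext i; fin_cases i <;> simp [cr, inner_smul_right]; ring }
  have hl : ∀ x, l x = !₂[inner ℝ τ x, cr τ x] := fun _ => rfl
  let L : Plane →ₗᵢ[ℝ] Plane :=
    { l with
      norm_map' := fun x => by
        rw [← sq_eq_sq₀ (norm_nonneg _) (norm_nonneg _), hl, norm_sq_plane]
        have := cr_sq_add_inner_sq τ x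
        rw [h1] at this
        simp
        linarith }
  let E : Plane ≃ₗᵢ[ℝ] Plane := L.toLinearIsometryEquiv rfl
  refine ⟨(AffineIsometryEquiv.vaddConst ℝ p).symm.trans E.toAffineIsometryEquiv, ?_, ?_⟩
  · simp
  · have : ((AffineIsometryEquiv.vaddConst ℝ p).symm.trans E.toAffineIsometryEquiv) q = l (q - p) := rfl
    rw [this, hl, h2, dist_comm, dist_eq_norm, inner_smul_right, real_inner_self_eq_norm_sq, h1]
    have hc : cr τ (‖q - p‖ • τ) = 0 := by simp [cr]; ring
    rw [hc]
    simp

lemma measurePreserving_affineIsometry (T : Plane ≃ᵃⁱ[ℝ] Plane) : MeasurePreserving T volume volume := by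
  have h : (T : Plane → Plane) = (fun y => y + T 0) ∘ T.linearIsometryEquiv := by
    ext1 x
    have := T.map_vadd 0 x
    simpa using this
  rw [h]
  exact (measurePreserving_add_right volume (T 0)).comp T.linearIsometryEquiv.measurePreserving

lemma measurableEmbedding_affineIsometry (T : Plane ≃ᵃⁱ[ℝ] Plane) : MeasurableEmbedding T :=
  T.toHomeomorph.measurableEmbedding

lemma contDiff_affineIsometry (T : Plane ≃ᵃⁱ[ℝ] Plane) {n : WithTop ℕ∞} : ContDiff ℝ n T := by
  have h : (T : Plane → Plane) = fun x => T.linearIsometryEquiv x + T 0 := by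
    ext1 x
    have := T.map_vadd 0 x
    simpa using this
  rw [h]
  exact T.linearIsometryEquiv.contDiff.add contDiff_const

lemma volume_preimage_frame (T : Plane ≃ᵃⁱ[ℝ] Plane) (s : Set Plane) :
    volume (T ⁻¹' s) = volume s :=
  (measurePreserving_affineIsometry T).measure_preimage_emb (measurableEmbedding_affineIsometry T) s

/-- The measure of the region between two graphs. -/
lemma volume_frame_graph (T : Plane ≃ᵃⁱ[ℝ] Plane) {I : Set ℝ} (hI : MeasurableSet I) {g₁ g₂ : ℝ → ℝ}
    (h1 : Measurable g₁) (h2 : Measurable g₂) :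
    volume {x | T x 0 ∈ I ∧ g₁ (T x 0) < T x 1 ∧ T x 1 < g₂ (T x 0)} =
      ∫⁻ t in I, ENNReal.ofReal (g₂ t - g₁ t) := by
  have e1 : {x | T x 0 ∈ I ∧ g₁ (T x 0) < T x 1 ∧ T x 1 < g₂ (T x 0)} =
      T ⁻¹' {y | y 0 ∈ I ∧ g₁ (y 0) < y 1 ∧ y 1 < g₂ (y 0)} := rfl
  have e2 : planeEquiv ⁻¹' {y | y 0 ∈ I ∧ g₁ (y 0) < y 1 ∧ y 1 < g₂ (y 0)} = regionBetween g₁ g₂ I := by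
    ext z
    simp [planeEquiv_apply, regionBetween]
  rw [e1, volume_preimage_frame, ← measurePreserving_planeEquiv.measure_preimage_equiv, e2]
  exact volume_regionBetween_eq_lintegral h1.aemeasurable h2.aemeasurable hI

/-- A set that lies in a neighbourhood of a graph is thin. -/
lemma thin_of_graph (T : Plane ≃ᵃⁱ[ℝ] Plane) {f : ℝ → ℝ} (hf : Measurable f) {a b δ : ℝ}
    (hab : b - a ≤ 4 * δ) {N : Set Plane} (hN : MeasurableSet N)
    (h : ∀ x ∈ N, f (T x 0) + a < T x 1 ∧ T x 1 < f (T x 0) + b) : Thin N δ := by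
  refine ⟨hN, fun z l hl => ?_⟩
  have hsub : N ∩ Metric.closedBall z l ⊆ {x | T x 0 ∈ Icc (T z 0 - l) (T z 0 + l) ∧
      (fun t => f t + a) (T x 0) < T x 1 ∧ T x 1 < (fun t => f t + b) (T x 0)} := by
    rintro x ⟨hx, hxl⟩
    refine ⟨?_, h x hx⟩
    have h1 : dist (T x) (T z) ≤ l := by rw [T.dist_map]; exact hxl
    have h2 : |T x 0 - T z 0| ≤ l := by
      refine le_trans ?_ h1
      rw [dist_eq_norm, ← Real.norm_eq_abs]
      exact PiLp.norm_apply_le (T x - T z) 0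
    have := abs_le.1 h2
    constructor <;> linarith
  refine (measure_mono hsub).trans ?_
  rw [volume_frame_graph T measurableSet_Icc (hf.add_const a) (hf.add_const b)]
  have : ∀ t, f t + b - (f t + a) = b - a := fun t => by ring
  simp only [this, lintegral_const, Measure.restrict_apply_univ, Real.volume_Icc]
  rw [← ENNReal.ofReal_mul' (by linarith)]
  apply ENNReal.ofReal_le_ofReal
  nlinarith

end Frame

/-! ## Cut-off functions near the edges -/

section Cutoff

lemma exists_lipschitz_smoothTransition : ∃ C : NNReal, LipschitzWith C Real.smoothTransition := by
  have hd : ContDiff ℝ 1 Real.smoothTransition := Real.smoothTransition.contDiff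
  obtain ⟨C, hC⟩ := isCompact_Icc.exists_bound_of_continuousOn (s := Icc (0 : ℝ) 1)
    (hd.continuous_deriv le_rfl).continuousOn
  refine ⟨Real.toNNReal (max C 0), lipschitzWith_of_nnnorm_deriv_le
    (hd.differentiable one_ne_zero) fun x => ?_⟩
  rw [← NNReal.coe_le_coe, coe_nnnorm, Real.coe_toNNReal _ (le_max_right _ _)]
  by_cases h0 : x < 0
  · have : Real.smoothTransition =ᶠ[nhds x] fun _ => 0 := by
      filter_upwards [Iio_mem_nhds h0] with y hy
      exact Real.smoothTransition.zero_of_nonpos (le_of_lt hy)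
    rw [this.deriv_eq]; simp
  by_cases h1 : 1 < x
  · have : Real.smoothTransition =ᶠ[nhds x] fun _ => 1 := by
      filter_upwards [Ioi_mem_nhds h1] with y hy
      exact Real.smoothTransition.one_of_one_le (le_of_lt hy)
    rw [this.deriv_eq]; simp
  exact (hC x ⟨not_lt.1 h0, not_lt.1 h1⟩).trans (le_max_left _ _)

lemma norm_fderiv_prod_le {ι : Type*} (s : Finset ι) {f : ι → Plane → ℝ}
    (hd : ∀ i, Differentiable ℝ (f i)) (h0 : ∀ i x, 0 ≤ f i x) (h1 : ∀ i x, f i x ≤ 1) (x : Plane) :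
    ‖fderiv ℝ (fun y => ∏ i ∈ s, f i y) x‖ ≤ ∑ i ∈ s, ‖fderiv ℝ (f i) x‖ := by
  classical
  have hfd := fderiv_finsetProd (𝕜 := ℝ) (u := s) (g := f) (x := x) fun i _ => (hd i) x
  have e : (fun y => ∏ i ∈ s, f i y) = (∏ i ∈ s, f i ·) := rfl
  rw [e, hfd]
  refine (norm_sum_le _ _).trans (Finset.sum_le_sum fun i _ => ?_)
  rw [norm_smul]
  refine mul_le_of_le_one_left (norm_nonneg _) ?_
  rw [Real.norm_eq_abs, abs_of_nonneg (Finset.prod_nonneg fun j _ => h0 j x)]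
  exact Finset.prod_le_one (fun j _ => h0 j x) fun j _ => h1 j x

/-- The distances of `y` to the sides of `[0, h] × {0}`, with a sign. -/
def boxDist (h : ℝ) (k : Fin 4) (y : Plane) : ℝ := ![y 0, h - y 0, y 1, -y 1] k

/-- The box around `[0, h] × {0}` in the coordinates `T`. -/
def boxSet (T : Plane ≃ᵃⁱ[ℝ] Plane) (h δ : ℝ) : Set Plane := {x | ∀ k, -(2 * δ) < boxDist h k (T x)}

/-- A cut-off function which is supported in a box. -/
def boxCut (T : Plane ≃ᵃⁱ[ℝ] Plane) (h δ : ℝ) (x : Plane) : ℝ :=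
  ∏ k, Real.smoothTransition (2 + boxDist h k (T x) / δ)

variable (T : Plane ≃ᵃⁱ[ℝ] Plane) {h δ : ℝ}

lemma lipschitzWith_boxDist (h : ℝ) (k : Fin 4) : LipschitzWith 1 (boxDist h k) := by
  refine LipschitzWith.of_dist_le_mul fun x y => ?_
  have h0 := PiLp.norm_apply_le (x - y) 0
  have h1 := PiLp.norm_apply_le (x - y) 1
  rw [← dist_eq_norm] at h0 h1
  rw [Real.dist_eq]
  simp only [PiLp.sub_apply, Real.norm_eq_abs] at h0 h1
  fin_cases k <;> simp [boxDist]
  · exact h0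
  · rw [abs_sub_comm]; exact h0
  · exact h1
  · rw [show -x 1 + y 1 = -(x 1 - y 1) by ring, abs_neg]; exact h1

lemma contDiff_boxDist (h : ℝ) (k : Fin 4) : ContDiff ℝ ∞ (boxDist h k) := by
  unfold boxDist
  fin_cases k <;> simp <;> fun_prop

lemma contDiff_boxFactor (k : Fin 4) :
    ContDiff ℝ ∞ fun x => Real.smoothTransition (2 + boxDist h k (T x) / δ) :=
  Real.smoothTransition.contDiff.comp
    (contDiff_const.add (((contDiff_boxDist h k).comp (contDiff_affineIsometry T)).div_const δ))

lemma contDiff_boxCut : ContDiff ℝ ∞ (boxCut T h δ) :=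
  contDiff_prod fun k _ => contDiff_boxFactor T k

lemma boxCut_nonneg (x : Plane) : 0 ≤ boxCut T h δ x :=
  Finset.prod_nonneg fun _ _ => Real.smoothTransition.nonneg _

lemma boxCut_le_one (x : Plane) : boxCut T h δ x ≤ 1 :=
  Finset.prod_le_one (fun _ _ => Real.smoothTransition.nonneg _) fun _ _ => Real.smoothTransition.le_one _

lemma boxCut_eq_zero (hδ : 0 < δ) {x : Plane} (hx : x ∉ boxSet T h δ) : boxCut T h δ x = 0 := by
  simp only [boxSet, mem_ofPred_eq, not_forall, not_lt] at hx
  obtain ⟨k, hk⟩ := hx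
  refine Finset.prod_eq_zero (Finset.mem_univ k) (Real.smoothTransition.zero_of_nonpos ?_)
  rw [← sub_nonpos, show 2 + boxDist h k (T x) / δ - 0 = (boxDist h k (T x) + 2 * δ) / δ by
    field_simp; ring]
  exact div_nonpos_of_nonpos_of_nonneg (by linarith) hδ.le

lemma boxCut_eq_one (hδ : 0 < δ) {x : Plane} (hx : ∀ k, -δ ≤ boxDist h k (T x)) :
    boxCut T h δ x = 1 := by
  refine Finset.prod_eq_one fun k _ => Real.smoothTransition.one_of_one_le ?_
  have : -1 ≤ boxDist h k (T x) / δ := by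
    rw [le_div_iff₀ hδ]; linarith [hx k]
  linarith

/-- Each of the four factors varies at the rate `1 / δ`. Outside the box the cut-off is zero, hence
minimal, and its derivative vanishes there without any discussion of the boundary of the box. -/
lemma exists_norm_fderiv_boxCut_le : ∃ C : ℝ, 0 ≤ C ∧ ∀ (T : Plane ≃ᵃⁱ[ℝ] Plane) (h δ : ℝ), 0 < δ →
    ∀ x, ‖fderiv ℝ (boxCut T h δ) x‖ ≤ (boxSet T h δ).indicator (fun _ => C / δ) x := by
  obtain ⟨C, hC⟩ := exists_lipschitz_smoothTransition
  refine ⟨4 * C, by positivity, fun T h δ hδ x => ?_⟩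
  by_cases hx : x ∈ boxSet T h δ
  · rw [indicator_of_mem hx]
    refine (norm_fderiv_prod_le _ (fun k => (contDiff_boxFactor T k).differentiable (by simp))
      (fun _ _ => Real.smoothTransition.nonneg _) (fun _ _ => Real.smoothTransition.le_one _) x).trans ?_
    have key : ∀ k ∈ Finset.univ, ‖fderiv ℝ (fun x => Real.smoothTransition
        (2 + boxDist h k (T x) / δ)) x‖ ≤ C / δ := fun k _ => by
      have hl : LipschitzWith (C * Real.toNNReal δ⁻¹) fun x => Real.smoothTransition
          (2 + boxDist h k (T x) / δ) := by
        refine hC.comp (LipschitzWith.of_dist_le_mul fun y z => ?_)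
        have h2 := (lipschitzWith_boxDist h k).dist_le_mul (T y) (T z)
        rw [T.dist_map, NNReal.coe_one, one_mul, Real.dist_eq] at h2
        rw [Real.dist_eq, Real.coe_toNNReal _ (by positivity), add_sub_add_left_eq_sub, ← sub_div,
          abs_div, abs_of_pos hδ, div_eq_inv_mul]
        gcongr
      refine (norm_fderiv_le_of_lipschitz ℝ hl).trans_eq ?_
      rw [NNReal.coe_mul, Real.coe_toNNReal _ (by positivity), div_eq_mul_inv]
    refine (Finset.sum_le_sum key).trans_eq ?_
    simp; ring
  · rw [indicator_of_notMem hx]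
    have hm : IsLocalMin (boxCut T h δ) x := by
      refine Filter.Eventually.of_forall fun y => ?_
      rw [boxCut_eq_zero T hδ hx]
      exact boxCut_nonneg T y
    rw [hm.fderiv_eq_zero, norm_zero]

lemma measurableSet_boxSet : MeasurableSet (boxSet T h δ) := by
  have : boxSet T h δ = ⋂ k, {x | -(2 * δ) < boxDist h k (T x)} := by
    ext; simp [boxSet]
  rw [this]
  exact MeasurableSet.iInter fun k => (isOpen_lt continuous_const
    ((contDiff_boxDist h k).continuous.comp T.continuous)).measurableSet

lemma boxSet_eq : boxSet T h δ = T ⁻¹' {y | y 0 ∈ Ioo (-(2 * δ)) (h + 2 * δ) ∧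
    y 1 ∈ Ioo (-(2 * δ)) (2 * δ)} := by
  ext x
  simp only [boxSet, boxDist, mem_ofPred_eq, Fin.forall_fin_succ, mem_preimage, mem_Ioo]
  simp
  constructor
  · rintro ⟨a, b, c, d⟩; exact ⟨⟨by linarith, by linarith⟩, by linarith, by linarith⟩
  · rintro ⟨⟨a, b⟩, c, d⟩; exact ⟨by linarith, by linarith, by linarith, by linarith⟩

/-- The integral over a box shrinking to an edge. -/
lemma integral_boxSet_le {φ : Plane → ℝ} (hφ : Continuous φ) (hc : HasCompactSupport φ)
    (hh : 0 < h) {ε : ℝ} (hε : 0 < ε) :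
    ∃ δ₀ > 0, ∀ δ, 0 < δ → δ < δ₀ → ∫ x in boxSet T h δ, φ x ≤
      δ * (4 * (∫ t in (0 : ℝ)..h, φ (T.symm !₂[t, 0])) + ε) := by
  set g : ℝ → ℝ := fun t => φ (T.symm !₂[t, 0]) with hg
  have hgc : Continuous g := by
    refine hφ.comp (T.symm.continuous.comp ?_)
    fun_prop
  obtain ⟨δ₁, hδ₁, hu⟩ := Metric.uniformContinuous_iff.1 (hc.uniformContinuous_of_continuous hφ)
    (ε / (8 * (h + 1))) (by positivity)
  -- The box has height `4 δ` and contains only points close to its axis, so the integrand is at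
  -- most its value on the axis plus a small error. `P` is a primitive of that bound; its continuity
  -- absorbs the excess length `4 δ` of the box.
  set P : ℝ → ℝ := fun x => ∫ t in (0 : ℝ)..x, (g t + ε / (8 * (h + 1))) with hP
  have hFc : Continuous fun t => g t + ε / (8 * (h + 1)) := hgc.add continuous_const
  have hPc : Continuous P :=
    intervalIntegral.continuous_primitive (fun a b => hFc.intervalIntegrable a b) 0
  have hlim : Filter.Tendsto (fun δ : ℝ => P (h + 2 * δ) - P (-(2 * δ))) (nhds 0)
      (nhds (P h)) := by
    have : Continuous fun δ : ℝ => P (h + 2 * δ) - P (-(2 * δ)) := by fun_prop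
    have h2 := this.tendsto 0
    simpa [hP] using h2
  obtain ⟨δ₂, hδ₂, h2⟩ := Metric.eventually_nhds_iff.1
    (hlim.eventually (gt_mem_nhds (show P h < P h + ε / 8 by linarith)))
  refine ⟨min (δ₁ / 2) δ₂, lt_min (by linarith) hδ₂, fun δ hδ hδ' => ?_⟩
  have hb1 : 2 * δ < δ₁ := by linarith [min_le_left (δ₁ / 2) δ₂]
  have hb2 : P (h + 2 * δ) - P (-(2 * δ)) < P h + ε / 8 := by
    refine h2 ?_
    rw [Real.dist_eq, sub_zero, abs_of_pos hδ]
    linarith [min_le_right (δ₁ / 2) δ₂]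
  set I := Ioo (-(2 * δ)) (h + 2 * δ) with hI
  set J := Ioo (-(2 * δ)) (2 * δ) with hJ
  have e1 : ∫ x in boxSet T h δ, φ x =
      ∫ z in I ×ˢ J, φ (T.symm (planeEquiv z)) := by
    have a1 := (measurePreserving_affineIsometry T).setIntegral_preimage_emb
      (measurableEmbedding_affineIsometry T) (fun y => φ (T.symm y)) {y | y 0 ∈ I ∧ y 1 ∈ J}
    have a2 := measurePreserving_planeEquiv.setIntegral_preimage_emb planeEquiv.measurableEmbedding
      (fun y => φ (T.symm y)) {y | y 0 ∈ I ∧ y 1 ∈ J}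
    rw [boxSet_eq]
    simp only [AffineIsometryEquiv.symm_apply_apply] at a1
    rw [a1, ← a2]
    congr 2
  have hle : ∀ z ∈ I ×ˢ J, φ (T.symm (planeEquiv z)) ≤ (g z.1 + ε / (8 * (h + 1))) * 1 := by
    rintro ⟨t, n⟩ ⟨-, hn⟩
    have : dist (T.symm (planeEquiv (t, n))) (T.symm !₂[t, 0]) < δ₁ := by
      rw [T.symm.dist_map, planeEquiv_apply, EuclideanSpace.dist_eq]
      simp only [Fin.sum_univ_two]
      simp only [Matrix.cons_val_zero, Matrix.cons_val_one, dist_self, Real.dist_eq,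
        sub_zero, sq_abs]
      norm_num
      rw [Real.sqrt_sq_eq_abs]
      exact (abs_lt.2 ⟨hn.1, hn.2⟩).trans hb1
    have := hu this
    rw [Real.dist_eq, abs_lt] at this
    simp only [hg]
    linarith [this.2]
  have hvol : volume (I ×ˢ J) ≠ ⊤ := by
    rw [Measure.volume_eq_prod, Measure.prod_prod, hI, hJ, Real.volume_Ioo, Real.volume_Ioo]
    exact ENNReal.mul_ne_top ENNReal.ofReal_ne_top ENNReal.ofReal_ne_top
  have hmeas : MeasurableSet (I ×ˢ J) := measurableSet_Ioo.prod measurableSet_Ioo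
  have hcpt : I ×ˢ J ⊆ Icc (-(2 * δ)) (h + 2 * δ) ×ˢ Icc (-(2 * δ)) (2 * δ) :=
    prod_mono Ioo_subset_Icc_self Ioo_subset_Icc_self
  have hint : ∀ F : ℝ × ℝ → ℝ, Continuous F → IntegrableOn F (I ×ˢ J) := fun F hF =>
    (hF.continuousOn.integrableOn_compact (isCompact_Icc.prod isCompact_Icc)).mono_set hcpt
  have hpc : Continuous fun z : ℝ × ℝ => planeEquiv z := by
    simp only [planeEquiv_apply]
    fun_prop
  rw [e1]
  calc ∫ z in I ×ˢ J, φ (T.symm (planeEquiv z))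
      ≤ ∫ z in I ×ˢ J, (g z.1 + ε / (8 * (h + 1))) * 1 := by
        refine setIntegral_mono_on (hint _ (hφ.comp (T.symm.continuous.comp hpc)))
          (hint _ ((hFc.comp continuous_fst).mul continuous_const)) hmeas hle
    _ = (∫ t in I, (g t + ε / (8 * (h + 1)))) * ∫ n in J, (1 : ℝ) :=
        setIntegral_prod_mul (μ := volume) (ν := volume) (fun t => g t + ε / (8 * (h + 1)))
          (fun _ => (1 : ℝ)) I J
    _ = (P (h + 2 * δ) - P (-(2 * δ))) * (4 * δ) := by
        congr 1
        · rw [hP, intervalIntegral.integral_interval_sub_left (hFc.intervalIntegrable _ _)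
            (hFc.intervalIntegrable _ _), intervalIntegral.integral_of_le (by linarith),
            integral_Ioc_eq_integral_Ioo]
        · simp [hJ]
          rw [max_eq_left (by linarith)]
          ring
    _ ≤ (P h + ε / 8) * (4 * δ) := by gcongr
    _ = δ * (4 * (∫ t in (0 : ℝ)..h, g t) + (4 * h * (ε / (8 * (h + 1))) + ε / 2)) := by
        rw [hP]
        simp only
        rw [intervalIntegral.integral_add (hgc.intervalIntegrable _ _) (by simp)]
        simp
        ring
    _ ≤ _ := by
        have h3 : 4 * h * (ε / (8 * (h + 1))) ≤ ε / 2 := by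
          rw [mul_div_assoc', div_le_div_iff₀ (by positivity) (by norm_num)]
          nlinarith
        gcongr
        linarith

end Cutoff

/-- The extension by zero of a function that vanishes near the boundary is a test function. -/
lemma isTest_indicator {D : Set Plane} (hD : IsOpen D) {f : Plane → ℝ} (hf : ContDiff ℝ ∞ f)
    (hc : HasCompactSupport f) (hfr : ∀ z ∈ frontier D, z ∉ tsupport f) :
    IsTest D (D.indicator f) ∧ ∀ x ∈ D, vrot (D.indicator f) x = vrot f x := by
  have hin : ∀ x ∈ D, D.indicator f =ᶠ[nhds x] f := fun x hx => by
    filter_upwards [hD.mem_nhds hx] with y hy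
    exact indicator_of_mem hy f
  have hout : ∀ x, x ∉ D → D.indicator f =ᶠ[nhds x] fun _ => 0 := fun x hx => by
    by_cases hxc : x ∈ closure D
    · have : x ∉ tsupport f := hfr x (by rw [hD.frontier_eq]; exact ⟨hxc, hx⟩)
      filter_upwards [(notMem_tsupport_iff_eventuallyEq.1 this)] with y hy
      by_cases hyD : y ∈ D
      · rw [indicator_of_mem hyD]; exact hy
      · exact indicator_of_notMem hyD f
    · filter_upwards [isClosed_closure.isOpen_compl.mem_nhds hxc] with y hy
      exact indicator_of_notMem (fun h => hy (subset_closure h)) f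
  have hts : tsupport (D.indicator f) ⊆ D := fun x hx => by
    by_contra h
    exact notMem_tsupport_iff_eventuallyEq.2 (hout x h) hx
  refine ⟨⟨contDiff_iff_contDiffAt.2 fun x => ?_, ?_, hts⟩, fun x hx => ?_⟩
  · by_cases hx : x ∈ D
    · exact hf.contDiffAt.congr_of_eventuallyEq (hin x hx)
    · exact contDiffAt_const.congr_of_eventuallyEq (hout x hx)
  · refine hc.mono fun x hx => ?_
    rw [Function.mem_support] at hx ⊢
    by_cases hxD : x ∈ D
    · rwa [indicator_of_mem hxD] at hx
    · exact absurd (indicator_of_notMem hxD f) hx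
  · simp only [vrot, pderiv, (hin x hx).fderiv_eq]

lemma vrot_mul {φ ψ : Plane → ℝ} {x : Plane} (hφ : DifferentiableAt ℝ φ x)
    (hψ : DifferentiableAt ℝ ψ x) :
    vrot (fun y => φ y * ψ y) x = ψ x • vrot φ x + φ x • vrot ψ x := by
  have : ∀ i, pderiv i (fun y => φ y * ψ y) x = ψ x * pderiv i φ x + φ x * pderiv i ψ x := fun i => by
    unfold pderiv
    rw [fderiv_fun_mul hφ hψ]
    simp; ring
  ext i
  fin_cases i <;> simp [vrot, this]
  ring

lemma abs_inner_vrot_le (φ : Plane → ℝ) (w x : Plane) :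
    |inner ℝ w (vrot φ x)| ≤ ‖w‖ * ‖fderiv ℝ φ x‖ := by
  have : (inner ℝ w (vrot φ x) : ℝ) = fderiv ℝ φ x (rotQ w) := by
    rw [fderiv_apply_plane, inner_plane, vrot_zero, vrot_one]
    simp [rotQ]
    ring
  rw [this, ← Real.norm_eq_abs]
  refine ((fderiv ℝ φ x).le_opNorm _).trans_eq ?_
  rw [norm_rotQ, mul_comm]

namespace PolyCell
variable (K : PolyCell)

/-- Coordinates with the origin at the start of the `i`-th edge and the first axis along it. -/
def edgeFrame (i : Fin (K.m + 3)) : Plane ≃ᵃⁱ[ℝ] Plane :=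
  (exists_frame (K.vertex i) (K.vertex (i + 1))).choose

/-- The box of width `δ` around the `i`-th edge. -/
def edgeBox (i : Fin (K.m + 3)) (δ : ℝ) : Set Plane := boxSet (K.edgeFrame i) (K.edgeLength i) δ

/-- A function that vanishes near the boundary and equals `1` away from the boxes of width `δ`. -/
def boundaryCut (δ : ℝ) (x : Plane) : ℝ := ∏ i, (1 - boxCut (K.edgeFrame i) (K.edgeLength i) δ x)

lemma edgeFrame_edgePoint (i : Fin (K.m + 3)) (τ : ℝ) :
    K.edgeFrame i (K.edgePoint i τ) = !₂[K.edgeLength i * τ, 0] := by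
  have hs := (exists_frame (K.vertex i) (K.vertex (i + 1))).choose_spec
  have h1 : K.edgeFrame i (K.vertex i) = 0 := hs.1
  have h2 : K.edgeFrame i (K.vertex (i + 1)) = !₂[K.edgeLength i, 0] := hs.2
  have h3 := (K.edgeFrame i).toAffineEquiv.toAffineMap.apply_lineMap (K.vertex i) (K.vertex (i + 1)) τ
  change K.edgeFrame i (K.edgePoint i τ) = AffineMap.lineMap (K.edgeFrame i (K.vertex i))
    (K.edgeFrame i (K.vertex (i + 1))) τ at h3
  rw [h3, h1, h2, AffineMap.lineMap_apply_module]
  ext j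
  fin_cases j <;> simp [mul_comm]

lemma exists_edgePoint {x : Plane} (hx : x ∈ frontier K.carrier) :
    ∃ i, ∃ τ ∈ Icc (0 : ℝ) 1, x = K.edgePoint i τ := by
  rw [K.frontier_eq, mem_iUnion] at hx
  obtain ⟨i, hi⟩ := hx
  rw [segment_eq_image_lineMap] at hi
  obtain ⟨τ, hτ, h⟩ := hi
  exact ⟨i, τ, hτ, h.symm⟩

lemma contDiff_boundaryCut {δ : ℝ} : ContDiff ℝ ∞ (K.boundaryCut δ) :=
  contDiff_prod fun _ _ => contDiff_const.sub (contDiff_boxCut _)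

lemma boundaryCut_nonneg {δ : ℝ} (x : Plane) : 0 ≤ K.boundaryCut δ x :=
  Finset.prod_nonneg fun _ _ => sub_nonneg.2 (boxCut_le_one _ _)

lemma boundaryCut_le_one {δ : ℝ} (x : Plane) : K.boundaryCut δ x ≤ 1 :=
  Finset.prod_le_one (fun _ _ => sub_nonneg.2 (boxCut_le_one _ _))
    fun _ _ => sub_le_self _ (boxCut_nonneg _ _)

/-- Near a point of an edge the box cut-off of this edge is identically one, so one factor of the
product is zero on a whole neighbourhood. -/
lemma notMem_tsupport_boundaryCut {δ : ℝ} (hδ : 0 < δ) {z : Plane} (hz : z ∈ frontier K.carrier) :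
    z ∉ tsupport (K.boundaryCut δ) := by
  obtain ⟨i, τ, hτ, rfl⟩ := K.exists_edgePoint hz
  rw [notMem_tsupport_iff_eventuallyEq]
  have hL := K.edgeLength_pos i
  have hev : ∀ k, ∀ᶠ x in nhds (K.edgePoint i τ), -δ < boxDist (K.edgeLength i) k (K.edgeFrame i x) := by
    intro k
    have hc : Continuous fun x => boxDist (K.edgeLength i) k (K.edgeFrame i x) :=
      (contDiff_boxDist _ k).continuous.comp (K.edgeFrame i).continuous
    refine hc.continuousAt.eventually (lt_mem_nhds ?_)
    refine lt_of_lt_of_le (neg_lt_zero.2 hδ) ?_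
    beta_reduce
    rw [edgeFrame_edgePoint]
    fin_cases k <;> simp [boxDist]
    · exact mul_nonneg hL.le hτ.1
    · nlinarith [hτ.2]
  filter_upwards [Filter.eventually_all.2 hev] with x hx
  refine Finset.prod_eq_zero (Finset.mem_univ i) ?_
  rw [boxCut_eq_one _ hδ fun k => (hx k).le, sub_self]

/-- A point of the open cell lies on no edge, so one of the four signed distances is negative, and
the point leaves each box once `δ` is small. -/
lemma tendsto_boundaryCut {x : Plane} (hx : x ∈ K.carrier) :
    ∀ᶠ δ in nhdsWithin (0 : ℝ) (Ioi 0), K.boundaryCut δ x = 1 := by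
  have key : ∀ i, ∀ᶠ δ in nhdsWithin (0 : ℝ) (Ioi 0), x ∉ K.edgeBox i δ := by
    intro i
    have hneg : ∃ k, boxDist (K.edgeLength i) k (K.edgeFrame i x) < 0 := by
      by_contra! hcon
      have hL := K.edgeLength_pos i
      have c0 := hcon 0
      have c1 := hcon 1
      have c2 := hcon 2
      have c3 := hcon 3
      simp [boxDist] at c0 c1 c2 c3
      have h1 : K.edgeFrame i x = K.edgeFrame i (K.edgePoint i (K.edgeFrame i x 0 / K.edgeLength i)) := by
        rw [edgeFrame_edgePoint, mul_div_cancel₀ _ hL.ne']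
        ext j
        fin_cases j
        · simp
        · simp; linarith
      have h2 := (K.edgeFrame i).injective h1
      have h3 : x ∈ frontier K.carrier := by
        rw [h2, K.frontier_eq]
        exact mem_iUnion.2 ⟨i, edgePoint_mem ⟨div_nonneg c0 hL.le, (div_le_one hL).2 c1⟩⟩
      rw [K.isOpen.frontier_eq] at h3
      exact h3.2 hx
    obtain ⟨k, hk⟩ := hneg
    have : ∀ᶠ δ in nhdsWithin (0 : ℝ) (Ioi 0), 2 * δ < -boxDist (K.edgeLength i) k (K.edgeFrame i x) := by
      have hc : Continuous fun δ : ℝ => 2 * δ := by fun_prop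
      refine (hc.continuousAt.eventually (gt_mem_nhds ?_)).filter_mono nhdsWithin_le_nhds
      simpa using hk
    filter_upwards [this] with δ hδ hmem
    have := hmem k
    linarith
  filter_upwards [Filter.eventually_all.2 key, self_mem_nhdsWithin] with δ hδ hpos
  exact Finset.prod_eq_one fun i _ => by rw [boxCut_eq_zero _ hpos (hδ i), sub_zero]

lemma exists_norm_fderiv_boundaryCut_le : ∃ C : ℝ, 0 < C ∧ ∀ (K : PolyCell) (δ : ℝ), 0 < δ → ∀ x,
    ‖fderiv ℝ (K.boundaryCut δ) x‖ ≤ ∑ i, (K.edgeBox i δ).indicator (fun _ => C / δ) x := by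
  obtain ⟨C, hC, h⟩ := exists_norm_fderiv_boxCut_le
  refine ⟨C + 1, by positivity, fun K δ hδ x => ?_⟩
  refine (norm_fderiv_prod_le _ (fun i => ((contDiff_const.sub
    (contDiff_boxCut (K.edgeFrame i)))).differentiable (by simp : (∞ : WithTop ℕ∞) ≠ 0))
    (fun _ _ => sub_nonneg.2 (boxCut_le_one _ _))
    (fun _ _ => sub_le_self _ (boxCut_nonneg _ _)) x).trans (Finset.sum_le_sum fun i _ => ?_)
  rw [fderiv_const_sub, norm_neg]
  refine (h (K.edgeFrame i) (K.edgeLength i) δ hδ x).trans ?_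
  refine indicator_le_indicator ?_
  gcongr
  linarith

end PolyCell

/-! ### Existence of a square integrable tangential trace by duality -/

namespace PolyCell
variable {K : PolyCell} {u : Plane → Plane}

/-- The boundary functional `(rot u, φ)_K - (u, rot φ)_K`. -/
def boundaryFun (K : PolyCell) (u : Plane → Plane) (φ : Plane → ℝ) : ℝ :=
  (∫ x in K.carrier, MaxwellVEM.weakRot K.carrier u x * φ x) - ∫ x in K.carrier, inner ℝ (u x) (vrot φ x)

/-- The product of `φ` and the cut-off vanishes near the boundary and is a test function after
extension by zero, so the weak rotation may be tested with it; the product rule splits its gradient.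
-/
lemma boundaryFun_cut (hu : MemHRot K.carrier u) {φ : Plane → ℝ} (hφ : ContDiff ℝ ∞ φ)
    (hc : HasCompactSupport φ) {δ : ℝ} (hδ : 0 < δ) :
    (∫ x in K.carrier, MaxwellVEM.weakRot K.carrier u x * (φ x * K.boundaryCut δ x)) =
      (∫ x in K.carrier, K.boundaryCut δ x * inner ℝ (u x) (vrot φ x)) +
        ∫ x in K.carrier, φ x * inner ℝ (u x) (vrot (K.boundaryCut δ) x) := by
  have hr := (weakRot_spec hu.2).2
  have hχ := K.contDiff_boundaryCut (δ := δ)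
  have hφ1 : ContDiff ℝ 1 φ := hφ.of_le (by exact_mod_cast le_top)
  have hχ1 : ContDiff ℝ 1 (K.boundaryCut δ) := hχ.of_le (by exact_mod_cast le_top)
  have hc' : HasCompactSupport fun x => φ x * K.boundaryCut δ x := hc.mul_right
  obtain ⟨h1, h2⟩ := isTest_indicator K.isOpen (hφ.mul hχ) hc' fun z hz hmem =>
    K.notMem_tsupport_boundaryCut hδ hz (closure_mono (Function.support_mul_subset_right _ _) hmem)
  have h3 := hr _ h1
  have hm := K.isOpen.measurableSet
  have e1 : ∫ x in K.carrier, MaxwellVEM.weakRot K.carrier u x *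
      K.carrier.indicator (fun x => φ x * K.boundaryCut δ x) x =
      ∫ x in K.carrier, MaxwellVEM.weakRot K.carrier u x * (φ x * K.boundaryCut δ x) :=
    setIntegral_congr_fun hm fun x hx => by simp only [indicator_of_mem hx]
  have e2 : ∫ x in K.carrier, inner ℝ (u x)
      (vrot (K.carrier.indicator fun x => φ x * K.boundaryCut δ x) x) =
      ∫ x in K.carrier, (K.boundaryCut δ x * inner ℝ (u x) (vrot φ x) +
        φ x * inner ℝ (u x) (vrot (K.boundaryCut δ) x)) :=
    setIntegral_congr_fun hm fun x hx => by
      rw [h2 x hx, vrot_mul (hφ1.differentiable one_ne_zero x) (hχ1.differentiable one_ne_zero x),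
        inner_add_right, inner_smul_right, inner_smul_right]
  rw [← e1, h3, e2, integral_add]
  · have := integrableOn_inner_of_memLp hu.1 (w := fun x => K.boundaryCut δ x • vrot φ x)
      (hχ1.continuous.smul (continuous_vrot hφ1))
      ((hasCompactSupport_vrot hc).smul_left (f := K.boundaryCut δ))
    simp only [inner_smul_right] at this
    exact this
  · have := integrableOn_inner_of_memLp hu.1 (w := fun x => φ x • vrot (K.boundaryCut δ) x)
      (hφ1.continuous.smul (continuous_vrot hχ1)) (hc.smul_right (f' := vrot (K.boundaryCut δ)))
    simp only [inner_smul_right] at this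
    exact this

/-- By dominated convergence the cut-off disappears from the terms without its derivative. What the
derivative of the cut-off leaves behind is the boundary functional. -/
lemma tendsto_boundaryFun (hu : MemHRot K.carrier u) {φ : Plane → ℝ} (hφ : ContDiff ℝ ∞ φ)
    (hc : HasCompactSupport φ) :
    Filter.Tendsto (fun δ => ∫ x in K.carrier, φ x * inner ℝ (u x) (vrot (K.boundaryCut δ) x))
      (nhdsWithin (0 : ℝ) (Ioi 0)) (nhds (K.boundaryFun u φ)) := by
  have hφ1 : ContDiff ℝ 1 φ := hφ.of_le (by exact_mod_cast le_top)
  have hr := (weakRot_spec hu.2)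
  have hi1 := integrableOn_mul_of_memLp hr.1 hφ1.continuous hc
  have hi2 := integrableOn_inner_of_memLp hu.1 (continuous_vrot hφ1) (hasCompactSupport_vrot hc)
  have hcont : ∀ δ, Continuous (K.boundaryCut δ) := fun δ => (K.contDiff_boundaryCut (δ := δ)).continuous
  have key : ∀ F : Plane → ℝ, IntegrableOn F K.carrier →
      Filter.Tendsto (fun δ => ∫ x in K.carrier, K.boundaryCut δ x * F x)
        (nhdsWithin (0 : ℝ) (Ioi 0)) (nhds (∫ x in K.carrier, F x)) := by
    intro F hF
    refine tendsto_integral_filter_of_dominated_convergence (fun x => ‖F x‖)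
      (Filter.Eventually.of_forall fun δ => (hcont δ).aestronglyMeasurable.mul hF.1)
      (Filter.Eventually.of_forall fun δ => Filter.Eventually.of_forall fun x => ?_) hF.norm ?_
    · rw [norm_mul, Real.norm_eq_abs, abs_of_nonneg (K.boundaryCut_nonneg x)]
      exact mul_le_of_le_one_left (norm_nonneg _) (K.boundaryCut_le_one x)
    · filter_upwards [ae_restrict_mem K.isOpen.measurableSet] with x hx
      refine Filter.Tendsto.congr' ?_ tendsto_const_nhds
      filter_upwards [K.tendsto_boundaryCut hx] with δ hδ
      rw [hδ, one_mul]
  refine Filter.Tendsto.congr' ?_ ((key _ hi1).sub (key _ hi2))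
  filter_upwards [self_mem_nhdsWithin] with δ hδ
  have := boundaryFun_cut hu hφ hc hδ
  rw [sub_eq_iff_eq_add, add_comm, ← this]
  congr 1 with x
  ring

/-- The derivative of the cut-off is of size `1 / δ` on the boxes. Young's inequality separates `φ`
from `u` there: the mean of `φ ^ 2` over a shrinking box tends to an edge integral, and that of `‖u‖
^ 2` is bounded by assumption. The two terms scale differently in `φ`, which is used afterwards. -/
lemma boundaryFun_le {C : ℝ} (hC : 0 < C) (hbound : ∀ (δ : ℝ), 0 < δ → ∀ x,
      ‖fderiv ℝ (K.boundaryCut δ) x‖ ≤ ∑ i, (K.edgeBox i δ).indicator (fun _ => C / δ) x)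
    (hu : MemHRot K.carrier u) {A : ℝ}
    (h : ∀ i, ∃ δ₀ > 0, ∀ δ, 0 < δ → δ < δ₀ → ∫ x in K.carrier ∩ K.edgeBox i δ, ‖u x‖ ^ 2 ≤ δ * A)
    {φ : Plane → ℝ} (hφ : ContDiff ℝ ∞ φ) (hc : HasCompactSupport φ) :
    K.boundaryFun u φ ≤ 2 * C * (K.boundaryIntegral fun i τ => φ (K.edgePoint i τ) ^ 2)
      + C / 2 * (K.numVertices * A) := by
  have hφc := hφ.continuous
  refine le_of_forall_pos_le_add fun ε hε => ?_
  set n : ℝ := (K.numVertices : ℝ) with hn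
  have hn0 : 0 < n := by rw [hn]; simp [numVertices]; positivity
  refine le_of_tendsto (tendsto_boundaryFun hu hφ hc) ?_
  have hbox : ∀ i, ∃ δ₀ > 0, ∀ δ, 0 < δ → δ < δ₀ → ∫ x in K.edgeBox i δ, φ x ^ 2 ≤
      δ * (4 * (K.edgeLength i * ∫ τ in (0 : ℝ)..1, φ (K.edgePoint i τ) ^ 2) + 2 * ε / (C * n)) := by
    intro i
    obtain ⟨δ₀, h0, h1⟩ := integral_boxSet_le (K.edgeFrame i) (φ := fun x => φ x ^ 2) (hφc.pow 2)
      (by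
        have : (fun x => φ x ^ 2) = fun x => φ x * φ x := by ext; ring
        rw [this]; exact hc.mul_right)
      (K.edgeLength_pos i) (ε := 2 * ε / (C * n)) (by positivity)
    refine ⟨δ₀, h0, fun δ hδ hδ' => (h1 δ hδ hδ').trans_eq ?_⟩
    congr 3
    have := intervalIntegral.smul_integral_comp_mul_left (a := 0) (b := 1)
      (fun t => φ ((K.edgeFrame i).symm !₂[t, 0]) ^ 2) (K.edgeLength i)
    rw [mul_zero, mul_one, smul_eq_mul] at this
    rw [← this]
    simp only [← edgeFrame_edgePoint, AffineIsometryEquiv.symm_apply_apply]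
  choose d1 hd1 hd1' using hbox
  choose d2 hd2 hd2' using h
  have hev : ∀ᶠ δ in nhdsWithin (0 : ℝ) (Ioi 0), ∀ i, δ < d1 i ∧ δ < d2 i :=
    Filter.eventually_all.2 fun i =>
      ((gt_mem_nhds (hd1 i)).and (gt_mem_nhds (hd2 i))).filter_mono nhdsWithin_le_nhds
  have hp2 : IntegrableOn (fun x => φ x ^ 2) univ := by
    have : (fun x => φ x ^ 2) = fun x => φ x * φ x := by ext; ring
    rw [this]
    exact ((hφc.mul hφc).integrable_of_hasCompactSupport hc.mul_right).integrableOn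
  have hu2 : IntegrableOn (fun x => ‖u x‖ ^ 2) K.carrier := hu.1.integrable_norm_pow (by norm_num)
  filter_upwards [hev, self_mem_nhdsWithin] with δ hδ hδ0
  have hδ0 : 0 < δ := hδ0
  have hmb : ∀ i, MeasurableSet (K.edgeBox i δ) := fun i => measurableSet_boxSet _
  have hint : ∀ i, IntegrableOn (fun x => (K.edgeBox i δ).indicator
      (fun x => C / δ * (φ x ^ 2 / 2 + ‖u x‖ ^ 2 / 2)) x) K.carrier := fun i =>
    IntegrableOn.indicator ((((hp2.mono_set (subset_univ _)).div_const 2).add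
      (hu2.div_const 2)).const_mul _) (hmb i)
  have hχ1 : ContDiff ℝ 1 (K.boundaryCut δ) :=
    (K.contDiff_boundaryCut (δ := δ)).of_le (by exact_mod_cast le_top)
  have hleft : IntegrableOn (fun x => φ x * inner ℝ (u x) (vrot (K.boundaryCut δ) x)) K.carrier := by
    have := integrableOn_inner_of_memLp hu.1 (w := fun x => φ x • vrot (K.boundaryCut δ) x)
        (hφc.smul (continuous_vrot hχ1)) (hc.smul_right)
    simpa only [inner_smul_right] using this
  calc ∫ x in K.carrier, φ x * inner ℝ (u x) (vrot (K.boundaryCut δ) x)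
      ≤ ∫ x in K.carrier, ∑ i, (K.edgeBox i δ).indicator
          (fun x => C / δ * (φ x ^ 2 / 2 + ‖u x‖ ^ 2 / 2)) x := by
        refine integral_mono hleft (integrable_finsetSum _ fun i _ => hint i) fun x => ?_
        have a1 := abs_inner_vrot_le (K.boundaryCut δ) (u x) x
        have a2 := hbound δ hδ0 x
        have a3 : |φ x| * ‖u x‖ ≤ φ x ^ 2 / 2 + ‖u x‖ ^ 2 / 2 := by
          rw [← sq_abs (φ x)]; nlinarith [sq_nonneg (|φ x| - ‖u x‖)]
        calc φ x * inner ℝ (u x) (vrot (K.boundaryCut δ) x)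
            ≤ |φ x| * (‖u x‖ * ∑ i, (K.edgeBox i δ).indicator (fun _ => C / δ) x) := by
              refine (le_abs_self _).trans ?_
              rw [abs_mul]
              gcongr
              exact a1.trans (by gcongr)
          _ = ∑ i, (K.edgeBox i δ).indicator (fun x => C / δ * (|φ x| * ‖u x‖)) x := by
              rw [← mul_assoc, Finset.mul_sum]
              refine Finset.sum_congr rfl fun i _ => ?_
              by_cases hx : x ∈ K.edgeBox i δ
              · simp only [indicator_of_mem hx]; ring
              · simp only [indicator_of_notMem hx, mul_zero]
          _ ≤ _ := by
              refine Finset.sum_le_sum fun i _ => indicator_le_indicator ?_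
              gcongr
    _ = ∑ i, ∫ x in K.carrier ∩ K.edgeBox i δ, C / δ * (φ x ^ 2 / 2 + ‖u x‖ ^ 2 / 2) := by
        rw [integral_finsetSum _ fun i _ => hint i]
        exact Finset.sum_congr rfl fun i _ => setIntegral_indicator (hmb i)
    _ ≤ ∑ i, (C / 2 * (4 * (K.edgeLength i * ∫ τ in (0 : ℝ)..1, φ (K.edgePoint i τ) ^ 2)
          + 2 * ε / (C * n)) + C / 2 * A) := by
        refine Finset.sum_le_sum fun i _ => ?_
        rw [integral_const_mul, integral_add ((hp2.mono_set (subset_univ _)).div_const 2)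
          ((hu2.mono_set inter_subset_left).div_const 2), integral_div, integral_div]
        have b1 := hd1' i δ hδ0 (hδ i).1
        have b2 := hd2' i δ hδ0 (hδ i).2
        have b3 : ∫ x in K.carrier ∩ K.edgeBox i δ, φ x ^ 2 ≤ ∫ x in K.edgeBox i δ, φ x ^ 2 :=
          setIntegral_mono_set (hp2.mono_set (subset_univ _))
            (Filter.Eventually.of_forall fun x => sq_nonneg _) inter_subset_right.eventuallyLE
        rw [div_mul_eq_mul_div, div_le_iff₀ hδ0]
        have := mul_le_mul_of_nonneg_left (add_le_add (b3.trans b1) b2) hC.le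
        nlinarith
    _ = _ := by
        rw [Finset.sum_add_distrib, ← Finset.mul_sum, Finset.sum_add_distrib, ← Finset.mul_sum]
        simp only [Finset.sum_const, Finset.card_univ, Fintype.card_fin, nsmul_eq_mul]
        have e : ((K.m + 3 : ℕ) : ℝ) = n := rfl
        rw [e]
        unfold boundaryIntegral
        field_simp
        ring

/-- The smooth functions with compact support. -/
def smoothFunctions : Submodule ℝ (Plane → ℝ) where
  carrier := {φ | ContDiff ℝ ∞ φ ∧ HasCompactSupport φ}
  add_mem' h h' := ⟨h.1.add h'.1, h.2.add h'.2⟩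
  zero_mem' := ⟨contDiff_const, HasCompactSupport.zero⟩
  smul_mem' _ _ h := ⟨contDiff_const.smul h.1, h.2.smul_left⟩

lemma memLp_edge (φ : smoothFunctions) (i : Fin (K.m + 3)) :
    MemLp (fun τ => φ.1 (K.edgePoint i τ)) 2 (volume.restrict (Icc (0 : ℝ) 1)) := by
  obtain ⟨C, hC⟩ := φ.2.2.exists_bound_of_continuous φ.2.1.continuous
  exact MemLp.of_bound (φ.2.1.continuous.comp (K.continuous_edgePoint i)).aestronglyMeasurable C
    (Filter.Eventually.of_forall fun τ => hC _)

/-- The trace operator, weighted by the edge lengths. -/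
def traceMap (K : PolyCell) : smoothFunctions →ₗ[ℝ]
    PiLp 2 fun _ : Fin (K.m + 3) => Lp ℝ 2 (volume.restrict (Icc (0 : ℝ) 1)) where
  toFun φ := WithLp.toLp 2 fun i => √(K.edgeLength i) • (memLp_edge φ i).toLp
  map_add' φ ψ := by
    ext1 i
    simp only [PiLp.add_apply, ← smul_add]
    congr 1
  map_smul' c φ := by
    ext1 i
    simp only [PiLp.smul_apply, RingHom.id_apply]
    rw [smul_comm]
    congr 1

/-- The boundary functional as a linear map. -/
def boundaryMap (hu : MemHRot K.carrier u) : smoothFunctions →ₗ[ℝ] ℝ where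
  toFun φ := K.boundaryFun u φ.1
  map_add' φ ψ := by
    have hr := weakRot_spec hu.2
    have h1 : ∀ φ : smoothFunctions, ContDiff ℝ 1 φ.1 := fun φ => φ.2.1.of_le (by exact_mod_cast le_top)
    have a := fun φ : smoothFunctions => integrableOn_mul_of_memLp hr.1 (h1 φ).continuous φ.2.2
    have b := fun φ : smoothFunctions => integrableOn_inner_of_memLp hu.1 (continuous_vrot (h1 φ))
      (hasCompactSupport_vrot φ.2.2)
    have e : ∀ x, vrot (φ.1 + ψ.1) x = vrot φ.1 x + vrot ψ.1 x := fun x => by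
      have : ∀ i, pderiv i (φ.1 + ψ.1) x = pderiv i φ.1 x + pderiv i ψ.1 x := fun i => by
        unfold pderiv
        rw [fderiv_add ((h1 φ).differentiable one_ne_zero x) ((h1 ψ).differentiable one_ne_zero x)]
        rfl
      ext i
      fin_cases i <;> simp [vrot, this]
      ring
    simp only [boundaryFun, Submodule.coe_add, e, inner_add_right, Pi.add_apply, mul_add]
    rw [integral_add (a φ) (a ψ), integral_add (b φ) (b ψ)]
    ring
  map_smul' c φ := by
    have e : ∀ x, vrot (c • φ.1) x = c • vrot φ.1 x := fun x => by
      have : ∀ i, pderiv i (c • φ.1) x = c * pderiv i φ.1 x := fun i => by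
        unfold pderiv
        rw [fderiv_const_smul ((φ.2.1.differentiable (by simp)) x)]
        rfl
      ext i
      fin_cases i <;> simp [vrot, this]
    simp only [boundaryFun, Submodule.coe_smul, e, inner_smul_right, Pi.smul_apply, smul_eq_mul,
      RingHom.id_apply, mul_left_comm _ c, integral_const_mul, mul_sub]

lemma norm_sq_lp {μ : Measure ℝ} (g : Lp ℝ 2 μ) : ‖g‖ ^ 2 = ∫ t, g t ^ 2 ∂μ := by
  rw [← real_inner_self_eq_norm_sq, L2.inner_def]
  congr 1 with t
  simp [sq]

lemma norm_traceMap_sq (φ : smoothFunctions) :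
    ‖K.traceMap φ‖ ^ 2 = K.boundaryIntegral fun i τ => φ.1 (K.edgePoint i τ) ^ 2 := by
  rw [PiLp.norm_sq_eq_of_L2]
  refine Finset.sum_congr rfl fun i _ => ?_
  change ‖√(K.edgeLength i) • (memLp_edge φ i).toLp‖ ^ 2 = _
  rw [norm_smul, mul_pow, Real.norm_eq_abs, sq_abs, Real.sq_sqrt (K.edgeLength_pos i).le, norm_sq_lp,
    intervalIntegral.integral_of_le zero_le_one, ← integral_Icc_eq_integral_Ioc]
  congr 1
  refine integral_congr_ae ?_
  filter_upwards [(memLp_edge φ i).coeFn_toLp] with τ hτ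
  rw [hτ]

lemma inner_traceMap (g : PiLp 2 fun _ : Fin (K.m + 3) => Lp ℝ 2 (volume.restrict (Icc (0 : ℝ) 1)))
    (φ : smoothFunctions) : inner ℝ g (K.traceMap φ) =
      K.boundaryIntegral fun i τ => (√(K.edgeLength i))⁻¹ * g i τ * φ.1 (K.edgePoint i τ) := by
  rw [PiLp.inner_apply]
  refine Finset.sum_congr rfl fun i _ => ?_
  change inner ℝ (g i) (√(K.edgeLength i) • (memLp_edge φ i).toLp) = _
  have hL := K.edgeLength_pos i
  rw [inner_smul_right, L2.inner_def, intervalIntegral.integral_of_le zero_le_one,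
    ← integral_Icc_eq_integral_Ioc]
  simp only [mul_assoc]
  rw [integral_const_mul, ← mul_assoc]
  congr 1
  · nth_rewrite 2 [← Real.mul_self_sqrt hL.le]
    rw [mul_assoc, mul_inv_cancel₀ (Real.sqrt_pos.2 hL).ne', mul_one]
  · refine integral_congr_ae ?_
    filter_upwards [(memLp_edge φ i).coeFn_toLp] with τ hτ
    rw [hτ]
    simp [mul_comm]

/-- A field that is square integrable on narrow strips along the edges, with a bound proportional to
the width of the strip, has a square integrable tangential trace. -/
theorem exists_hasTangentialTrace : ∃ C : ℝ, 0 < C ∧ ∀ (K : PolyCell) (u : Plane → Plane) (A : ℝ),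
    MemHRot K.carrier u → 0 ≤ A →
    (∀ i, ∃ δ₀ > 0, ∀ δ, 0 < δ → δ < δ₀ → ∫ x in K.carrier ∩ K.edgeBox i δ, ‖u x‖ ^ 2 ≤ δ * A) →
    K.HasTangentialTrace u ∧ K.traceNorm u ^ 2 ≤ C * (K.numVertices * A) := by
  obtain ⟨C, hC, hbound⟩ := exists_norm_fderiv_boundaryCut_le
  refine ⟨4 * C ^ 2, by positivity, fun K u A hu hA h => ?_⟩
  have hQ : 0 ≤ (K.numVertices : ℝ) * A := by positivity
  have hle : ∀ φ : smoothFunctions, |boundaryMap hu φ| ≤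
      2 * C * √(K.numVertices * A) * ‖K.traceMap φ‖ := by
    intro φ
    -- The bound for `t • φ` is a quadratic polynomial in `t` without negative values. Its
    -- discriminant turns the inhomogeneous estimate into a norm bound of the functional by the
    -- trace of `φ`.
    have h1 : ∀ t : ℝ, 0 ≤ (2 * C * ‖K.traceMap φ‖ ^ 2) * (t * t) + (-boundaryMap hu φ) * t
        + C / 2 * (K.numVertices * A) := fun t => by
      have a1 : boundaryMap hu (t • φ) ≤ 2 * C * ‖K.traceMap (t • φ)‖ ^ 2 +
          C / 2 * (K.numVertices * A) := by
        rw [norm_traceMap_sq]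
        exact boundaryFun_le hC (hbound K) hu h (t • φ).2.1 (t • φ).2.2
      rw [map_smul, map_smul, norm_smul, mul_pow, Real.norm_eq_abs, sq_abs, smul_eq_mul] at a1
      nlinarith
    have h2 := discrim_le_zero h1
    unfold discrim at h2
    refine abs_le_of_sq_le_sq ?_ (by positivity)
    rw [mul_pow, mul_pow, Real.sq_sqrt hQ]
    nlinarith
  obtain ⟨g, hg, hgr⟩ := exists_riesz K.traceMap (boundaryMap hu) (by positivity) hle
  have hT : K.IsTangentialTrace u fun i τ => (√(K.edgeLength i))⁻¹ * g i τ := by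
    refine ⟨fun i => (Lp.memLp (g i)).const_mul _, fun φ h1 h2 => ?_⟩
    have := hgr ⟨φ, h1, h2⟩
    rw [inner_traceMap] at this
    exact this
  refine ⟨⟨hu, _, hT⟩, ?_⟩
  rw [hT.traceNorm_sq]
  have e : (K.boundaryIntegral fun i τ => ((√(K.edgeLength i))⁻¹ * g i τ) ^ 2) = ‖g‖ ^ 2 := by
    rw [PiLp.norm_sq_eq_of_L2]
    refine Finset.sum_congr rfl fun i _ => ?_
    have hL := K.edgeLength_pos i
    simp only [mul_pow, inv_pow, Real.sq_sqrt hL.le]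
    rw [norm_sq_lp, intervalIntegral.integral_const_mul, ← mul_assoc, mul_inv_cancel₀ hL.ne', one_mul,
      intervalIntegral.integral_of_le zero_le_one, ← integral_Icc_eq_integral_Ioc]
  rw [e]
  calc ‖g‖ ^ 2 ≤ (2 * C * √(K.numVertices * A)) ^ 2 := by gcongr
    _ = _ := by rw [mul_pow, mul_pow, Real.sq_sqrt hQ]; ring

end PolyCell

/-! ## Lipschitz domains -/

section Lipschitz
variable {D : Set Plane}

lemma abs_coord_le (x : Plane) (i : Fin 2) : |x i| ≤ ‖x‖ := PiLp.norm_apply_le x i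

lemma abs_frame_sub_le (T : Plane ≃ᵃⁱ[ℝ] Plane) (x y : Plane) (i : Fin 2) :
    |T x i - T y i| ≤ dist x y := by
  rw [← T.dist_map, dist_eq_norm]
  exact abs_coord_le (T x - T y) i

/-- `D` is the region above a Lipschitz graph in the ball around `q`. -/
def IsChart (D : Set Plane) (q : Plane) (T : Plane ≃ᵃⁱ[ℝ] Plane) (r : ℝ) (L : NNReal) (f : ℝ → ℝ) : Prop :=
  0 < r ∧ LipschitzWith L f ∧ ∀ x ∈ Metric.ball q r, x ∈ D ↔ f (T x 0) < T x 1

variable {q : Plane} {T : Plane ≃ᵃⁱ[ℝ] Plane} {r : ℝ} {L : NNReal} {f : ℝ → ℝ}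

lemma IsChart.eq_of_frontier (hD : IsOpen D) (h : IsChart D q T r L f) {p : Plane}
    (hp : p ∈ frontier D) (hpq : p ∈ Metric.ball q r) : T p 1 = f (T p 0) := by
  rw [hD.frontier_eq] at hp
  refine le_antisymm (not_lt.1 fun hlt => hp.2 ((h.2.2 p hpq).2 hlt)) (not_lt.1 fun hlt => ?_)
  have hev : ∀ᶠ x in nhds p, T x 1 < f (T x 0) := by
    have h1 : Continuous fun x => T x 1 := by
      have := T.continuous; fun_prop
    have h2 : Continuous fun x => f (T x 0) := h.2.1.continuous.comp (by
      have := T.continuous; fun_prop)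
    exact h1.continuousAt.eventually_lt h2.continuousAt hlt
  obtain ⟨x, ⟨hx1, hx2⟩, hxD⟩ := mem_closure_iff_nhds.1 hp.1 _
    (Filter.inter_mem hev (Metric.isOpen_ball.mem_nhds hpq))
  exact lt_asymm hx1 ((h.2.2 x hx2).1 hxD)

/-- A point above an `L`-Lipschitz graph that rises by `l / 2` and deviates by at most `l lam`, with
`lam (L + 1) = 1/2`, stays above it. Half of the radius is kept so that these points remain within
the chart. -/
lemma IsChart.cone (h : IsChart D q T r L f) : ∃ e : Plane, ∃ lam > 0, ‖e‖ + lam ≤ 1 ∧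
    ∀ x ∈ Metric.ball q (r / 2) ∩ D, ∀ l, 0 ≤ l → l ≤ r / 2 → coneBall e lam l x ⊆ D := by
  obtain ⟨hr, hL, hch⟩ := h
  set w : Plane := EuclideanSpace.single 1 (1 / 2) with hw
  refine ⟨T.linearIsometryEquiv.symm w, 1 / (2 * (L + 1)), by positivity, ?_, ?_⟩
  · rw [LinearIsometryEquiv.norm_map, hw, PiLp.norm_single]
    have : 1 / (2 * ((L : ℝ) + 1)) ≤ 1 / 2 := by
      apply one_div_le_one_div_of_le <;> [norm_num; nlinarith [L.coe_nonneg]]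
    norm_num at this ⊢
    linarith
  · rintro x ⟨hxq, hxD⟩ l hl hlr z hz
    set lam : ℝ := 1 / (2 * (L + 1)) with hlam
    have hlam' : lam * (L + 1) = 1 / 2 := by
      rw [hlam]; field_simp
    have hlam1 : lam ≤ 1 / 2 := by
      have : 0 < lam := by positivity
      nlinarith [L.coe_nonneg]
    have hTe : T (x + l • T.linearIsometryEquiv.symm w) = T x + l • w := by
      have := T.map_vadd x (l • T.linearIsometryEquiv.symm w)
      simp only [vadd_eq_add, map_smul, LinearIsometryEquiv.apply_symm_apply] at this
      rw [add_comm, this, add_comm]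
    have hd : dist z (x + l • T.linearIsometryEquiv.symm w) ≤ l * lam := hz
    have h0 := (abs_frame_sub_le T z _ 0).trans hd
    have h1 := (abs_frame_sub_le T z _ 1).trans hd
    rw [hTe] at h0 h1
    simp [hw] at h0 h1
    have hzq : z ∈ Metric.ball q r := by
      rw [Metric.mem_ball] at hxq ⊢
      have a1 : dist (x + l • T.linearIsometryEquiv.symm w) x = l / 2 := by
        rw [dist_eq_norm, add_sub_cancel_left, norm_smul, LinearIsometryEquiv.norm_map, hw,
          PiLp.norm_single, Real.norm_eq_abs, abs_of_nonneg hl]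
        norm_num
        ring
      have a2 := dist_triangle z (x + l • T.linearIsometryEquiv.symm w) q
      have a3 := dist_triangle (x + l • T.linearIsometryEquiv.symm w) x q
      nlinarith
    have hxq' : x ∈ Metric.ball q r := Metric.ball_subset_ball (by linarith) hxq
    rw [hch z hzq]
    have hx1 := (hch x hxq').1 hxD
    have hf := hL.dist_le_mul (T z 0) (T x 0)
    rw [Real.dist_eq, Real.dist_eq] at hf
    have hf2 : (L : ℝ) * |T z 0 - T x 0| ≤ L * (l * lam) := by gcongr
    have b1 := (abs_le.1 (hf.trans hf2)).2
    have b2 := (abs_le.1 h1).1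
    have b3 : l * (lam * (L + 1)) = l * (1 / 2) := by rw [hlam']
    nlinarith

/-- Uniform cone property of a bounded Lipschitz open set. -/
lemma IsLipschitzOpen.exists_cone (hD : IsLipschitzOpen D) (hb : Bornology.IsBounded D) :
    ∃ (J : Finset Plane) (U : Plane → Set Plane) (e : Plane → Plane) (lam r₀ : ℝ), 0 < lam ∧ 0 < r₀ ∧
      D ⊆ ⋃ q ∈ J, U q ∧ (∀ q, MeasurableSet (U q)) ∧ ∀ q ∈ J, ‖e q‖ + lam ≤ 1 ∧
      ∀ x ∈ U q, ∀ y ∈ D, dist y x ≤ r₀ → ∀ l, 0 ≤ l → l ≤ r₀ → coneBall (e q) lam l y ⊆ D := by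
  have key : ∀ q : Plane, ∃ (ρ : ℝ) (e : Plane) (lam : ℝ), 0 < ρ ∧ 0 < lam ∧ ‖e‖ + lam ≤ 1 ∧
      (q ∈ closure D → ∀ x ∈ Metric.ball q ρ ∩ D, ∀ l, 0 ≤ l → l ≤ ρ → coneBall e lam l x ⊆ D) := by
    intro q
    by_cases hq : q ∈ closure D
    · by_cases hqD : q ∈ D
      · obtain ⟨ε, hε, hεD⟩ := Metric.isOpen_iff.1 hD.1 q hqD
        refine ⟨ε / 2, 0, 1, by positivity, one_pos, by simp, fun _ x hx l hl hlε z hz => hεD ?_⟩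
        rw [coneBall, smul_zero, add_zero, mul_one, Metric.mem_closedBall] at hz
        have := Metric.mem_ball.1 hx.1
        rw [Metric.mem_ball]
        linarith [dist_triangle z x q]
      · obtain ⟨T, r, L, f, h⟩ := hD.2 q (by rw [hD.1.frontier_eq]; exact ⟨hq, hqD⟩)
        have h : IsChart D q T r L f := h
        obtain ⟨e, lam, h1, h2, h3⟩ := h.cone
        exact ⟨r / 2, e, lam, half_pos h.1, h1, h2, fun _ => h3⟩
    · exact ⟨1, 0, 1, one_pos, one_pos, by simp, fun h => absurd h hq⟩
  choose ρ e lam hρ hlam he hcone using key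
  have hK : IsCompact (closure D) := hb.isCompact_closure
  obtain ⟨J, hJ, hcov⟩ := hK.elim_nhds_subcover (fun q => Metric.ball q (ρ q / 2))
    fun q _ => Metric.ball_mem_nhds q (half_pos (hρ q))
  obtain ⟨lam₀, h1, h2⟩ : ∃ c > 0, ∀ q ∈ J, c ≤ lam q := by
    rcases J.eq_empty_or_nonempty with h | h
    · exact ⟨1, one_pos, by simp [h]⟩
    · exact ⟨J.inf' h lam, (Finset.lt_inf'_iff h).2 fun q _ => hlam q, fun q hq => J.inf'_le lam hq⟩
  obtain ⟨ρ₀, h3, h4⟩ : ∃ c > 0, ∀ q ∈ J, c ≤ ρ q := by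
    rcases J.eq_empty_or_nonempty with h | h
    · exact ⟨1, one_pos, by simp [h]⟩
    · exact ⟨J.inf' h ρ, (Finset.lt_inf'_iff h).2 fun q _ => hρ q, fun q hq => J.inf'_le ρ hq⟩
  refine ⟨J, fun q => Metric.ball q (ρ q / 2), e, lam₀, ρ₀ / 2, h1, half_pos h3, subset_closure.trans hcov,
    fun q => measurableSet_ball, fun q hq =>
      ⟨by linarith [he q, h2 q hq], fun x hx y hy hyx l hl hlr => ?_⟩⟩
  have h5 := h4 q hq
  have hyq : y ∈ Metric.ball q (ρ q) := by
    rw [Metric.mem_ball] at hx ⊢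
    linarith [dist_triangle y x q]
  refine Subset.trans (Metric.closedBall_subset_closedBall ?_)
    (hcone q (hJ q hq) y ⟨hyq, hy⟩ l hl (by linarith))
  exact mul_le_mul_of_nonneg_left (h2 q hq) hl

/-- Finitely many charts around the boundary points. -/
lemma IsLipschitzOpen.exists_charts (hD : IsLipschitzOpen D) (hb : Bornology.IsBounded D) :
    ∃ (J : Finset Plane) (T : Plane → Plane ≃ᵃⁱ[ℝ] Plane) (f : Plane → ℝ → ℝ) (L : NNReal) (ρ : ℝ),
      0 < ρ ∧ (∀ q ∈ J, LipschitzWith L (f q)) ∧ ∀ p ∈ frontier D, ∃ q ∈ J, IsChart D p (T q) ρ L (f q) := by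
  have hc : ∀ q : frontier D, ∃ (T : Plane ≃ᵃⁱ[ℝ] Plane) (r : ℝ) (L : NNReal) (f : ℝ → ℝ),
      IsChart D q T r L f := fun q => hD.2 q q.2
  choose T₀ r₀ L₀ f₀ h₀ using hc
  classical
  let T : Plane → Plane ≃ᵃⁱ[ℝ] Plane := fun q => if h : q ∈ frontier D then T₀ ⟨q, h⟩ else
    AffineIsometryEquiv.refl ℝ Plane
  let r : Plane → ℝ := fun q => if h : q ∈ frontier D then r₀ ⟨q, h⟩ else 1
  let L : Plane → NNReal := fun q => if h : q ∈ frontier D then L₀ ⟨q, h⟩ else 1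
  let f : Plane → ℝ → ℝ := fun q => if h : q ∈ frontier D then f₀ ⟨q, h⟩ else fun _ => 0
  have hch : ∀ q ∈ frontier D, IsChart D q (T q) (r q) (L q) (f q) := fun q hq => by
    simpa only [T, r, L, f, dif_pos hq] using h₀ ⟨q, hq⟩
  have hK : IsCompact (frontier D) := hb.isCompact_closure.of_isClosed_subset isClosed_frontier
    frontier_subset_closure
  obtain ⟨J, hcov⟩ := hK.elim_nhds_subcover' (fun q _ => Metric.ball q (r q / 2))
    fun q hq => Metric.ball_mem_nhds q (half_pos (hch q hq).1)
  have hJ' : ∀ q ∈ J, IsChart D q (T q) (r q) (L q) (f q) := fun q _ => hch q q.2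
  obtain ⟨ρ₀, h3, h4⟩ : ∃ c > 0, ∀ q ∈ J, c ≤ r q / 2 := by
    rcases J.eq_empty_or_nonempty with h | h
    · exact ⟨1, one_pos, by simp [h]⟩
    · exact ⟨J.inf' h fun q => r q / 2, (Finset.lt_inf'_iff h).2 fun q hq => half_pos (hJ' q hq).1,
        fun q hq => J.inf'_le (fun q => r q / 2) hq⟩
  have hL : ∀ q ∈ J, LipschitzWith (J.sup fun q => L q) (f q) := fun q hq =>
    (hJ' q hq).2.1.weaken (J.le_sup (f := fun q => L q) hq)
  refine ⟨J.image Subtype.val, T, f, J.sup fun q => L q, ρ₀, h3, ?_, fun p hp => ?_⟩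
  · intro q hq
    obtain ⟨q', hq', rfl⟩ := Finset.mem_image.1 hq
    exact hL q' hq'
  · have hpJ := hcov hp
    simp only [mem_iUnion] at hpJ
    obtain ⟨q, hq, hpq⟩ := hpJ
    refine ⟨q, Finset.mem_image_of_mem _ hq, h3, hL q hq, fun x hx => (hJ' q hq).2.2 x ?_⟩
    rw [Metric.mem_ball] at hpq hx ⊢
    linarith [dist_triangle x p q, h4 q hq]

lemma measurable_frame_coord (T : Plane ≃ᵃⁱ[ℝ] Plane) (i : Fin 2) : Measurable fun x => T x i := by
  have : Continuous fun x => T x i := by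
    have := T.continuous; fun_prop
  exact this.measurable

/-- The boundary of a bounded Lipschitz open set has measure zero. -/
lemma IsLipschitzOpen.volume_frontier (hD : IsLipschitzOpen D) : volume (frontier D) = 0 := by
  refine measure_null_of_locally_null _ fun p hp => ?_
  obtain ⟨T, r, L, f, h⟩ := hD.2 p hp
  have h : IsChart D p T r L f := h
  refine ⟨frontier D ∩ Metric.ball p r, inter_mem_nhdsWithin _ (Metric.ball_mem_nhds p h.1), ?_⟩
  -- Locally the boundary is a graph, hence thin for every width, so its measure is arbitrarily
  -- small.
  have hthin : ∀ δ > 0, Thin (frontier D ∩ Metric.ball p r) δ := fun δ hδ =>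
    thin_of_graph T h.2.1.continuous.measurable (a := -δ) (b := δ) (by linarith)
      (isClosed_frontier.measurableSet.inter measurableSet_ball) fun x hx => by
        rw [h.eq_of_frontier hD.1 hx.1 hx.2]
        constructor <;> linarith
  have hle : ∀ δ > 0, volume (frontier D ∩ Metric.ball p r) ≤ ENNReal.ofReal (8 * δ * r) := fun δ hδ => by
    refine (measure_mono fun x hx => ?_).trans ((hthin δ hδ).2 p r h.1)
    exact ⟨hx, Metric.ball_subset_closedBall hx.2⟩
  refine le_antisymm (ENNReal.le_of_forall_pos_le_add fun ε hε _ => ?_) (zero_le)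
  have hr := h.1
  refine (hle (ε / (8 * r)) (by positivity)).trans_eq ?_
  rw [zero_add, show 8 * ((ε : ℝ) / (8 * r)) * r = ε by field_simp]
  exact ENNReal.ofReal_coe_nnreal

/-- Thin layers along the boundary which have a part of the expected size near each boundary point. -/
lemma IsLipschitzOpen.exists_layers (hD : IsLipschitzOpen D) (hb : Bornology.IsBounded D) :
    ∃ (J : Finset Plane) (S : Plane → ℝ → Set Plane) (a₀ c : ℝ), 0 < a₀ ∧ 0 < c ∧
      (∀ q ∈ J, ∀ δ, 0 < δ → Thin (S q δ) δ ∧ S q δ ⊆ D) ∧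
      ∀ p ∈ frontier D, ∀ a δ, 0 < δ → a ≤ a₀ → δ ≤ c * a →
        ∃ q ∈ J, ENNReal.ofReal (c * δ * a) ≤ volume (S q δ ∩ Metric.ball p a) := by
  obtain ⟨J, T, f, L, ρ, hρ, hf, hch⟩ := hD.exists_charts hb
  have hL0 := L.coe_nonneg
  refine ⟨J, fun q δ => D ∩ {x | f q (T q x 0) < T q x 1 ∧ T q x 1 < f q (T q x 0) + δ}, ρ,
    1 / (4 * (L + 1)), hρ, by positivity, fun q hq δ hδ => ⟨?_, inter_subset_left⟩,
    fun p hp a δ hδ ha hδa => ?_⟩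
  · have hm := (hf q hq).continuous.measurable
    have m0 := measurable_frame_coord (T q) 0
    have m1 := measurable_frame_coord (T q) 1
    refine thin_of_graph (T q) hm (a := 0) (b := δ) (by linarith) (hD.1.measurableSet.inter
      ((measurableSet_lt (hm.comp m0) m1).inter (measurableSet_lt m1 ((hm.comp m0).add_const δ)))) ?_
    intro x hx
    rw [add_zero]
    exact hx.2
  · obtain ⟨q, hq, hC⟩ := hch p hp
    refine ⟨q, hq, ?_⟩
    have hm := hC.2.1.continuous.measurable
    have hp1 := hC.eq_of_frontier hD.1 hp (Metric.mem_ball_self hρ)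
    have ha0 : 0 < a := by
      have : 0 < 1 / (4 * ((L : ℝ) + 1)) * a := lt_of_lt_of_le hδ hδa
      exact pos_of_mul_pos_right this (by positivity)
    -- Half the width of the piece of the layer that is kept: over an interval of this length the
    -- graph rises by at most `L b`, and with `δ ≤ b` the piece fits into the ball of radius `a = 4
    -- (L + 1) b`.
    set b : ℝ := 1 / (4 * (L + 1)) * a with hb
    have hb0 : 0 < b := by positivity
    have hb4 : 4 * (L + 1) * b = a := by rw [hb]; field_simp
    have hsub : {x | T q x 0 ∈ Ioo (T q p 0 - b) (T q p 0 + b) ∧ f q (T q x 0) < T q x 1 ∧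
        T q x 1 < (fun t => f q t + δ) (T q x 0)} ⊆ (D ∩ {x | f q (T q x 0) < T q x 1 ∧
          T q x 1 < f q (T q x 0) + δ}) ∩ Metric.ball p a := by
      rintro x ⟨hx0, hx1, hx2⟩
      have e1 : |T q x 0 - T q p 0| < b := by
        rw [abs_lt]; constructor <;> linarith [hx0.1, hx0.2]
      have e2 := hC.2.1.dist_le_mul (T q x 0) (T q p 0)
      rw [Real.dist_eq, Real.dist_eq] at e2
      have e3 : (L : ℝ) * |T q x 0 - T q p 0| ≤ L * b := by gcongr
      have e4 := abs_le.1 (e2.trans e3)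
      have e5 : |T q x 1 - T q p 1| ≤ L * b + b := by
        rw [abs_le, hp1]
        simp only at hx2
        constructor <;> linarith
      have hball : x ∈ Metric.ball p a := by
        rw [Metric.mem_ball, ← (T q).dist_map, EuclideanSpace.dist_eq, Fin.sum_univ_two, Real.dist_eq,
          Real.dist_eq, sq_abs, sq_abs]
        refine (Real.sqrt_lt' ha0).2 ?_
        have k1 : (T q x 0 - T q p 0) ^ 2 ≤ b ^ 2 := sq_le_sq' (by linarith [(abs_lt.1 e1).1])
          (by linarith [(abs_lt.1 e1).2])
        have k2 : (T q x 1 - T q p 1) ^ 2 ≤ (L * b + b) ^ 2 := sq_le_sq' (by linarith [(abs_le.1 e5).1])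
          (by linarith [(abs_le.1 e5).2])
        have k3 : b ^ 2 ≤ (L * b + b) ^ 2 := by
          apply pow_le_pow_left₀ hb0.le
          nlinarith
        have k4 : a ^ 2 = 16 * (L * b + b) ^ 2 := by rw [← hb4]; ring
        have k5 : 0 < (L * b + b) ^ 2 := by positivity
        linarith
      have hD' : x ∈ D := (hC.2.2 x (Metric.ball_subset_ball ha hball)).2 hx1
      exact ⟨⟨hD', hx1, hx2⟩, hball⟩
    refine le_trans ?_ (measure_mono hsub)
    rw [volume_frame_graph (T q) measurableSet_Ioo hm (hm.add_const δ)]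
    have : ∀ t, f q t + δ - f q t = δ := fun t => by ring
    simp only [this, lintegral_const, Measure.restrict_apply_univ, Real.volume_Ioo]
    rw [← ENNReal.ofReal_mul hδ.le]
    apply ENNReal.ofReal_le_ofReal
    rw [show 1 / (4 * ((L : ℝ) + 1)) * δ * a = δ * b by rw [hb]; ring]
    nlinarith

end Lipschitz

/-! ## Fields of fractional regularity on a Lipschitz domain -/

/-- A square integrable field with a finite Sobolev–Slobodeckij double integral. -/
structure FracField (s : ℝ) (D : Set Plane) (w : Plane → Plane) : Prop where
  measurable : Measurable w
  memL2 : MemL2 D w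
  gag_ne_top : gag s D w ≠ ⊤

/-- The Sobolev–Slobodeckij double integral as a real number. -/
def gagR (s : ℝ) (E : Set Plane) (w : Plane → Plane) : ℝ := (gag s E w).toReal

section Frac
variable {s : ℝ} {D E N : Set Plane} {w : Plane → Plane}

lemma gag_mono (h : E ⊆ D) : gag s E w ≤ gag s D w :=
  (lintegral_mono_set h).trans (lintegral_mono fun _ => lintegral_mono_set h)

lemma FracField.mono (h : FracField s D w) (hE : E ⊆ D) : FracField s E w :=
  ⟨h.measurable, h.memL2.mono_measure (Measure.restrict_mono hE le_rfl),
    ne_top_of_le_ne_top h.gag_ne_top (gag_mono hE)⟩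

lemma FracField.ofReal_gagR (h : FracField s D w) : ENNReal.ofReal (gagR s D w) = gag s D w :=
  ENNReal.ofReal_toReal h.gag_ne_top

lemma gagR_nonneg : 0 ≤ gagR s D w := ENNReal.toReal_nonneg

lemma integrableOn_norm_sub_sq (h : MemL2 D w) (hD : volume D ≠ ⊤) (m : Plane) :
    IntegrableOn (fun x => ‖w x - m‖ ^ 2) D := by
  have : IsFiniteMeasure (volume.restrict D) := ⟨by simpa using hD.lt_top⟩
  exact (MemLp.sub h (memLp_const m)).integrable_norm_pow (by norm_num)

lemma FracField.integrableOn (h : FracField s D w) (hD : volume D ≠ ⊤) (m : Plane) :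
    IntegrableOn (fun x => ‖w x - m‖ ^ 2) D := integrableOn_norm_sub_sq h.memL2 hD m

lemma FracField.lintegral_eq (h : FracField s D w) (hD : volume D ≠ ⊤) (m : Plane) :
    ∫⁻ x in D, ‖w x - m‖ₑ ^ 2 = ENNReal.ofReal (∫ x in D, ‖w x - m‖ ^ 2) := by
  rw [ofReal_integral_eq_lintegral_ofReal (h.integrableOn hD m)
    (Filter.Eventually.of_forall fun x => sq_nonneg _)]
  congr 1 with x
  rw [ENNReal.ofReal_pow (norm_nonneg _), ofReal_norm]

lemma setIntegral_sq_nonneg (m : Plane) : 0 ≤ ∫ x in D, ‖w x - m‖ ^ 2 :=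
  integral_nonneg fun _ => sq_nonneg _

/-- The trace inequality on thin subsets of a Lipschitz domain, and the measure density. -/
lemma IsLipschitzOpen.thin_trace (hs : 1 / 2 < s) (hD : IsLipschitzOpen D)
    (hb : Bornology.IsBounded D) : ∃ C r₀ c : ℝ, 0 < C ∧ 0 < r₀ ∧ 0 < c ∧
      (∀ {N E : Set Plane} {δ r : ℝ} {w : Plane → Plane} (m : Plane), FracField s D w → Thin N δ →
        N ⊆ D → 0 < δ → 0 < r → r ≤ r₀ → MeasurableSet E → E ⊆ D →
        (∀ x ∈ N, Metric.closedBall x r ∩ D ⊆ E) → ∫ x in N, ‖w x - m‖ ^ 2 ≤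
          C * δ * (r⁻¹ * (∫ x in E, ‖w x - m‖ ^ 2) + r ^ (2 * s - 1) * gagR s E w)) ∧
      ∀ x ∈ D, ∀ r, 0 < r → r ≤ r₀ → ENNReal.ofReal (c * r ^ 2) ≤ volume (Metric.closedBall x r ∩ D) := by
  obtain ⟨J, U, e, lam, r₀, hlam, hr₀, hcov, hU, hcone⟩ := hD.exists_cone hb
  obtain ⟨C, hC, hT⟩ := MaxwellVEM.thin_trace hs hlam
  have hpi := Real.pi_pos
  have hvol := (hb.measure_lt_top (μ := volume)).ne
  refine ⟨(J.card + 1) * C, r₀, lam ^ 2 * Real.pi, by positivity, hr₀, by positivity, ?_, ?_⟩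
  · intro N E δ r w m hw hN hND hδ hr hrr hE hED hNE
    set X := r⁻¹ * (∫ x in E, ‖w x - m‖ ^ 2) + r ^ (2 * s - 1) * gagR s E w with hX
    have hX0 : 0 ≤ X := add_nonneg (mul_nonneg (inv_nonneg.2 hr.le) (setIntegral_sq_nonneg m))
      (mul_nonneg (by positivity) gagR_nonneg)
    have hEv : volume E ≠ ⊤ := ne_top_of_le_ne_top hvol (measure_mono hED)
    have hNv : volume N ≠ ⊤ := ne_top_of_le_ne_top hvol (measure_mono hND)
    -- On each member of the finite cover one cone direction serves all points, as
    -- `MaxwellVEM.thin_trace` requires.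
    have h1 : ∀ q : J, ∫⁻ x in N ∩ U q, ‖w x - m‖ₑ ^ 2 ≤ ENNReal.ofReal (C * δ * X) := fun q => by
      have h2 := hT (N := N ∩ U q) (E := E) (e := e q) (r := r) (w := w) (δ := δ) m
        ⟨hN.1.inter (hU q), fun z l hl => (measure_mono (by gcongr; exact inter_subset_left)).trans
          (hN.2 z l hl)⟩ hδ hr (hcone q q.2).1 hE
        (fun x hx l hl hlr => fun z hz => hNE x hx.1
          ⟨Metric.closedBall_subset_closedBall hlr (coneBall_subset (hcone q q.2).1 hl x hz),
            (hcone q q.2).2 x hx.2 x (hND hx.1) (by simpa using hr₀.le) l hl (hlr.trans hrr) hz⟩) hw.measurable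
      rw [(hw.mono hED).lintegral_eq hEv, ← (hw.mono hED).ofReal_gagR, ← ENNReal.ofReal_mul (by positivity),
        ← ENNReal.ofReal_mul (by positivity), ← ENNReal.ofReal_add
          (mul_nonneg (inv_nonneg.2 hr.le) (setIntegral_sq_nonneg m))
          (mul_nonneg (by positivity) gagR_nonneg), ← ENNReal.ofReal_mul (by positivity)] at h2
      exact h2
    have h3 : ∫⁻ x in N, ‖w x - m‖ₑ ^ 2 ≤ ENNReal.ofReal (J.card * (C * δ * X)) := by
      have hsub : N ⊆ ⋃ q : J, N ∩ U q := fun x hx => by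
        obtain ⟨q, hq, hxq⟩ := mem_iUnion₂.1 (hcov (hND hx))
        exact mem_iUnion.2 ⟨⟨q, hq⟩, hx, hxq⟩
      refine (lintegral_mono_set hsub).trans ((lintegral_iUnion_le _ _).trans ?_)
      rw [tsum_fintype]
      refine (Finset.sum_le_sum fun q _ => h1 q).trans_eq ?_
      rw [Finset.sum_const, Finset.card_univ, Fintype.card_coe, nsmul_eq_mul,
        ENNReal.ofReal_mul (p := (J.card : ℝ)) (by positivity), ENNReal.ofReal_natCast]
    rw [(hw.mono hND).lintegral_eq hNv, ENNReal.ofReal_le_ofReal_iff (by positivity)] at h3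
    refine h3.trans ?_
    have : 0 ≤ C * δ * X := by positivity
    nlinarith
  · intro x hx r hr hrr
    obtain ⟨q, hq, hxq⟩ := mem_iUnion₂.1 (hcov hx)
    have h1 := (hcone q hq).2 x hxq x hx (by simpa using hr₀.le) r hr.le hrr
    have h2 := coneBall_subset (hcone q hq).1 hr.le x
    refine le_trans ?_ (measure_mono (subset_inter h2 h1))
    rw [volume_coneBall hr.le hlam.le]
    apply ENNReal.ofReal_le_ofReal
    apply le_of_eq
    ring

/-- A Poincaré inequality with the value of the field at a suitable point. -/
lemma exists_mean (hs : 0 ≤ s) (hw : FracField s E w) (hE : MeasurableSet E) {d V : ℝ} (hV : 0 < V)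
    (hVE : ENNReal.ofReal V ≤ volume E) (hEt : volume E ≠ ⊤) (hd : ∀ x ∈ E, ∀ y ∈ E, dist x y ≤ d) :
    ∃ m, ∫ x in E, ‖w x - m‖ ^ 2 ≤ d ^ (2 * (1 + s)) / V * gagR s E w := by
  have hV0 : ENNReal.ofReal V ≠ 0 := by simpa using hV
  have hE0 : volume E ≠ 0 := fun h => hV0 (by rw [h] at hVE; exact le_antisymm hVE zero_le)
  have hm := measurable_gag_integrand hw.measurable s
  -- The constant is the value of the field at a point `z` where the inner integral of the double
  -- integral does not exceed its mean.
  obtain ⟨z, hz, h⟩ := exists_le_setLAverage hE0 hEt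
    (Measurable.lintegral_prod_right' (ν := volume.restrict E) hm).aemeasurable
  obtain ⟨z', hz'⟩ : E.Nonempty := ⟨z, hz⟩
  have hd0 : 0 ≤ d := dist_nonneg.trans (hd z hz z' hz')
  refine ⟨w z, ?_⟩
  have h1 : ∫⁻ y in E, ‖w y - w z‖ₑ ^ 2 ≤ ENNReal.ofReal (d ^ (2 * (1 + s)) / V * gagR s E w) := by
    calc ∫⁻ y in E, ‖w y - w z‖ₑ ^ 2 ≤ ∫⁻ y in E, ENNReal.ofReal (d ^ (2 * (1 + s))) *
          (‖w z - w y‖ₑ ^ 2 / edist z y ^ (2 * (1 + s))) := by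
          refine setLIntegral_mono' hE fun y hy => ?_
          rw [← enorm_neg, neg_sub]
          exact enorm_sq_le_gag_integrand hs (hd z hz y hy)
      _ = ENNReal.ofReal (d ^ (2 * (1 + s))) * ∫⁻ y in E, ‖w z - w y‖ₑ ^ 2 / edist z y ^ (2 * (1 + s)) :=
          lintegral_const_mul' _ _ ENNReal.ofReal_ne_top
      _ ≤ ENNReal.ofReal (d ^ (2 * (1 + s))) * (gag s E w / ENNReal.ofReal V) := by
          refine mul_le_mul' le_rfl (h.trans ?_)
          rw [setLAverage_eq]
          exact ENNReal.div_le_div le_rfl hVE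
      _ = _ := by
          rw [← hw.ofReal_gagR, ← ENNReal.ofReal_div_of_pos hV, ← ENNReal.ofReal_mul (by positivity)]
          congr 1
          ring
  rw [hw.lintegral_eq hEt, ENNReal.ofReal_le_ofReal_iff] at h1
  · exact h1
  · exact mul_nonneg (by positivity) gagR_nonneg

/-- The mean value is at least as close as any constant, in a pointwise sense. -/
lemma norm_average_sub_sq_le {K : Set Plane} (hw : MemL2 K w) (hK0 : volume K ≠ 0)
    (hK : volume K ≠ ⊤) (m : Plane) :
    volume.real K * ‖(⨍ x in K, w x) - m‖ ^ 2 ≤ ∫ x in K, ‖w x - m‖ ^ 2 := by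
  have : IsFiniteMeasure (volume.restrict K) := ⟨by simpa using hK.lt_top⟩
  have hi : IntegrableOn w K := MemLp.integrable (by norm_num) hw
  set a := ⨍ x in K, w x with ha
  have hV : 0 < volume.real K := ENNReal.toReal_pos hK0 hK
  have key : ∫ x in K, (2 * inner ℝ (w x - a) (a - m) + ‖a - m‖ ^ 2) = volume.real K * ‖a - m‖ ^ 2 := by
    have h0 : ∫ x in K, (inner ℝ (w x - a) (a - m) : ℝ) = 0 := by
      have := integral_inner (𝕜 := ℝ) (f := fun x => w x - a) (μ := volume.restrict K)
        (hi.sub (integrable_const a)) (a - m)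
      simp only [real_inner_comm (a - m)] at this ⊢
      have h3 : ∫ x in K, (w x - a) = 0 := by
        rw [integral_sub hi (integrable_const a), setIntegral_const, ha, setAverage_eq,
          smul_inv_smul₀ hV.ne', sub_self]
      rw [h3, inner_zero_right] at this
      simpa only [real_inner_comm] using this
    have hii : Integrable (fun x => 2 * (inner ℝ (w x - a) (a - m) : ℝ)) (volume.restrict K) :=
      ((hi.sub (integrable_const a)).inner_const (a - m)).const_mul 2
    rw [integral_add hii (integrable_const _), integral_const_mul, h0, setIntegral_const]
    simp
  rw [← key]
  refine integral_mono ?_ (integrableOn_norm_sub_sq hw hK m) fun x => ?_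
  · exact (((hi.sub (integrable_const a)).inner_const (a - m)).const_mul 2).add (integrable_const _)
  · have : w x - m = (w x - a) + (a - m) := by abel
    simp only
    rw [this, norm_add_sq_real]
    nlinarith [sq_nonneg ‖w x - a‖]

end Frac

/-! ### Estimates at the scale of an element -/

section Local
variable {s : ℝ} {D : Set Plane}

/-- The part of `D` in a neighbourhood of an element with centroid `c` and diameter `h`. -/
def patch (D : Set Plane) (c : Plane) (h : ℝ) : Set Plane := D ∩ Metric.ball c (5 / 4 * h)

lemma measurableSet_patch (hD : IsOpen D) (c : Plane) (h : ℝ) : MeasurableSet (patch D c h) :=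
  hD.measurableSet.inter measurableSet_ball

lemma patch_subset (c : Plane) (h : ℝ) : patch D c h ⊆ D := inter_subset_left

/-- The trace inequality at the scale of an element, and the Poincaré inequality on a patch. -/
lemma IsLipschitzOpen.patch_estimates (hs : 1 / 2 < s) (hD : IsLipschitzOpen D)
    (hb : Bornology.IsBounded D) {H : ℝ} (hH : 0 < H) : ∃ C : ℝ, 0 < C ∧
      ∀ {w : Plane → Plane}, FracField s D w → ∀ (c : Plane) (h : ℝ), 0 < h → h ≤ H →
        (∀ {N : Set Plane} {δ : ℝ} (m : Plane), Thin N δ → N ⊆ D → N ⊆ Metric.closedBall c (9 / 8 * h) →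
          0 < δ → ∫ x in N, ‖w x - m‖ ^ 2 ≤ C * δ * (h⁻¹ * (∫ x in patch D c h, ‖w x - m‖ ^ 2) +
            h ^ (2 * s - 1) * gagR s (patch D c h) w)) ∧
        ∀ x ∈ D, dist x c ≤ 9 / 8 * h → ∃ m, h⁻¹ * (∫ x in patch D c h, ‖w x - m‖ ^ 2) ≤
          C * (h ^ (2 * s - 1) * gagR s (patch D c h) w) := by
  obtain ⟨C, r₀, v, hC, hr₀, hv, hT, hV⟩ := hD.thin_trace hs hb
  -- The cones reach a distance `κ h`: with `9/8 + 1/16 < 5/4` they stay in the patch, and `κ h ≤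
  -- r₀` for all `h ≤ H`.
  set κ := min (1 / 16) (r₀ / H) with hκ
  have hκ0 : 0 < κ := lt_min (by norm_num) (by positivity)
  have hκ1 : κ ≤ 1 / 16 := min_le_left _ _
  have hκr : ∀ h, 0 < h → h ≤ H → κ * h ≤ r₀ := fun h h0 h1 => by
    calc κ * h ≤ r₀ / H * H := by gcongr; exact min_le_right _ _
      _ = r₀ := by field_simp
  have hsub : ∀ (c : Plane) (h : ℝ), 0 < h → ∀ x, dist x c ≤ 9 / 8 * h →
      Metric.closedBall x (κ * h) ∩ D ⊆ patch D c h := fun c h h0 x hx z hz => by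
    refine ⟨hz.2, ?_⟩
    have := Metric.mem_closedBall.1 hz.1
    rw [Metric.mem_ball]
    nlinarith [dist_triangle z x c]
  refine ⟨C * κ⁻¹ + (5 / 2) ^ (2 * (1 + s)) / (v * κ ^ 2), by positivity, ?_⟩
  intro w hw c h h0 hhH
  have hG : 0 ≤ gagR s (patch D c h) w := gagR_nonneg
  constructor
  · intro N δ m hN hND hNc hδ
    have h1 := hT m hw hN hND hδ (mul_pos hκ0 h0) (hκr h h0 hhH) (measurableSet_patch hD.1 c h)
      (patch_subset c h) fun x hx => hsub c h h0 x (hNc hx)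
    refine h1.trans ?_
    have hI : 0 ≤ ∫ x in patch D c h, ‖w x - m‖ ^ 2 := setIntegral_sq_nonneg m
    have h2 : (κ * h) ^ (2 * s - 1) ≤ κ⁻¹ * h ^ (2 * s - 1) := by
      rw [Real.mul_rpow hκ0.le h0.le]
      gcongr
      calc κ ^ (2 * s - 1) ≤ 1 := Real.rpow_le_one hκ0.le (by linarith) (by linarith)
        _ ≤ κ⁻¹ := (one_le_inv₀ hκ0).2 (by linarith)
    have h3 : 0 ≤ (5 / 2 : ℝ) ^ (2 * (1 + s)) / (v * κ ^ 2) := by positivity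
    calc C * δ * ((κ * h)⁻¹ * (∫ x in patch D c h, ‖w x - m‖ ^ 2) +
          (κ * h) ^ (2 * s - 1) * gagR s (patch D c h) w)
        ≤ C * δ * (κ⁻¹ * h⁻¹ * (∫ x in patch D c h, ‖w x - m‖ ^ 2) +
          κ⁻¹ * h ^ (2 * s - 1) * gagR s (patch D c h) w) := by
          rw [mul_inv]; gcongr
      _ = C * κ⁻¹ * δ * (h⁻¹ * (∫ x in patch D c h, ‖w x - m‖ ^ 2) +
          h ^ (2 * s - 1) * gagR s (patch D c h) w) := by ring
      _ ≤ _ := by gcongr; linarith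
  · intro x hx hxc
    have hvol := (hb.measure_lt_top (μ := volume)).ne
    have h1 := (hV x hx (κ * h) (by positivity) (hκr h h0 hhH)).trans (measure_mono (hsub c h h0 x hxc))
    obtain ⟨m, hm⟩ := exists_mean (by linarith) (hw.mono (patch_subset c h)) (measurableSet_patch hD.1 c h)
      (V := v * (κ * h) ^ 2) (d := 5 / 2 * h) (by positivity) h1
      (ne_top_of_le_ne_top hvol (measure_mono (patch_subset c h))) fun y hy z hz => by
        have a1 := Metric.mem_ball.1 hy.2
        have a2 := Metric.mem_ball.1 hz.2
        linarith [dist_triangle_right y z c]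
    refine ⟨m, ?_⟩
    have e : h⁻¹ * ((5 / 2 * h) ^ (2 * (1 + s)) / (v * (κ * h) ^ 2)) =
        (5 / 2) ^ (2 * (1 + s)) / (v * κ ^ 2) * h ^ (2 * s - 1) := by
      rw [Real.mul_rpow (by norm_num) h0.le, show 2 * (1 + s) = (2 * s - 1) + 3 by ring,
        Real.rpow_add h0, show h ^ (3 : ℝ) = h ^ 3 by norm_cast]
      field_simp
    calc h⁻¹ * (∫ x in patch D c h, ‖w x - m‖ ^ 2)
        ≤ h⁻¹ * ((5 / 2 * h) ^ (2 * (1 + s)) / (v * (κ * h) ^ 2) * gagR s (patch D c h) w) := by gcongr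
      _ = (5 / 2) ^ (2 * (1 + s)) / (v * κ ^ 2) * (h ^ (2 * s - 1) * gagR s (patch D c h) w) := by
          rw [← mul_assoc, e]; ring
      _ ≤ _ := by gcongr; linarith [show 0 < C * κ⁻¹ by positivity]

lemma norm_sq_le_two (a b : Plane) : ‖a‖ ^ 2 ≤ 2 * ‖b‖ ^ 2 + 2 * ‖b - a‖ ^ 2 := by
  have h1 : ‖a‖ ≤ ‖b‖ + ‖b - a‖ := by
    calc ‖a‖ = ‖b - (b - a)‖ := by rw [sub_sub_cancel]
      _ ≤ _ := norm_sub_le _ _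
  calc ‖a‖ ^ 2 ≤ (‖b‖ + ‖b - a‖) ^ 2 := by gcongr
    _ ≤ _ := by nlinarith [sq_nonneg (‖b‖ - ‖b - a‖)]

/-- The estimates near elements that meet the boundary of `D`. -/
lemma IsLipschitzOpen.layer_estimates (hs : 1 / 2 < s) (hD : IsLipschitzOpen D)
    (hb : Bornology.IsBounded D) {H : ℝ} (hH : 0 < H) :
    ∃ (C : ℝ) (J : Finset Plane) (S : Plane → ℝ → Set Plane), 0 < C ∧
      (∀ q ∈ J, ∀ δ, 0 < δ → MeasurableSet (S q δ) ∧ S q δ ⊆ D) ∧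
      ∀ {w : Plane → Plane}, FracField s D w →
        (∀ q ∈ J, ∀ δ, 0 < δ → δ⁻¹ * (∫ x in S q δ, ‖w x‖ ^ 2) ≤
          C * ((∫ x in D, ‖w x‖ ^ 2) + gagR s D w)) ∧
        ∀ (c : Plane) (h δ : ℝ), 0 < h → h ≤ H → 0 < δ → C * δ ≤ h →
          ∀ p ∈ frontier D, dist p c ≤ h → h⁻¹ * (∫ x in patch D c h, ‖w x‖ ^ 2) ≤
            C * (δ⁻¹ * (∑ q ∈ J, ∫ x in S q δ ∩ Metric.ball c (5 / 4 * h), ‖w x‖ ^ 2) +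
              h ^ (2 * s - 1) * gagR s (patch D c h) w) := by
  obtain ⟨J, S, a₀, v, ha₀, hv, hS, hSp⟩ := hD.exists_layers hb
  obtain ⟨C₁, hC₁, hpatch⟩ := hD.patch_estimates hs hb hH
  obtain ⟨C₂, r₀, _, hC₂, hr₀, _, hT, -⟩ := hD.thin_trace hs hb
  -- Points within `κ h` of `p` are within `9/8 h` of `c`, where the patch estimates apply, and the
  -- layers have their full size at the radius `κ h ≤ a₀`.
  set κ := min (1 / 8) (a₀ / H) with hκ
  have hκ0 : 0 < κ := lt_min (by norm_num) (by positivity)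
  have hκ1 : κ ≤ 1 / 8 := min_le_left _ _
  have hκr : ∀ h, 0 < h → h ≤ H → κ * h ≤ a₀ := fun h h0 h1 => by
    calc κ * h ≤ a₀ / H * H := by gcongr; exact min_le_right _ _
      _ = a₀ := by field_simp
  have hvol := (hb.measure_lt_top (μ := volume)).ne
  set A := C₂ * (r₀⁻¹ + r₀ ^ (2 * s - 1)) with hA
  set B := 20 / (v * κ) * (1 + C₁ * (C₁ + 1)) + 2 * C₁ with hB
  have hA0 : 0 < A := by positivity
  have hB0 : 0 < B := by positivity
  refine ⟨A + B + (v * κ)⁻¹, J, S, by positivity,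
    fun q hq δ hδ => ⟨(hS q hq δ hδ).1.1, (hS q hq δ hδ).2⟩, fun {w} hw => ⟨?_, ?_⟩⟩
  · intro q hq δ hδ
    have h1 := hT (N := S q δ) (E := D) 0 hw (hS q hq δ hδ).1 (hS q hq δ hδ).2 hδ hr₀ le_rfl
      hD.1.measurableSet subset_rfl fun x _ => inter_subset_right
    simp only [sub_zero] at h1
    have hI : 0 ≤ ∫ x in D, ‖w x‖ ^ 2 := integral_nonneg fun _ => sq_nonneg _
    have hG : 0 ≤ gagR s D w := gagR_nonneg
    have hr1 : 0 < r₀⁻¹ := by positivity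
    have hr2 : 0 < r₀ ^ (2 * s - 1) := by positivity
    calc δ⁻¹ * (∫ x in S q δ, ‖w x‖ ^ 2)
        ≤ δ⁻¹ * (C₂ * δ * (r₀⁻¹ * (∫ x in D, ‖w x‖ ^ 2) + r₀ ^ (2 * s - 1) * gagR s D w)) := by gcongr
      _ = C₂ * (r₀⁻¹ * (∫ x in D, ‖w x‖ ^ 2) + r₀ ^ (2 * s - 1) * gagR s D w) := by
          field_simp
      _ ≤ A * ((∫ x in D, ‖w x‖ ^ 2) + gagR s D w) := by
          rw [hA, mul_assoc]
          gcongr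
          nlinarith [mul_nonneg hr1.le hG, mul_nonneg hr2.le hI]
      _ ≤ _ := by
          gcongr
          linarith [show 0 < (v * κ)⁻¹ by positivity]
  · intro c h δ h0 hhH hδ hδh p hp hpc
    have hδ' : δ ≤ v * (κ * h) := by
      have h1 : (v * κ)⁻¹ * δ ≤ h := le_trans (by gcongr; linarith) hδh
      rw [inv_mul_le_iff₀ (by positivity)] at h1
      linarith
    obtain ⟨q, hq, hqv⟩ := hSp p hp (κ * h) δ hδ (hκr h h0 hhH) hδ'
    set N := S q δ ∩ Metric.ball p (κ * h) with hN
    have hND : N ⊆ D := inter_subset_left.trans (hS q hq δ hδ).2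
    have hNthin : Thin N δ := ⟨(hS q hq δ hδ).1.1.inter measurableSet_ball, fun z l hl =>
      (measure_mono (by gcongr; exact inter_subset_left)).trans ((hS q hq δ hδ).1.2 z l hl)⟩
    have hNc : ∀ x ∈ N, dist x c ≤ 9 / 8 * h := fun x hx => by
      have := Metric.mem_ball.1 hx.2
      nlinarith [dist_triangle x p c]
    have hNv : volume N ≠ ⊤ := ne_top_of_le_ne_top hvol (measure_mono hND)
    have hNpos : 0 < v * δ * (κ * h) := by positivity
    have hNv' : v * δ * (κ * h) ≤ volume.real N := by
      rw [Measure.real, ← ENNReal.ofReal_le_iff_le_toReal hNv]; exact hqv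
    obtain ⟨x, hx⟩ : N.Nonempty := by
      refine nonempty_of_measure_ne_zero (μ := volume) fun h0 => ?_
      rw [h0, nonpos_iff_eq_zero, ENNReal.ofReal_eq_zero] at hqv
      linarith
    obtain ⟨hp1, hp2⟩ := hpatch hw c h h0 hhH
    -- On the patch `w` is close to a constant `m` which need not be small. Its size is read off on
    -- the piece `N` of the layer: there `w - m` is small by the trace inequality, and `N` has
    -- measure of order `δ h`, so `h ‖m‖ ^ 2` is bounded by the layer average of `‖w‖ ^ 2`.
    obtain ⟨m, hm⟩ := hp2 x (hND hx) (hNc x hx)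
    have hm2 := hp1 m hNthin hND (fun x hx => hNc x hx) hδ
    set G := h ^ (2 * s - 1) * gagR s (patch D c h) w with hG
    have hG0 : 0 ≤ G := mul_nonneg (by positivity) gagR_nonneg
    have hwN := hw.mono hND
    have hwE := hw.mono (patch_subset c h)
    have hEv : volume (patch D c h) ≠ ⊤ := ne_top_of_le_ne_top hvol (measure_mono (patch_subset c h))
    have hE5 : volume.real (patch D c h) ≤ 5 * h ^ 2 := by
      have h1 : volume (patch D c h) ≤ ENNReal.ofReal (5 * h ^ 2) := by
        refine (measure_mono (inter_subset_right.trans Metric.ball_subset_closedBall)).trans ?_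
        rw [EuclideanSpace.volume_closedBall_fin_two, ← ENNReal.ofReal_pow (by positivity),
          ← ENNReal.ofReal_mul (by positivity)]
        apply ENNReal.ofReal_le_ofReal
        have := Real.pi_lt_d2
        nlinarith [sq_nonneg h]
      exact ENNReal.toReal_le_of_le_ofReal (by positivity) h1
    have i0 : IntegrableOn (fun x => ‖w x‖ ^ 2) N := by
      simpa only [sub_zero] using hwN.integrableOn hNv 0
    have iE : IntegrableOn (fun x => ‖w x‖ ^ 2) (patch D c h) := by
      simpa only [sub_zero] using hwE.integrableOn hEv 0
    have : IsFiniteMeasure (volume.restrict N) := ⟨by simpa using hNv.lt_top⟩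
    have : IsFiniteMeasure (volume.restrict (patch D c h)) := ⟨by simpa using hEv.lt_top⟩
    have k1 : volume.real N * ‖m‖ ^ 2 ≤ 2 * (∫ x in N, ‖w x‖ ^ 2) + 2 * ∫ x in N, ‖w x - m‖ ^ 2 := by
      rw [← integral_const_mul, ← integral_const_mul, ← integral_add (i0.const_mul 2)
        ((hwN.integrableOn hNv m).const_mul 2), ← smul_eq_mul, ← setIntegral_const]
      exact integral_mono (integrable_const _) ((i0.const_mul 2).add
        ((hwN.integrableOn hNv m).const_mul 2)) fun x => norm_sq_le_two m (w x)
    have k2 : ∫ x in patch D c h, ‖w x‖ ^ 2 ≤ volume.real (patch D c h) * (2 * ‖m‖ ^ 2) +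
        2 * ∫ x in patch D c h, ‖w x - m‖ ^ 2 := by
      rw [← integral_const_mul, ← smul_eq_mul, ← setIntegral_const, ← integral_add (integrable_const _)
        ((hwE.integrableOn hEv m).const_mul 2)]
      refine integral_mono iE ((integrable_const _).add ((hwE.integrableOn hEv m).const_mul 2))
        fun x => ?_
      have := norm_sq_le_two (w x) m
      rw [norm_sub_rev] at this
      exact this
    have hSle : ∫ x in N, ‖w x‖ ^ 2 ≤ ∑ q ∈ J, ∫ x in S q δ ∩ Metric.ball c (5 / 4 * h), ‖w x‖ ^ 2 := by
      have a1 : ∫ x in N, ‖w x‖ ^ 2 ≤ ∫ x in S q δ ∩ Metric.ball c (5 / 4 * h), ‖w x‖ ^ 2 := by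
        refine setIntegral_mono_set ?_ (Filter.Eventually.of_forall fun x => sq_nonneg _)
          (LE.le.eventuallyLE fun x hx => ⟨hx.1, ?_⟩)
        · have h2 : S q δ ∩ Metric.ball c (5 / 4 * h) ⊆ patch D c h :=
            inter_subset_inter_left _ (hS q hq δ hδ).2
          exact iE.mono_set h2
        · rw [Metric.mem_ball]
          linarith [hNc x hx]
      exact a1.trans (Finset.single_le_sum (f := fun q => ∫ x in S q δ ∩ Metric.ball c (5 / 4 * h), ‖w x‖ ^ 2)
        (fun q _ => integral_nonneg fun _ => sq_nonneg _) hq)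
    set X := ∑ q ∈ J, ∫ x in S q δ ∩ Metric.ball c (5 / 4 * h), ‖w x‖ ^ 2 with hX
    set IE := ∫ x in patch D c h, ‖w x - m‖ ^ 2 with hIE
    set IN := ∫ x in N, ‖w x - m‖ ^ 2 with hIN
    have hX0 : 0 ≤ X := Finset.sum_nonneg fun q _ => integral_nonneg fun _ => sq_nonneg _
    have l1 : IN ≤ C₁ * δ * ((C₁ + 1) * G) := hm2.trans (by
      gcongr
      linarith)
    have l2 : h * ‖m‖ ^ 2 ≤ 2 / (v * κ) * (δ⁻¹ * X + C₁ * (C₁ + 1) * G) := by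
      have : (v * δ * (κ * h)) * ‖m‖ ^ 2 ≤ 2 * X + 2 * (C₁ * δ * ((C₁ + 1) * G)) := by
        calc (v * δ * (κ * h)) * ‖m‖ ^ 2 ≤ volume.real N * ‖m‖ ^ 2 := by gcongr
          _ ≤ _ := k1.trans (by gcongr)
      have e : 2 / (v * κ) * (δ⁻¹ * X + C₁ * (C₁ + 1) * G) =
          (2 * X + 2 * (C₁ * δ * ((C₁ + 1) * G))) / (v * κ * δ) := by
        field_simp
      rw [e, le_div_iff₀ (by positivity)]
      linarith
    calc h⁻¹ * (∫ x in patch D c h, ‖w x‖ ^ 2)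
        ≤ h⁻¹ * (5 * h ^ 2 * (2 * ‖m‖ ^ 2) + 2 * IE) := by
          gcongr
          exact k2.trans (by gcongr)
      _ = 10 * (h * ‖m‖ ^ 2) + 2 * (h⁻¹ * IE) := by field_simp; ring
      _ ≤ 10 * (2 / (v * κ) * (δ⁻¹ * X + C₁ * (C₁ + 1) * G)) + 2 * (C₁ * G) := by gcongr
      _ ≤ B * (δ⁻¹ * X + G) := by
          have b1 : 0 ≤ δ⁻¹ * X := by positivity
          have b2 : 0 ≤ 20 / (v * κ) := by positivity
          have b3 : 0 ≤ C₁ * (C₁ + 1) := by positivity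
          have e : B * (δ⁻¹ * X + G) - (10 * (2 / (v * κ) * (δ⁻¹ * X + C₁ * (C₁ + 1) * G)) + 2 * (C₁ * G))
              = 20 / (v * κ) * (C₁ * (C₁ + 1)) * (δ⁻¹ * X) + 20 / (v * κ) * G + 2 * C₁ * (δ⁻¹ * X) := by
            rw [hB]; ring
          have : 0 ≤ 20 / (v * κ) * (C₁ * (C₁ + 1)) * (δ⁻¹ * X) + 20 / (v * κ) * G + 2 * C₁ * (δ⁻¹ * X) := by
            positivity
          linarith
      _ ≤ _ := by
          gcongr
          linarith [show 0 < (v * κ)⁻¹ by positivity]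

end Local

lemma setIntegral_le_sum {ι : Type*} {G : Finset ι} {A : Set Plane} {B : ι → Set Plane} {f : Plane → ℝ}
    (hA : MeasurableSet A) (hB : ∀ i, MeasurableSet (B i)) (hf : IntegrableOn f A) (h0 : ∀ x, 0 ≤ f x)
    (hnull : volume (A \ ⋃ i ∈ G, B i) = 0) :
    ∫ x in A, f x ≤ ∑ i ∈ G, ∫ x in A ∩ B i, f x := by
  have e : ∀ i, ∫ x in A ∩ B i, f x = ∫ x in A, (B i).indicator f x := fun i =>
    (setIntegral_indicator (hB i)).symm
  simp only [e]
  rw [← integral_finsetSum _ fun i _ => IntegrableOn.indicator hf (hB i)]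
  refine integral_mono_ae hf (integrable_finsetSum _ fun i _ => IntegrableOn.indicator hf (hB i)) ?_
  have hae : ∀ᵐ x ∂volume.restrict A, x ∈ ⋃ i ∈ G, B i := by
    rw [ae_restrict_iff' hA]
    have : ∀ᵐ x, x ∉ A \ ⋃ i ∈ G, B i := measure_eq_zero_iff_ae_notMem.1 hnull
    filter_upwards [this] with x hx hxA
    by_contra hcon
    exact hx ⟨hxA, hcon⟩
  filter_upwards [hae] with x hx
  obtain ⟨i, hi, hxi⟩ := mem_iUnion₂.1 hx
  calc f x = (B i).indicator f x := (indicator_of_mem hxi f).symm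
    _ ≤ _ := Finset.single_le_sum (f := fun i => (B i).indicator f x)
      (fun j _ => indicator_nonneg (fun y _ => h0 y) x) hi

/-! ### The tangential trace on one element -/

namespace InterfaceDomain

/-- The two parts of the domain. -/
def side (P : InterfaceDomain) (b : Bool) : Set Plane := if b then P.Ωp else P.Ωm

variable (P : InterfaceDomain)

lemma side_subset (b : Bool) : P.side b ⊆ P.Ω := by
  cases b
  · exact P.minus_subset
  · exact P.plus_subset

lemma side_lipschitz (b : Bool) : IsLipschitzOpen (P.side b) := by
  cases b
  · exact P.lipschitz_minus
  · exact P.lipschitz_plus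

lemma side_bounded (b : Bool) : Bornology.IsBounded (P.side b) := P.bounded.subset (P.side_subset b)

end InterfaceDomain

namespace PolyCell
variable (K : PolyCell)

lemma volume_carrier_ne_zero : volume K.carrier ≠ 0 :=
  (K.isOpen.measure_pos volume K.isConnected.nonempty).ne'

/-- The ball of radius `h_K` around a point of `K` contains `K`; it is closed and convex, so it
contains the centroid as well. -/
lemma carrier_subset_closedBall : K.carrier ⊆ Metric.closedBall K.centroid K.diam := by
  intro x hx
  have hmem : K.centroid ∈ Metric.closedBall x K.diam := by
    refine (convex_closedBall x K.diam).set_average_mem Metric.isClosed_closedBall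
      K.volume_carrier_ne_zero K.isBounded.measure_lt_top.ne ?_ ?_
    · filter_upwards [ae_restrict_mem K.isOpen.measurableSet] with y hy
      exact Metric.dist_le_diam_of_mem K.isBounded hy hx
    · have hc : IsCompact (closure K.carrier) := K.isBounded.isCompact_closure
      exact (continuous_id.continuousOn.integrableOn_compact hc).mono_set subset_closure
  rw [Metric.mem_closedBall] at hmem ⊢
  rwa [dist_comm]

lemma abs_edgeFrame_le (i : Fin (K.m + 3)) {x : Plane} (hx : x ∈ closure K.carrier) :
    Metric.infDist x (segment ℝ (K.vertex i) (K.vertex (i + 1))) ≤ K.edgeHeight i ∧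
    |K.edgeFrame i x 1| ≤ K.edgeHeight i ∧ K.edgeHeight i ≤ K.diam := by
  set S := segment ℝ (K.vertex i) (K.vertex (i + 1)) with hS
  have hSne : S.Nonempty := ⟨_, left_mem_segment ℝ _ _⟩
  have hScl : S ⊆ closure K.carrier := by
    refine Subset.trans ?_ frontier_subset_closure
    rw [K.frontier_eq]
    exact subset_iUnion (fun i => segment ℝ (K.vertex i) (K.vertex (i + 1))) i
  have hle : ∀ y ∈ closure K.carrier, Metric.infDist y S ≤ K.diam := fun y hy => by
    refine (Metric.infDist_le_dist_of_mem (left_mem_segment ℝ _ _)).trans ?_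
    have := Metric.dist_le_diam_of_mem K.isBounded.closure hy (hScl (left_mem_segment ℝ _ _))
    rwa [Metric.diam_closure] at this
  have hb : BddAbove ((fun x => Metric.infDist x S) '' closure K.carrier) :=
    ⟨K.diam, by rintro _ ⟨y, hy, rfl⟩; exact hle y hy⟩
  have h1 : Metric.infDist x S ≤ K.edgeHeight i := le_csSup hb ⟨x, hx, rfl⟩
  refine ⟨h1, le_trans ?_ h1, csSup_le ⟨_, x, hx, rfl⟩ ?_⟩
  · refine (Metric.le_infDist hSne).2 fun y hy => ?_
    rw [hS, segment_eq_image_lineMap] at hy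
    obtain ⟨τ, -, rfl⟩ := hy
    have h2 := abs_frame_sub_le (K.edgeFrame i) x (K.edgePoint i τ) 1
    rw [edgeFrame_edgePoint] at h2
    simp at h2
    exact h2
  · rintro _ ⟨y, hy, rfl⟩; exact hle y hy

lemma edgeHeight_pos (i : Fin (K.m + 3)) : 0 < K.edgeHeight i := by
  by_contra! hcon
  refine K.volume_carrier_ne_zero (measure_mono_null (fun x hx => ?_)
    (volume_segment (K.vertex i) (K.vertex (i + 1))))
  have h1 := (K.abs_edgeFrame_le i (subset_closure hx)).1
  have hcl : IsClosed (segment ℝ (K.vertex i) (K.vertex (i + 1))) := by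
    rw [segment_eq_image_lineMap]
    exact (isCompact_Icc.image (AffineMap.lineMap_continuous)).isClosed
  rw [hcl.mem_iff_infDist_zero ⟨_, left_mem_segment ℝ _ _⟩]
  exact le_antisymm (h1.trans hcon) Metric.infDist_nonneg

lemma volume_edgeBox_le (i : Fin (K.m + 3)) {δ : ℝ} (hδ : 0 < δ) (hδ' : 4 * δ ≤ K.edgeLength i) :
    volume (K.edgeBox i δ) ≤ ENNReal.ofReal (8 * δ * K.edgeLength i) := by
  have e : K.edgeBox i δ = {x | K.edgeFrame i x 0 ∈ Ioo (-(2 * δ)) (K.edgeLength i + 2 * δ) ∧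
      (fun _ => -(2 * δ)) (K.edgeFrame i x 0) < K.edgeFrame i x 1 ∧
      K.edgeFrame i x 1 < (fun _ => 2 * δ) (K.edgeFrame i x 0)} := boxSet_eq _
  rw [e, volume_frame_graph _ measurableSet_Ioo measurable_const measurable_const]
  simp only [lintegral_const, Measure.restrict_apply_univ, Real.volume_Ioo]
  rw [← ENNReal.ofReal_mul (by linarith)]
  apply ENNReal.ofReal_le_ofReal
  nlinarith

/-- The edge condition, with a common constant. -/
lemma edgeLength_mul_edgeHeight_le {i : Fin (K.m + 3)} {c₁ c₂ : ℝ}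
    (h : K.edgeLength i * K.diam ≤ c₁ * K.area ∨ (c₂⁻¹ * K.diam ≤ K.edgeLength i ∧
      K.edgeLength i ≤ c₂ * (K.edgeHeight i)⁻¹ * K.area)) :
    K.edgeLength i * K.edgeHeight i ≤ (|c₁| + |c₂|) * K.area := by
  have hA : 0 ≤ K.area := measureReal_nonneg
  have hl := K.edgeHeight_pos i
  have hL := K.edgeLength_pos i
  rcases h with h | ⟨-, h⟩
  · obtain ⟨x, hx⟩ := K.isConnected.nonempty
    have h1 := (K.abs_edgeFrame_le i (subset_closure hx)).2.2
    calc K.edgeLength i * K.edgeHeight i ≤ K.edgeLength i * K.diam := by gcongr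
      _ ≤ c₁ * K.area := h
      _ ≤ _ := by gcongr; linarith [le_abs_self c₁, abs_nonneg c₂]
  · calc K.edgeLength i * K.edgeHeight i ≤ c₂ * (K.edgeHeight i)⁻¹ * K.area * K.edgeHeight i := by gcongr
      _ = c₂ * K.area := by field_simp
      _ ≤ _ := by gcongr; linarith [le_abs_self c₂, abs_nonneg c₁]

end PolyCell

/-- The terms of the local estimate on one side of the interface. -/
def InterfaceDomain.sideTerm (P : InterfaceDomain) (s : ℝ) (w : Plane → Plane) (K : PolyCell) (m : Plane)
    (b : Bool) : ℝ :=
  K.diam⁻¹ * (∫ x in patch (P.side b) K.centroid K.diam, ‖w x - m‖ ^ 2) +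
    K.diam ^ (2 * s - 1) * gagR s (patch (P.side b) K.centroid K.diam) w

lemma InterfaceDomain.sideTerm_nonneg (P : InterfaceDomain) {s : ℝ} {w : Plane → Plane} {K : PolyCell}
    {m : Plane} {b : Bool} : 0 ≤ P.sideTerm s w K m b := by
  have := VirtualMesh.diam_pos K
  exact add_nonneg (mul_nonneg (by positivity) (setIntegral_sq_nonneg m))
    (mul_nonneg (by positivity) gagR_nonneg)

/-- The bound of the tangential trace on one element. -/
lemma InterfaceDomain.traceNorm_le (P : InterfaceDomain) {s : ℝ} (hs : 1 / 2 < s) (c₁ c₂ : ℝ) :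
    ∃ C : ℝ, 0 < C ∧ ∀ (K : PolyCell) (v w : Plane → Plane) (G : Finset Bool) (m : Plane),
      K.carrier ⊆ P.Ω → (∀ i, K.edgeLength i * K.diam ≤ c₁ * K.area ∨ (c₂⁻¹ * K.diam ≤ K.edgeLength i ∧
        K.edgeLength i ≤ c₂ * (K.edgeHeight i)⁻¹ * K.area)) →
      MemHRot K.carrier (K.projErr v) → v =ᵐ[volume.restrict K.carrier] w → MemL2 K.carrier w →
      (∀ b, FracField s (P.side b) w) → volume (K.carrier \ ⋃ b ∈ G, P.side b) = 0 →
      K.HasTangentialTrace (K.projErr v) ∧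
        K.traceNorm (K.projErr v) ^ 2 ≤ C * (K.numVertices * ∑ b ∈ G, P.sideTerm s w K m b) := by
  set H := Metric.diam P.Ω + 1 with hH
  have hH0 : 0 < H := by
    have : 0 ≤ Metric.diam P.Ω := Metric.diam_nonneg
    linarith
  have hp : ∀ b, ∃ C : ℝ, 0 < C ∧ ∀ {w : Plane → Plane}, FracField s (P.side b) w →
      ∀ (c : Plane) (h : ℝ), 0 < h → h ≤ H → ∀ {N : Set Plane} {δ : ℝ} (m : Plane), Thin N δ →
        N ⊆ P.side b → N ⊆ Metric.closedBall c (9 / 8 * h) → 0 < δ → ∫ x in N, ‖w x - m‖ ^ 2 ≤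
          C * δ * (h⁻¹ * (∫ x in patch (P.side b) c h, ‖w x - m‖ ^ 2) +
            h ^ (2 * s - 1) * gagR s (patch (P.side b) c h) w) := fun b => by
    obtain ⟨C, hC, h⟩ := (P.side_lipschitz b).patch_estimates hs (P.side_bounded b) hH0
    exact ⟨C, hC, fun hw c h' h0 h1 => (h hw c h' h0 h1).1⟩
  choose C₀ hC₀ hthin using hp
  set C := C₀ true + C₀ false with hC
  have hCpos : 0 < C := add_pos (hC₀ _) (hC₀ _)
  have hCle : ∀ b, C₀ b ≤ C := fun b => by
    cases b
    · linarith [hC₀ true]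
    · linarith [hC₀ false]
  obtain ⟨CT, hCT, htr⟩ := PolyCell.exists_hasTangentialTrace
  set c' := |c₁| + |c₂| with hc'
  have hc'0 : 0 ≤ c' := by positivity
  refine ⟨CT * (2 * C + 16 * c' * C), by positivity, ?_⟩
  intro K v w G m hK hedge hrot hvw hw2 hw hnull
  have hdiam := VirtualMesh.diam_pos K
  have hKH : K.diam ≤ H := by
    have : K.diam ≤ Metric.diam P.Ω := Metric.diam_mono hK P.bounded
    linarith
  set X := ∑ b ∈ G, P.sideTerm s w K m b with hX
  have hX0 : 0 ≤ X := Finset.sum_nonneg fun b _ => P.sideTerm_nonneg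
  have hKm := K.isOpen.measurableSet
  have hKv := volume_carrier_ne_top K
  have hside : ∀ b, MeasurableSet (P.side b) := fun b => (P.side_lipschitz b).1.measurableSet
  have hi := integrableOn_norm_sub_sq hw2 hKv
  -- The strip is divided between the two parts of the domain and the trace inequality is used in
  -- each of them. The cones leave `K` but not the part, so the shape of `K` does not matter.
  have hstrip : ∀ (A : Set Plane) (δ : ℝ), 0 < δ → MeasurableSet A → A ⊆ K.carrier →
      (∃ (T : Plane ≃ᵃⁱ[ℝ] Plane), ∀ x ∈ A, |T x 1| < 2 * δ) →
      ∫ x in A, ‖w x - m‖ ^ 2 ≤ C * δ * X := by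
    rintro A δ hδ hA hAK ⟨T, hT⟩
    have hnull' : volume (A \ ⋃ b ∈ G, P.side b) = 0 :=
      measure_mono_null (sdiff_subset_sdiff_left hAK) hnull
    refine (setIntegral_le_sum hA hside ((hi m).mono_set hAK) (fun x => sq_nonneg _) hnull').trans ?_
    rw [hX, Finset.mul_sum]
    refine Finset.sum_le_sum fun b _ => ?_
    refine (hthin b (hw b) K.centroid K.diam hdiam hKH (N := A ∩ P.side b) (δ := δ) m ?_
      inter_subset_right ?_ hδ).trans ?_
    · refine thin_of_graph T (f := fun _ => 0) measurable_const (a := -(2 * δ)) (b := 2 * δ) (by linarith)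
        (hA.inter (hside b)) fun x hx => ?_
      have := abs_lt.1 (hT x hx.1)
      constructor <;> linarith [this.1, this.2]
    · intro x hx
      refine Metric.closedBall_subset_closedBall ?_ (K.carrier_subset_closedBall (hAK hx.1))
      linarith
    · refine mul_le_mul_of_nonneg_right ?_ P.sideTerm_nonneg
      exact mul_le_mul_of_nonneg_right (hCle b) hδ.le
  -- The element itself is a strip along the line of any of its edges, of half-width at most the
  -- supporting height.
  have hwhole : ∀ i, ∫ x in K.carrier, ‖w x - m‖ ^ 2 ≤ C * K.edgeHeight i * X := fun i =>
    hstrip K.carrier (K.edgeHeight i) (K.edgeHeight_pos i) hKm subset_rfl ⟨K.edgeFrame i, fun x hx => by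
      linarith [(K.abs_edgeFrame_le i (subset_closure hx)).2.1, K.edgeHeight_pos i]⟩
  have ha : K.proj v = ⨍ x in K.carrier, w x := by
    unfold PolyCell.proj
    rw [setAverage_eq, setAverage_eq, integral_congr_ae hvw]
  have hmean := norm_average_sub_sq_le hw2 K.volume_carrier_ne_zero hKv m
  rw [← ha] at hmean
  have hA0 : 0 < K.area := ENNReal.toReal_pos K.volume_carrier_ne_zero hKv
  -- Here the edge condition enters. The square of `Π_K v - m` costs `l_e / |K|`, and `h_e l_e` is
  -- at most a multiple of `|K|`.
  have hmean' : ∀ i, K.edgeLength i * ‖K.proj v - m‖ ^ 2 ≤ c' * C * X := fun i => by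
    have h1 := PolyCell.edgeLength_mul_edgeHeight_le K (hedge i)
    have hL := K.edgeLength_pos i
    have h2 : K.area * (K.edgeLength i * ‖K.proj v - m‖ ^ 2) ≤ K.area * (c' * C * X) := by
      calc K.area * (K.edgeLength i * ‖K.proj v - m‖ ^ 2)
          = K.edgeLength i * (K.area * ‖K.proj v - m‖ ^ 2) := by ring
        _ ≤ K.edgeLength i * (C * K.edgeHeight i * X) := by
          exact mul_le_mul_of_nonneg_left (hmean.trans (hwhole i)) hL.le
        _ = (K.edgeLength i * K.edgeHeight i) * (C * X) := by ring
        _ ≤ (c' * K.area) * (C * X) := by gcongr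
        _ = _ := by ring
    exact le_of_mul_le_mul_left h2 hA0
  have hA : 0 ≤ (2 * C + 16 * c' * C) * X := by positivity
  obtain ⟨t1, t2⟩ := htr K (K.projErr v) ((2 * C + 16 * c' * C) * X) hrot hA fun i => by
    have hL := K.edgeLength_pos i
    -- For `4 δ ≤ h_e` the box has length at most `2 h_e`, so that its area is at most `8 δ h_e`.
    refine ⟨K.edgeLength i / 4, by positivity, fun δ hδ hδ' => ?_⟩
    set A := K.carrier ∩ K.edgeBox i δ with hAdef
    have hAm : MeasurableSet A := hKm.inter (measurableSet_boxSet _)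
    have hAv : volume A ≠ ⊤ := ne_top_of_le_ne_top hKv (measure_mono inter_subset_left)
    have : IsFiniteMeasure (volume.restrict A) := ⟨by simpa using hAv.lt_top⟩
    have hvolA : volume.real A ≤ 8 * δ * K.edgeLength i :=
      ENNReal.toReal_le_of_le_ofReal (by positivity)
        ((measure_mono inter_subset_right).trans (K.volume_edgeBox_le i hδ (by linarith)))
    have h1 : ∫ x in A, ‖w x - m‖ ^ 2 ≤ C * δ * X :=
      hstrip A δ hδ hAm inter_subset_left ⟨K.edgeFrame i, fun x hx => by
        have h2 : x ∈ boxSet (K.edgeFrame i) (K.edgeLength i) δ := hx.2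
        rw [boxSet_eq] at h2
        exact abs_lt.2 h2.2⟩
    have h2 : ∫ x in A, ‖K.projErr v x‖ ^ 2 = ∫ x in A, ‖w x - K.proj v‖ ^ 2 := by
      refine integral_congr_ae ?_
      filter_upwards [ae_mono (Measure.restrict_mono inter_subset_left le_rfl) hvw] with x hx
      simp only [PolyCell.projErr, hx]
    rw [h2]
    have hiA := (hi m).mono_set (inter_subset_left : A ⊆ K.carrier)
    calc ∫ x in A, ‖w x - K.proj v‖ ^ 2
        ≤ ∫ x in A, (2 * ‖w x - m‖ ^ 2 + 2 * ‖K.proj v - m‖ ^ 2) := by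
          refine integral_mono ((hi (K.proj v)).mono_set inter_subset_left)
            ((hiA.const_mul 2).add (integrable_const _)) fun x => ?_
          have := norm_sq_le_two (w x - K.proj v) (w x - m)
          rw [show w x - m - (w x - K.proj v) = K.proj v - m by abel] at this
          exact this
      _ = 2 * (∫ x in A, ‖w x - m‖ ^ 2) + volume.real A * (2 * ‖K.proj v - m‖ ^ 2) := by
          rw [integral_add (hiA.const_mul 2) (integrable_const _), integral_const_mul, setIntegral_const,
            smul_eq_mul]
      _ ≤ 2 * (C * δ * X) + 8 * δ * K.edgeLength i * (2 * ‖K.proj v - m‖ ^ 2) := by gcongr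
      _ = 2 * (C * δ * X) + 16 * δ * (K.edgeLength i * ‖K.proj v - m‖ ^ 2) := by ring
      _ ≤ 2 * (C * δ * X) + 16 * δ * (c' * C * X) := by
          exact add_le_add le_rfl (mul_le_mul_of_nonneg_left (hmean' i) (by positivity))
      _ = _ := by ring
  exact ⟨t1, t2.trans_eq (by ring)⟩

/-! ## Overlap of the patches -/

section Overlap
variable {ι : Type*} [Fintype ι] {B : ι → Set Plane} {A : Set Plane} {n : ℕ}

lemma sum_indicator_le (h : ∀ x, {k | x ∈ B k}.ncard ≤ n) (a : ℝ≥0∞) (x : Plane) :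
    ∑ k, (B k).indicator (fun _ => a) x ≤ n * a := by
  classical
  have : ∑ k, (B k).indicator (fun _ => a) x = (Finset.univ.filter fun k => x ∈ B k).card * a := by
    simp only [indicator_apply, Finset.sum_ite, Finset.sum_const_zero, add_zero, Finset.sum_const,
      nsmul_eq_mul]
  rw [this]
  gcongr
  have h1 := h x
  rwa [← Finset.coe_filter_univ, ncard_coe_finset] at h1

lemma sum_lintegral_le (hB : ∀ k, MeasurableSet (B k)) (h : ∀ x, {k | x ∈ B k}.ncard ≤ n)
    {f : Plane → ℝ≥0∞} (hf : Measurable f) :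
    ∑ k, ∫⁻ x in A ∩ B k, f x ≤ n * ∫⁻ x in A, f x := by
  have e : ∀ k, ∫⁻ x in A ∩ B k, f x = ∫⁻ x in A, (B k).indicator f x := fun k => by
    rw [lintegral_indicator (hB k), Measure.restrict_restrict (hB k), inter_comm]
  simp only [e]
  rw [← lintegral_finsetSum _ fun k _ => hf.indicator (hB k),
    ← lintegral_const_mul' _ _ (ENNReal.natCast_ne_top n)]
  refine lintegral_mono fun x => ?_
  have := sum_indicator_le h (f x) x
  exact this

lemma sum_setIntegral_le (hB : ∀ k, MeasurableSet (B k)) (h : ∀ x, {k | x ∈ B k}.ncard ≤ n)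
    {w : Plane → Plane} (hw : Measurable w) (hi : IntegrableOn (fun x => ‖w x‖ ^ 2) A) :
    ∑ k, ∫ x in A ∩ B k, ‖w x‖ ^ 2 ≤ n * ∫ x in A, ‖w x‖ ^ 2 := by
  have e : ∀ S ⊆ A, ENNReal.ofReal (∫ x in S, ‖w x‖ ^ 2) = ∫⁻ x in S, ENNReal.ofReal (‖w x‖ ^ 2) :=
    fun S hS => ofReal_integral_eq_lintegral_ofReal (hi.mono_set hS)
      (Filter.Eventually.of_forall fun x => sq_nonneg _)
  have h0 : ∀ S : Set Plane, 0 ≤ ∫ x in S, ‖w x‖ ^ 2 := fun S => integral_nonneg fun _ => sq_nonneg _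
  have h1 := sum_lintegral_le (A := A) hB h (f := fun x => ENNReal.ofReal (‖w x‖ ^ 2))
    ((hw.norm.pow_const 2).ennreal_ofReal)
  rw [← e A subset_rfl, Finset.sum_congr rfl fun k _ => (e (A ∩ B k) inter_subset_left).symm,
    ← ENNReal.ofReal_sum_of_nonneg fun k _ => h0 _, ← ENNReal.ofReal_natCast,
    ← ENNReal.ofReal_mul (by positivity), ENNReal.ofReal_le_ofReal_iff (mul_nonneg (by positivity) (h0 _))] at h1
  exact h1

/-- Only the outer variable is counted: the inner integral is enlarged to all of `A` first, and the
remaining sum is that of a single function over sets of bounded overlap. -/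
lemma sum_gagR_le (hB : ∀ k, MeasurableSet (B k)) (h : ∀ x, {k | x ∈ B k}.ncard ≤ n) {s : ℝ}
    {w : Plane → Plane} (hw : FracField s A w) :
    ∑ k, gagR s (A ∩ B k) w ≤ n * gagR s A w := by
  have hm : Measurable fun x => ∫⁻ y in A, ‖w x - w y‖ₑ ^ 2 / edist x y ^ (2 * (1 + s)) :=
    Measurable.lintegral_prod_right' (measurable_gag_integrand hw.measurable s)
  have h1 : ∑ k, gag s (A ∩ B k) w ≤ n * gag s A w := by
    refine le_trans (Finset.sum_le_sum fun k _ => ?_) (sum_lintegral_le (A := A) hB h hm)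
    exact lintegral_mono fun x => lintegral_mono_set inter_subset_left
  rw [← hw.ofReal_gagR, Finset.sum_congr rfl fun k _ => (hw.mono inter_subset_left).ofReal_gagR.symm,
    ← ENNReal.ofReal_sum_of_nonneg fun k _ => gagR_nonneg, ← ENNReal.ofReal_natCast,
    ← ENNReal.ofReal_mul (by positivity),
    ENNReal.ofReal_le_ofReal_iff (mul_nonneg (by positivity) gagR_nonneg)] at h1
  exact h1

end Overlap

namespace PolyMesh

/-- Under the block condition every point lies in boundedly many patches. -/
lemma exists_overlap : ∃ M₀ : ℕ, ∀ {Ω : Set Plane} (M : PolyMesh Ω) (N : ℕ), M.BlockCondition N → ∀ x,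
    {k | x ∈ Metric.ball (M.cell k).centroid (5 / 4 * (M.cell k).diam)}.ncard ≤ M₀ * N := by
  obtain ⟨t, -, htf, hcov⟩ := (isCompact_closedBall (0 : Plane) (5 / 4)).finite_cover_balls
    (show (0 : ℝ) < 1 / 8 by norm_num)
  classical
  lift t to Finset Plane using htf
  refine ⟨t.card, fun {Ω} M N hM x => ?_⟩
  set c := fun k => (M.cell k).centroid with hc
  set d := fun k => (M.cell k).diam with hd
  have hd0 : ∀ k, 0 < d k := fun k => VirtualMesh.diam_pos _
  -- The patches through `x` are grouped by the position of `x` relative to the element, measured in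
  -- units of its diameter. These positions lie in a fixed ball, which finitely many small balls
  -- cover.
  set F : Plane → Finset (Fin M.num) := fun p => Finset.univ.filter fun k =>
    x ∈ Metric.ball (c k) (5 / 4 * d k) ∧ (d k)⁻¹ • (c k - x) ∈ Metric.ball p (1 / 8) with hF
  have hFc : ∀ p ∈ t, (F p).card ≤ N := by
    intro p _
    rcases (F p).eq_empty_or_nonempty with h | h
    · rw [h]; simp
    -- Every element of a group meets the block of the largest one. As the relative positions differ
    -- by at most `1/4`, the centroids are at most `d_k / 4 + 5/4 (d_l - d_k)` apart, and any point
    -- of the smaller element is within `5/4 d_l < 3/2 d_l` of the centroid of the larger.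
    obtain ⟨l, hl, hmax⟩ := (F p).exists_max_image d h
    refine le_trans ?_ (hM l)
    rw [← ncard_coe_finset]
    refine ncard_le_ncard ?_ (toFinite _)
    intro k hk
    have hk := hk
    rw [Finset.mem_coe] at hk
    have hkl := hmax k hk
    rw [hF, Finset.mem_filter] at hk hl
    obtain ⟨-, -, hk2⟩ := hk
    obtain ⟨-, hl1, hl2⟩ := hl
    obtain ⟨z, hz⟩ := (M.cell k).isConnected.nonempty
    refine ⟨z, hz, ?_⟩
    have hzc := (M.cell k).carrier_subset_closedBall hz
    rw [Metric.mem_closedBall] at hzc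
    rw [Metric.mem_ball] at hk2 hl2 hl1 ⊢
    have hyy : ‖(d k)⁻¹ • (c k - x) - (d l)⁻¹ • (c l - x)‖ ≤ 1 / 4 := by
      rw [← dist_eq_norm]
      linarith [dist_triangle_right ((d k)⁻¹ • (c k - x)) ((d l)⁻¹ • (c l - x)) p]
    have e : c k - c l = d k • ((d k)⁻¹ • (c k - x) - (d l)⁻¹ • (c l - x)) +
        ((d k - d l) * (d l)⁻¹) • (c l - x) := by
      have h1 := (hd0 k).ne'
      have h2 := (hd0 l).ne'
      rw [smul_sub, smul_smul, smul_smul, mul_inv_cancel₀ h1, one_smul, sub_mul, mul_inv_cancel₀ h2,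
        sub_smul, one_smul]
      abel
    have hcl : ‖c l - x‖ ≤ 5 / 4 * d l := by
      rw [← dist_eq_norm, dist_comm]; exact hl1.le
    have h3 : dist (c k) (c l) ≤ d k * (1 / 4) + (d l - d k) * (5 / 4) := by
      rw [dist_eq_norm, e]
      refine (norm_add_le _ _).trans (add_le_add ?_ ?_)
      · rw [norm_smul, Real.norm_eq_abs, abs_of_pos (hd0 k)]
        exact mul_le_mul_of_nonneg_left hyy (hd0 k).le
      · rw [norm_smul, Real.norm_eq_abs, abs_mul, abs_of_nonneg (inv_nonneg.2 (hd0 l).le),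
          abs_of_nonpos (by linarith), neg_sub]
        calc (d l - d k) * (d l)⁻¹ * ‖c l - x‖ ≤ (d l - d k) * (d l)⁻¹ * (5 / 4 * d l) := by
              gcongr
              exact mul_nonneg (by linarith) (inv_nonneg.2 (hd0 l).le)
          _ = (d l - d k) * (5 / 4) := by
              have := (hd0 l).ne'
              field_simp
    have h4 := dist_triangle z (c k) (c l)
    have h5 : dist z (c k) ≤ d k := hzc
    have h6 := hd0 l
    change dist z (c l) < 3 / 2 * d l
    linarith
  have hsub : {k | x ∈ Metric.ball (c k) (5 / 4 * d k)} ⊆ (t.biUnion F : Finset (Fin M.num)) := by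
    intro k hk
    have hk' : x ∈ Metric.ball (c k) (5 / 4 * d k) := hk
    have hy : (d k)⁻¹ • (c k - x) ∈ Metric.closedBall (0 : Plane) (5 / 4) := by
      rw [mem_closedBall_zero_iff, norm_smul, norm_inv, Real.norm_eq_abs, abs_of_pos (hd0 k),
        inv_mul_le_iff₀ (hd0 k), ← dist_eq_norm, dist_comm]
      have := Metric.mem_ball.1 hk'
      linarith
    obtain ⟨p, hp, hyp⟩ := mem_iUnion₂.1 (hcov hy)
    rw [Finset.coe_biUnion]
    refine mem_iUnion₂.2 ⟨p, hp, ?_⟩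
    simp only [hF, Finset.coe_filter, Finset.mem_univ, true_and]
    exact ⟨hk', hyp⟩
  refine (ncard_le_ncard hsub (toFinite _)).trans ?_
  rw [ncard_coe_finset]
  exact Finset.card_biUnion_le_card_mul _ _ _ hFc

end PolyMesh

lemma exists_mem_frontier {K D : Set Plane} (hK : IsPreconnected K) (hD : IsOpen D)
    (h1 : (K ∩ D).Nonempty) (h2 : (K \ D).Nonempty) : (K ∩ frontier D).Nonempty := by
  by_contra hcon
  have hcov : K ⊆ D ∪ (closure D)ᶜ := fun x hx => by
    by_contra h
    rw [mem_union, not_or, mem_compl_iff, not_not] at h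
    exact hcon ⟨x, hx, by rw [hD.frontier_eq]; exact ⟨h.2, h.1⟩⟩
  obtain ⟨x, hxK, hxD⟩ := h2
  have hx : x ∈ (closure D)ᶜ := (hcov hxK).resolve_left hxD
  obtain ⟨y, -, hy1, hy2⟩ := hK D (closure D)ᶜ hD isClosed_closure.isOpen_compl hcov h1 ⟨x, hxK, hx⟩
  exact hy2 (subset_closure hy1)

/-! ### Elements in one part and elements cut by the interface -/

namespace InterfaceDomain
variable (P : InterfaceDomain)

/-- A point of `Ω` outside both parts lies in the closure of one of them, hence on its boundary, and
the boundaries are null sets. -/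
lemma volume_diff_sides : volume (P.Ω \ ⋃ b ∈ (Finset.univ : Finset Bool), P.side b) = 0 := by
  refine measure_mono_null (t := ⋃ b, frontier (P.side b)) (fun x hx => ?_)
    (measure_iUnion_null fun b => (P.side_lipschitz b).volume_frontier)
  simp only [Finset.mem_univ, iUnion_true] at hx
  have hn : ∀ b, x ∉ P.side b := fun b hb => hx.2 (mem_iUnion.2 ⟨b, hb⟩)
  rcases P.cover hx.1 with h | h
  · refine mem_iUnion.2 ⟨true, ?_⟩
    rw [(P.side_lipschitz true).1.frontier_eq]
    exact ⟨h, hn true⟩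
  · refine mem_iUnion.2 ⟨false, ?_⟩
    rw [(P.side_lipschitz false).1.frontier_eq]
    exact ⟨h, hn false⟩

/-- The local terms are bounded by integrals over thin layers and patches. -/
lemma exists_sideTerm_le {s : ℝ} (hs : 1 / 2 < s) : ∃ (C : ℝ) (J : Bool → Finset Plane)
    (S : Bool → Plane → ℝ → Set Plane), 0 < C ∧
      (∀ b, ∀ q ∈ J b, ∀ δ, 0 < δ → MeasurableSet (S b q δ) ∧ S b q δ ⊆ P.side b) ∧
      ∀ {w : Plane → Plane}, (∀ b, FracField s (P.side b) w) →
        (∀ b, ∀ q ∈ J b, ∀ δ, 0 < δ → δ⁻¹ * (∫ x in S b q δ, ‖w x‖ ^ 2) ≤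
          C * ((∫ x in P.side b, ‖w x‖ ^ 2) + gagR s (P.side b) w)) ∧
        ∀ (K : PolyCell) (δ : ℝ), K.carrier ⊆ P.Ω → 0 < δ → C * δ ≤ K.diam → ∃ (G : Finset Bool) (m : Plane),
          volume (K.carrier \ ⋃ b ∈ G, P.side b) = 0 ∧ ∑ b ∈ G, P.sideTerm s w K m b ≤
            C * ∑ b, (δ⁻¹ * (∑ q ∈ J b, ∫ x in S b q δ ∩ Metric.ball K.centroid (5 / 4 * K.diam), ‖w x‖ ^ 2) +
              K.diam ^ (2 * s - 1) * gagR s (patch (P.side b) K.centroid K.diam) w) := by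
  set H := Metric.diam P.Ω + 1 with hH
  have hH0 : 0 < H := by
    have : 0 ≤ Metric.diam P.Ω := Metric.diam_nonneg
    linarith
  have hp : ∀ b, ∃ C : ℝ, 0 < C ∧ ∀ {w : Plane → Plane}, FracField s (P.side b) w →
      ∀ (c : Plane) (h : ℝ), 0 < h → h ≤ H → ∀ x ∈ P.side b, dist x c ≤ 9 / 8 * h →
        ∃ m, h⁻¹ * (∫ x in patch (P.side b) c h, ‖w x - m‖ ^ 2) ≤
          C * (h ^ (2 * s - 1) * gagR s (patch (P.side b) c h) w) := fun b => by
    obtain ⟨C, hC, h⟩ := (P.side_lipschitz b).patch_estimates hs (P.side_bounded b) hH0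
    exact ⟨C, hC, fun hw c h' h0 h1 => (h hw c h' h0 h1).2⟩
  choose C₁ hC₁ hpatch using hp
  choose C₂ J S hC₂ hS hlayer using fun b =>
    (P.side_lipschitz b).layer_estimates hs (P.side_bounded b) hH0
  set C := 1 + (C₁ true + C₁ false) + (C₂ true + C₂ false) with hC
  have hC1 : ∀ b, C₁ b + 1 ≤ C := fun b => by
    cases b <;> linarith [hC₁ true, hC₁ false, hC₂ true, hC₂ false]
  have hC2 : ∀ b, C₂ b + 1 ≤ C := fun b => by
    cases b <;> linarith [hC₁ true, hC₁ false, hC₂ true, hC₂ false]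
  have hC0 : 0 < C := by linarith [hC1 true, hC₁ true]
  refine ⟨C, J, S, hC0, hS, fun {w} hw => ⟨fun b q hq δ hδ => ?_, fun K δ hK hδ hδK => ?_⟩⟩
  · refine ((hlayer b (hw b)).1 q hq δ hδ).trans ?_
    refine mul_le_mul_of_nonneg_right (by linarith [hC2 b])
      (add_nonneg (integral_nonneg fun _ => sq_nonneg _) gagR_nonneg)
  have hdiam := VirtualMesh.diam_pos K
  have hKH : K.diam ≤ H := by
    have : K.diam ≤ Metric.diam P.Ω := Metric.diam_mono hK P.bounded
    linarith
  have hdist : ∀ x ∈ K.carrier, dist x K.centroid ≤ K.diam := fun x hx =>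
    K.carrier_subset_closedBall hx
  set X := fun b => δ⁻¹ * (∑ q ∈ J b, ∫ x in S b q δ ∩ Metric.ball K.centroid (5 / 4 * K.diam), ‖w x‖ ^ 2)
    with hX
  set Y := fun b => K.diam ^ (2 * s - 1) * gagR s (patch (P.side b) K.centroid K.diam) w with hY
  have hX0 : ∀ b, 0 ≤ X b := fun b => mul_nonneg (by positivity)
    (Finset.sum_nonneg fun q _ => integral_nonneg fun _ => sq_nonneg _)
  have hY0 : ∀ b, 0 ≤ Y b := fun b => mul_nonneg (by positivity) gagR_nonneg
  change ∃ (G : Finset Bool) (m : Plane), volume (K.carrier \ ⋃ b ∈ G, P.side b) = 0 ∧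
    ∑ b ∈ G, P.sideTerm s w K m b ≤ C * ∑ b, (X b + Y b)
  have hnull : volume (K.carrier \ ⋃ b ∈ (Finset.univ : Finset Bool), P.side b) = 0 :=
    measure_mono_null (sdiff_subset_sdiff_left hK) P.volume_diff_sides
  -- If the element misses one part, it lies in the other up to a null set. Only that part is
  -- needed, and the Poincaré constant `m` of its patch is available.
  by_cases hcase : ∃ b, K.carrier ∩ P.side (!b) = ∅
  · obtain ⟨b, hb⟩ := hcase
    have hnull' : volume (K.carrier \ ⋃ b' ∈ ({b} : Finset Bool), P.side b') = 0 := by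
      refine measure_mono_null (t := K.carrier \ ⋃ b ∈ (Finset.univ : Finset Bool), P.side b)
        (fun x hx => ⟨hx.1, fun hmem => ?_⟩) hnull
      obtain ⟨b', -, hb'⟩ := mem_iUnion₂.1 hmem
      rcases Bool.eq_or_eq_not b' b with h | h
      · exact hx.2 (mem_iUnion₂.2 ⟨b', Finset.mem_singleton.2 h, hb'⟩)
      · have : x ∈ K.carrier ∩ P.side (!b) := ⟨hx.1, h ▸ hb'⟩
        rw [hb] at this
        exact this
    obtain ⟨x, hxK, hxb⟩ : (K.carrier ∩ P.side b).Nonempty := by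
      by_contra hcon
      refine K.volume_carrier_ne_zero (measure_mono_null
        (t := K.carrier \ ⋃ b' ∈ ({b} : Finset Bool), P.side b') (fun x hx => ⟨hx, fun hmem => ?_⟩) hnull')
      obtain ⟨b', h1, hb'⟩ := mem_iUnion₂.1 hmem
      rw [Finset.mem_singleton.1 h1] at hb'
      exact hcon ⟨x, hx, hb'⟩
    obtain ⟨m, hm⟩ := hpatch b (hw b) K.centroid K.diam hdiam hKH x hxb (by linarith [hdist x hxK])
    refine ⟨{b}, m, hnull', ?_⟩
    rw [Finset.sum_singleton]
    calc P.sideTerm s w K m b ≤ C₁ b * Y b + Y b := add_le_add hm le_rfl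
      _ ≤ C * Y b := by nlinarith [hC1 b, hY0 b]
      _ ≤ C * (X b + Y b) := by gcongr; linarith [hX0 b]
      _ ≤ _ := by
        gcongr
        exact Finset.single_le_sum (f := fun b => X b + Y b)
          (fun b _ => add_nonneg (hX0 b) (hY0 b)) (Finset.mem_univ b)
  -- If the element meets both parts, the constants on the two sides may be far apart. With `m = 0`
  -- nothing is subtracted; being connected, the element contains a boundary point of each part, and
  -- the layer estimates apply on both sides.
  · push Not at hcase
    refine ⟨Finset.univ, 0, hnull, ?_⟩
    rw [Finset.mul_sum]
    refine Finset.sum_le_sum fun b _ => ?_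
    have h1 : (K.carrier ∩ P.side b).Nonempty := by
      have := hcase (!b)
      rwa [Bool.not_not] at this
    have h2 : (K.carrier \ P.side b).Nonempty := by
      obtain ⟨x, hx, hxb⟩ := hcase b
      refine ⟨x, hx, fun h => ?_⟩
      cases b
      · exact P.disjoint.le_bot ⟨hxb, h⟩
      · exact P.disjoint.le_bot ⟨h, hxb⟩
    obtain ⟨p, hpK, hp⟩ := exists_mem_frontier K.isConnected.isPreconnected (P.side_lipschitz b).1 h1 h2
    have h3 := (hlayer b (hw b)).2 K.centroid K.diam δ hdiam hKH hδ
      (le_trans (by gcongr; linarith [hC2 b]) hδK) p hp (hdist p hpK)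
    unfold sideTerm
    simp only [sub_zero]
    calc _ ≤ C₂ b * (X b + Y b) + Y b := add_le_add h3 le_rfl
      _ ≤ C * (X b + Y b) := by nlinarith [hC2 b, hY0 b, hX0 b]

end InterfaceDomain

/-! ### Summation over the mesh -/

namespace PolyMesh

/-- The bound of `‖v‖_b` for fields of fractional regularity. -/
theorem bNorm_sq_le (P : InterfaceDomain) {s : ℝ} (hs : 1 / 2 < s) (c₁ c₂ : ℝ) (N N' : ℕ) :
    ∃ C : ℝ, 0 < C ∧ ∀ M : PolyMesh P.Ω, M.EdgeCount N → M.EdgeCondition c₁ c₂ → M.BlockCondition N' →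
      ∀ v w : Plane → Plane, MemHRot P.Ω v → v =ᵐ[volume.restrict P.Ω] w →
        (∀ b, FracField s (P.side b) w) → M.HasTraces v ∧
          M.bNorm v ^ 2 ≤ C * ∑ b, ((∫ x in P.side b, ‖w x‖ ^ 2) + gagR s (P.side b) w) := by
  obtain ⟨M₀, hover⟩ := exists_overlap
  obtain ⟨Ct, hCt, htrace⟩ := P.traceNorm_le hs c₁ c₂
  obtain ⟨Cs, J, S, hCs, hS, hside⟩ := P.exists_sideTerm_le hs
  set H := Metric.diam P.Ω + 1 with hH
  have hdiam0 : 0 ≤ Metric.diam P.Ω := Metric.diam_nonneg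
  have hH0 : 0 < H := by linarith
  set n : ℝ := M₀ * N' with hn
  have hn0 : 0 ≤ n := by positivity
  set cJ : ℝ := (J true).card + (J false).card with hcJ
  have hcJb : ∀ b, ((J b).card : ℝ) ≤ cJ := fun b => by
    cases b
    · rw [hcJ]; linarith [Nat.cast_nonneg (α := ℝ) (J true).card]
    · rw [hcJ]; linarith [Nat.cast_nonneg (α := ℝ) (J false).card]
  set β := P.βp + P.βm with hβ
  set A := H * (Ct * (N * Cs)) with hA
  have hA0 : 0 ≤ A := by positivity
  have hβ0 : 0 < β := add_pos P.βp_pos P.βm_pos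
  have hcJ0 : 0 ≤ cJ := by positivity
  refine ⟨β + A * (n * (cJ * Cs) + H ^ (2 * s - 1) * n), by positivity, ?_⟩
  intro M hN hedge hblock v w hv hvw hw
  have hwfin : ∀ b, volume (P.side b) ≠ ⊤ := fun b => (P.side_bounded b).measure_lt_top.ne
  have hwΩ : MemL2 P.Ω w := MemLp.ae_eq hvw hv.1
  have hwK : ∀ k, MemL2 (M.cell k).carrier w := fun k =>
    hwΩ.mono_measure (Measure.restrict_mono (M.subset k) le_rfl)
  have hvwK : ∀ k, v =ᵐ[volume.restrict (M.cell k).carrier] w := fun k =>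
    ae_mono (Measure.restrict_mono (M.subset k) le_rfl) hvw
  have hiΩ : IntegrableOn (fun x => ‖w x‖ ^ 2) P.Ω := by
    simpa only [sub_zero] using integrableOn_norm_sub_sq hwΩ domain_finite 0
  have hib : ∀ b, IntegrableOn (fun x => ‖w x‖ ^ 2) (P.side b) := fun b => hiΩ.mono_set (P.side_subset b)
  obtain ⟨hw1, hw2⟩ := hside hw
  -- One layer width for all elements, small compared with the smallest diameter. The constants do
  -- not depend on it, since the averages over the layers are bounded uniformly in the width.
  obtain ⟨δ, hδ, hδk⟩ : ∃ δ > 0, ∀ k, Cs * δ ≤ (M.cell k).diam := by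
    have hev : ∀ᶠ δ in nhdsWithin (0 : ℝ) (Ioi 0), ∀ k, Cs * δ ≤ (M.cell k).diam :=
      Filter.eventually_all.2 fun k => by
        have hc : Continuous fun δ : ℝ => Cs * δ := by fun_prop
        have : ∀ᶠ δ in nhds (0 : ℝ), Cs * δ < (M.cell k).diam :=
          hc.continuousAt.eventually (gt_mem_nhds (by simpa using VirtualMesh.diam_pos (M.cell k)))
        filter_upwards [this.filter_mono nhdsWithin_le_nhds] with δ hδ using hδ.le
    obtain ⟨δ, h1, h2⟩ := (hev.and self_mem_nhdsWithin).exists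
    exact ⟨δ, h2, h1⟩
  set B := fun k => Metric.ball (M.cell k).centroid (5 / 4 * (M.cell k).diam) with hB
  have hBm : ∀ k, MeasurableSet (B k) := fun k => measurableSet_ball
  have hBn : ∀ x, {k | x ∈ B k}.ncard ≤ M₀ * N' := hover M N' hblock
  have hdH : ∀ k, (M.cell k).diam ≤ H := fun k => by linarith [M.diam_cell_le P.bounded k]
  set Z := fun k => ∑ b, (δ⁻¹ * (∑ q ∈ J b, ∫ x in S b q δ ∩ B k, ‖w x‖ ^ 2) +
      H ^ (2 * s - 1) * gagR s (P.side b ∩ B k) w) with hZ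
  have helem : ∀ k, (M.cell k).HasTangentialTrace ((M.cell k).projErr v) ∧
      M.h * (M.cell k).traceNorm ((M.cell k).projErr v) ^ 2 ≤ A * Z k := fun k => by
    obtain ⟨G, m, hG, hle⟩ := hw2 (M.cell k) δ (M.subset k) hδ (hδk k)
    obtain ⟨h1, h2⟩ := htrace (M.cell k) v w G m (M.subset k) (hedge k) (M.projErr_memHRot hv k)
      (hvwK k) (hwK k) hw hG
    refine ⟨h1, ?_⟩
    have hhH : M.h ≤ H := by
      have : Nonempty (Fin M.num) := ⟨k⟩
      exact ciSup_le fun l => hdH l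
    have hX0 : 0 ≤ ∑ b ∈ G, P.sideTerm s w (M.cell k) m b :=
      Finset.sum_nonneg fun b _ => P.sideTerm_nonneg
    have hNk : ((M.cell k).numVertices : ℝ) ≤ N := by exact_mod_cast hN k
    have hle2 : ∑ b ∈ G, P.sideTerm s w (M.cell k) m b ≤ Cs * Z k := by
      refine hle.trans ?_
      have : ∀ b, (M.cell k).diam ^ (2 * s - 1) * gagR s (patch (P.side b) (M.cell k).centroid (M.cell k).diam) w
          ≤ H ^ (2 * s - 1) * gagR s (P.side b ∩ B k) w := fun b =>
        mul_le_mul_of_nonneg_right (Real.rpow_le_rpow (VirtualMesh.diam_pos _).le (hdH k) (by linarith))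
          gagR_nonneg
      refine mul_le_mul_of_nonneg_left (Finset.sum_le_sum fun b _ => ?_) hCs.le
      exact add_le_add le_rfl (this b)
    calc M.h * (M.cell k).traceNorm ((M.cell k).projErr v) ^ 2
        ≤ H * (Ct * (N * (Cs * Z k))) := by
          refine mul_le_mul hhH (h2.trans ?_) (sq_nonneg _) hH0.le
          refine mul_le_mul_of_nonneg_left ?_ hCt.le
          exact mul_le_mul hNk hle2 hX0 (by positivity)
      _ = _ := by rw [hA]; ring
  refine ⟨fun k => (helem k).1, ?_⟩
  set I := fun b => ∫ x in P.side b, ‖w x‖ ^ 2 with hI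
  have hI0 : ∀ b, 0 ≤ I b := fun b => integral_nonneg fun _ => sq_nonneg _
  -- Jensen's inequality on each element; the elements tile the domain.
  have hmean : ∑ k, M.βh k * ‖(M.cell k).proj v‖ ^ 2 * (M.cell k).area ≤ β * ∑ b, I b := by
    have h1 : ∀ k, M.βh k * ‖(M.cell k).proj v‖ ^ 2 * (M.cell k).area ≤
        β * ∫ x in (M.cell k).carrier, ‖w x‖ ^ 2 := fun k => by
      have h2 := norm_average_sub_sq_le (hwK k) (M.cell k).volume_carrier_ne_zero
        (volume_carrier_ne_top _) 0
      simp only [sub_zero] at h2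
      have h3 : (M.cell k).proj v = ⨍ x in (M.cell k).carrier, w x := by
        unfold PolyCell.proj
        rw [setAverage_eq, setAverage_eq, integral_congr_ae (hvwK k)]
      rw [← h3] at h2
      have h4 : M.βh k ≤ β := by
        unfold βh
        split_ifs
        · linarith [P.βm_pos]
        · linarith [P.βp_pos]
      have h5 : 0 ≤ (M.cell k).area := measureReal_nonneg
      calc M.βh k * ‖(M.cell k).proj v‖ ^ 2 * (M.cell k).area
          ≤ β * ‖(M.cell k).proj v‖ ^ 2 * (M.cell k).area := by gcongr
        _ = β * ((M.cell k).area * ‖(M.cell k).proj v‖ ^ 2) := by ring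
        _ ≤ _ := mul_le_mul_of_nonneg_left h2 hβ0.le
    refine (Finset.sum_le_sum fun k _ => h1 k).trans ?_
    rw [← Finset.mul_sum, ← M.integral_domain hiΩ]
    refine mul_le_mul_of_nonneg_left ?_ hβ0.le
    refine (setIntegral_le_sum P.lipschitz.1.measurableSet
      (fun b => (P.side_lipschitz b).1.measurableSet) hiΩ (fun _ => sq_nonneg _)
      P.volume_diff_sides).trans (Finset.sum_le_sum fun b _ => ?_)
    rw [inter_eq_self_of_subset_right (P.side_subset b)]
  -- By finite overlap the integrals over parts of a layer add up to at most a multiple of the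
  -- integral over the whole layer, where the global trace inequality applies; the seminorms on the
  -- patches add up likewise.
  have hZsum : ∑ k, Z k ≤ (n * (cJ * Cs) + H ^ (2 * s - 1) * n) * ∑ b, (I b + gagR s (P.side b) w) := by
    rw [hZ, Finset.sum_comm, Finset.mul_sum]
    refine Finset.sum_le_sum fun b _ => ?_
    rw [Finset.sum_add_distrib, ← Finset.mul_sum, ← Finset.mul_sum, Finset.sum_comm, add_mul]
    have hG0 : 0 ≤ gagR s (P.side b) w := gagR_nonneg
    have hcast : ((M₀ * N' : ℕ) : ℝ) = n := by push_cast; rfl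
    refine add_le_add ?_ ?_
    · calc δ⁻¹ * ∑ q ∈ J b, ∑ k, ∫ x in S b q δ ∩ B k, ‖w x‖ ^ 2
          ≤ δ⁻¹ * ∑ q ∈ J b, n * ∫ x in S b q δ, ‖w x‖ ^ 2 := by
            refine mul_le_mul_of_nonneg_left (Finset.sum_le_sum fun q hq => ?_) (inv_nonneg.2 hδ.le)
            rw [← hcast]
            exact sum_setIntegral_le hBm hBn (hw b).measurable ((hib b).mono_set (hS b q hq δ hδ).2)
        _ = n * ∑ q ∈ J b, δ⁻¹ * ∫ x in S b q δ, ‖w x‖ ^ 2 := by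
            rw [Finset.mul_sum, Finset.mul_sum]
            exact Finset.sum_congr rfl fun q _ => by ring
        _ ≤ n * ∑ q ∈ J b, Cs * (I b + gagR s (P.side b) w) := by
            refine mul_le_mul_of_nonneg_left (Finset.sum_le_sum fun q hq => ?_) hn0
            exact hw1 b q hq δ hδ
        _ = n * ((J b).card * Cs) * (I b + gagR s (P.side b) w) := by
            rw [Finset.sum_const, nsmul_eq_mul]; ring
        _ ≤ _ := by
            refine mul_le_mul_of_nonneg_right ?_ (add_nonneg (hI0 b) hG0)
            refine mul_le_mul_of_nonneg_left ?_ hn0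
            exact mul_le_mul_of_nonneg_right (hcJb b) hCs.le
    · rw [mul_assoc]
      refine mul_le_mul_of_nonneg_left ?_ (by positivity)
      calc ∑ k, gagR s (P.side b ∩ B k) w ≤ n * gagR s (P.side b) w := by
            rw [← hcast]
            exact sum_gagR_le hBm hBn (hw b)
        _ ≤ _ := mul_le_mul_of_nonneg_left (by linarith [hI0 b]) hn0
  rw [M.bNorm_sq, Finset.sum_add_distrib]
  have h1 : ∑ k, M.h * (M.cell k).traceNorm ((M.cell k).projErr v) ^ 2 ≤
      A * ((n * (cJ * Cs) + H ^ (2 * s - 1) * n) * ∑ b, (I b + gagR s (P.side b) w)) := by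
    refine (Finset.sum_le_sum fun k _ => (helem k).2).trans ?_
    rw [← Finset.mul_sum]
    exact mul_le_mul_of_nonneg_left hZsum hA0
  have h2 : ∑ b, I b ≤ ∑ b, (I b + gagR s (P.side b) w) :=
    Finset.sum_le_sum fun b _ => by linarith [gagR_nonneg (s := s) (D := P.side b) (w := w)]
  calc _ ≤ β * ∑ b, I b + A * ((n * (cJ * Cs) + H ^ (2 * s - 1) * n) *
        ∑ b, (I b + gagR s (P.side b) w)) := add_le_add hmean h1
    _ ≤ β * ∑ b, (I b + gagR s (P.side b) w) + A * ((n * (cJ * Cs) + H ^ (2 * s - 1) * n) *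
        ∑ b, (I b + gagR s (P.side b) w)) := add_le_add (mul_le_mul_of_nonneg_left h2 hβ0.le) le_rfl
    _ = _ := by ring

end PolyMesh

/-! ## Translates of weakly differentiable functions -/

/-- The points from which the segment in direction `ξ` stays in `D`. -/
def shiftSet (D : Set Plane) (ξ : Plane) : Set Plane := {x | ∀ t ∈ Icc (0 : ℝ) 1, x + t • ξ ∈ D}

section Shift
variable {D : Set Plane} {ξ : Plane}

/-- The complement is the Minkowski sum of the closed complement of `D` and a compact segment, hence
closed. -/
lemma isOpen_shiftSet (hD : IsOpen D) (ξ : Plane) : IsOpen (shiftSet D ξ) := by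
  have hK : IsCompact ((fun t : ℝ => -(t • ξ)) '' Icc (0 : ℝ) 1) := isCompact_Icc.image (by fun_prop)
  have h := hD.isClosed_compl.add_right_of_isCompact hK
  rw [← isClosed_compl_iff]
  convert h using 1
  ext x
  simp only [shiftSet, mem_compl_iff, mem_ofPred_eq, not_forall, mem_add, mem_image]
  constructor
  · rintro ⟨t, ht, hx⟩
    exact ⟨x + t • ξ, hx, -(t • ξ), ⟨t, ht, rfl⟩, by abel⟩
  · rintro ⟨y, hy, _, ⟨t, ht, rfl⟩, rfl⟩
    exact ⟨t, ht, by rwa [neg_add_cancel_right]⟩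

lemma shiftSet_subset : shiftSet D ξ ⊆ D := fun x hx => by
  simpa using hx 0 (left_mem_Icc.2 zero_le_one)

lemma IsTest.translate {φ : Plane → ℝ} (hφ : IsTest (shiftSet D ξ) φ) {t : ℝ} (ht : t ∈ Icc (0 : ℝ) 1) :
    IsTest D fun y => φ (y - t • ξ) := by
  have hc : HasCompactSupport fun y => φ (y - t • ξ) :=
    hφ.2.1.comp_homeomorph (Homeomorph.subRight (t • ξ))
  refine ⟨hφ.1.comp (contDiff_id.sub contDiff_const), hc, fun y hy => ?_⟩
  have h1 : tsupport (fun y => φ (y - t • ξ)) = (Homeomorph.subRight (t • ξ)) ⁻¹' tsupport φ :=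
    tsupport_comp_eq_preimage φ (Homeomorph.subRight (t • ξ))
  rw [h1] at hy
  have := hφ.2.2 hy t ht
  simpa using this

/-- The scalar test functions in `D`. -/
def testFunctions (D : Set Plane) : Submodule ℝ (Plane → ℝ) where
  carrier := {φ | IsTest D φ}
  add_mem' h h' := ⟨h.1.add h'.1, h.2.1.add h'.2.1, (tsupport_add _ _).trans (union_subset h.2.2 h'.2.2)⟩
  zero_mem' := ⟨contDiff_const, HasCompactSupport.zero, by simp⟩
  smul_mem' c φ h := ⟨contDiff_const.smul h.1, h.2.1.smul_left,
    (closure_mono (Function.support_const_smul_subset c φ)).trans h.2.2⟩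

lemma IsTest.memLp {φ : Plane → ℝ} (h : IsTest D φ) : MemLp φ 2 volume :=
  h.1.continuous.memLp_of_hasCompactSupport h.2.1

/-- The embedding of the test functions into `L²`. -/
def testToLp (D : Set Plane) : testFunctions D →ₗ[ℝ] Lp ℝ 2 (volume : Measure Plane) where
  toFun φ := (IsTest.memLp φ.2).toLp
  map_add' _ _ := rfl
  map_smul' _ _ := rfl

lemma norm_testToLp_sq (φ : testFunctions D) : ‖testToLp D φ‖ ^ 2 = ∫ x, φ.1 x ^ 2 := by
  rw [← real_inner_self_eq_norm_sq, L2.inner_def]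
  refine integral_congr_ae ?_
  filter_upwards [(IsTest.memLp φ.2).coeFn_toLp] with x hx
  have : testToLp D φ x = φ.1 x := hx
  rw [this]
  simp [sq]

variable {f : Plane → ℝ} {G : Fin 2 → Plane → ℝ}

/-- The derivative of a translated integral. -/
lemma hasDerivAt_translate (hfin : volume D ≠ ⊤) (hf : MemLp f 2 (volume.restrict D))
    {φ : Plane → ℝ} (hφ : ContDiff ℝ 1 φ) (hc : HasCompactSupport φ) (ξ : Plane) (t : ℝ) :
    HasDerivAt (fun t : ℝ => ∫ y in D, f y * φ (y - t • ξ))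
      (∫ y in D, f y * -(fderiv ℝ φ (y - t • ξ) ξ)) t := by
  have : IsFiniteMeasure (volume.restrict D) := ⟨by simpa using hfin.lt_top⟩
  have hf1 : Integrable f (volume.restrict D) := hf.integrable (by norm_num)
  obtain ⟨C, hC⟩ := (hc.fderiv ℝ).exists_bound_of_continuous (hφ.continuous_fderiv one_ne_zero)
  obtain ⟨C', hC'⟩ := hc.exists_bound_of_continuous hφ.continuous
  have hcont : ∀ t : ℝ, Continuous fun y : Plane => φ (y - t • ξ) := fun t =>
    hφ.continuous.comp (by fun_prop)
  have hcont' : Continuous fun y : Plane => fderiv ℝ φ (y - t • ξ) ξ :=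
    ((hφ.continuous_fderiv one_ne_zero).comp (by fun_prop)).clm_apply continuous_const
  refine (hasDerivAt_integral_of_dominated_loc_of_deriv_le
    (F := fun (t : ℝ) y => f y * φ (y - t • ξ)) (F' := fun t y => f y * -(fderiv ℝ φ (y - t • ξ) ξ))
    (bound := fun y => ‖f y‖ * (C * ‖ξ‖)) Filter.univ_mem
    (Filter.Eventually.of_forall fun t => hf.1.mul (hcont t).aestronglyMeasurable)
    (hf1.mul_bdd (c := C') (hcont t).aestronglyMeasurable (Filter.Eventually.of_forall fun y => hC' _))
    (hf.1.mul hcont'.neg.aestronglyMeasurable) ?_ (hf1.norm.mul_const _) ?_).2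
  · refine Filter.Eventually.of_forall fun y t _ => ?_
    rw [norm_mul, norm_neg]
    gcongr
    exact ((fderiv ℝ φ (y - t • ξ)).le_opNorm ξ).trans (by gcongr; exact hC _)
  · refine Filter.Eventually.of_forall fun y t _ => HasDerivAt.const_mul _ ?_
    have h1 : HasDerivAt (fun t : ℝ => y - t • ξ) (-ξ) t := by
      simpa using ((hasDerivAt_id t).smul_const ξ).const_sub y
    have h2 := ((hφ.differentiable one_ne_zero (y - t • ξ)).hasFDerivAt).comp_hasDerivAt t h1
    rw [map_neg] at h2
    exact h2

/-- The increments of a function with a weak gradient in `L²`. -/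
lemma exists_shift (hD : IsOpen D) (hfin : volume D ≠ ⊤) (hf : MemLp f 2 (volume.restrict D))
    (hG : ∀ i, MemLp (G i) 2 (volume.restrict D))
    (hw : ∀ i φ, IsTest D φ → ∫ x in D, φ x * G i x = -∫ x in D, pderiv i φ x * f x) (ξ : Plane) :
    ∫⁻ x in shiftSet D ξ, ENNReal.ofReal ((f (x + ξ) - f x) ^ 2) ≤
      ENNReal.ofReal (‖ξ‖ ^ 2 * ∫ x in D, (G 0 x ^ 2 + G 1 x ^ 2)) := by
  set O := shiftSet D ξ with hO
  have hOo : IsOpen O := isOpen_shiftSet hD ξ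
  have hOD : O ⊆ D := shiftSet_subset
  set M2 := ‖ξ‖ ^ 2 * ∫ x in D, (G 0 x ^ 2 + G 1 x ^ 2) with hM2
  have hM20 : 0 ≤ M2 := mul_nonneg (sq_nonneg _) (integral_nonneg fun x => by positivity)
  have hfO : MemLp f 2 (volume.restrict O) := hf.mono_measure (Measure.restrict_mono hOD le_rfl)
  have hfs : MemLp (fun x => f (x + ξ)) 2 (volume.restrict O) := by
    have h1 := (measurePreserving_add_right volume ξ).restrict_preimage hD.measurableSet
    refine (hf.comp_measurePreserving h1).mono_measure (Measure.restrict_mono (fun x hx => ?_) le_rfl)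
    have := hx 1 (right_mem_Icc.2 zero_le_one)
    rwa [one_smul] at this
  have hΔ : MemLp (fun x => f (x + ξ) - f x) 2 (volume.restrict O) := hfs.sub hfO
  have hintΔ : ∀ φ : testFunctions O, IntegrableOn (fun x => (f (x + ξ) - f x) * φ.1 x) O := fun φ =>
    integrableOn_mul_of_memLp hΔ φ.2.1.continuous φ.2.2.1
  -- The increment is estimated by duality, without approximation by smooth functions: its pairing
  -- with a test function is bounded through translates of that function.
  let l : testFunctions O →ₗ[ℝ] ℝ :=
    { toFun := fun φ => ∫ x in O, (f (x + ξ) - f x) * φ.1 x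
      map_add' := fun φ ψ => by
        simp only [Submodule.coe_add, Pi.add_apply, mul_add]
        exact integral_add (hintΔ φ) (hintΔ ψ)
      map_smul' := fun c φ => by
        simp only [Submodule.coe_smul, Pi.smul_apply, smul_eq_mul, RingHom.id_apply, mul_left_comm _ c,
          integral_const_mul] }
  have hl : ∀ φ, l φ = ∫ x in O, (f (x + ξ) - f x) * φ.1 x := fun _ => rfl
  have hbound : ∀ φ : testFunctions O, |l φ| ≤ (M2 + ‖testToLp O φ‖ ^ 2) / 2 := fun φ => by
    have hφ1 : ContDiff ℝ 1 φ.1 := φ.2.1.of_le (by exact_mod_cast le_top)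
    have hφc := hφ1.continuous
    set F : ℝ → ℝ := fun t => ∫ y in D, f y * φ.1 (y - t • ξ) with hF
    have hzero : ∀ x, x ∉ O → φ.1 x = 0 := fun x hx =>
      image_eq_zero_of_notMem_tsupport fun h => hx (φ.2.2.2 h)
    have e0 : F 0 = ∫ x in O, f x * φ.1 x := by
      simp only [hF, zero_smul, sub_zero]
      rw [setIntegral_eq_integral_of_forall_compl_eq_zero fun x hx => by
          rw [hzero x fun h => hx (hOD h), mul_zero],
        setIntegral_eq_integral_of_forall_compl_eq_zero fun x hx => by rw [hzero x hx, mul_zero]]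
    have e1 : F 1 = ∫ x in O, f (x + ξ) * φ.1 x := by
      simp only [hF, one_smul]
      rw [setIntegral_eq_integral_of_forall_compl_eq_zero fun x hx => by
          rw [hzero (x - ξ) fun h => hx (by
            have := h 1 (right_mem_Icc.2 zero_le_one)
            rwa [one_smul, sub_add_cancel] at this), mul_zero],
        setIntegral_eq_integral_of_forall_compl_eq_zero fun x hx => by rw [hzero x hx, mul_zero],
        ← integral_add_right_eq_self (fun y => f y * φ.1 (y - ξ)) ξ]
      simp only [add_sub_cancel_right]
    have e2 : l φ = F 1 - F 0 := by
      rw [hl, e0, e1, ← integral_sub (integrableOn_mul_of_memLp hfs hφc φ.2.2.1)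
        (integrableOn_mul_of_memLp hfO hφc φ.2.2.1)]
      congr 1 with x
      ring
    rw [e2, ← Real.norm_eq_abs]
    -- Mean value inequality along the translation. At each `t` the translated test function is
    -- still supported in `D`, because points of `O` have their whole segment in `D`; so the
    -- derivative falls on `f` and becomes the weak gradient.
    refine norm_image_sub_le_of_norm_deriv_le_segment_01'
      (fun t _ => (hasDerivAt_translate hfin hf hφ1 φ.2.2.1 ξ t).hasDerivWithinAt) fun t ht => ?_
    have htI : t ∈ Icc (0 : ℝ) 1 := ⟨ht.1, ht.2.le⟩
    have hT := IsTest.translate φ.2 htI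
    set ψ : Plane → ℝ := fun y => φ.1 (y - t • ξ) with hψ
    have hψ1 : ContDiff ℝ 1 ψ := hT.1.of_le (by exact_mod_cast le_top)
    have hpd : ∀ i y, pderiv i ψ y = pderiv i φ.1 (y - t • ξ) := fun i y => by
      unfold pderiv
      rw [hψ, fderiv_comp_sub]
    have hip : ∀ i, IntegrableOn (fun x => pderiv i ψ x * f x) D := fun i => by
      have := integrableOn_mul_of_memLp hf (continuous_pderiv hψ1 i)
        (hT.2.1.of_isClosed_subset (isClosed_tsupport _) (tsupport_pderiv_subset i ψ))
      simpa only [mul_comm] using this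
    have hiG : ∀ i, IntegrableOn (fun x => ψ x * G i x) D := fun i => by
      have := integrableOn_mul_of_memLp (hG i) hψ1.continuous hT.2.1
      simpa only [mul_comm] using this
    have e3 : ∫ y in D, f y * -(fderiv ℝ φ.1 (y - t • ξ) ξ) =
        ∫ y in D, ψ y * (ξ 0 * G 0 y + ξ 1 * G 1 y) := by
      calc ∫ y in D, f y * -(fderiv ℝ φ.1 (y - t • ξ) ξ)
          = ∫ y in D, (-ξ 0 * (pderiv 0 ψ y * f y) + -ξ 1 * (pderiv 1 ψ y * f y)) := by
            congr 1 with y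
            rw [fderiv_apply_plane, hpd, hpd]
            ring
        _ = ξ 0 * (∫ y in D, ψ y * G 0 y) + ξ 1 * ∫ y in D, ψ y * G 1 y := by
            rw [integral_add ((hip 0).const_mul _) ((hip 1).const_mul _), integral_const_mul,
              integral_const_mul, hw 0 ψ hT, hw 1 ψ hT]
            ring
        _ = _ := by
            rw [← integral_const_mul, ← integral_const_mul,
              ← integral_add ((hiG 0).const_mul _) ((hiG 1).const_mul _)]
            congr 1 with y
            ring
    rw [e3]
    have hG2 : ∀ i, IntegrableOn (fun x => G i x ^ 2) D := fun i => (hG i).integrable_sq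
    have hψ2 : Integrable (fun x => ψ x ^ 2) volume := (IsTest.memLp hT).integrable_sq
    have hGi : IntegrableOn (fun x => ‖ξ‖ ^ 2 * (G 0 x ^ 2 + G 1 x ^ 2)) D :=
      ((hG2 0).add (hG2 1)).const_mul _
    have hb : IntegrableOn (fun y => (‖ξ‖ ^ 2 * (G 0 y ^ 2 + G 1 y ^ 2) + ψ y ^ 2) / 2) D :=
      (hGi.add hψ2.integrableOn).div_const 2
    refine (norm_integral_le_of_norm_le hb (Filter.Eventually.of_forall fun y => ?_)).trans ?_
    · rw [norm_mul, Real.norm_eq_abs, Real.norm_eq_abs]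
      have a1 : (ξ 0 * G 0 y + ξ 1 * G 1 y) ^ 2 ≤ ‖ξ‖ ^ 2 * (G 0 y ^ 2 + G 1 y ^ 2) := by
        rw [norm_sq_plane]
        nlinarith [sq_nonneg (ξ 0 * G 1 y - ξ 1 * G 0 y)]
      rw [← sq_abs (ξ 0 * G 0 y + ξ 1 * G 1 y)] at a1
      rw [← sq_abs (ψ y)]
      nlinarith [sq_nonneg (|ψ y| - |ξ 0 * G 0 y + ξ 1 * G 1 y|)]
    · rw [integral_div, integral_add hGi hψ2.integrableOn, integral_const_mul]
      have a2 : ∫ y in D, ψ y ^ 2 ≤ ‖testToLp O φ‖ ^ 2 := by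
        rw [norm_testToLp_sq, ← integral_sub_right_eq_self (fun x => φ.1 x ^ 2) (t • ξ)]
        exact setIntegral_le_integral hψ2 (Filter.Eventually.of_forall fun x => sq_nonneg _)
      have : M2 = ‖ξ‖ ^ 2 * ∫ x in D, (G 0 x ^ 2 + G 1 x ^ 2) := hM2
      linarith
  -- Replacing `φ` by `t • φ` and taking the discriminant yields the homogeneous bound, with `√M2`
  -- as norm of the functional.
  have hle : ∀ φ : testFunctions O, |l φ| ≤ √M2 * ‖testToLp O φ‖ := fun φ => by
    have h1 : ∀ t : ℝ, 0 ≤ (‖testToLp O φ‖ ^ 2 / 2) * (t * t) + (-l φ) * t + M2 / 2 := fun t => by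
      have a1 := (le_abs_self _).trans (hbound (t • φ))
      rw [map_smul, map_smul, norm_smul, mul_pow, Real.norm_eq_abs, sq_abs, smul_eq_mul] at a1
      nlinarith
    have h2 := discrim_le_zero h1
    unfold discrim at h2
    refine abs_le_of_sq_le_sq ?_ (by positivity)
    rw [mul_pow, Real.sq_sqrt hM20]
    nlinarith
  obtain ⟨g, hg, hgl⟩ := exists_riesz (testToLp O) l (Real.sqrt_nonneg _) hle
  have hgm : MemLp g 2 volume := Lp.memLp g
  have hloc : LocallyIntegrableOn (fun x => (f (x + ξ) - f x) - g x) O :=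
    locallyIntegrableOn_of_locallyIntegrable_restrict
      ((hΔ.sub (hgm.restrict O)).locallyIntegrable (by norm_num))
  have hae := hOo.ae_eq_zero_of_integral_contDiff_smul_eq_zero hloc fun φ h1 h2 h3 => by
    have hT : IsTest O φ := ⟨h1, h2, h3⟩
    have hz : ∀ x, x ∉ O → φ x = 0 := fun x hx => image_eq_zero_of_notMem_tsupport fun h => hx (h3 h)
    rw [← setIntegral_eq_integral_of_forall_compl_eq_zero (s := O) (fun x hx => by
      rw [hz x hx, zero_smul])]
    have e4 := hgl ⟨φ, hT⟩
    rw [hl, L2.inner_def] at e4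
    have e5 : ∫ x, inner ℝ (g x) (testToLp O ⟨φ, hT⟩ x) = ∫ x in O, g x * φ x := by
      rw [setIntegral_eq_integral_of_forall_compl_eq_zero (s := O) (fun x hx => by rw [hz x hx, mul_zero])]
      refine integral_congr_ae ?_
      filter_upwards [(IsTest.memLp hT).coeFn_toLp] with x hx
      have : testToLp O ⟨φ, hT⟩ x = φ x := hx
      rw [this]
      simp [mul_comm]
    rw [e5] at e4
    calc ∫ x in O, φ x • ((f (x + ξ) - f x) - g x)
        = ∫ x in O, ((f (x + ξ) - f x) * φ x - g x * φ x) := by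
          congr 1 with x
          simp only [smul_eq_mul]; ring
      _ = 0 := by
          rw [integral_sub (integrableOn_mul_of_memLp hΔ h1.continuous h2)
            (integrableOn_mul_of_memLp (hgm.restrict O) h1.continuous h2)]
          exact sub_eq_zero.2 e4
  have hae' : ∀ᵐ x ∂volume.restrict O, ENNReal.ofReal ((f (x + ξ) - f x) ^ 2) = ENNReal.ofReal (g x ^ 2) := by
    rw [ae_restrict_iff' hOo.measurableSet]
    filter_upwards [hae] with x hx hxO
    rw [sub_eq_zero.1 (hx hxO)]
  calc ∫⁻ x in O, ENNReal.ofReal ((f (x + ξ) - f x) ^ 2) = ∫⁻ x in O, ENNReal.ofReal (g x ^ 2) :=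
        lintegral_congr_ae hae'
    _ ≤ ∫⁻ x, ENNReal.ofReal (g x ^ 2) := setLIntegral_le_lintegral _ _
    _ = ENNReal.ofReal (∫ x, g x ^ 2) := (ofReal_integral_eq_lintegral_ofReal hgm.integrable_sq
        (Filter.Eventually.of_forall fun x => sq_nonneg _)).symm
    _ ≤ ENNReal.ofReal M2 := by
        apply ENNReal.ofReal_le_ofReal
        have e6 : ∫ x, g x ^ 2 = ‖g‖ ^ 2 := by
          rw [← real_inner_self_eq_norm_sq, L2.inner_def]
          congr 1 with x
          simp [sq]
        rw [e6]
        calc ‖g‖ ^ 2 ≤ √M2 ^ 2 := by gcongr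
          _ = M2 := Real.sq_sqrt hM20

end Shift

/-! ## Fields with a weak gradient are of fractional regularity -/

section Gradient
variable {D : Set Plane} {w : Plane → Plane} {g : Fin 2 → Plane → Plane}

/-- The squared `L²` norm of the gradient. -/
def gradSq (D : Set Plane) (g : Fin 2 → Plane → Plane) : ℝ := ∑ i, ∫ x in D, ‖g i x‖ ^ 2

lemma gradSq_nonneg : 0 ≤ gradSq D g := Finset.sum_nonneg fun _ _ => integral_nonneg fun _ => sq_nonneg _

lemma memLp_coord {v : Plane → Plane} {μ : Measure Plane} (hv : MemLp v 2 μ) (j : Fin 2) :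
    MemLp (fun x => v x j) 2 μ := by
  refine hv.mono ((EuclideanSpace.proj (𝕜 := ℝ) j).continuous.comp_aestronglyMeasurable hv.1) ?_
  exact Filter.Eventually.of_forall fun x => PiLp.norm_apply_le (v x) j

/-- The scalar estimate for each component. The part of `D` from which the whole segment stays in
`D` is enough: the cones make up for the lack of convexity later. -/
lemma lintegral_shift_le (hD : IsOpen D) (hfin : volume D ≠ ⊤) (hw : Measurable w) (hw2 : MemL2 D w)
    (hg : ∀ i, IsWeakPartial i D w (g i)) (ξ : Plane) :
    ∫⁻ x in shiftSet D ξ, ‖w (x + ξ) - w x‖ₑ ^ 2 ≤ ENNReal.ofReal (‖ξ‖ ^ 2 * gradSq D g) := by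
  have hcoord : ∀ (F : Plane → Plane) (j : Fin 2), IntegrableOn F D →
      (∫ x in D, F x) j = ∫ x in D, F x j := fun F j hF =>
    ((EuclideanSpace.proj (𝕜 := ℝ) j).integral_comp_comm hF).symm
  have hsm : ∀ (φ : Plane → ℝ) (v : Plane → Plane), Continuous φ → HasCompactSupport φ → MemL2 D v →
      IntegrableOn (fun x => φ x • v x) D := fun φ v h1 h2 hv => by
    have h3 : MemLp φ 2 (volume.restrict D) := (h1.memLp_of_hasCompactSupport h2).restrict D
    exact memLp_one_iff_integrable.1 (hv.smul h3)
  have hweak : ∀ j i φ, IsTest D φ → ∫ x in D, φ x * g i x j = -∫ x in D, pderiv i φ x * w x j := by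
    intro j i φ hφ
    have hφ1 : ContDiff ℝ 1 φ := hφ.1.of_le (by exact_mod_cast le_top)
    have h1 := congrArg (fun z : Plane => z j) ((hg i).2 φ hφ)
    have i1 := hsm φ (g i) hφ1.continuous hφ.2.1 (hg i).1
    have i2 := hsm (pderiv i φ) w (continuous_pderiv hφ1 i)
      (hφ.2.1.of_isClosed_subset (isClosed_tsupport _) (tsupport_pderiv_subset i φ)) hw2
    simp only [PiLp.neg_apply] at h1
    rw [hcoord _ j i1, hcoord _ j i2] at h1
    simpa using h1
  have hj := fun j : Fin 2 => exists_shift hD hfin (memLp_coord hw2 j)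
    (fun i => memLp_coord (hg i).1 j) (hweak j) ξ
  have hcm : ∀ j, Measurable fun x => w x j := fun j =>
    (EuclideanSpace.proj (𝕜 := ℝ) j).continuous.measurable.comp hw
  have e : ∀ x, ‖w (x + ξ) - w x‖ₑ ^ 2 = ENNReal.ofReal ((w (x + ξ) 0 - w x 0) ^ 2) +
      ENNReal.ofReal ((w (x + ξ) 1 - w x 1) ^ 2) := fun x => by
    rw [← ENNReal.ofReal_add (sq_nonneg _) (sq_nonneg _), ← ofReal_norm,
      ← ENNReal.ofReal_pow (norm_nonneg _), norm_sq_plane]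
    simp
  simp only [e]
  have hm : Measurable fun x => ENNReal.ofReal ((w (x + ξ) 0 - w x 0) ^ 2) :=
    ((((hcm 0).comp (measurable_add_const ξ)).sub (hcm 0)).pow_const 2).ennreal_ofReal
  rw [lintegral_add_left hm]
  refine (add_le_add (hj 0) (hj 1)).trans_eq ?_
  have h0 : ∀ j, 0 ≤ ∫ x in D, (g 0 x j ^ 2 + g 1 x j ^ 2) := fun j =>
    integral_nonneg fun x => by positivity
  rw [← ENNReal.ofReal_add (mul_nonneg (sq_nonneg _) (h0 0)) (mul_nonneg (sq_nonneg _) (h0 1)), ← mul_add]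
  congr 2
  have hi : ∀ i j, IntegrableOn (fun x => g i x j ^ 2) D := fun i j =>
    (memLp_coord (hg i).1 j).integrable_sq
  unfold gradSq
  simp only [Fin.sum_univ_two, norm_sq_plane]
  rw [integral_add (hi 0 0) (hi 1 0), integral_add (hi 0 1) (hi 1 1), integral_add (hi 0 0) (hi 0 1),
    integral_add (hi 1 0) (hi 1 1)]
  ring

/-- The increments between points that are joined through a cone. -/
lemma lintegral_increment_le (hD : IsOpen D) (hfin : volume D ≠ ⊤) (hw : Measurable w) (hw2 : MemL2 D w)
    (hg : ∀ i, IsWeakPartial i D w (g i)) {J : Finset Plane} {U : Plane → Set Plane} {e : Plane → Plane}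
    {lam r₀ : ℝ} (hlam : 0 < lam) (hcov : D ⊆ ⋃ q ∈ J, U q)
    (hcone : ∀ q ∈ J, ‖e q‖ + lam ≤ 1 ∧
      ∀ x ∈ U q, ∀ y ∈ D, dist y x ≤ r₀ → ∀ l, 0 ≤ l → l ≤ r₀ → coneBall (e q) lam l y ⊆ D)
    {z : Plane} (hz : ‖z‖ ≤ r₀) (hz' : ‖z‖ ≤ lam * r₀) :
    ∫⁻ x in {x | x ∈ D ∧ x + z ∈ D}, ‖w x - w (x + z)‖ₑ ^ 2 ≤
      ENNReal.ofReal (J.card * (10 / lam ^ 2 * ‖z‖ ^ 2 * gradSq D g)) := by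
  set S := {x | x ∈ D ∧ x + z ∈ D} with hS
  -- Two points at distance `‖z‖` are joined through `x + l • e q + z`. At the height `l` the cone
  -- has radius `l lam = ‖z‖`, so both segments to this point stay in `D`, and their lengths are of
  -- order `‖z‖`.
  set l := ‖z‖ / lam with hl
  have hl0 : 0 ≤ l := by positivity
  have hlr : l ≤ r₀ := by rw [hl, div_le_iff₀ hlam]; linarith
  have hlz : l * lam = ‖z‖ := by rw [hl]; field_simp
  have hr0 : 0 ≤ r₀ := hl0.trans hlr
  have key : ∀ q : J, ∫⁻ x in S ∩ U q, ‖w x - w (x + z)‖ₑ ^ 2 ≤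
      ENNReal.ofReal (10 / lam ^ 2 * ‖z‖ ^ 2 * gradSq D g) := fun q => by
    obtain ⟨he, hc⟩ := hcone q q.2
    have he1 : ‖e q‖ ≤ 1 := by linarith
    have hlam1 : lam ≤ 1 := by linarith [norm_nonneg (e q)]
    set ζ := l • e q + z with hζ
    have hζn : ‖ζ‖ ≤ 2 * l := by
      refine (norm_add_le _ _).trans ?_
      rw [norm_smul, Real.norm_eq_abs, abs_of_nonneg hl0]
      nlinarith
    have hsub1 : S ∩ U q ⊆ shiftSet D ζ := fun x hx t ht => by
      refine hc x hx.2 x hx.1.1 (by simpa using hr0) (t * l) (mul_nonneg ht.1 hl0)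
        ((mul_le_of_le_one_left hl0 ht.2).trans hlr) ?_
      rw [coneBall, Metric.mem_closedBall, dist_eq_norm, hζ]
      have : x + t • (l • e q + z) - (x + (t * l) • e q) = t • z := by
        rw [smul_add, smul_smul]; abel
      rw [this, norm_smul, Real.norm_eq_abs, abs_of_nonneg ht.1, mul_assoc, hlz]
    have hsub2 : S ∩ U q ⊆ (fun x => x + z) ⁻¹' shiftSet D (l • e q) := fun x hx t ht => by
      refine hc x hx.2 (x + z) hx.1.2 (by simpa using hz) (t * l) (mul_nonneg ht.1 hl0)
        ((mul_le_of_le_one_left hl0 ht.2).trans hlr) ?_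
      rw [coneBall, smul_smul]
      exact Metric.mem_closedBall_self (by have := ht.1; positivity)
    have hpt : ∀ x, ‖w x - w (x + z)‖ₑ ^ 2 ≤ 2 * ‖w (x + ζ) - w x‖ₑ ^ 2 +
        2 * ‖w (x + z + l • e q) - w (x + z)‖ₑ ^ 2 := fun x => by
      have e1 : x + z + l • e q = x + ζ := by rw [hζ]; abel
      have e2 : w x - w (x + z) = -(w (x + ζ) - w x) + (w (x + z + l • e q) - w (x + z)) := by
        rw [e1]; abel
      rw [e2]
      refine (enorm_add_sq_le _ _).trans_eq ?_
      rw [enorm_neg]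
    have hm1 : Measurable fun x => 2 * ‖w (x + ζ) - w x‖ₑ ^ 2 :=
      ((((hw.comp (measurable_add_const ζ)).sub hw).enorm).pow_const 2).const_mul 2
    have b1 := lintegral_shift_le hD hfin hw hw2 hg ζ
    have b2 := lintegral_shift_le hD hfin hw hw2 hg (l • e q)
    have b3 : ∫⁻ x in S ∩ U q, ‖w (x + z + l • e q) - w (x + z)‖ₑ ^ 2 ≤
        ENNReal.ofReal (‖l • e q‖ ^ 2 * gradSq D g) := by
      refine (lintegral_mono_set hsub2).trans (le_trans (le_of_eq ?_) b2)
      exact (measurePreserving_add_right volume z).setLIntegral_comp_preimage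
        (isOpen_shiftSet hD _).measurableSet
        (f := fun y => ‖w (y + l • e q) - w y‖ₑ ^ 2)
        ((((hw.comp (measurable_add_const _)).sub hw).enorm).pow_const 2)
    have hG := gradSq_nonneg (D := D) (g := g)
    calc ∫⁻ x in S ∩ U q, ‖w x - w (x + z)‖ₑ ^ 2
        ≤ ∫⁻ x in S ∩ U q, (2 * ‖w (x + ζ) - w x‖ₑ ^ 2 + 2 * ‖w (x + z + l • e q) - w (x + z)‖ₑ ^ 2) :=
          lintegral_mono hpt
      _ = 2 * (∫⁻ x in S ∩ U q, ‖w (x + ζ) - w x‖ₑ ^ 2) +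
          2 * ∫⁻ x in S ∩ U q, ‖w (x + z + l • e q) - w (x + z)‖ₑ ^ 2 := by
          rw [lintegral_add_left hm1, lintegral_const_mul' _ _ ENNReal.ofNat_ne_top,
            lintegral_const_mul' _ _ ENNReal.ofNat_ne_top]
      _ ≤ 2 * ENNReal.ofReal (‖ζ‖ ^ 2 * gradSq D g) + 2 * ENNReal.ofReal (‖l • e q‖ ^ 2 * gradSq D g) := by
          gcongr
          exact (lintegral_mono_set hsub1).trans b1
      _ = ENNReal.ofReal (2 * (‖ζ‖ ^ 2 * gradSq D g) + 2 * (‖l • e q‖ ^ 2 * gradSq D g)) := by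
          rw [ENNReal.ofReal_add (by positivity) (by positivity), ENNReal.ofReal_mul (p := 2) (by norm_num),
            ENNReal.ofReal_mul (p := 2) (by norm_num)]
          simp
      _ ≤ _ := by
          apply ENNReal.ofReal_le_ofReal
          have c1 : ‖ζ‖ ^ 2 ≤ 4 * l ^ 2 := by nlinarith [norm_nonneg ζ]
          have c2 : ‖l • e q‖ ^ 2 ≤ l ^ 2 := by
            rw [norm_smul, mul_pow, Real.norm_eq_abs, sq_abs]
            have : ‖e q‖ ^ 2 ≤ 1 := by nlinarith [norm_nonneg (e q)]
            nlinarith [sq_nonneg l]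
          have c3 : 10 / lam ^ 2 * ‖z‖ ^ 2 = 10 * l ^ 2 := by rw [hl]; field_simp
          rw [c3]
          nlinarith
  have hsub : S ⊆ ⋃ q : J, S ∩ U q := fun x hx => by
    obtain ⟨q, hq, hxq⟩ := mem_iUnion₂.1 (hcov hx.1)
    exact mem_iUnion.2 ⟨⟨q, hq⟩, hx, hxq⟩
  refine (lintegral_mono_set hsub).trans ((lintegral_iUnion_le _ _).trans ?_)
  rw [tsum_fintype]
  refine (Finset.sum_le_sum fun q _ => key q).trans_eq ?_
  rw [Finset.sum_const, Finset.card_univ, Fintype.card_coe, nsmul_eq_mul,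
    ENNReal.ofReal_mul (p := (J.card : ℝ)) (by positivity), ENNReal.ofReal_natCast]

end Gradient

section Gradient
variable {D : Set Plane} {v w : Plane → Plane}

/-- Polar coordinates: the exponent `-3/2` exceeds `-2`. -/
lemma lintegral_norm_rpow_lt_top (ρ : ℝ) :
    ∫⁻ z in Metric.ball (0 : Plane) ρ, ENNReal.ofReal (‖z‖ ^ (-(3 / 2) : ℝ)) < ⊤ := by
  have h : IntegrableOn (fun z : Plane => ‖z‖ ^ (-(3 / 2) : ℝ)) (Metric.ball 0 ρ) := by
    rw [integrableOn_fun_norm_addHaar volume (f := fun y : ℝ => y ^ (-(3 / 2) : ℝ))]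
    have : IntegrableOn (fun y : ℝ => y ^ (-(1 / 2) : ℝ)) (Ioo 0 ρ) := by
      by_cases hρ : 0 < ρ
      · exact (intervalIntegral.integrableOn_Ioo_rpow_iff hρ).2 (by norm_num)
      · simp [Ioo_eq_empty hρ]
    refine this.congr_fun (fun y hy => ?_) measurableSet_Ioo
    simp only [finrank_euclideanSpace, Fintype.card_fin, smul_eq_mul]
    rw [← Real.rpow_natCast, ← Real.rpow_add hy.1]
    norm_num
  exact h.lintegral_lt_top

/-- On a bounded Lipschitz domain the gradient controls a fractional seminorm. -/
lemma IsLipschitzOpen.gag_le_gradSq (hD : IsLipschitzOpen D) (hb : Bornology.IsBounded D) :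
    ∃ C : ℝ, 0 < C ∧ ∀ (w : Plane → Plane) (g : Fin 2 → Plane → Plane), Measurable w → MemL2 D w →
      (∀ i, IsWeakPartial i D w (g i)) →
      gag (3 / 4) D w ≤ ENNReal.ofReal C * ((∫⁻ x in D, ‖w x‖ₑ ^ 2) + ENNReal.ofReal (gradSq D g)) := by
  obtain ⟨J, U, e, lam, r₀, hlam, hr₀, hcov, -, hcone⟩ := hD.exists_cone hb
  have hvol := (hb.measure_lt_top (μ := volume)).ne
  have hDm := hD.1.measurableSet
  set p : ℝ := 2 * (1 + 3 / 4) with hp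
  have hp0 : 0 ≤ p := by norm_num [hp]
  -- Pairs at a distance of at least `ρ` contribute at most a multiple of the `L²` norm. For closer
  -- pairs the increment estimate applies to each difference `z`.
  set ρ := min r₀ (lam * r₀) with hρ
  have hρ0 : 0 < ρ := lt_min hr₀ (by positivity)
  set A : ℝ≥0∞ := (ENNReal.ofReal ρ ^ p)⁻¹ with hA
  have hAt : A ≠ ⊤ := by
    rw [hA, ENNReal.inv_ne_top, Ne, ENNReal.rpow_eq_zero_iff_of_pos (by norm_num [hp])]
    simpa using hρ0
  set B := ∫⁻ z in Metric.ball (0 : Plane) ρ, ENNReal.ofReal (‖z‖ ^ (-(3 / 2) : ℝ)) with hB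
  have hBt : B ≠ ⊤ := (lintegral_norm_rpow_lt_top ρ).ne
  set k : ℝ := J.card * (10 / lam ^ 2) with hk
  have hk0 : 0 ≤ k := by positivity
  set c : ℝ≥0∞ := A * (4 * volume D) + ENNReal.ofReal k * B with hc
  have hct : c ≠ ⊤ := ENNReal.add_ne_top.2 ⟨ENNReal.mul_ne_top hAt (ENNReal.mul_ne_top (by norm_num) hvol),
    ENNReal.mul_ne_top ENNReal.ofReal_ne_top hBt⟩
  refine ⟨c.toReal + 1, by positivity, fun w g hw hw2 hg => ?_⟩
  set W := ∫⁻ x in D, ‖w x‖ₑ ^ 2 with hW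
  have hG := gradSq_nonneg (D := D) (g := g)
  set Q : Set (Plane × Plane) := {q | q.1 ∈ D ∧ q.1 + q.2 ∈ D ∧ q.2 ∈ Metric.ball (0 : Plane) ρ} with hQ
  have hQm : MeasurableSet Q := (measurable_fst hDm).inter
    (((measurable_fst.add measurable_snd) hDm).inter (measurable_snd measurableSet_ball))
  set H : Plane → Plane → ℝ≥0∞ := fun x z =>
    Q.indicator (fun q => ‖w q.1 - w (q.1 + q.2)‖ₑ ^ 2 / ‖q.2‖ₑ ^ p) (x, z) with hH
  have hHm : Measurable fun q : Plane × Plane => H q.1 q.2 := by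
    refine Measurable.indicator ?_ hQm
    exact ((((hw.comp measurable_fst).sub
      (hw.comp (measurable_fst.add measurable_snd))).enorm).pow_const 2).div
      ((measurable_snd.enorm).pow_const _)
  have hnm : Measurable fun x => ‖w x‖ₑ ^ 2 := hw.enorm.pow_const 2
  have hpt : ∀ x ∈ D, ∀ y ∈ D, ‖w x - w y‖ₑ ^ 2 / edist x y ^ p ≤
      A * (2 * ‖w x‖ₑ ^ 2 + 2 * ‖w y‖ₑ ^ 2) + H x (y - x) := fun x hx y hy => by
    by_cases hxy : y - x ∈ Metric.ball (0 : Plane) ρ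
    · refine le_add_left (le_of_eq ?_)
      have hq : (x, y - x) ∈ Q := ⟨hx, by simpa using hy, hxy⟩
      simp only [hH]
      rw [indicator_of_mem hq]
      simp only [add_sub_cancel]
      rw [edist_comm, edist_eq_enorm_sub]
    · refine le_add_right ?_
      rw [ENNReal.div_eq_inv_mul]
      refine mul_le_mul' ?_ ?_
      · rw [hA]
        refine ENNReal.inv_le_inv.2 (ENNReal.rpow_le_rpow ?_ hp0)
        rw [edist_comm, edist_dist]
        apply ENNReal.ofReal_le_ofReal
        simpa [dist_eq_norm] using hxy
      · have := enorm_add_sq_le (w x) (-w y)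
        rwa [enorm_neg, ← sub_eq_add_neg] at this
  have hfar : ∫⁻ x in D, ∫⁻ y in D, A * (2 * ‖w x‖ₑ ^ 2 + 2 * ‖w y‖ₑ ^ 2) = A * (4 * volume D) * W := by
    have e1 : ∀ x, ∫⁻ y in D, A * (2 * ‖w x‖ₑ ^ 2 + 2 * ‖w y‖ₑ ^ 2) =
        A * (2 * volume D * ‖w x‖ₑ ^ 2 + 2 * W) := fun x => by
      rw [lintegral_const_mul' _ _ hAt, lintegral_add_left measurable_const, setLIntegral_const,
        lintegral_const_mul' _ _ ENNReal.ofNat_ne_top]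
      ring
    simp only [e1]
    rw [lintegral_const_mul' _ _ hAt, lintegral_add_right _ measurable_const, setLIntegral_const,
      lintegral_const_mul' _ _ (ENNReal.mul_ne_top (by norm_num) hvol)]
    ring
  have hz : ∀ z, ∫⁻ x, H x z ≤ (Metric.ball (0 : Plane) ρ).indicator
      (fun z => ENNReal.ofReal (k * gradSq D g) * ENNReal.ofReal (‖z‖ ^ (-(3 / 2) : ℝ))) z := fun z => by
    by_cases hzb : z ∈ Metric.ball (0 : Plane) ρ
    · have hzn : ‖z‖ < ρ := by simpa using hzb
      rw [indicator_of_mem hzb]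
      set S := {x | x ∈ D ∧ x + z ∈ D} with hS
      have hSm : MeasurableSet S := hDm.inter ((measurable_add_const z) hDm)
      have e1 : ∀ x, H x z = S.indicator (fun x => (‖z‖ₑ ^ p)⁻¹ * ‖w x - w (x + z)‖ₑ ^ 2) x := fun x => by
        by_cases hx : x ∈ S
        · have hq : (x, z) ∈ Q := ⟨hx.1, hx.2, hzb⟩
          simp only [hH]
          rw [indicator_of_mem hq, indicator_of_mem hx, ENNReal.div_eq_inv_mul]
        · have hq : (x, z) ∉ Q := fun h => hx ⟨h.1, h.2.1⟩
          simp only [hH]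
          rw [indicator_of_notMem hq, indicator_of_notMem hx]
      simp only [e1]
      rw [lintegral_indicator hSm]
      have hmm : Measurable fun x => ‖w x - w (x + z)‖ₑ ^ 2 :=
        ((hw.sub (hw.comp (measurable_add_const z))).enorm).pow_const 2
      rw [lintegral_const_mul _ hmm]
      have h1 := lintegral_increment_le hD.1 hvol hw hw2 hg hlam hcov hcone
        (hzn.le.trans (min_le_left _ _)) (hzn.le.trans (min_le_right _ _))
      refine (mul_le_mul' le_rfl h1).trans ?_
      rcases eq_or_ne z 0 with rfl | hz0
      · simp
      have hzp : 0 < ‖z‖ := norm_pos_iff.2 hz0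
      rw [← ofReal_norm, ENNReal.ofReal_rpow_of_pos hzp,
        ← ENNReal.ofReal_inv_of_pos (by positivity), ← ENNReal.ofReal_mul (by positivity),
        ← ENNReal.ofReal_mul (by positivity)]
      apply ENNReal.ofReal_le_ofReal
      -- The kernel has the exponent `p = 7/2`, the increments gain `‖z‖ ^ 2`; what is left is
      -- integrable near zero in the plane. Any order below `1` would do here.
      have e2 : ‖z‖ ^ (-(3 / 2) : ℝ) = (‖z‖ ^ p)⁻¹ * ‖z‖ ^ 2 := by
        rw [← Real.rpow_neg hzp.le, ← Real.rpow_natCast, ← Real.rpow_add hzp, hp]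
        norm_num
      rw [e2, hk]
      apply le_of_eq
      ring
    · rw [indicator_of_notMem hzb]
      have : ∀ x, H x z = 0 := fun x => indicator_of_notMem (fun h => hzb h.2.2) _
      simp [this]
  have hnear : ∫⁻ x in D, ∫⁻ y in D, H x (y - x) ≤ ENNReal.ofReal k * B * ENNReal.ofReal (gradSq D g) := by
    calc ∫⁻ x in D, ∫⁻ y in D, H x (y - x) ≤ ∫⁻ x, ∫⁻ y, H x (y - x) :=
          (lintegral_mono fun x => setLIntegral_le_lintegral _ _).trans (setLIntegral_le_lintegral _ _)
      _ = ∫⁻ x, ∫⁻ z, H x z := lintegral_congr fun x => lintegral_sub_right_eq_self (H x) x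
      _ = ∫⁻ z, ∫⁻ x, H x z := lintegral_lintegral_swap hHm.aemeasurable
      _ ≤ _ := lintegral_mono hz
      _ = _ := by
          rw [lintegral_indicator measurableSet_ball, lintegral_const_mul' _ _ ENNReal.ofReal_ne_top,
            ENNReal.ofReal_mul hk0]
          ring
  have hm1 : ∀ x, Measurable fun y => A * (2 * ‖w x‖ₑ ^ 2 + 2 * ‖w y‖ₑ ^ 2) := fun x =>
    ((hnm.const_mul 2).const_add _).const_mul A
  have hm2 : Measurable fun x => ∫⁻ y in D, A * (2 * ‖w x‖ₑ ^ 2 + 2 * ‖w y‖ₑ ^ 2) := by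
    refine Measurable.lintegral_prod_right' (ν := volume.restrict D)
      (f := fun q : Plane × Plane => A * (2 * ‖w q.1‖ₑ ^ 2 + 2 * ‖w q.2‖ₑ ^ 2)) ?_
    exact (((hnm.comp measurable_fst).const_mul 2).add ((hnm.comp measurable_snd).const_mul 2)).const_mul A
  calc gag (3 / 4) D w
      ≤ ∫⁻ x in D, ∫⁻ y in D, (A * (2 * ‖w x‖ₑ ^ 2 + 2 * ‖w y‖ₑ ^ 2) + H x (y - x)) :=
        setLIntegral_mono' hDm fun x hx => setLIntegral_mono' hDm fun y hy => hpt x hx y hy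
    _ = (∫⁻ x in D, ∫⁻ y in D, A * (2 * ‖w x‖ₑ ^ 2 + 2 * ‖w y‖ₑ ^ 2)) +
        ∫⁻ x in D, ∫⁻ y in D, H x (y - x) := by
        rw [← lintegral_add_left hm2]
        exact lintegral_congr fun x => lintegral_add_left (hm1 x) _
    _ ≤ A * (4 * volume D) * W + ENNReal.ofReal k * B * ENNReal.ofReal (gradSq D g) := by
        rw [hfar]
        exact add_le_add le_rfl hnear
    _ ≤ c * W + c * ENNReal.ofReal (gradSq D g) :=
        add_le_add (mul_le_mul' le_self_add le_rfl) (mul_le_mul' le_add_self le_rfl)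
    _ = c * (W + ENNReal.ofReal (gradSq D g)) := (mul_add _ _ _).symm
    _ ≤ _ := by
        refine mul_le_mul' ?_ le_rfl
        rw [← ENNReal.ofReal_toReal hct]
        apply ENNReal.ofReal_le_ofReal
        simp

lemma MemL2.lintegral_eq (h : MemL2 D w) :
    ∫⁻ x in D, ‖w x‖ₑ ^ 2 = ENNReal.ofReal (∫ x in D, ‖w x‖ ^ 2) := by
  rw [ofReal_integral_eq_lintegral_ofReal (h.integrable_norm_pow (by norm_num))
    (Filter.Eventually.of_forall fun x => sq_nonneg _)]
  congr 1 with x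
  rw [ENNReal.ofReal_pow (norm_nonneg _), ofReal_norm]

lemma eLpNorm_two_sq (μ : Measure Plane) (w : Plane → Plane) :
    eLpNorm w 2 μ ^ 2 = ∫⁻ x, ‖w x‖ₑ ^ 2 ∂μ := by
  have := eLpNorm_nnreal_pow_eq_lintegral (f := w) (μ := μ) (p := 2) (by norm_num)
  simpa using this

/-- Fields in `H^s` have a fractional seminorm of an order in `(1/2, 1)`. -/
lemma IsLipschitzOpen.exists_fracField (hD : IsLipschitzOpen D) (hb : Bornology.IsBounded D)
    {s : ℝ} : ∃ C : ℝ, 0 < C ∧ ∀ v w : Plane → Plane, MemHs s D v →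
      v =ᵐ[volume.restrict D] w → Measurable w → FracField (if s < 1 then s else 3 / 4) D w ∧
        (∫ x in D, ‖w x‖ ^ 2) + gagR (if s < 1 then s else 3 / 4) D w ≤
          C * (sobolevNorm s D v).toReal ^ 2 := by
  obtain ⟨C, hC, hgrad⟩ := hD.gag_le_gradSq hb
  refine ⟨2 + C, by positivity, fun v w hv hvw hw => ?_⟩
  have hw2 : MemL2 D w := (memLp_congr_ae hvw).1 hv.1
  set W := eLpNorm v 2 (volume.restrict D) with hW
  set S := sobolevSeminorm s D v with hS
  have hWt : W ≠ ⊤ := hv.1.eLpNorm_ne_top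
  have hSt : S ≠ ⊤ := hv.2.ne
  have hWsq : W ^ 2 = ∫⁻ x in D, ‖w x‖ₑ ^ 2 := by
    rw [hW, eLpNorm_congr_ae hvw, eLpNorm_two_sq]
  -- For `s < 1` the seminorm is the double integral itself. Otherwise the order `3/4` is taken,
  -- which only has to lie strictly between `1/2` and `1`.
  have key : gag (if s < 1 then s else 3 / 4) D w ≤ ENNReal.ofReal (1 + C) * (W ^ 2 + S ^ 2) := by
    by_cases hs : s < 1
    · simp only [hs, if_true]
      have e1 : gag s D w = S ^ 2 := by
        rw [hS, sobolevSeminorm, if_pos hs, ← ENNReal.rpow_natCast, ← ENNReal.rpow_mul]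
        norm_num
        refine lintegral_congr_ae ?_
        filter_upwards [hvw] with x hx
        refine lintegral_congr_ae ?_
        filter_upwards [hvw] with y hy
        rw [hx, hy]
      rw [e1]
      refine le_trans (le_trans le_add_self (one_mul _).symm.le) (mul_le_mul' ?_ le_rfl)
      rw [← ENNReal.ofReal_one]
      exact ENNReal.ofReal_le_ofReal (by linarith)
    · simp only [hs, if_false]
      have hC0 : ENNReal.ofReal C ≠ 0 := by simpa using hC
      -- The seminorm is an infimum over all weak gradients. Each of them satisfies the gradient
      -- estimate; solving it for the gradient gives the lower bound `X` of the infimum, with no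
      -- need for a minimiser.
      set X := gag (3 / 4) D w / ENNReal.ofReal C - W ^ 2 with hX
      have h1 : X ^ (1 / 2 : ℝ) ≤ S := by
        rw [hS, sobolevSeminorm, if_neg hs]
        refine le_iInf₂ fun g hg => ENNReal.rpow_le_rpow ?_ (by norm_num)
        have hg' : ∀ i, IsWeakPartial i D w (g i) := fun i => ⟨(hg i).1, fun φ hφ => by
          rw [(hg i).2 φ hφ]
          congr 1
          refine integral_congr_ae ?_
          filter_upwards [hvw] with x hx
          rw [hx]⟩
        have h2 := hgrad w g hw hw2 hg'
        rw [hX, tsub_le_iff_left]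
        refine ENNReal.div_le_of_le_mul' (h2.trans_eq ?_)
        rw [hWsq, gradSq, ENNReal.ofReal_sum_of_nonneg fun i _ => integral_nonneg fun x => sq_nonneg _]
        congr 2
        refine Finset.sum_congr rfl fun i _ => ?_
        rw [eLpNorm_two_sq, MemL2.lintegral_eq (hg i).1]
      have h2 : X ≤ S ^ 2 := by
        calc X = (X ^ (1 / 2 : ℝ)) ^ 2 := by
              rw [← ENNReal.rpow_natCast, ← ENNReal.rpow_mul]
              norm_num
          _ ≤ S ^ 2 := by gcongr
      rw [hX, tsub_le_iff_left, ENNReal.div_le_iff hC0 ENNReal.ofReal_ne_top, mul_comm] at h2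
      refine h2.trans (mul_le_mul' (ENNReal.ofReal_le_ofReal (by linarith)) le_rfl)
  have hRt : ENNReal.ofReal (1 + C) * (W ^ 2 + S ^ 2) ≠ ⊤ :=
    ENNReal.mul_ne_top ENNReal.ofReal_ne_top
      (ENNReal.add_ne_top.2 ⟨ENNReal.pow_ne_top hWt, ENNReal.pow_ne_top hSt⟩)
  refine ⟨⟨hw, hw2, ne_top_of_le_ne_top hRt key⟩, ?_⟩
  have k1 := ENNReal.toReal_mono hRt key
  rw [ENNReal.toReal_mul, ENNReal.toReal_ofReal (by positivity),
    ENNReal.toReal_add (ENNReal.pow_ne_top hWt) (ENNReal.pow_ne_top hSt), ENNReal.toReal_pow,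
    ENNReal.toReal_pow] at k1
  have k2 : ∫ x in D, ‖w x‖ ^ 2 = W.toReal ^ 2 := by
    rw [← ENNReal.toReal_pow, hWsq, hw2.lintegral_eq, ENNReal.toReal_ofReal
      (integral_nonneg fun x => sq_nonneg _)]
  have k3 : (sobolevNorm s D v).toReal = W.toReal + S.toReal := ENNReal.toReal_add hWt hSt
  rw [k2, k3]
  have a1 : 0 ≤ W.toReal := ENNReal.toReal_nonneg
  have a2 : 0 ≤ S.toReal := ENNReal.toReal_nonneg
  have k4 : gagR (if s < 1 then s else 3 / 4) D w ≤ (1 + C) * (W.toReal ^ 2 + S.toReal ^ 2) := k1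
  have : 0 ≤ W.toReal * S.toReal := by positivity
  nlinarith [sq_nonneg S.toReal]

end Gradient

/-! ### Passage to the broken norm -/

namespace PolyMesh

/-- The norm `‖·‖_b` is bounded by the broken `H^s` norm. -/
theorem bNorm_le_brokenNorm (P : InterfaceDomain) {s : ℝ} (hs : 1 / 2 < s) (c₁ c₂ : ℝ) (N N' : ℕ) :
    ∃ C : ℝ, 0 < C ∧ ∀ M : PolyMesh P.Ω, M.EdgeCount N → M.EdgeCondition c₁ c₂ → M.BlockCondition N' →
      ∀ v : Plane → Plane, P.MemY s v → M.HasTraces v ∧ M.bNorm v ≤ C * P.brokenNorm s v := by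
  have hs' : 1 / 2 < (if s < 1 then s else 3 / 4) := by
    split_ifs
    · exact hs
    · norm_num
  obtain ⟨C, hC, hb⟩ := bNorm_sq_le P hs' c₁ c₂ N N'
  obtain ⟨Cp, hCp, hp⟩ := P.lipschitz_plus.exists_fracField (P.side_bounded true) (s := s)
  obtain ⟨Cm, hCm, hm⟩ := P.lipschitz_minus.exists_fracField (P.side_bounded false) (s := s)
  refine ⟨√(C * (Cp + Cm)), by positivity, fun M h1 h2 h3 v hv => ?_⟩
  -- The exchanges of integrals require a measurable field, so `v` is replaced by a measurable
  -- representative. It is chosen once on `Ω` and serves both parts.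
  obtain ⟨w, hw, hvw⟩ := hv.2.2.2.1.1.aemeasurable
  obtain ⟨fp, ep⟩ := hp v w hv.1 (ae_restrict_of_ae_restrict_of_subset P.plus_subset hvw) hw
  obtain ⟨fm, em⟩ := hm v w hv.2.1 (ae_restrict_of_ae_restrict_of_subset P.minus_subset hvw) hw
  obtain ⟨ht, hle⟩ := hb M h1 h2 h3 v w hv.2.2.2 hvw fun b => by
    cases b
    · exact fm
    · exact fp
  refine ⟨ht, ?_⟩
  have hfin : ∀ {D}, MemHs s D v → sobolevNorm s D v ≠ ⊤ := fun h =>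
    ENNReal.add_ne_top.2 ⟨h.1.eLpNorm_ne_top, h.2.ne⟩
  have hbr : P.brokenNorm s v = (sobolevNorm s P.Ωp v).toReal + (sobolevNorm s P.Ωm v).toReal :=
    ENNReal.toReal_add (hfin hv.1) (hfin hv.2.1)
  rw [hbr]
  set a := (sobolevNorm s P.Ωp v).toReal
  set b := (sobolevNorm s P.Ωm v).toReal
  have ha : 0 ≤ a := ENNReal.toReal_nonneg
  have hb0 : 0 ≤ b := ENNReal.toReal_nonneg
  refine le_of_abs_le (abs_le_of_sq_le_sq ?_ (by positivity))
  rw [mul_pow, Real.sq_sqrt (by positivity)]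
  refine hle.trans ?_
  rw [mul_assoc]
  refine mul_le_mul_of_nonneg_left ?_ hC.le
  rw [Fintype.sum_bool]
  simp only [InterfaceDomain.side, if_true, Bool.false_eq_true, if_false]
  have : 0 ≤ a * b := by positivity
  nlinarith [mul_nonneg hCp.le (sq_nonneg b), mul_nonneg hCm.le (sq_nonneg a), mul_nonneg hCp.le this,
    mul_nonneg hCm.le this]

end PolyMesh

end MaxwellVEM

end

theorem mainTheorem6 :
    -- the local Poincaré-type bound; the integer `C n` depends only on the number `n` of vertices
    (∃ C : ℕ → ℕ, ∀ (θM d₁ d₂ : ℝ), θM < Real.pi → 0 < d₁ → d₁ ≤ 1 → 0 < d₂ → d₂ ≤ 1 →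
      ∀ (K : PolyCell) (V : VirtualMesh K), V.Admissible θM d₁ d₂ →
      ∀ v : Plane → Plane, V.MemEdgeSpace v →
        K.HasTangentialTrace v ∧
        l2Norm K.carrier v ≤
          √(Real.cot ((Real.pi - θM) / 2) * (C K.numVertices : ℝ) / (2 * min d₁ d₂)) *
            (√K.diam * K.traceNorm v + K.diam * l2Norm K.carrier (weakRot K.carrier v))) ∧
    -- the `L²` norm is bounded by the norm `‖·‖_a` on the global edge space
    (∀ (P : InterfaceDomain) (θM d₁ d₂ : ℝ) (N : ℕ), θM < Real.pi → 0 < d₁ → 0 < d₂ →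
      ∃ C : ℝ, 0 < C ∧ ∀ (M : PolyMesh P.Ω) (V : ∀ k, VirtualMesh (M.cell k)),
        (∀ k, (V k).Admissible θM d₁ d₂) → M.EdgeCount N →
        ∀ v : Plane → Plane, M.MemEdgeSpace V v →
          M.HasTraces v ∧ l2Norm P.Ω v ≤ C * M.aNorm v) ∧
    -- the norm `‖·‖_b` is bounded by the broken `H^s` norm on `Y^s(Ω)`
    (∀ (P : InterfaceDomain) (s θM d₁ d₂ c₁ c₂ : ℝ) (N N' : ℕ),
      1 / 2 < s → s ≤ 1 → θM < Real.pi → 0 < d₁ → 0 < d₂ →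
      ∃ C : ℝ, 0 < C ∧ ∀ (M : PolyMesh P.Ω) (V : ∀ k, VirtualMesh (M.cell k)),
        (∀ k, (V k).Admissible θM d₁ d₂) →
        M.EdgeCount N → M.EdgeCondition c₁ c₂ → M.BlockCondition N' →
        ∀ v : Plane → Plane, P.MemY s v →
          M.HasTraces v ∧ M.bNorm v ≤ C * P.brokenNorm s v) := by
  refine ⟨⟨fun n => 24 * n * 2 ^ n + 2, fun θM d₁ d₂ hθ hd1 hd1' hd2 _ K V hV v hv => ?_⟩,
    fun P θM d₁ d₂ N hθ hd1 hd2 => PolyMesh.l2Norm_le_aNorm P N hθ hd1 hd2, ?_⟩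
  · obtain ⟨h1, -, h2⟩ := VirtualMesh.l2Norm_le hd1 hd1' hd2 hθ hV hv
    exact ⟨h1, h2⟩
  · intro P s θM d₁ d₂ c₁ c₂ N N' hs _ _ _ _
    obtain ⟨C, hC, h⟩ := PolyMesh.bNorm_le_brokenNorm P hs c₁ c₂ N N'
    exact ⟨C, hC, fun M _ _ h1 h2 h3 v hv => h M h1 h2 h3 v hv⟩
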